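/- **Setting.** Let $K$ be a number field with ring of integers $\mathcal O_K$, let $g\ge 1$, and let $f(x,s)=\sum_{i=0}^{2g+2} f_i x^i s^{2g+2-i}$ with $f_i\in\mathcal O_K$ be a binary form without repeated factors over $K$. Let $C$ be the (hyper)elliptic curve $y^2=f(x,s)$ of genus $g$ in the weighted projective space $\mathbb P_K(1,1,g+1)$ with coordinates $(x:s:y)$, and let $p\mapsto p^-$ be the involution $(x:s:y)\mapsto(x:s:-y)$. Let $\mathscr C_1$ be the Zariski closure of $C$ in $\mathbb P_{\mathcal O_K}(1,1,g+1)$, and let $\pi:\mathscr C\to\mathscr C_1$ be a resolution: $\mathscr C$ is regular and $\pi$ is a composite of finitely many blowups, each along a reduced closed subscheme (for instance a closed point or a smooth curve) contained in the fibre over one maximal ideal $\nu_k$ of $\mathcal O_K$, $k=1,\dots,n$. An effective divisor $D$ on $C$ (over $K$) is *reduced* if its degree is at most $g$, every point $p=p^-$ over $\overline K$ has coefficient at most $1$ in $D$, and no two distinct points $p,p^-$ over $\overline K$ both occur in $D$. For effective divisors $D,E$ on $C$ with no common point in their supports let $\mathscr D,\mathscr E$ be their closures on $\mathscr C$ (extended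 linearly from prime divisors), and for a maximal ideal $\nu$ of $\mathcal O_K$ (that is, $\nu\in M_K^0$) put $$\iota_\nu(\mathscr D,\mathscr E)=\sum_{Q\mid\nu}\log\#\kappa(Q)\cdot\operatorname{length}_{\mathcal O_{\mathscr C,Q}}\bigl(\mathcal O_{\mathscr C,Q}/(I_{\mathscr D,Q}+I_{\mathscr E,Q})\bigr),$$ where $Q$ runs over the points of $\mathscr C$ over $\nu$. For a number field $L\supseteq K$ let $M_L^0$ be the set of its finite places, each with the absolute value $|a|_w=\#\kappa(w)^{-\operatorname{ord}_w(a)}$. For $p=(x_p:s_p:y_p)$ and $q=(x_q:s_q:y_q)$ in $C(L)$ and $w\in M_L^0$ put $$d_w(p,q)=\begin{cases}\max\bigl(|\tfrac{x_p}{s_p}-\tfrac{x_q}{s_q}|_w,\ |\tfrac{y_p}{s_p^{g+1}}-\tfrac{y_q}{s_q^{g+1}}|_w\bigr)&\text{if }|x_p|_w\le|s_p|_w,\ |x_q|_w\le|s_q|_w,\\ \max\bigl(|\tfrac{s_p}{x_p}-\tfrac{s_q}{x_q}|_w,\ |\tfrac{y_p}{x_p^{g+1}}-\tfrac{y_q}{x_q^{g+1}}|_w\bigr)&\text{if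 }|x_p|_w\ge|s_p|_w,\ |x_q|_w\ge|s_q|_w,\\ 1&\text{otherwise.}\end{cases}$$ **Proposition.** There is a computable constant $\mathscr B_2$, depending only on $C$ and $\mathscr C$, such that for all reduced divisors $D$ and $E$ on $C$ with no common point in their supports, and for every finite extension $L/K$ over which $D=\sum_i p_i$ and $E=\sum_j q_j$ are both pointwise rational (that is, all $p_i,q_j\in C(L)$), $$\left|\ \sum_{\nu\in M_K^0}\iota_\nu(\mathscr D,\mathscr E)\;-\;\frac1{[L:K]}\sum_{w\in M_L^0}\log^+\Bigl(\frac1{\prod_{i,j}d_w(p_i,q_j)}\Bigr)\right|\le\mathscr B_2 .$$ All lengths here are finite, all products $\prod_{i,j}d_w(p_i,q_j)$ are positive, and only finitely many points $Q$ and places $w$ contribute to the sums. "Computable" means: one algorithm, working for all $K$, $g$, $f$ and $\mathscr C$, outputs an admissible $\mathscr B_2\in\mathbb N$ from the following input: the minimal polynomial over $\mathbb Z$ of an algebraic integer $\theta$ with $K=\mathbb Q(\theta)$, the coefficients $f_i$ written as integer polynomials in $\theta$ over a common denominator, and the list of cardinalities $\#(\mathcal O_K/\nu_k)$, $k=1,\dots,n$,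 of the residue fields at the primes below the centres of the blowups. -/

import Mathlib

open CategoryTheory AlgebraicGeometry NumberField IsDedekindDomain Polynomial

universe u v

attribute [local instance] MvPolynomial.weightedGradedAlgebra

noncomputable section

namespace Hyperelliptic

/-! ### Weighted projective space and the naive model of the curve -/

/-- The weights of the coordinates `x`, `s`, `y` (numbered `0`, `1`, `2`) of `ℙ(1, 1, g + 1)`. -/
def weights (g : ℕ) : Fin 3 → ℕ := ![1, 1, g + 1]

/-- The grading of `R[x, s, y]` by weighted degree. -/
abbrev grading (R : Type u) [CommRing R] (g : ℕ) : ℕ → Submodule R (MvPolynomial (Fin 3) R) :=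
  MvPolynomial.weightedHomogeneousSubmodule R (weights g)

/-- The weighted projective space `ℙ_R(1, 1, g + 1)`. -/
abbrev WeightedProj (R : Type u) [CommRing R] (g : ℕ) : Scheme.{u} := Proj (grading R g)

/-- The structure morphism of `ℙ_R(1, 1, g + 1)`. -/
def weightedProjToSpec (R : Type u) [CommRing R] (g : ℕ) :
    WeightedProj R g ⟶ Spec (CommRingCat.of R) :=
  Proj.toSpecZero (grading R g) ≫
    Spec.map (CommRingCat.ofHom (algebraMap R (grading R g 0)))

/-- The weighted homogeneous polynomial `y ^ 2 - ∑ i, f i * x ^ i * s ^ (2 * g + 2 - i)`. -/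
def equation {R : Type u} [CommRing R] {g : ℕ} (f : Fin (2 * g + 3) → R) :
    MvPolynomial (Fin 3) R :=
  MvPolynomial.X 2 ^ 2 - ∑ i : Fin (2 * g + 3),
    MvPolynomial.C (f i) * MvPolynomial.X 0 ^ (i : ℕ) *
      MvPolynomial.X 1 ^ (2 * g + 2 - (i : ℕ))

/-- The binary form `f` of degree `2 g + 2` is nonzero without repeated factors over `K`:
its dehomogenisation is squarefree, and `s ^ 2` does not divide `f`. For `g ≥ 1` this says
that `y ^ 2 = f(x, s)` is a smooth, geometrically integral curve of genus `g`. -/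
def IsSeparableForm {K : Type u} [Field K] {g : ℕ} (f : Fin (2 * g + 3) → 𝓞 K) : Prop :=
  Squarefree (∑ i : Fin (2 * g + 3), C (f i : K) * X ^ (i : ℕ) : K[X]) ∧
    (f ⟨2 * g + 2, by omega⟩ ≠ 0 ∨ f ⟨2 * g + 1, by omega⟩ ≠ 0)

section Model

variable {K : Type u} [Field K] [NumberField K] {g : ℕ} (f : Fin (2 * g + 3) → 𝓞 K)

/-- The Zariski closure, in `ℙ_{𝓞 K}(1, 1, g + 1)`, of the curve `y ^ 2 = f(x, s)` in the generic
fibre (the set of homogeneous primes which contain the equation and lie over `(0) ⊂ 𝓞 K`). -/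
def closedLocus : TopologicalSpace.Closeds (WeightedProj (𝓞 K) g) :=
  TopologicalSpace.Closeds.closure
    {P : WeightedProj (𝓞 K) g | equation f ∈ P.asHomogeneousIdeal ∧
      ∀ r : 𝓞 K, MvPolynomial.C r ∈ P.asHomogeneousIdeal → r = 0}

/-- The naive model `𝒞₁`: the Zariski closure of `C`, with its reduced structure. -/
def naiveModel : Scheme.{u} :=
  (Scheme.IdealSheafData.vanishingIdeal (closedLocus f)).subscheme

/-- The inclusion of `𝒞₁` into weighted projective space. -/
def naiveModelι : naiveModel f ⟶ WeightedProj (𝓞 K) g :=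
  (Scheme.IdealSheafData.vanishingIdeal (closedLocus f)).subschemeι

/-- The structure morphism `𝒞₁ ⟶ Spec (𝓞 K)`. -/
def naiveModelToSpec : naiveModel f ⟶ Spec (CommRingCat.of (𝓞 K)) :=
  naiveModelι f ≫ weightedProjToSpec (𝓞 K) g

/-- The hyperelliptic curve `C`, as the generic fibre of `𝒞₁`. -/
def curve : Scheme.{u} :=
  (naiveModelToSpec f).fiber (genericPoint (Spec (CommRingCat.of (𝓞 K))))

/-- The map `C ⟶ 𝒞₁`. -/
def curveι : curve f ⟶ naiveModel f :=
  (naiveModelToSpec f).fiberι (genericPoint (Spec (CommRingCat.of (𝓞 K))))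

/-- The residue degree `[κ(P) : K]` of a point of `C`. -/
def residueDegree (P : curve f) : ℕ :=
  ((naiveModelToSpec f).fiberToSpecResidueField
    (genericPoint (Spec (CommRingCat.of (𝓞 K))))).residueDegree P

end Model

/-! ### Resolutions -/

/-- An ideal sheaf is invertible if it is locally generated by a non-zero-divisor. -/
def IsInvertible {X : Scheme.{u}} (I : X.IdealSheafData) : Prop :=
  ∀ x : X, ∃ U : X.affineOpens, x ∈ U.1 ∧
    ∃ r ∈ nonZeroDivisors Γ(X, U.1), I.ideal U = Ideal.span {r}

/-- `π : Y ⟶ X` is the blowup of `X` along the ideal sheaf `I`: the final morphism to `X` for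
which the inverse image ideal sheaf of `I` is invertible. -/
structure IsBlowup {X Y : Scheme.{u}} (π : Y ⟶ X) (I : X.IdealSheafData) : Prop where
  isInvertible : IsInvertible (I.comap π)
  existsUnique_lift : ∀ (T : Scheme.{u}) (φ : T ⟶ X), IsInvertible (I.comap φ) →
    ∃! ψ : T ⟶ Y, ψ ≫ π = φ

/-- The closed point of `Spec (𝓞 K)` given by a maximal ideal. -/
def closedPt {K : Type u} [Field K] [NumberField K] (ν : HeightOneSpectrum (𝓞 K)) :
    Spec (CommRingCat.of (𝓞 K)) :=
  (⟨ν.asIdeal, ν.isPrime⟩ : PrimeSpectrum (𝓞 K))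

/-- `IsBlowupSequence b π l` says that `π : Y ⟶ X` is a composite of finitely many blowups, each
of them along a closed subset (with its reduced structure) of a single closed fibre over
`Spec (𝓞 K)`; for instance along a closed point or along a smooth fibral curve. The list `l`
records the primes of `𝓞 K` below the centres, the last blowup first. -/
inductive IsBlowupSequence {K : Type u} [Field K] [NumberField K] {X : Scheme.{u}}
    (b : X ⟶ Spec (CommRingCat.of (𝓞 K))) :
    {Y : Scheme.{u}} → (Y ⟶ X) → List (HeightOneSpectrum (𝓞 K)) → Prop
  | refl : IsBlowupSequence b (𝟙 X) []
  | blowup {Y Y' : Scheme.{u}} (π : Y ⟶ X) (l : List (HeightOneSpectrum (𝓞 K)))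
      (h : IsBlowupSequence b π l) (ν : HeightOneSpectrum (𝓞 K))
      (Z : TopologicalSpace.Closeds Y) (hZ : ∀ z ∈ Z, (π ≫ b) z = closedPt ν)
      (ρ : Y' ⟶ Y) (hρ : IsBlowup ρ (Scheme.IdealSheafData.vanishingIdeal Z)) :
      IsBlowupSequence b (ρ ≫ π) (ν :: l)

/-- A scheme all of whose local rings are regular. -/
def IsRegularScheme (X : Scheme.{u}) : Prop :=
  ∀ x : X, IsRegularLocalRing (X.presheaf.stalk x)

/-! ### Points of the curve with coordinates -/

section Points

variable {K : Type u} [Field K] [NumberField K] {g : ℕ} (f : Fin (2 * g + 3) → 𝓞 K)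

/-- An `L`-valued point `(x : s : y)` of the curve `y ^ 2 = f(x, s)` in `ℙ(1, 1, g + 1)`, given by
its unique representative with `s = 1`, or `s = 0` and `x = 1`. (There is no point with
`x = s = 0` on the curve.) -/
@[ext]
structure CurvePoint (L : Type v) [Field L] [Algebra K L] where
  x : L
  s : L
  y : L
  eqn : y ^ 2 = ∑ i : Fin (2 * g + 3), algebraMap K L (f i) * x ^ (i : ℕ) *
    s ^ (2 * g + 2 - (i : ℕ))
  normalized : s = 1 ∨ (s = 0 ∧ x = 1)

namespace CurvePoint

variable {f} {L : Type v} [Field L] [Algebra K L]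

/-- The image `p⁻` of a point under the hyperelliptic involution. -/
def involution (p : CurvePoint f L) : CurvePoint f L where
  x := p.x
  s := p.s
  y := -p.y
  eqn := by rw [neg_sq]; exact p.eqn
  normalized := p.normalized

/-- Extension of the field of definition of a point. -/
def map {M : Type v} [Field M] [Algebra K M] (φ : L →ₐ[K] M) (p : CurvePoint f L) :
    CurvePoint f M where
  x := φ p.x
  s := φ p.s
  y := φ p.y
  eqn := by
    rw [← map_pow, p.eqn]
    simp
  normalized := by
    rcases p.normalized with h | ⟨h, h'⟩
    · left; simp [h]
    · right; simp [h, h']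

/-- The `L`-valued point `p` is supported at the scheme-theoretic point `P` of `C`: a weighted
homogeneous polynomial vanishes at `P` if and only if it vanishes at the coordinates of `p`. -/
def LiesAt (p : CurvePoint f L) (P : curve f) : Prop :=
  ∀ (n : ℕ), ∀ h ∈ grading (𝓞 K) g n,
    h ∈ ((curveι f ≫ naiveModelι f) P : WeightedProj (𝓞 K) g).asHomogeneousIdeal ↔
      MvPolynomial.eval₂ ((algebraMap K L).comp (algebraMap (𝓞 K) K)) ![p.x, p.s, p.y] h = 0

/-- The distance `d_w` between two points at a finite place `w`. -/
def dist [NumberField L] (w : FinitePlace L) (p q : CurvePoint f L) : ℝ :=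
  open Classical in
  if w p.x ≤ w p.s ∧ w q.x ≤ w q.s then
    max (w (p.x / p.s - q.x / q.s)) (w (p.y / p.s ^ (g + 1) - q.y / q.s ^ (g + 1)))
  else if w p.s ≤ w p.x ∧ w q.s ≤ w q.x then
    max (w (p.s / p.x - q.s / q.x)) (w (p.y / p.x ^ (g + 1) - q.y / q.x ^ (g + 1)))
  else 1

end CurvePoint

/-! ### Divisors -/

/-- An effective Weil divisor on `C` (over `K`). -/
structure EffectiveDivisor where
  mult : curve f →₀ ℕ
  isClosed : ∀ P, mult P ≠ 0 → IsClosed ({P} : Set (curve f))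

namespace EffectiveDivisor

variable {f}

/-- The degree over `K`. -/
def degree (D : EffectiveDivisor f) : ℕ :=
  D.mult.sum fun P n => n * residueDegree f P

/-- Reduced divisors: effective, Weierstrass points (fixed points of the involution) have
coefficient at most `1`, no two distinct points `p`, `p⁻` both occur, and the degree is at most
`g`. The conditions on points refer to points over an algebraic closure. -/
def IsReduced (D : EffectiveDivisor f) : Prop :=
  (∀ (p : CurvePoint f (AlgebraicClosure K)) (P : curve f), p.LiesAt P →
    p.involution = p → D.mult P ≤ 1) ∧
  (∀ (p : CurvePoint f (AlgebraicClosure K)) (P Q : curve f), p.LiesAt P →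
    p.involution.LiesAt Q → p.involution ≠ p → D.mult P = 0 ∨ D.mult Q = 0) ∧
  D.degree ≤ g

/-- The supports have no common point. -/
def DisjointSupport (D E : EffectiveDivisor f) : Prop :=
  ∀ P, D.mult P = 0 ∨ E.mult P = 0

/-- Every geometric point in the support of `D` is defined over `L`. -/
def PointwiseRational (D : EffectiveDivisor f) (L : Type v) [Field L] [Algebra K L] : Prop :=
  ∀ (q : CurvePoint f (AlgebraicClosure L)) (P : curve f), q.LiesAt P → D.mult P ≠ 0 →
    ∃ p : CurvePoint f L, p.map (IsScalarTower.toAlgHom K L (AlgebraicClosure L)) = q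

/-- `D = ∑ i, p i` over `L`, i.e. every `L`-valued point occurs in the family `p` as often as the
coefficient of `D` at its support says. (To be used when `D` is pointwise rational over `L`.) -/
def IsSumOf (D : EffectiveDivisor f) {L : Type v} [Field L] [Algebra K L] {d : ℕ}
    (p : Fin d → CurvePoint f L) : Prop :=
  ∀ (c : CurvePoint f L) (P : curve f), c.LiesAt P → Nat.card {i // p i = c} = D.mult P

end EffectiveDivisor

end Points

/-! ### Intersection numbers on a model -/

section Intersection

/-- The ideal, in the local ring of `X` at `Q`, of the closure of the point `η`: the germs which
vanish at `η` if `Q` lies in the closure of `η`, the unit ideal otherwise. -/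
def closureIdeal {X : Scheme.{u}} (η Q : X) : Ideal (X.presheaf.stalk Q) :=
  open Classical in
  if h : η ⤳ Q then
    RingHom.ker (X.presheaf.stalkSpecializes h ≫ X.residue η).hom
  else ⊤

variable {K : Type u} [Field K] [NumberField K] {g : ℕ} {f : Fin (2 * g + 3) → 𝓞 K}
  {X : Scheme.{u}} (π : X ⟶ naiveModel f)

/-- The local ideal at `Q` of the closure `𝒟` on `X` of the divisor `D` on `C`. For a prime
divisor `P` it is the ideal of the closure of the (unique) point of `X` over `P`, and it is
extended to all effective divisors by multiplicativity. -/
def divisorIdeal (D : EffectiveDivisor f) (Q : X) : Ideal (X.presheaf.stalk Q) :=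
  ∏ P ∈ D.mult.support,
    (⨅ (η : X) (_ : π η = curveι f P), closureIdeal η Q) ^ D.mult P

/-- The local intersection multiplicity at `Q` of the closures of `D` and `E`. -/
def localMultiplicity (D E : EffectiveDivisor f) (Q : X) : ℕ∞ :=
  Module.length (X.presheaf.stalk Q)
    (X.presheaf.stalk Q ⧸ (divisorIdeal π D Q ⊔ divisorIdeal π E Q))

/-- The points of `X` over the finite place `ν` of `K`. -/
def specialFibre (ν : HeightOneSpectrum (𝓞 K)) : Set X :=
  {Q | (π ≫ naiveModelToSpec f) Q = closedPt ν}

/-- The arithmetic intersection pairing at `ν`: the sum of the local multiplicities at the points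
`Q` over `ν`, weighted by `log #κ(Q)`. -/
def intersectionPairing (D E : EffectiveDivisor f) (ν : HeightOneSpectrum (𝓞 K)) : ℝ :=
  ∑ᶠ Q ∈ specialFibre π ν,
    ((localMultiplicity π D E Q).toNat : ℝ) * Real.log (Nat.card (X.residueField Q))

end Intersection

/-! ### The input of the algorithm -/

/-- The integer polynomial with a given list of coefficients, constant coefficient first. -/
def polyOfList (l : List ℤ) : ℤ[X] :=
  ∑ i ∈ Finset.range l.length, C (l.getD i 0) * X ^ i

/-- Finite data that describe a number field and a binary form over it: the coefficients of a
monic integer polynomial, a common denominator, and one list of integers per coefficient. -/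
abbrev CurveData : Type := List ℤ × ℕ × List (List ℤ)

/-- `data = (m, N, c)` describes `(K, f)`: `K = ℚ(θ)` where `θ` is an algebraic integer with
minimal polynomial `m`, and `f i = N⁻¹ ∑ j, c i j θ ^ j`. -/
def Describes (data : CurveData) {K : Type u} [Field K] [NumberField K] {g : ℕ}
    (f : Fin (2 * g + 3) → 𝓞 K) : Prop :=
  ∃ θ : K, IntermediateField.adjoin ℚ {θ} = ⊤ ∧ IsIntegral ℤ θ ∧
    minpoly ℤ θ = polyOfList data.1 ∧ data.2.1 ≠ 0 ∧ data.2.2.length = 2 * g + 3 ∧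
    ∀ i : Fin (2 * g + 3),
      (data.2.1 : K) * (f i : K) = aeval θ (polyOfList (data.2.2.getD i []))

end Hyperelliptic

end

noncomputable section
set_option linter.unusedSectionVars false

namespace Hyperelliptic

open RingHom (ker mem_ker ker_isPrime ker_eq_comap_bot comap_ker)
open Ideal (span map_span absNorm mul_mem_right mem_comap mem_span_singleton
  span_singleton_le_iff_mem mem_bot mul_mem_left mem_span_singleton_self span_singleton_prime
  mk_ker comap_isPrime)
open CommRingCat (ofHom ofHom_hom ofHom_comp)
open Finset (mem_univ sum_congr mul_sum prod_mul_distrib sum_mul prod_congr sum_ite_eq prod_const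
  card_univ prod_insert prod_le_prod prod_nonneg prod_pos prod_le_one sum_eq_zero sum_sub_distrib
  abs_sum_le_sum_abs sum_le_sum sum_comm)
open Ideal.Quotient (mk_surjective isDomain_iff_prime eq_zero_iff_mem)
open Function (Bijective Injective Surjective)
open Category (assoc comp_id id_comp)
open Scheme.IdealSheafData (ofIdealTop le_of_isAffine comap_comp vanishingIdeal
  vanishingIdeal_ideal coe_support_vanishingIdeal)
open HomogeneousLocalization (fromZeroRingHom val_injective awayMap awayMap_mk)
open MvPolynomial (eval₂_eq' isWeightedHomogeneous_C eval₂Hom eval₂Hom_C eval₂Hom_X'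
  constantCoeff_eq)
open Module (finrank finBasis finrank_pos)
open IsLocalRing (maximalIdeal closedPoint mem_maximalIdeal of_surjective' maximalIdeal_le_jacobson
  le_maximalIdeal)
open FaithfulSMul (algebraMap_injective algebraMap_eq_zero_iff)
open Fintype (card card_fin)
open IsLocalization (lift_mk'_spec map_units mk'_spec exists_mk'_eq mk' integerNormalization)
open Real (log_prod log_pow posLog)
open AddMonoidHom (mulLeft coe_mulLeft)
open Encodable (encode length_le_encode)
open Module.Finite (of_restrictScalars_finite)
open IsScalarTower (toAlgHom)
open HomogeneousLocalization.Away (isLocalizationElem isLocalization_mul val_mk)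
open StructureSheaf.IsLocalization (to_stalk)
open Submodule (exists_mem_ne_zero_of_ne_bot mapQ mapQ_apply)
open IsFractionRing (injective lift_algebraMap isAlgebraic_iff)
open IsRegularLocalRing (spanFinrank_maximalIdeal)
open AdjoinRoot (of eval₂_root mk_eq_mk)

/-! Both sides are bilinear in the divisors, so it suffices to treat two distinct closed points `P`,
`P'` of `C`, with an error proportional to `deg P * deg P'`.

A local ring of the model through which the closure of a closed point passes is regular of dimension
at most two, hence factorial, so the closure of `P'` has a local equation `h` there. Let `p` be an
`L`-point at `P`. Evaluating germs at `p` identifies the local ring modulo the ideal of `P` with a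
subring of the residue field of `P`. Counting the quotient of this subring by the value of `h`, by
means of the places of `L` (`card_quotient_pow_finrank`), turns the intersection number into a sum
of `-log |h(p)|_w` over the places `w` of `L`, where `h` is taken at the reduction `Q` of `p` at `w`
(`pairLength_mul_log`, `exists_sum_pairTerm`).

All then rests on an estimate at one place, `abv_localEquation`: `|h(p)|_w` and `∏ d_w(p, q)`, over
the geometric points `q` of `P'`, agree up to a factor `|Θ|_w ^ deg P'`. Here `Θ = (n!)^2 * 4δ *
M^2` is `badElement`, with `δ` a discriminant of the form and `M` the product of the residue
cardinalities below the centres. The product formula sums the errors to a multiple of `log |N(Θ)|`.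

For one inequality, a product of lines `y - b - j (x - a)` through the points `(a, b)` of `P'`,
scaled to be primitive, is a function on the model that vanishes on `P'`, so `h` divides it. A
suitable integer `j` makes each line nearly as large as its two terms (`exists_shift`), and Gauss's
lemma controls the scaling. For the other, multiply by lines through the conjugate points: each
product is `(x - a) * Y`, and `Y` is not small near the curve because the curve is smooth
(`abv_eval_slope_ge`). This needs the norm of `x - a` to divide `h` times the conjugate lines in the
local ring of the model. At horizontal primes that is a fact about curves over a field; at vertical
primes, the power `M ^ (2 * deg P')` already suffices (`dvd_normProd_pow_mul`).

The blowups enter only through lifting. A centre in the fibre over `ν` has the integer `N(ν)` in its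
ideal. So points with values in a local principal ideal domain of characteristic zero lift uniquely,
and two points congruent modulo `M t` have lifts congruent modulo `t`
(`IsBlowupSequence.exists_lift_congruentPairs`). Hence points closer than `|M|_w` reduce to the same
`Q`, and at a vertical prime `x` cannot approximate a root of a nonzero polynomial to more than
`M^2` (`sub_dvd_normProd_sq`).

Finally, the conjugates of `Θ` are bounded by a primitive recursive function of the code of the
input. -/

variable {K : Type u} [Field K] [NumberField K] {g : ℕ} {f : Fin (2 * g + 3) → 𝓞 K}

/-- The homogeneous coordinate ring of the ambient weighted projective plane. -/
notation "𝓐" K:max => MvPolynomial (Fin 3) (𝓞 K)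

/-- The `L`-valued points of the curve which lie at `P`. -/
notation "𝓢" f:max L:max P:max => {q : CurvePoint f L // CurvePoint.LiesAt q P}

/-- All geometric points at `P` are rational over `L`. -/
abbrev IsSplitAt (L : Type v) [Field L] [Algebra K L] (P : curve f) : Prop :=
  ∀ q : CurvePoint f (AlgebraicClosure L), q.LiesAt P →
    ∃ p : CurvePoint f L, p.map (toAlgHom K L (AlgebraicClosure L)) = q

instance finite_numberField (L : Type v) [Field L] [NumberField L] [Algebra K L] :
    Module.Finite K L := of_restrictScalars_finite ℚ K L

/-! ### Pullbacks of ideal sheaves to spectra of local rings -/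

/-- On an affine target, the ideal of a pulled back ideal sheaf is the extended ideal. -/
lemma comap_ideal_top {X Y : Scheme.{u}} [IsAffine X] [IsAffine Y] (f : X ⟶ Y)
    (I : Y.IdealSheafData) :
    (I.comap f).ideal ⟨⊤, isAffineOpen_top X⟩ =
      (I.ideal ⟨⊤, isAffineOpen_top Y⟩).map f.appTop.hom := by
  apply eq_of_forall_ge_iff
  intro J
  rw [Ideal.map_le_iff_le_comap]
  let J' := ofIdealTop J
  have hJ' : J'.ideal ⟨⊤, isAffineOpen_top X⟩ = J := by simp [J']
  have h1 : (I.comap f ≤ J') ↔ (I.comap f).ideal ⟨⊤, isAffineOpen_top X⟩ ≤ J := by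
    constructor
    · intro h
      rw [← hJ']
      exact h _
    · intro h
      exact le_of_isAffine (by rw [hJ']; exact h)
  rw [← h1, ← Scheme.IdealSheafData.le_map_iff_comap_le]
  have h2 : (J'.map f).ideal ⟨⊤, isAffineOpen_top Y⟩ = J.comap f.appTop.hom := by
    rw [Scheme.IdealSheafData.ideal_map_of_isAffineHom]
    rw [← hJ']
    rfl
  rw [← h2]
  constructor
  · intro h
    exact h _
  · intro h
    exact le_of_isAffine h

/-- Pullback of an ideal sheaf along a morphism from an affine scheme into an affine open. -/
lemma comap_ideal_top_of_le {X Y : Scheme.{u}} [IsAffine X] (U : Y.affineOpens)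
    (f : X ⟶ Y) (hf : ⊤ ≤ f ⁻¹ᵁ U.1) (I : Y.IdealSheafData) :
    (I.comap f).ideal ⟨⊤, isAffineOpen_top X⟩ = (I.ideal U).map (f.appLE U.1 ⊤ hf).hom := by
  have : IsAffine U.1.toScheme := U.2
  have hr : Set.range f ⊆ Set.range U.1.ι := by
    rintro _ ⟨x, rfl⟩
    simpa using hf (show x ∈ ⊤ from trivial)
  obtain ⟨f', rfl⟩ : ∃ f' : X ⟶ U.1, f' ≫ U.1.ι = f :=
    ⟨IsOpenImmersion.lift U.1.ι f hr, IsOpenImmersion.lift_fac _ _ _⟩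
  rw [comap_comp, comap_ideal_top, Scheme.IdealSheafData.ideal_comap_of_isOpenImmersion]
  have hU : U.1.ι ''ᵁ ⊤ = U.1 := by simp
  have h1 := I.map_ideal' (U := ⟨U.1.ι ''ᵁ ⊤, (isAffineOpen_top _).image_of_isOpenImmersion U.1.ι⟩)
    (V := U) (homOfLE hU.le).op
  rw [← h1]
  have h2 : ∀ (A B : CommRingCat.{u}) (e : A ≅ B) (J : Ideal A),
      J.comap e.inv.hom = J.map e.hom.hom := by
    intro A B e J
    exact (Ideal.map_comap_of_equiv (I := J) e.commRingCatIsoToRingEquiv).symm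
  rw [h2, Ideal.map_map, Ideal.map_map]
  congr 1
  rw [← CommRingCat.hom_comp, ← CommRingCat.hom_comp]
  congr 1
  change _ ≫ (U.1.ι.appIso ⊤).hom ≫ f'.app ⊤ = _
  rw [Scheme.Hom.appIso_hom', Scheme.Hom.app_eq_appLE, Scheme.Hom.appLE_comp_appLE,
    Scheme.Hom.map_appLE]
  rfl

lemma isInvertible_of_isAffine {X : Scheme.{u}} [IsAffine X] (I : X.IdealSheafData)
    (r : Γ(X, ⊤)) (hr : r ∈ nonZeroDivisors Γ(X, ⊤))
    (h : I.ideal ⟨⊤, isAffineOpen_top X⟩ = span {r}) : IsInvertible I :=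
  fun _ => ⟨⟨⊤, isAffineOpen_top X⟩, trivial, r, hr, h⟩

/-- A morphism from the spectrum of a local ring factors through every open neighbourhood of the
image of the closed point. -/
lemma top_le_preimage_of_closedPoint_mem {Y : Scheme.{u}} {W : Type u} [CommRing W] [IsLocalRing W]
    (φ : Spec (.of W) ⟶ Y) (U : Y.Opens)
    (h : φ (closedPoint W) ∈ U) : ⊤ ≤ φ ⁻¹ᵁ U := by
  intro x _
  have : x ⤳ (closedPoint W : PrimeSpectrum W) := IsLocalRing.specializes_closedPoint x
  exact (this.map φ.continuous).mem_open U.2 h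

/-- The ring homomorphism on sections over `U` given by a morphism `Spec W ⟶ U ⊆ Y`. -/
def sectionsHom {Y : Scheme.{u}} {W : Type u} [CommRing W] 
    (φ : Spec (.of W) ⟶ Y) (U : Y.Opens) (h : ⊤ ≤ φ ⁻¹ᵁ U) : Γ(Y, U) →+* W :=
  (φ.appLE U ⊤ h ≫ (Scheme.ΓSpecIso (CommRingCat.of W)).hom).hom

lemma sectionsHom_comp {Y : Scheme.{u}} {W W' : Type u} [CommRing W] [CommRing W']
    (φ : Spec (.of W) ⟶ Y) (U : Y.Opens) (h : ⊤ ≤ φ ⁻¹ᵁ U) (g : W →+* W')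
    (h' : ⊤ ≤ (Spec.map (ofHom g) ≫ φ) ⁻¹ᵁ U) :
    sectionsHom (Spec.map (ofHom g) ≫ φ) U h' = g.comp (sectionsHom φ U h) := by
  unfold sectionsHom
  have h1 : (Spec.map (ofHom g)).appLE ⊤ ⊤ le_top = (Spec.map (ofHom g)).appTop := by
    rw [Scheme.Hom.appTop, Scheme.Hom.app_eq_appLE]; rfl
  rw [← Scheme.Hom.appLE_comp_appLE _ _ U ⊤ ⊤ h le_top, assoc, h1, Scheme.ΓSpecIso_naturality]
  rfl

/-- If the ideal generated in a local ring `W` by `I` is generated by a non-zero-divisor, then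
the pullback of `I` to `Spec W` is invertible. -/
lemma isInvertible_comap_of_span {Y : Scheme.{u}} {W : Type u} [CommRing W] (I : Y.IdealSheafData)
    (φ : Spec (.of W) ⟶ Y) (U : Y.affineOpens) (h : ⊤ ≤ φ ⁻¹ᵁ U.1)
    (r : W) (hr : r ∈ nonZeroDivisors W)
    (hI : (I.ideal U).map (sectionsHom φ U.1 h) = span {r}) : IsInvertible (I.comap φ) := by
  let e : Γ(Spec (.of W), ⊤) ≃+* W := (Scheme.ΓSpecIso (CommRingCat.of W)).commRingCatIsoToRingEquiv
  refine isInvertible_of_isAffine _ (e.symm r) ?_ ?_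
  · exact (MulEquivClass.map_nonZeroDivisors e.symm.toMulEquiv) ▸ ⟨r, hr, rfl⟩
  · rw [comap_ideal_top_of_le U φ h]
    have h1 : (I.ideal U).map (sectionsHom φ U.1 h) =
        ((I.ideal U).map (φ.appLE U.1 ⊤ h).hom).map (e : Γ(Spec (.of W), ⊤) →+* W) := by
      rw [Ideal.map_map]; rfl
    rw [h1] at hI
    have h2 := congrArg (Ideal.map (e.symm : W →+* Γ(Spec (.of W), ⊤))) hI
    rw [Ideal.map_map, map_span, Set.image_singleton] at h2
    simpa using h2

/-- The structure of the vanishing ideal: a section vanishing at all points of `Z`. -/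
lemma mem_vanishingIdeal_of_forall {Y : Scheme.{u}} (Z : TopologicalSpace.Closeds Y)
    (U : Y.affineOpens) (a : Γ(Y, U.1)) (h : ∀ z ∈ Z, z ∈ U.1 → z ∉ Y.basicOpen a) :
    a ∈ (vanishingIdeal Z).ideal U := by
  rw [vanishingIdeal_ideal]
  rw [PrimeSpectrum.mem_vanishingIdeal]
  intro x hx
  by_contra hcon
  have hx' : U.2.fromSpec x ∈ Z := hx
  refine h _ hx' ?_ ?_
  · have := U.2.range_fromSpec ▸ Set.mem_range_self x
    exact this
  · have : x ∈ U.2.fromSpec ⁻¹ᵁ Y.basicOpen a := by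
      rw [U.2.fromSpec_preimage_basicOpen]
      exact hcon
    exact this

lemma notMem_of_isUnit_stalk_Spec {R : CommRingCat.{u}} (p : PrimeSpectrum R) (r : R)
    (h : IsUnit (StructureSheaf.toStalk R p r)) : r ∉ p.asIdeal := by
  have := to_stalk R p
  exact (IsLocalization.AtPrime.isUnit_to_map_iff
    ((Spec.structureSheaf R).presheaf.stalk p) p.asIdeal r).mp h

lemma notMem_of_isUnit_stalk_natCast {R : CommRingCat.{u}} (p : PrimeSpectrum R) (n : ℕ)
    (h : IsUnit (n : (Spec R).presheaf.stalk p)) : (n : R) ∉ p.asIdeal := by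
  refine notMem_of_isUnit_stalk_Spec p _ ?_
  rw [map_natCast]
  exact h
-- The norm of `ν` lies in `ν`, so it vanishes at every point of the centre. This nonzero integer is
-- the only feature of a centre that enters the lifting arguments.
lemma natCast_mem_vanishingIdeal {K : Type u} [Field K] [NumberField K] {Y : Scheme.{u}}
    (b : Y ⟶ Spec (.of (𝓞 K))) (ν : HeightOneSpectrum (𝓞 K))
    (Z : TopologicalSpace.Closeds Y) (hZ : ∀ z ∈ Z, b z = closedPt ν) (U : Y.affineOpens) :
    ((absNorm ν.asIdeal : ℕ) : Γ(Y, U.1)) ∈ (vanishingIdeal Z).ideal U := by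
  refine mem_vanishingIdeal_of_forall Z U _ fun z hz hzU hzb => ?_
  rw [Scheme.mem_basicOpen _ _ _ hzU, map_natCast] at hzb
  have h1 : IsUnit ((absNorm ν.asIdeal : ℕ) :
      (Spec (.of (𝓞 K))).presheaf.stalk (b z)) := by
    refine isUnit_of_map_unit (b.stalkMap z).hom _ ?_
    rwa [map_natCast]
  rw [hZ z hz] at h1
  exact notMem_of_isUnit_stalk_natCast (R := CommRingCat.of (𝓞 K)) (closedPt ν) _ h1
    (Ideal.absNorm_mem ν.asIdeal)

/-! ### Pairs of congruent elements -/

/-- In a local principal ideal domain, one element of a nonempty family divides all others. -/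
lemma exists_dvd_of_pid {V : Type*} [CommRing V] [IsDomain V] [IsLocalRing V]
    [IsPrincipalIdealRing V] {ι : Type*} [Nonempty ι] (a : ι → V) : ∃ i, ∀ j, a i ∣ a j := by
  have : ValuationRing V := by
    by_cases h : IsField V
    · let := h.toField
      infer_instance
    · haveI : IsDiscreteValuationRing V :=
        { not_a_field' := fun h' => h (IsLocalRing.isField_iff_maximalIdeal_eq.mpr h') }
      infer_instance
  obtain ⟨i, hi⟩ := set_has_maximal_iff_noetherian.mpr
    (inferInstance : IsNoetherianRing V) (Set.range fun i => span {a i})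
    (Set.range_nonempty _)
  obtain ⟨⟨i, rfl⟩, hmax⟩ := hi
  refine ⟨i, fun j => ?_⟩
  rcases ValuationRing.dvd_total (a i) (a j) with h | h
  · exact h
  · by_contra hcon
    refine hmax _ ⟨j, rfl⟩ (lt_of_le_of_ne (Ideal.span_singleton_le_span_singleton.mpr h) ?_)
    intro heq
    exact hcon (Ideal.span_singleton_le_span_singleton.mp heq.ge)

/-- The ring of pairs of elements of `V` that are congruent modulo `t`. -/
def congruentPairs {V : Type*} [CommRing V] (t : V) : Subring (V × V) where
  carrier := {p | t ∣ p.1 - p.2}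
  mul_mem' := by
    rintro ⟨a, b⟩ ⟨c, d⟩ h h'
    have : a * c - b * d = (a - b) * c + b * (c - d) := by ring
    simp only [Set.mem_ofPred_eq, Prod.mk_mul_mk] at *
    rw [this]
    exact dvd_add (h.mul_right _) (h'.mul_left _)
  one_mem' := by simp
  add_mem' := by
    rintro ⟨a, b⟩ ⟨c, d⟩ h h'
    have : a + c - (b + d) = (a - b) + (c - d) := by ring
    simp only [Set.mem_ofPred_eq, Prod.mk_add_mk] at *
    rw [this]
    exact dvd_add h h'
  zero_mem' := by simp
  neg_mem' := by
    rintro ⟨a, b⟩ h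
    have : -a - -b = -(a - b) := by ring
    simp only [Set.mem_ofPred_eq, Prod.neg_mk] at *
    rw [this]
    exact h.neg_right

lemma congruentPairs_mono {V : Type*} [CommRing V] {s t : V} (h : s ∣ t) :
    congruentPairs t ≤ congruentPairs s := fun _ hp => h.trans hp

/-- Since `t` is not a unit, both components have the same residue, and the inverses are congruent
because `a' - b' = a' * b' * (b - a)`. Hence the ring of pairs is local and its first projection is
a local homomorphism. -/
lemma isUnit_congruentPairs {V : Type*} [CommRing V] [IsLocalRing V] {t : V}
    (ht : t ∈ maximalIdeal V) (p : congruentPairs t) (hp : IsUnit p.1.1) :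
    IsUnit p := by
  obtain ⟨⟨a, b⟩, c, hc⟩ := p
  have hp : IsUnit a := hp
  have hc : a - b = t * c := hc
  have hb : IsUnit b := by
    by_contra hb
    have h1 : a ∈ maximalIdeal V := by
      rw [show a = b + t * c by rw [← hc]; ring]
      exact add_mem ((mem_maximalIdeal b).mpr hb) (mul_mem_right _ _ ht)
    exact (mem_maximalIdeal a).mp h1 hp
  obtain ⟨a', ha'⟩ := hp.exists_right_inv
  obtain ⟨b', hb'⟩ := hb.exists_right_inv
  refine IsUnit.of_mul_eq_one ⟨(a', b'), ?_⟩ ?_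
  · refine ⟨-c * a' * b', ?_⟩
    show a' - b' = _
    linear_combination (- b' * a') * hc - a' * hb' + b' * ha'
  · ext
    · exact ha'
    · exact hb'

lemma isLocalRing_congruentPairs {V : Type*} [CommRing V] [IsLocalRing V] {t : V}
    (ht : t ∈ maximalIdeal V) : IsLocalRing (congruentPairs t) := by
  refine IsLocalRing.of_isUnit_or_isUnit_one_sub_self fun p => ?_
  rcases IsLocalRing.isUnit_or_isUnit_one_sub_self p.1.1 with h | h
  · exact Or.inl (isUnit_congruentPairs ht p h)
  · exact Or.inr (isUnit_congruentPairs ht (1 - p) h)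

/-- An ideal which contains `N` becomes principal on pairs congruent modulo `t`, when it is
extended from pairs congruent modulo a multiple of `N * t`. -/
lemma exists_map_congruentPairs_eq_span {V : Type*} [CommRing V] [IsDomain V] [IsLocalRing V]
    [IsPrincipalIdealRing V] [CharZero V] {Γ : Type*} [CommRing Γ] (J : Ideal Γ) (N : ℕ)
    (hN0 : N ≠ 0) (hN : (N : Γ) ∈ J) {t T : V} (ht : t ∈ maximalIdeal V)
    (hT : (N : V) * t ∣ T) (s : Γ →+* congruentPairs T) :
    ∃ r ∈ nonZeroDivisors (congruentPairs t), J.map ((Subring.inclusion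
        (congruentPairs_mono ((Dvd.intro_left _ rfl).trans hT))).comp s) = span {r} := by
  set ι := Subring.inclusion (congruentPairs_mono ((Dvd.intro_left (N : V) rfl).trans hT)) with hι
  have : Nonempty J := ⟨0⟩
  -- The generator is the element of `J` whose first component `a₀` divides all first components; in
  -- particular `a₀` divides `N`, with quotient `c`.
  obtain ⟨j₀, hj₀⟩ := exists_dvd_of_pid fun j : J => (s j.1).1.1
  obtain ⟨c, hc⟩ := hj₀ ⟨N, hN⟩
  obtain ⟨y, hy⟩ := hT
  have hc : (N : V) = (s j₀.1).1.1 * c := by rw [← hc]; simp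
  have hz : ∀ j : J, ∃ z, (s j.1).1.1 - (s j.1).1.2 = T * z := fun j => (s j.1).2
  choose z hz using hz
  choose d hd using hj₀
  set a₀ := (s j₀.1).1.1
  have ha₀ : a₀ ≠ 0 := by
    intro h
    rw [h, zero_mul] at hc
    exact hN0 (by exact_mod_cast hc)
  -- With `T = N * t * y` and `N = a₀ * c`, the congruence modulo `T` says that the second component
  -- of the generator is `a₀ * ε`, and `ε` is a unit because `t` is not.
  set ε := 1 - c * t * y * z j₀ with hε
  have hεu : IsUnit ε := by
    by_contra hcon
    have h1 : (1 : V) ∈ maximalIdeal V := by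
      rw [show (1 : V) = ε + t * (c * y * z j₀) by rw [hε]; ring]
      exact add_mem ((mem_maximalIdeal ε).mpr hcon) (mul_mem_right _ _ ht)
    exact (mem_maximalIdeal _).mp h1 isUnit_one
  obtain ⟨ε', hε'⟩ := hεu.exists_right_inv
  have hb₀ : (s j₀.1).1.2 = a₀ * ε := by
    have := hz j₀
    rw [hε]
    linear_combination (-1 : V) * this - z j₀ * hy - (t * y * z j₀) * hc
  have hb₀' : (s j₀.1).1.2 ≠ 0 := by rw [hb₀]; exact mul_ne_zero ha₀ hεu.ne_zero
  refine ⟨ι (s j₀.1), ?_, ?_⟩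
  · rw [mem_nonZeroDivisors_iff_right]
    rintro ⟨⟨x, x'⟩, hx⟩ h0
    have h1 : x * a₀ = 0 := congrArg (fun p => p.1.1) h0
    have h2 : x' * (s j₀.1).1.2 = 0 := congrArg (fun p => p.1.2) h0
    ext
    · exact (mul_eq_zero.mp h1).resolve_right ha₀
    · exact (mul_eq_zero.mp h2).resolve_right hb₀'
  · apply le_antisymm
    · rw [Ideal.map_le_iff_le_comap]
      intro j hj
      rw [mem_comap, mem_span_singleton]
      -- The second component of an arbitrary `j` is `a₀ * (d - c * t * y * z)`; dividing by `a₀ *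
      -- ε` gives a cofactor congruent to `d` modulo `t` only. This is where one factor `N` of the
      -- congruence is lost.
      refine ⟨⟨(d ⟨j, hj⟩, ε' * (d ⟨j, hj⟩ - c * t * y * z ⟨j, hj⟩)), ?_⟩, ?_⟩
      · refine ⟨ε' * (-c * y * z j₀ * d ⟨j, hj⟩ + c * y * z ⟨j, hj⟩), ?_⟩
        show d ⟨j, hj⟩ - ε' * (d ⟨j, hj⟩ - c * t * y * z ⟨j, hj⟩) = _
        linear_combination (-d ⟨j, hj⟩) * hε' + (d ⟨j, hj⟩ * ε') * hε
      · ext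
        · exact hd ⟨j, hj⟩
        · show (s j).1.2 = (s j₀.1).1.2 * (ε' * (d ⟨j, hj⟩ - c * t * y * z ⟨j, hj⟩))
          have h1 := hz ⟨j, hj⟩
          have h2 := hd ⟨j, hj⟩
          rw [hb₀]
          simp only at h1 h2
          linear_combination (-1 : V) * h1 + h2 - z ⟨j, hj⟩ * hy - (t * y * z ⟨j, hj⟩) * hc
            - a₀ * (d ⟨j, hj⟩ - c * t * y * z ⟨j, hj⟩) * hε'
    · rw [span_singleton_le_iff_mem]
      exact Ideal.mem_map_of_mem (ι.comp s) j₀.2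

/-! ### Lifting points through blowups -/

section Lift

lemma exists_affineOpen_mem {Y : Scheme.{u}} (y : Y) : ∃ U : Y.affineOpens, y ∈ U.1 := by
  obtain ⟨_, ⟨U, hU, rfl⟩, hyU, -⟩ :=
    Y.isBasis_affineOpens.exists_subset_of_mem_open (Set.mem_univ y) isOpen_univ
  exact ⟨⟨U, hU⟩, hyU⟩

lemma absNorm_ne_zero (ν : HeightOneSpectrum (𝓞 K)) : absNorm ν.asIdeal ≠ 0 := by
  rw [Ne, Ideal.absNorm_eq_zero_iff]
  exact ν.ne_bot

/-- Morphisms from spectra of local principal ideal domains of characteristic zero lift uniquely to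
a blowup in a closed fibre. -/
lemma IsBlowup.existsUnique_lift_of_pid {Y Y' : Scheme.{u}} {b : Y ⟶ Spec (.of (𝓞 K))}
    {ν : HeightOneSpectrum (𝓞 K)} {Z : TopologicalSpace.Closeds Y}
    (hZ : ∀ z ∈ Z, b z = closedPt ν) {ρ : Y' ⟶ Y}
    (hρ : IsBlowup ρ (vanishingIdeal Z))
    {V : Type u} [CommRing V] [IsDomain V] [IsLocalRing V] [IsPrincipalIdealRing V] [CharZero V]
    (φ : Spec (.of V) ⟶ Y) : ∃! ψ, ψ ≫ ρ = φ := by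
  refine hρ.existsUnique_lift _ φ ?_
  obtain ⟨U, hU⟩ := exists_affineOpen_mem (φ (closedPoint V))
  have h := top_le_preimage_of_closedPoint_mem φ U.1 hU
  set J := ((vanishingIdeal Z).ideal U).map (sectionsHom φ U.1 h)
  have hN : (absNorm ν.asIdeal : V) ∈ J := by
    have := Ideal.mem_map_of_mem (sectionsHom φ U.1 h) (natCast_mem_vanishingIdeal b ν Z hZ U)
    rwa [map_natCast] at this
  refine isInvertible_comap_of_span _ φ U h (Submodule.IsPrincipal.generator J) ?_
    (Ideal.span_singleton_generator J).symm
  rw [mem_nonZeroDivisors_iff_ne_zero, Ne, ← Submodule.IsPrincipal.eq_bot_iff_generator_eq_zero]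
  intro hJ
  rw [hJ, mem_bot] at hN
  exact absNorm_ne_zero ν (by exact_mod_cast hN)

variable {X Y : Scheme.{u}} {b : X ⟶ Spec (.of (𝓞 K))} {π : Y ⟶ X}
  {l : List (HeightOneSpectrum (𝓞 K))}

/-- The product of the residue cardinalities of a list of primes. -/
def normProd (l : List (HeightOneSpectrum (𝓞 K))) : ℕ := (l.map fun ν => absNorm ν.asIdeal).prod

lemma normProd_ne_zero (l : List (HeightOneSpectrum (𝓞 K))) : normProd l ≠ 0 := by
  rw [normProd, Ne, List.prod_eq_zero_iff, List.mem_map]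
  rintro ⟨ν, -, h⟩
  exact absNorm_ne_zero ν h

/-- The valuative criterion for a sequence of blowups. -/
lemma IsBlowupSequence.existsUnique_lift (hπ : IsBlowupSequence b π l)
    {V : Type u} [CommRing V] [IsDomain V] [IsLocalRing V] [IsPrincipalIdealRing V] [CharZero V]
    (φ : Spec (.of V) ⟶ X) : ∃! ψ, ψ ≫ π = φ := by
  induction hπ with
  | refl => exact ⟨φ, comp_id _, fun ψ h => by rw [← h]; exact (comp_id _).symm⟩
  | blowup π l _ ν Z hZ ρ hρ ih =>
    obtain ⟨ψ, hψ, hu⟩ := ih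
    obtain ⟨ψ', hψ', hu'⟩ := hρ.existsUnique_lift_of_pid hZ ψ
    refine ⟨ψ', by simp only [← assoc, hψ']; exact hψ, fun χ hχ => hu' χ (hu _ ?_)⟩
    simpa using hχ

/-- Two congruent local points have congruent lifts to a sequence of blowups. -/
lemma IsBlowupSequence.exists_lift_congruentPairs (hπ : IsBlowupSequence b π l)
    {V : Type u} [CommRing V] [IsDomain V] [IsLocalRing V] [IsPrincipalIdealRing V] [CharZero V]
    {t : V} (ht : t ∈ maximalIdeal V) {T : V} (hT : (normProd l : V) * t ∣ T)
    (φ : Spec (.of (congruentPairs T)) ⟶ X) :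
    ∃ ψ : Spec (.of (congruentPairs t)) ⟶ Y, ψ ≫ π = Spec.map (ofHom (Subring.inclusion
        (congruentPairs_mono ((Dvd.intro_left _ rfl).trans hT)))) ≫ φ := by
  induction hπ generalizing t with
  | refl => exact ⟨_, comp_id _⟩
  | blowup π l h ν Z hZ ρ hρ ih =>
    set N := absNorm ν.asIdeal with hN
    -- The induction hypothesis is used for `N * t` in place of `t`: the last blowup costs one
    -- factor `N`.
    have hNt : (N : V) * t ∈ maximalIdeal V := mul_mem_left _ _ ht
    have hT' : (normProd l : V) * ((N : V) * t) ∣ T := by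
      convert hT using 1
      simp [normProd, hN]; ring
    obtain ⟨ψ, hψ⟩ := ih hNt hT'
    have hloc := isLocalRing_congruentPairs hNt
    let i : congruentPairs ((N : V) * t) →+* congruentPairs t :=
      Subring.inclusion (congruentPairs_mono (Dvd.intro_left _ rfl))
    obtain ⟨U, hU⟩ := exists_affineOpen_mem
      (ψ (closedPoint (congruentPairs ((N : V) * t))))
    have hle := top_le_preimage_of_closedPoint_mem ψ U.1 hU
    have hle' : ⊤ ≤ (Spec.map (ofHom i) ≫ ψ) ⁻¹ᵁ U.1 := fun x _ => hle trivial
    obtain ⟨r, hr, hr'⟩ := exists_map_congruentPairs_eq_span _ N (absNorm_ne_zero ν)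
      (natCast_mem_vanishingIdeal (π ≫ b) ν Z hZ U) ht (dvd_refl _) (sectionsHom ψ U.1 hle)
    have hinv : IsInvertible ((vanishingIdeal Z).comap
        (Spec.map (ofHom i) ≫ ψ)) := by
      refine isInvertible_comap_of_span _ _ U hle' r hr ?_
      rw [sectionsHom_comp _ _ hle]
      exact hr'
    obtain ⟨χ, hχ, -⟩ := hρ.existsUnique_lift _ _ hinv
    refine ⟨χ, ?_⟩
    have hχ : χ ≫ ρ = Spec.map (ofHom i) ≫ ψ := hχ
    rw [← assoc, hχ, assoc, hψ, ← assoc, ← Spec.map_comp]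
    rfl

end Lift
-- Blowups away from their centres
section OffCentre

lemma isInvertible_top (X : Scheme.{u}) : IsInvertible (⊤ : X.IdealSheafData) := by
  intro x
  obtain ⟨U, hU⟩ := exists_affineOpen_mem x
  exact ⟨U, hU, 1, one_mem _, by simp⟩

/-- A blowup is an isomorphism away from its centre. -/
lemma IsBlowup.isIso_morphismRestrict {Y Y' : Scheme.{u}} {Z : TopologicalSpace.Closeds Y}
    {ρ : Y' ⟶ Y} (hρ : IsBlowup ρ (vanishingIdeal Z)) (U : Y.Opens)
    (hU : ∀ z ∈ Z, z ∉ U) : IsIso (ρ ∣_ U) := by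
  -- Along a morphism that avoids the centre, the ideal sheaf pulls back to the unit ideal, so the
  -- universal property applies to it.
  have key : ∀ {T : Scheme.{u}} (φ : T ⟶ Y) (_ : ∀ t, φ t ∈ U),
      IsInvertible ((vanishingIdeal Z).comap φ) := by
    intro T φ hφ
    have : (vanishingIdeal Z).comap φ = ⊤ := by
      rw [← Scheme.IdealSheafData.support_eq_bot_iff, Scheme.IdealSheafData.support_comap]
      ext t
      simp only [TopologicalSpace.Closeds.coe_preimage, Set.mem_preimage,
        TopologicalSpace.Closeds.coe_bot, Set.mem_empty_iff_false, iff_false,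
        coe_support_vanishingIdeal]
      exact fun h => hU _ h (hφ t)
    rw [this]
    exact isInvertible_top T
  obtain ⟨ψ, hψ, -⟩ := hρ.existsUnique_lift _ U.ι (key _ fun t => t.2)
  have h1 : (ρ ∣_ U) ≫ ψ = (ρ ⁻¹ᵁ U).ι := by
    refine (hρ.existsUnique_lift _ ((ρ ⁻¹ᵁ U).ι ≫ ρ) (key _ fun t => t.2)).unique ?_ rfl
    rw [assoc, hψ, morphismRestrict_ι]
  have hr : Set.range ψ ⊆ Set.range (ρ ⁻¹ᵁ U).ι := by
    rintro _ ⟨x, rfl⟩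
    simp only [Scheme.Opens.range_ι]
    show ρ (ψ x) ∈ U
    rw [← Scheme.Hom.comp_apply, hψ]
    exact x.2
  refine ⟨IsOpenImmersion.lift (ρ ⁻¹ᵁ U).ι ψ hr, ?_, ?_⟩
  · rw [← cancel_mono (ρ ⁻¹ᵁ U).ι, assoc, IsOpenImmersion.lift_fac, h1, id_comp]
  · rw [← cancel_mono U.ι, assoc, morphismRestrict_ι, IsOpenImmersion.lift_fac_assoc, hψ, id_comp]

lemma isIso_stalkMap_of_morphismRestrict {Y Y' : Scheme.{u}} (ρ : Y' ⟶ Y) (U : Y.Opens)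
    [IsIso (ρ ∣_ U)] (y : Y') (hy : ρ y ∈ U) : IsIso (ρ.stalkMap y) := by
  have e := morphismRestrictStalkMap ρ U ⟨y, hy⟩
  let x : (ρ ⁻¹ᵁ U).toScheme := ⟨y, hy⟩
  have h1 : IsIso ((ρ ∣_ U).stalkMap x) := inferInstance
  exact (MorphismProperty.arrow_mk_iso_iff (MorphismProperty.isomorphisms CommRingCat) e).mp h1

lemma existsUnique_of_morphismRestrict {Y Y' : Scheme.{u}} (ρ : Y' ⟶ Y) (U : Y.Opens)
    [IsIso (ρ ∣_ U)] (y : Y) (hy : y ∈ U) : ∃! y', ρ y' = y := by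
  have hb : Bijective (ρ ∣_ U) := (ρ ∣_ U).homeomorph.bijective
  have hv : ∀ x : (ρ ⁻¹ᵁ U), ((ρ ∣_ U) x).1 = ρ x.1 := fun x => by
    have := congrArg (fun f => f x) (congrArg (fun f : _ ⟶ Y => (f : _ → Y)) (morphismRestrict_ι ρ U))
    exact this
  obtain ⟨x, hx⟩ := hb.2 ⟨y, hy⟩
  refine ⟨x.1, (hv x).symm.trans (congrArg Subtype.val hx), fun y' hy' => ?_⟩
  have hy'' : y' ∈ ρ ⁻¹ᵁ U := by show ρ y' ∈ U; rw [hy']; exact hy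
  have : (⟨y', hy''⟩ : (ρ ⁻¹ᵁ U)) = x := hb.1 (Subtype.ext
    ((hv _).trans (hy'.trans (congrArg Subtype.val hx).symm)))
  rw [← this]

variable {X Y : Scheme.{u}}
  {b : X ⟶ Spec (.of (𝓞 K))} {π : Y ⟶ X} {l : List (HeightOneSpectrum (𝓞 K))}

/-- A point outside the listed fibres never meets a centre. It is applied on the generic fibre,
where the local rings of the model are those of `C`. -/
lemma IsBlowupSequence.isIso_stalkMap (hπ : IsBlowupSequence b π l) (y : Y)
    (hy : ∀ ν ∈ l, (π ≫ b) y ≠ closedPt ν) : IsIso (π.stalkMap y) := by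
  induction hπ with
  | refl => infer_instance
  | blowup π l h ν Z hZ ρ hρ ih =>
    let U := Z.compl
    have hi : IsIso (ρ ∣_ U) := hρ.isIso_morphismRestrict U fun z hz hz' => hz' hz
    have hyU : ρ y ∈ U := fun hz => hy ν (by simp) (by simpa using hZ _ hz)
    have h1 := isIso_stalkMap_of_morphismRestrict ρ U y hyU
    have h2 := ih (ρ y) fun ν' hν' => by simpa using hy ν' (by simp [hν'])
    rw [Scheme.Hom.stalkMap_comp]
    exact IsIso.comp_isIso' h2 h1

/-- It is needed for the points of `C`: each has exactly one point of the model above it, so that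
the infimum in `divisorIdeal` runs over a single closure. -/
lemma IsBlowupSequence.existsUnique_point (hπ : IsBlowupSequence b π l) (x : X)
    (hx : ∀ ν ∈ l, b x ≠ closedPt ν) : ∃! y, π y = x := by
  induction hπ with
  | refl => exact ⟨x, rfl, fun _ h => h⟩
  | blowup π l h ν Z hZ ρ hρ ih =>
    let U := Z.compl
    have hi : IsIso (ρ ∣_ U) := hρ.isIso_morphismRestrict U fun z hz hz' => hz' hz
    obtain ⟨y, hy, hyu⟩ := ih fun ν' hν' => hx ν' (by simp [hν'])
    have hyU : y ∈ U := fun hz => hx ν (by simp) (by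
      have := hZ _ hz
      rwa [Scheme.Hom.comp_apply, hy] at this)
    obtain ⟨y', hy', hyu'⟩ := existsUnique_of_morphismRestrict ρ U y hyU
    exact ⟨y', by simp [hy', hy], fun z hz => hyu' z (hyu _ (by simpa using hz))⟩

end OffCentre

/-! ### The affine charts `v ^ 2 = F(u)` and their integrality -/

section ChartRing

variable (f)

/-- The exponent with which the affine coordinate of a chart occurs in the monomial
`x ^ i * s ^ (2 * g + 2 - i)`. -/
def chartExp (g : ℕ) (c : Bool) (i : ℕ) : ℕ := if c then 2 * g + 2 - i else i

/-- The dehomogenisation of `f` in the chart `s ≠ 0` (for `c = false`) or `x ≠ 0`. -/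
def affForm (c : Bool) : (𝓞 K)[X] := ∑ i : Fin (2 * g + 3), C (f i) * X ^ chartExp g c i

/-- The affine equation of the curve in a chart. -/
def chartPoly (c : Bool) : (𝓞 K)[X][X] := X ^ 2 - C (affForm f c)

lemma chartPoly_monic (c : Bool) : (chartPoly f c).Monic := monic_X_pow_sub_C _ two_ne_zero

lemma natDegree_chartPoly (c : Bool) : (chartPoly f c).natDegree = 2 := natDegree_X_pow_sub_C

/-- The coordinate ring of the affine chart. -/
abbrev ChartRing (c : Bool) : Type u := AdjoinRoot (chartPoly f c)

/-- The coordinate `x / s` or `s / x`. -/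
def coordU (c : Bool) : ChartRing f c := of _ X

/-- The coordinate `y / s ^ (g + 1)` or `y / x ^ (g + 1)`. -/
def coordV (c : Bool) : ChartRing f c := AdjoinRoot.root _

/-- The inclusion of the constants. -/
def chartC (c : Bool) : 𝓞 K →+* ChartRing f c := (of _).comp C

lemma of_eq_eval₂ (c : Bool) (p : (𝓞 K)[X]) :
    of (chartPoly f c) p = p.eval₂ (chartC f c) (coordU f c) := by
  rw [chartC, coordU, ← hom_eval₂, eval₂_C_X]

lemma coordV_sq (c : Bool) :
    coordV f c ^ 2 = (affForm f c).eval₂ (chartC f c) (coordU f c) := by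
  rw [← of_eq_eval₂]
  have h := eval₂_root (chartPoly f c)
  have h2 : eval₂ (of (chartPoly f c)) (AdjoinRoot.root (chartPoly f c))
      (X ^ 2 - C (affForm f c)) = 0 := h
  rw [eval₂_sub, eval₂_X_pow, eval₂_C] at h2
  exact sub_eq_zero.mp h2

/-- The homomorphism from the coordinate ring of a chart given by the values of the coordinates. -/
def chartHom {f : Fin (2 * g + 3) → 𝓞 K} {S : Type*} [CommRing S] (c : Bool) (i : 𝓞 K →+* S)
    (a b : S) (h : b ^ 2 = (affForm f c).eval₂ i a) : ChartRing f c →+* S :=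
  AdjoinRoot.lift (eval₂RingHom i a) b (by simp [chartPoly, h])

section

variable {f} {S : Type*} [CommRing S] (c : Bool) (i : 𝓞 K →+* S) (a b : S)
  (h : b ^ 2 = (affForm f c).eval₂ i a)

@[simp] lemma chartHom_coordU : chartHom c i a b h (coordU f c) = a := by simp [chartHom, coordU]

@[simp] lemma chartHom_coordV : chartHom c i a b h (coordV f c) = b := by simp [chartHom, coordV]

@[simp] lemma chartHom_chartC (r : 𝓞 K) : chartHom c i a b h (chartC f c r) = i r := by
  simp [chartHom, chartC]

lemma chartHom_comp_chartC : (chartHom c i a b h).comp (chartC f c) = i :=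
  RingHom.ext fun r => chartHom_chartC c i a b h r

variable {c}

lemma ChartRing.hom_ext {e e' : ChartRing f c →+* S}
    (hC : e.comp (chartC f c) = e'.comp (chartC f c)) (hu : e (coordU f c) = e' (coordU f c))
    (hv : e (coordV f c) = e' (coordV f c)) : e = e' := by
  refine AdjoinRoot.ringHom_ext (Polynomial.ringHom_ext' ?_ ?_) hv
  · rw [RingHom.comp_assoc, RingHom.comp_assoc]; exact hC
  · exact hu

lemma ChartRing.map_equation (e : ChartRing f c →+* S) :
    e (coordV f c) ^ 2 = (affForm f c).eval₂ (e.comp (chartC f c)) (e (coordU f c)) := by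
  rw [← map_pow, coordV_sq, hom_eval₂]

end

lemma ChartRing.exists_eq_add_mul (c : Bool) (z : ChartRing f c) :
    ∃ p q : (𝓞 K)[X], z = of _ p + of _ q * coordV f c := by
  obtain ⟨z, rfl⟩ := AdjoinRoot.mk_surjective z
  have hd : (z %ₘ chartPoly f c).natDegree < 2 := by
    rw [← natDegree_chartPoly f c]
    exact natDegree_modByMonic_lt _ (chartPoly_monic f c) (by
      intro h
      have := natDegree_chartPoly f c
      rw [h] at this; simp at this)
  have h1 : AdjoinRoot.mk (chartPoly f c) z = AdjoinRoot.mk _ (z %ₘ chartPoly f c) := by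
    rw [mk_eq_mk]
    exact ⟨z /ₘ chartPoly f c, by
      rw [sub_eq_iff_eq_add, add_comm]; exact (modByMonic_add_div z _).symm⟩
  refine ⟨(z %ₘ chartPoly f c).coeff 0, (z %ₘ chartPoly f c).coeff 1, ?_⟩
  rw [h1]
  conv_lhs => rw [eq_X_add_C_of_natDegree_le_one (Nat.lt_succ_iff.mp hd)]
  simp [coordV]
  ring

variable {f} (hf : IsSeparableForm f)

/-- The affine equation over the field `K`. -/
abbrev affFormK (f : Fin (2 * g + 3) → 𝓞 K) (c : Bool) : K[X] :=
  (affForm f c).map (algebraMap (𝓞 K) K)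

lemma affForm_false_coeff (j : ℕ) (hj : j < 2 * g + 3) :
    (affForm f false).coeff j = f ⟨j, hj⟩ := by
  simp only [affForm, chartExp, finsetSum_coeff, coeff_C_mul, coeff_X_pow]
  rw [Finset.sum_eq_single ⟨j, hj⟩]
  · simp
  · grind
  · simp

lemma natDegree_affForm_le (c : Bool) : (affForm f c).natDegree ≤ 2 * g + 2 := by
  refine natDegree_sum_le_of_forall_le _ _ fun i _ => (natDegree_C_mul_X_pow_le _ _).trans ?_
  unfold chartExp
  split <;> omega

/-- The reflection is at the formal degree `2 * g + 2`, not at the actual degree, which may be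
smaller. -/
lemma affForm_true_eq_reflect : affForm f true = (affForm f false).reflect (2 * g + 2) := by
  have h : ∀ (s : Finset (Fin (2 * g + 3))) (p : Fin (2 * g + 3) → (𝓞 K)[X]),
      (∑ i ∈ s, p i).reflect (2 * g + 2) = ∑ i ∈ s, (p i).reflect (2 * g + 2) := by
    intro s p
    induction s using Finset.cons_induction with
    | empty => simp
    | cons a s ha ih => rw [Finset.sum_cons, Finset.sum_cons, reflect_add, ih]
  rw [affForm, affForm, h]
  refine sum_congr rfl fun i _ => ?_
  rw [reflect_C_mul_X_pow]
  simp only [chartExp, if_true, Bool.false_eq_true, if_false]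
  rw [revAt_le (by omega)]

include hf

lemma squarefree_affFormK_false : Squarefree (affFormK f false) := by
  have h := hf.1
  convert h using 1
  simp [affFormK, affForm, chartExp, Polynomial.map_sum]

-- The two lowest coefficients in the chart at infinity are the two leading coefficients of the
-- form, one of which is nonzero.
omit hf in
lemma not_X_sq_dvd_affFormK_true (hf : IsSeparableForm f) : ¬ X ^ 2 ∣ affFormK f true := by
  rw [X_pow_dvd_iff]
  intro h
  have hr : ∀ d, d ≤ 2 * g + 2 → (affFormK f true).coeff d =
      (algebraMap (𝓞 K) K) ((affForm f false).coeff (2 * g + 2 - d)) := by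
    intro d hd
    rw [coeff_map, affForm_true_eq_reflect, coeff_reflect, revAt_le hd]
  have h0 := h 0 (by norm_num)
  have h1 := h 1 (by norm_num)
  rw [hr _ (by omega), affForm_false_coeff _ (by omega)] at h0 h1
  have hi := algebraMap_injective (𝓞 K) K
  rw [map_eq_zero_iff _ hi] at h0 h1
  rcases hf.2 with h2 | h2
  · exact h2 h0
  · exact h2 h1

/-- A square factor in the chart at infinity reverses to one in the finite chart. The only factors
invisible there are powers of the coordinate, and these are excluded by the condition on the leading
coefficients. -/
lemma squarefree_affFormK (c : Bool) : Squarefree (affFormK f c) := by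
  cases c
  · exact squarefree_affFormK_false hf
  intro p hp
  have h0 : affFormK f true ≠ 0 := fun h => not_X_sq_dvd_affFormK_true hf (h ▸ dvd_zero _)
  have hrefl : (affFormK f true).reflect (2 * g + 2) = affFormK f false := by
    rw [affFormK, affForm_true_eq_reflect, ← reflect_map, reflect_reflect]
  obtain ⟨q, hq⟩ := hp
  have hp0 : p ≠ 0 := by rintro rfl; simp at hq; exact h0 hq
  have hq0 : q ≠ 0 := by rintro rfl; simp at hq; exact h0 hq
  have hdeg : p.natDegree + p.natDegree + q.natDegree ≤ 2 * g + 2 := by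
    rw [← natDegree_mul hp0 hp0, ← natDegree_mul (mul_ne_zero hp0 hp0) hq0, ← hq]
    exact natDegree_map_le.trans (natDegree_affForm_le _)
  have hu : IsUnit p.reverse := by
    refine squarefree_affFormK_false hf _ ?_
    rw [← hrefl, hq, show 2 * g + 2 = p.natDegree + p.natDegree +
      (2 * g + 2 - p.natDegree - p.natDegree) by omega, reflect_mul _ _ (natDegree_mul_le) (by omega),
      reflect_mul _ _ le_rfl le_rfl]
    exact Dvd.intro _ rfl
  -- A constant reverse means that degree and trailing degree of `p` agree, so `p` is a monomial.
  have hd := natDegree_eq_zero_of_isUnit hu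
  rw [reverse_natDegree] at hd
  have hpX : X ^ p.natDegree ∣ p := by
    rw [X_pow_dvd_iff]
    intro d hd'
    exact coeff_eq_zero_of_lt_natTrailingDegree (by omega)
  rcases Nat.eq_zero_or_pos p.natDegree with h | h
  · rw [isUnit_iff_degree_eq_zero, degree_eq_natDegree hp0, h]; rfl
  · refine absurd ?_ (not_X_sq_dvd_affFormK_true hf)
    have : X ∣ p := (dvd_pow_self X h.ne').trans hpX
    rw [sq, hq]
    exact (mul_dvd_mul this this).mul_right _

/-- In the chart at infinity, a constant would mean that the form is a constant times `x ^ (2 * g +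
2)`, which is not squarefree. Positivity excludes that the polynomial is a unit, and so possibly a
square. -/
lemma natDegree_affFormK_pos (c : Bool) : 0 < (affFormK f c).natDegree := by
  have hi := algebraMap_injective (𝓞 K) K
  have h1 : 0 < (affFormK f false).natDegree := by
    rcases hf.2 with h | h
    · refine lt_of_lt_of_le (by omega : 0 < 2 * g + 2) (le_natDegree_of_ne_zero ?_)
      rw [coeff_map, affForm_false_coeff _ (by omega), map_ne_zero_iff _ hi]
      exact h
    · refine lt_of_lt_of_le (by omega : 0 < 2 * g + 1) (le_natDegree_of_ne_zero ?_)
      rw [coeff_map, affForm_false_coeff _ (by omega), map_ne_zero_iff _ hi]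
      exact h
  cases c
  · exact h1
  rw [Nat.pos_iff_ne_zero]
  intro h
  rw [natDegree_eq_zero] at h
  obtain ⟨x, hx⟩ := h
  have hrefl : (affFormK f true).reflect (2 * g + 2) = affFormK f false := by
    rw [affFormK, affForm_true_eq_reflect, ← reflect_map, reflect_reflect]
  rw [← hx, reflect_C] at hrefl
  have hu := squarefree_affFormK_false hf X (by
    rw [← hrefl, ← sq]
    exact (pow_dvd_pow X (by omega)).mul_left _)
  exact not_isUnit_X hu

/-- A nonconstant squarefree polynomial is not a square in `K(X)`; equivalently, the affine equation
is irreducible. -/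
lemma sq_ne_sq_mul_affFormK (c : Bool) (a b : K[X]) (hb : b ≠ 0) :
    a ^ 2 ≠ b ^ 2 * affFormK f c := by
  intro h
  have hdvd : b ∣ a := (IsIntegrallyClosed.pow_dvd_pow_iff two_ne_zero).mp (Dvd.intro _ h.symm)
  obtain ⟨d, rfl⟩ := hdvd
  have h1 : d ^ 2 = affFormK f c := by
    rw [mul_pow] at h
    exact mul_left_cancel₀ (pow_ne_zero 2 hb) h
  have hd : IsUnit d := squarefree_affFormK hf c d (by rw [← h1, sq])
  have := natDegree_eq_zero_of_isUnit (hd.pow 2)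
  rw [h1] at this
  exact (natDegree_affFormK_pos hf c).ne' this

lemma sq_ne_sq_mul_affForm (c : Bool) (a b : (𝓞 K)[X]) (hb : b ≠ 0) :
    a ^ 2 ≠ b ^ 2 * affForm f c := by
  intro h
  have hi := algebraMap_injective (𝓞 K) K
  refine sq_ne_sq_mul_affFormK hf c (a.map (algebraMap (𝓞 K) K)) (b.map (algebraMap (𝓞 K) K))
    ((Polynomial.map_ne_zero_iff hi).mpr hb) ?_
  rw [affFormK, ← Polynomial.map_pow, h, Polynomial.map_mul, Polynomial.map_pow]

omit hf in
lemma of_injective (c : Bool) : Injective (of (chartPoly f c)) := by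
  refine of.injective_of_degree_ne_zero ?_
  rw [degree_eq_natDegree (chartPoly_monic f c).ne_zero, natDegree_chartPoly]
  norm_num

omit hf in
lemma chartC_injective (c : Bool) : Injective (chartC f c) :=
  (of_injective c).comp (C_injective)

/-- The conjugate of an element of the chart ring times the element is its norm to `𝓞 K [u]`. -/
lemma ChartRing.exists_mul_eq_of (c : Bool) (z : ChartRing f c) (hz : z ≠ 0) :
    ∃ z' : ChartRing f c, ∃ n : (𝓞 K)[X], n ≠ 0 ∧ z' * z = of _ n := by
  obtain ⟨p, q, rfl⟩ := ChartRing.exists_eq_add_mul f c z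
  refine ⟨of _ p - of _ q * coordV f c, p ^ 2 - q ^ 2 * affForm f c, ?_, ?_⟩
  · intro h
    by_cases hq : q = 0
    · subst hq
      have hp : p = 0 := by simpa using h
      simp [hp] at hz
    · exact sq_ne_sq_mul_affForm hf c p q hq (sub_eq_zero.mp h)
  · have h2 := coordV_sq f c
    rw [← of_eq_eval₂] at h2
    grind

lemma ChartRing.of_eq_zero_of_mul (c : Bool) (n : (𝓞 K)[X]) (z : ChartRing f c) (hn : n ≠ 0)
    (h : of _ n * z = 0) : z = 0 := by
  by_contra hz
  obtain ⟨z', m, hm, hzm⟩ := ChartRing.exists_mul_eq_of hf c z hz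
  have : of (chartPoly f c) (n * m) = 0 := by grind
  rw [map_eq_zero_iff _ (of_injective c)] at this
  exact mul_ne_zero hn hm this

/-- If `a * b = 0` with `a ≠ 0`, multiplication by the conjugate of `a` shows that a nonzero
polynomial in `u` kills `b`. Passing to the norm of `b` then gives `b = 0`. -/
lemma ChartRing.isDomain (c : Bool) : IsDomain (ChartRing f c) := by
  have hnt : Nontrivial (ChartRing f c) := (of_injective c).nontrivial
  have : NoZeroDivisors (ChartRing f c) := ⟨by
    intro a b hab
    by_contra! h
    obtain ⟨z', n, hn, hz⟩ := ChartRing.exists_mul_eq_of hf c a h.1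
    exact h.2 (ChartRing.of_eq_zero_of_mul hf c n b hn (by grind))⟩
  exact NoZeroDivisors.to_isDomain _

end ChartRing

/-! ### Affine charts of reduced closed subschemes, and weighted homogeneity -/

section General

lemma exists_iso_of_isOpenImmersion {X : Scheme.{u}} {U : X.Opens} (hU : IsAffineOpen U)
    {A : CommRingCat.{u}} (k : Spec A ⟶ X) [IsOpenImmersion k] (hk : k.opensRange = U) :
    ∃ e : Γ(X, U) ≅ A, Spec.map e.hom ≫ hU.fromSpec = k := by
  let σ : Spec A ≅ Spec Γ(X, U) := IsOpenImmersion.isoOfRangeEq k hU.fromSpec (by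
    rw [hU.range_fromSpec, ← hk]; rfl)
  refine ⟨⟨Spec.preimage σ.hom, Spec.preimage σ.inv, ?_, ?_⟩, ?_⟩
  · apply Spec.map_injective; simp
  · apply Spec.map_injective; simp
  · simp [σ]

lemma exists_chart_subscheme {X : Scheme.{u}} (I : X.IdealSheafData) (U : X.affineOpens) :
    ∃ j : Spec (.of (Γ(X, U.1) ⧸ I.ideal U)) ⟶ I.subscheme,
      ∃ _ : IsOpenImmersion j, j ≫ I.subschemeι =
        Spec.map (ofHom (Ideal.Quotient.mk (I.ideal U))) ≫ IsAffineOpen.fromSpec U.2 ∧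
      j.opensRange = I.subschemeι ⁻¹ᵁ U.1 :=
  ⟨I.subschemeCover.f U, I.subschemeCover.map_prop U,
    (I.subschemeCover_map_subschemeι U).trans (I.glueDataObjι_ι U),
    I.opensRange_subschemeCover_map U⟩

/-- An affine chart of a reduced closed subscheme. -/
lemma exists_chart_vanishingIdeal {X : Scheme.{u}} (Z : TopologicalSpace.Closeds X)
    {A B : Type u} [CommRing A] [CommRing B] (ε : A →+* B)
    (hε : Surjective ε) (k : Spec (.of A) ⟶ X) [IsOpenImmersion k]
    (hZ : ∀ a, (∀ q : Spec (.of A), k q ∈ Z → a ∈ (q : PrimeSpectrum A).asIdeal) ↔ ε a = 0) :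
    ∃ j : Spec (.of B) ⟶ (vanishingIdeal Z).subscheme,
      ∃ _ : IsOpenImmersion j, j ≫ (vanishingIdeal Z).subschemeι = Spec.map (ofHom ε) ≫ k ∧
      j.opensRange = (vanishingIdeal Z).subschemeι ⁻¹ᵁ k.opensRange := by
  have hU : IsAffineOpen k.opensRange := isAffineOpen_opensRange k
  let U : X.affineOpens := ⟨k.opensRange, hU⟩
  obtain ⟨e, he⟩ := exists_iso_of_isOpenImmersion hU k rfl
  have he2 : Spec.map e.inv ≫ k = hU.fromSpec := by
    calc Spec.map e.inv ≫ k = Spec.map e.inv ≫ Spec.map e.hom ≫ hU.fromSpec := by rw [he]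
      _ = hU.fromSpec := by rw [← assoc, ← Spec.map_comp]; simp
  have key : ∀ q, hU.fromSpec (Spec.map e.hom q) = k q := fun q => by
    rw [← Scheme.Hom.comp_apply, he]
  have key' : ∀ q, k (Spec.map e.inv q) = hU.fromSpec q := fun q => by
    rw [← Scheme.Hom.comp_apply, he2]
  set I := vanishingIdeal Z with hI
  let e' : Γ(X, k.opensRange) ≃+* A := e.commRingCatIsoToRingEquiv
  let φ : Γ(X, k.opensRange) →+* B := ε.comp e'
  have hφ : Surjective φ := hε.comp e'.surjective
  -- Transported to `A`, the sections of the vanishing ideal are the elements contained in all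
  -- primes of `Z`; by `hZ` these form the kernel of `ε`.
  have hker : I.ideal U = ker φ := by
    ext x
    rw [hI, vanishingIdeal_ideal, PrimeSpectrum.mem_vanishingIdeal]
    have h1 : x ∈ ker φ ↔ ε (e' x) = 0 := Iff.rfl
    rw [h1, ← hZ]
    constructor
    · intro h q hq
      exact h (Spec.map e.hom q) (show hU.fromSpec (Spec.map e.hom q) ∈ Z from (key q).symm ▸ hq)
    · intro h q hq
      have h2 := h (Spec.map e.inv q) ((key' q).symm ▸ hq)
      have h3 : e.inv.hom (e' x) ∈ q.asIdeal := h2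
      have h4 : e.inv.hom (e' x) = x := e'.symm_apply_apply x
      rwa [h4] at h3
  obtain ⟨j₁, ho, h1, h2⟩ := exists_chart_subscheme I U
  let ι : (Γ(X, k.opensRange) ⧸ I.ideal U) ≃+* B :=
    (Ideal.quotEquivOfEq hker).trans (RingHom.quotientKerEquivOfSurjective hφ)
  have hι : ι.toRingHom.comp (Ideal.Quotient.mk _) = φ := by ext x; rfl
  let j₀ : Spec (.of B) ⟶ Spec (.of (Γ(X, k.opensRange) ⧸ I.ideal U)) :=
    Spec.map (ofHom ι.toRingHom)
  have hj₀ : IsIso j₀ := by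
    have : IsIso (ofHom ι.toRingHom) := (inferInstance : IsIso ι.toCommRingCatIso.hom)
    infer_instance
  have h3 : j₀ ≫ Spec.map (ofHom (Ideal.Quotient.mk (I.ideal U))) = Spec.map (ofHom φ) := by
    rw [← hι]; exact (Spec.map_comp _ _).symm
  have h4 : Spec.map (ofHom φ) ≫ hU.fromSpec = Spec.map (ofHom ε) ≫ k := by
    calc Spec.map (ofHom φ) ≫ hU.fromSpec =
          (Spec.map (ofHom ε) ≫ Spec.map e.hom) ≫ hU.fromSpec := by
          rw [← Spec.map_comp]; rfl
      _ = Spec.map (ofHom ε) ≫ k := by rw [assoc, he]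
  refine ⟨j₀ ≫ j₁, IsOpenImmersion.comp _ _, ?_, ?_⟩
  · rw [assoc, h1, ← h4, ← h3, assoc]
  · rw [Scheme.Hom.opensRange_comp_of_isIso]
    exact h2

/-- Weighted homogeneity. -/
lemma eval₂_weighted_scale {σ R S : Type*} [Fintype σ] [CommRing R] [CommRing S] (w : σ → ℕ)
    (e : R →+* S) (t : S) (a : σ → S) (n : ℕ) (p : MvPolynomial σ R)
    (hp : p ∈ MvPolynomial.weightedHomogeneousSubmodule R w n) :
    p.eval₂ e (fun i => t ^ w i * a i) = t ^ n * p.eval₂ e a := by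
  rw [eval₂_eq', eval₂_eq', mul_sum]
  refine sum_congr rfl fun d hd => ?_
  have h1 := hp (MvPolynomial.mem_support_iff.mp hd)
  rw [← h1, Finsupp.weight_apply, Finsupp.sum_fintype _ _ (by simp), ← Finset.prod_pow_eq_pow_sum]
  simp only [mul_pow, prod_mul_distrib, smul_eq_mul, ← pow_mul]
  rw [mul_left_comm]
  congr 2
  funext i
  rw [mul_comm]

end General

/-! ### Dehomogenisation -/

section Dehomogenize

variable (f)

/-- The coordinate that does not vanish on a chart. -/
def cIdx (c : Bool) : Fin 3 := if c then 0 else 1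

/-- The other coordinate of weight `1`. -/
def oIdx (c : Bool) : Fin 3 := if c then 1 else 0

/-- Coordinates of a point in a chart. -/
def chartCoords {S : Type*} [One S] (c : Bool) (a b : S) : Fin 3 → S :=
  if c then ![1, a, b] else ![a, 1, b]

lemma chartCoords_map {S T : Type*} [CommRing S] [CommRing T] (φ : S →+* T) (c : Bool) (a b : S) :
    φ ∘ chartCoords c a b = chartCoords c (φ a) (φ b) := by
  funext i
  cases c <;> fin_cases i <;> simp [chartCoords]

lemma X_mem_grading (i : Fin 3) : (MvPolynomial.X i : 𝓐 K) ∈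
    grading (𝓞 K) g (weights g i) := MvPolynomial.isWeightedHomogeneous_X _ _ _

lemma Xc_mem_grading (c : Bool) : (MvPolynomial.X (cIdx c) : 𝓐 K) ∈
    grading (𝓞 K) g 1 := by
  have := X_mem_grading (K := K) (g := g) (cIdx c)
  cases c <;> simpa [cIdx, weights] using this

lemma X2_mem_grading : (MvPolynomial.X 2 : 𝓐 K) ∈
    grading (𝓞 K) g (g + 1) := X_mem_grading 2

lemma Xo_mem_grading (c : Bool) : (MvPolynomial.X (oIdx c) : 𝓐 K) ∈
    grading (𝓞 K) g 1 := by
  have := X_mem_grading (K := K) (g := g) (oIdx c)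
  cases c <;> simpa [oIdx, weights] using this

lemma equation_mem_grading : equation f ∈ grading (𝓞 K) g (2 * g + 2) := by
  refine Submodule.sub_mem _ ?_ (Submodule.sum_mem _ fun i _ => ?_)
  · have := SetLike.pow_mem_graded 2 (X2_mem_grading (K := K) (g := g))
    rwa [show 2 • (g + 1) = 2 * g + 2 by rw [smul_eq_mul]; ring] at this
  · have h0 : (MvPolynomial.C (f i) : 𝓐 K) ∈ grading (𝓞 K) g 0 :=
      isWeightedHomogeneous_C _ _
    have h1 := SetLike.pow_mem_graded i (X_mem_grading (K := K) (g := g) 0)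
    have h2 := SetLike.pow_mem_graded (2 * g + 2 - i) (X_mem_grading (K := K) (g := g) 1)
    have := SetLike.mul_mem_graded (SetLike.mul_mem_graded h0 h1) h2
    have hi := i.2
    rwa [show 0 + (i : ℕ) • weights g 0 + (2 * g + 2 - i) • weights g 1 = 2 * g + 2 by
      simp only [weights, smul_eq_mul, Matrix.cons_val]; omega] at this

/-- The degree zero part of the localization of the coordinate ring at `s` or `x`. -/
abbrev AwayRing (K : Type u) [Field K] [NumberField K] (g : ℕ) (c : Bool) : Type u :=
  HomogeneousLocalization.Away (grading (𝓞 K) g) (MvPolynomial.X (cIdx c))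

/-- The fraction `h / s ^ n` or `h / x ^ n`. -/
def awayFrac (c : Bool) (n : ℕ) (h : 𝓐 K) (hh : h ∈ grading (𝓞 K) g n) :
    AwayRing K g c :=
  HomogeneousLocalization.Away.mk _ (Xc_mem_grading c) n h (by simpa using hh)

lemma awayFrac_surjective {c : Bool} (z : AwayRing K g c) :
    ∃ n h, ∃ hh : h ∈ grading (𝓞 K) g n, awayFrac c n h hh = z := by
  obtain ⟨n, a, ha, h⟩ := HomogeneousLocalization.Away.mk_surjective _ (Xc_mem_grading c) z
  exact ⟨n, a, by simpa using ha, h⟩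

/-- Dehomogenisation. -/
def dehom (c : Bool) : 𝓐 K →+* ChartRing f c :=
  eval₂Hom (chartC f c) (chartCoords c (coordU f c) (coordV f c))

lemma dehom_X_cIdx (c : Bool) : dehom f c (MvPolynomial.X (cIdx c)) = 1 := by
  cases c <;> simp [dehom, chartCoords, cIdx]

/-- The localization at the nonvanishing coordinate. -/
abbrev XcLoc (K : Type u) [Field K] [NumberField K] (c : Bool) : Type u :=
  Localization.Away (MvPolynomial.X (cIdx c) : 𝓐 K)

/-- Powers of the nonvanishing coordinate. -/
def XcPow (K : Type u) [Field K] [NumberField K] (c : Bool) (n : ℕ) :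
    Submonoid.powers (MvPolynomial.X (cIdx c) : 𝓐 K) :=
  ⟨MvPolynomial.X (cIdx c) ^ n, n, rfl⟩

/-- Dehomogenisation as a map on fractions. -/
def dehomAway (c : Bool) : AwayRing K g c →+* ChartRing f c :=
  (IsLocalization.Away.lift (S := XcLoc K c) (MvPolynomial.X (cIdx c))
    (g := dehom f c) (by rw [dehom_X_cIdx]; exact isUnit_one)).comp
    (algebraMap (AwayRing K g c) (XcLoc K c))

lemma dehomAway_awayFrac (c : Bool) (n : ℕ) (h : 𝓐 K)
    (hh : h ∈ grading (𝓞 K) g n) : dehomAway f c (awayFrac c n h hh) = dehom f c h := by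
  have h1 : algebraMap (AwayRing K g c) (XcLoc K c)
      (awayFrac c n h hh) = Localization.mk h (XcPow K c n) := rfl
  rw [dehomAway, RingHom.comp_apply, h1, Localization.mk_eq_mk', IsLocalization.Away.lift,
    lift_mk'_spec,
    show (XcPow K c n : 𝓐 K) = MvPolynomial.X (cIdx c) ^ n from rfl, map_pow,
    dehom_X_cIdx, one_pow, one_mul]

/-- The inverse of dehomogenisation, on polynomials. -/
def homogenize (g : ℕ) (c : Bool) : (𝓞 K)[X][X] →+* AwayRing K g c :=
  eval₂RingHom (eval₂RingHom ((fromZeroRingHom _ _).comp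
      (algebraMap (𝓞 K) (grading (𝓞 K) g 0)))
    (awayFrac c 1 (MvPolynomial.X (oIdx c)) (Xo_mem_grading c)))
    (awayFrac c (g + 1) (MvPolynomial.X 2) X2_mem_grading)

/-- Dehomogenisation with values in polynomials. -/
def dehomPoly (c : Bool) : 𝓐 K →+* (𝓞 K)[X][X] :=
  eval₂Hom (C.comp C) (chartCoords c (C X) X)

lemma dehom_eq_mk_dehomPoly (c : Bool) (h : 𝓐 K) :
    dehom f c h = AdjoinRoot.mk (chartPoly f c) (dehomPoly c h) := by
  have : dehom f c = (AdjoinRoot.mk (chartPoly f c)).comp (dehomPoly c) := by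
    refine MvPolynomial.ringHom_ext (fun r => ?_) fun i => ?_
    · simp only [dehom, dehomPoly, eval₂Hom_C, RingHom.comp_apply]
      rfl
    · simp only [dehom, dehomPoly, eval₂Hom_X', RingHom.comp_apply]
      rw [← Function.comp_apply (f := AdjoinRoot.mk (chartPoly f c)), chartCoords_map]
      rfl
  rw [this]; rfl

/-- After multiplication by the power `t ^ n` of the inverted coordinate, weighted homogeneity moves
the powers of `t` into the arguments, and substitution gives back `h` itself. -/
lemma homogenize_dehomPoly (c : Bool) (n : ℕ) (h : 𝓐 K)
    (hh : h ∈ grading (𝓞 K) g n) : homogenize g c (dehomPoly c h) = awayFrac c n h hh := by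
  apply val_injective
  let L := XcLoc K c
  let ρ := algebraMap (AwayRing K g c) L
  let t : L := algebraMap (𝓐 K) L (MvPolynomial.X (cIdx c))
  have ht : IsUnit t := map_units L
    (⟨MvPolynomial.X (cIdx c), 1, pow_one _⟩ :
      Submonoid.powers (MvPolynomial.X (cIdx c) : 𝓐 K))
  let U : AwayRing K g c := homogenize g c (C X)
  let V : AwayRing K g c := homogenize g c X
  have hval : ∀ n h hh, t ^ n * ρ (awayFrac c n h hh) = algebraMap (𝓐 K) L h := by
    intro n h hh
    have h1 : ρ (awayFrac c n h hh) = Localization.mk h (XcPow K c n) := rfl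
    rw [h1, Localization.mk_eq_mk', mul_comm, ← map_pow]
    exact mk'_spec L h (XcPow K c n)
  have hU : t * ρ U = algebraMap (𝓐 K) L (MvPolynomial.X (oIdx c)) := by
    have := hval 1 (MvPolynomial.X (oIdx c)) (Xo_mem_grading c)
    rw [pow_one] at this
    simpa [U, homogenize] using this
  have hV : t ^ (g + 1) * ρ V = algebraMap (𝓐 K) L (MvPolynomial.X 2) := by
    have := hval (g + 1) (MvPolynomial.X 2) X2_mem_grading
    simpa [V, homogenize] using this
  have h1 : ∀ h, ρ (homogenize g c (dehomPoly c h)) =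
      h.eval₂ ((algebraMap (𝓐 K) L).comp MvPolynomial.C) (chartCoords c (ρ U) (ρ V)) := by
    intro h
    have : (ρ.comp (homogenize g c)).comp (dehomPoly c) =
        eval₂Hom ((algebraMap (𝓐 K) L).comp MvPolynomial.C)
          (chartCoords c (ρ U) (ρ V)) := by
      refine MvPolynomial.ringHom_ext (fun r => ?_) fun i => ?_
      · simp only [RingHom.comp_apply, dehomPoly, eval₂Hom_C, homogenize, coe_eval₂RingHom, eval₂_C]
        show Localization.mk _ _ = _
        exact Localization.mk_one_eq_algebraMap _
      · simp only [RingHom.comp_apply, dehomPoly, eval₂Hom_X']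
        rw [← RingHom.comp_apply, ← Function.comp_apply (f := ρ.comp (homogenize g c)),
          chartCoords_map]
        rfl
    exact congrArg (fun φ => φ h) this
  have h2 := eval₂_weighted_scale (weights g) ((algebraMap (𝓐 K) L).comp MvPolynomial.C) t
    (chartCoords c (ρ U) (ρ V)) n h hh
  have h3 : (fun i => t ^ weights g i * chartCoords c (ρ U) (ρ V) i) =
      fun i => algebraMap (𝓐 K) L (MvPolynomial.X i) := by
    funext i
    cases c <;> fin_cases i <;>
      simp [chartCoords, weights] <;> first | exact hU | exact hV | rfl
  have h4 : h.eval₂ ((algebraMap (𝓐 K) L).comp MvPolynomial.C)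
      (fun i => algebraMap (𝓐 K) L (MvPolynomial.X i)) = algebraMap (𝓐 K) L h := by
    rw [← MvPolynomial.coe_eval₂Hom]
    have : eval₂Hom ((algebraMap (𝓐 K) L).comp MvPolynomial.C)
      (fun i => algebraMap (𝓐 K) L (MvPolynomial.X i)) = algebraMap (𝓐 K) L :=
      MvPolynomial.ringHom_ext (by simp) (by simp)
    rw [this]
  rw [h3, h4, ← h1, ← hval n h hh] at h2
  exact ((ht.pow n).mul_left_cancel h2).symm

lemma dehomPoly_equation (c : Bool) : dehomPoly c (equation f) = chartPoly f c := by
  cases c <;> simp [dehomPoly, equation, chartPoly, chartCoords, affForm, chartExp]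

lemma dehom_equation (c : Bool) : dehom f c (equation f) = 0 := by
  rw [dehom_eq_mk_dehomPoly, dehomPoly_equation, AdjoinRoot.mk_self]

/-- A dehomogenised polynomial that vanishes on the chart is a multiple of the monic chart equation,
and `homogenize` carries this factorisation back to fractions. The kernel is thus no larger than the
ideal of the equation. -/
lemma ker_dehomAway (c : Bool) : ker (dehomAway f c) =
    span {awayFrac c (2 * g + 2) (equation f) (equation_mem_grading f)} := by
  apply le_antisymm
  · intro z hz
    obtain ⟨n, h, hh, rfl⟩ := awayFrac_surjective z
    rw [mem_ker, dehomAway_awayFrac, dehom_eq_mk_dehomPoly, AdjoinRoot.mk_eq_zero] at hz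
    obtain ⟨q, hq⟩ := hz
    rw [mem_span_singleton, ← homogenize_dehomPoly c n h hh, hq, map_mul,
      ← dehomPoly_equation, homogenize_dehomPoly c _ _ (equation_mem_grading f)]
    exact Dvd.intro _ rfl
  · rw [span_singleton_le_iff_mem, mem_ker, dehomAway_awayFrac, dehom_equation]

lemma dehomAway_homogenize (c : Bool) (p : (𝓞 K)[X][X]) :
    dehomAway f c (homogenize g c p) = AdjoinRoot.mk (chartPoly f c) p := by
  have : (dehomAway f c).comp (homogenize g c) = AdjoinRoot.mk (chartPoly f c) := by
    refine Polynomial.ringHom_ext' (Polynomial.ringHom_ext (fun r => ?_) ?_) ?_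
    · have := dehomAway_awayFrac f c 0 (MvPolynomial.C r)
        (isWeightedHomogeneous_C _ _)
      rw [← homogenize_dehomPoly c 0 _ (isWeightedHomogeneous_C _ _)] at this
      simp only [dehomPoly, dehom, eval₂Hom_C] at this
      exact this
    · simp only [RingHom.comp_apply, homogenize, coe_eval₂RingHom, eval₂_C, eval₂_X]
      rw [dehomAway_awayFrac f c 1]
      simp only [dehom, eval₂Hom_X']
      cases c <;> rfl
    · simp only [RingHom.comp_apply, homogenize, coe_eval₂RingHom, eval₂_X]
      rw [dehomAway_awayFrac f c (g + 1)]
      simp only [dehom, eval₂Hom_X']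
      cases c <;> rfl
  rw [← this]; rfl

lemma dehomAway_surjective (c : Bool) : Surjective (dehomAway f c) := by
  intro z
  obtain ⟨p, rfl⟩ := AdjoinRoot.mk_surjective z
  exact ⟨_, dehomAway_homogenize f c p⟩

end Dehomogenize

/-! ### The affine charts of the naive model and their gluing -/

section Charts

/-- The standard affine charts of weighted projective space. -/
abbrev projChart (K : Type u) [Field K] [NumberField K] (g : ℕ) (c : Bool) :
    Spec (.of (AwayRing K g c)) ⟶ WeightedProj (𝓞 K) g :=
  Proj.awayι (grading (𝓞 K) g) (MvPolynomial.X (cIdx c)) (Xc_mem_grading c) one_pos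

lemma projChart_opensRange (c : Bool) : (projChart K g c).opensRange =
    Proj.basicOpen (grading (𝓞 K) g) (MvPolynomial.X (cIdx c)) :=
  Proj.opensRange_awayι _ _ _ _

lemma X_notMem_projChart (c : Bool) (q : Spec (.of (AwayRing K g c))) :
    MvPolynomial.X (cIdx c) ∉ (projChart K g c q).asHomogeneousIdeal := by
  have : projChart K g c q ∈ (projChart K g c).opensRange := ⟨q, rfl⟩
  rwa [projChart_opensRange] at this

lemma mem_projChart_iff (c : Bool) (q : Spec (.of (AwayRing K g c))) (n : ℕ)
    (h : 𝓐 K) (hh : h ∈ grading (𝓞 K) g n) :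
    h ∈ (projChart K g c q).asHomogeneousIdeal ↔
      awayFrac c n h hh ∈ (q : PrimeSpectrum (AwayRing K g c)).asIdeal := by
  have hX := X_notMem_projChart c q
  -- The extra factor makes the degree positive, as basic open sets of `Proj` require here; it does
  -- not lie in the prime, so membership is not affected.
  have hh' : h * MvPolynomial.X (cIdx c) ∈ grading (𝓞 K) g (n + 1) :=
    SetLike.mul_mem_graded hh (Xc_mem_grading c)
  have h1 := Proj.awayι_preimage_basicOpen (grading (𝓞 K) g) (Xc_mem_grading c) one_pos hh'
    n.succ_pos
  have h2 : isLocalizationElem (Xc_mem_grading c) hh' = awayFrac c n h hh := by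
    apply val_injective
    refine Localization.mk_eq_mk_iff.mpr ?_
    rw [Localization.r_iff_exists]
    exact ⟨1, by simp only [OneMemClass.coe_one, one_mul, pow_one]; ring⟩
  rw [h2] at h1
  have h3 : q ∈ (projChart K g c) ⁻¹ᵁ
      Proj.basicOpen (grading (𝓞 K) g) (h * MvPolynomial.X (cIdx c)) ↔
      q ∈ PrimeSpectrum.basicOpen (awayFrac c n h hh) := by rw [h1]; exact Iff.rfl
  have h4 : q ∈ (projChart K g c) ⁻¹ᵁ
      Proj.basicOpen (grading (𝓞 K) g) (h * MvPolynomial.X (cIdx c)) ↔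
      h * MvPolynomial.X (cIdx c) ∉ (projChart K g c q).asHomogeneousIdeal := Iff.rfl
  have h5 : q ∈ PrimeSpectrum.basicOpen (awayFrac c n h hh) ↔
      awayFrac c n h hh ∉ (q : PrimeSpectrum (AwayRing K g c)).asIdeal := Iff.rfl
  rw [h4, h5, not_iff_not] at h3
  rw [← h3]
  refine ⟨fun hm => mul_mem_right _ _ hm, fun hm => ?_⟩
  exact ((projChart K g c q).isPrime.mem_or_mem hm).resolve_right hX

lemma equation_mem_of_mem_closedLocus (P : WeightedProj (𝓞 K) g) (hP : P ∈ closedLocus f) :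
    equation f ∈ P.asHomogeneousIdeal := by
  have h1 : IsClosed {P : WeightedProj (𝓞 K) g | equation f ∈ P.asHomogeneousIdeal} := by
    have h : {P : WeightedProj (𝓞 K) g | equation f ∈ P.asHomogeneousIdeal} =
        ProjectiveSpectrum.zeroLocus (grading (𝓞 K) g) {equation f} :=
      Set.ext fun P =>
        ⟨fun h x hx => (show x = equation f from hx) ▸ h, fun h => h (show equation f = equation f from rfl)⟩
    rw [h]
    exact ProjectiveSpectrum.isClosed_zeroLocus (grading (𝓞 K) g) {equation f}
  exact closure_minimal (fun P hP => hP.1) h1 hP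

/-- If `x` and `s` lie in the prime, the equation forces `y ^ 2`, hence `y`, into it, and the prime
contains the irrelevant ideal. -/
lemma exists_X_notMem (P : WeightedProj (𝓞 K) g) (hP : equation f ∈ P.asHomogeneousIdeal) :
    ∃ c, MvPolynomial.X (cIdx c) ∉ P.asHomogeneousIdeal := by
  by_contra! hcon
  have h0 : MvPolynomial.X 0 ∈ P.asHomogeneousIdeal.toIdeal := hcon true
  have h1 : MvPolynomial.X 1 ∈ P.asHomogeneousIdeal.toIdeal := hcon false
  have h2 : MvPolynomial.X 2 ∈ P.asHomogeneousIdeal.toIdeal := by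
    refine P.isPrime.mem_of_pow_mem 2 ?_
    have hs : ∑ i : Fin (2 * g + 3), MvPolynomial.C (f i) * MvPolynomial.X 0 ^ (i : ℕ) *
        MvPolynomial.X 1 ^ (2 * g + 2 - (i : ℕ)) ∈ P.asHomogeneousIdeal.toIdeal := by
      refine Ideal.sum_mem _ fun i _ => ?_
      rcases Nat.eq_zero_or_pos (i : ℕ) with hi | hi
      · exact mul_mem_left _ _ (Ideal.pow_mem_of_mem _ h1 _ (by omega))
      · exact mul_mem_right _ _ (mul_mem_left _ _ (Ideal.pow_mem_of_mem _ h0 _ hi))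
    have := Ideal.add_mem _ hP hs
    rwa [equation, sub_add_cancel] at this
  refine P.not_irrelevant_le ?_
  have hle : ∀ p : 𝓐 K,
      p - MvPolynomial.C (MvPolynomial.constantCoeff p) ∈ P.asHomogeneousIdeal.toIdeal := by
    intro p
    induction p using MvPolynomial.induction_on with
    | C a => simp
    | add p q hp hq =>
      have := Ideal.add_mem _ hp hq
      convert this using 1
      simp only [map_add]
      ring
    | mul_X p i hp =>
      have hi : MvPolynomial.X i ∈ P.asHomogeneousIdeal.toIdeal := by
        fin_cases i
        · exact h0
        · exact h1
        · exact h2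
      simpa using mul_mem_left _ p hi
  intro p hp
  have hp0 : MvPolynomial.constantCoeff p = 0 := by
    have h3 : GradedRing.proj (grading (𝓞 K) g) 0 p = 0 := hp
    have h4 := congrArg MvPolynomial.constantCoeff
      ((MvPolynomial.weightedDecomposition.decompose'_apply (𝓞 K) (weights g) p 0).symm.trans h3)
    rw [constantCoeff_eq, MvPolynomial.coeff_weightedHomogeneousComponent] at h4
    rw [constantCoeff_eq]
    simpa using h4
  have := hle p
  rwa [hp0, map_zero, sub_zero] at this

lemma C_mem_grading (r : 𝓞 K) :
    (MvPolynomial.C r : 𝓐 K) ∈ grading (𝓞 K) g 0 :=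
  isWeightedHomogeneous_C _ _

lemma fromZero_algebraMap (c : Bool) (r : 𝓞 K) :
    fromZeroRingHom (grading (𝓞 K) g)
      (Submonoid.powers (MvPolynomial.X (cIdx c))) (algebraMap (𝓞 K) (grading (𝓞 K) g 0) r) =
      awayFrac c 0 (MvPolynomial.C r) (C_mem_grading _) := by
  rw [← homogenize_dehomPoly c 0 _ (C_mem_grading _)]
  simp [dehomPoly, homogenize]

lemma dehomAway_comp_algebraMap (c : Bool) :
    ((dehomAway f c).comp (fromZeroRingHom (grading (𝓞 K) g)
      (Submonoid.powers (MvPolynomial.X (cIdx c))))).comp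
      (algebraMap (𝓞 K) (grading (𝓞 K) g 0)) = chartC f c := by
  ext r
  rw [RingHom.comp_apply, RingHom.comp_apply, fromZero_algebraMap, dehomAway_awayFrac]
  simp [dehom]

variable (hf : IsSeparableForm f)
include hf

/-- The kernel of dehomogenisation is a prime that contains no nonzero constant, so it is itself one
of the points whose closure is taken; a function vanishing on the closure lies in it. Conversely the
kernel is generated by the equation, which vanishes on the whole closure. -/
lemma closedLocus_projChart (c : Bool) (a : AwayRing K g c) :
    (∀ q : Spec (.of (AwayRing K g c)), projChart K g c q ∈ closedLocus f →
      a ∈ (q : PrimeSpectrum (AwayRing K g c)).asIdeal) ↔ dehomAway f c a = 0 := by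
  have hdom := ChartRing.isDomain hf c
  constructor
  · intro h
    have hp : (ker (dehomAway f c)).IsPrime := ker_isPrime _
    let q₀ : PrimeSpectrum (AwayRing K g c) := ⟨ker (dehomAway f c), hp⟩
    refine h q₀ (subset_closure ⟨?_, fun r hr => ?_⟩)
    · rw [mem_projChart_iff c q₀ _ _ (equation_mem_grading f)]
      show _ ∈ ker (dehomAway f c)
      rw [mem_ker, dehomAway_awayFrac, dehom_equation]
    · rw [mem_projChart_iff c q₀ 0 _ (C_mem_grading _)] at hr
      have hr' : dehomAway f c (awayFrac c 0 (MvPolynomial.C r)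
        (C_mem_grading _)) = 0 := hr
      rw [dehomAway_awayFrac, dehom, eval₂Hom_C, map_eq_zero_iff _ (chartC_injective c)] at hr'
      exact hr'
  · intro h q hq
    have h1 : a ∈ ker (dehomAway f c) := h
    rw [ker_dehomAway, mem_span_singleton] at h1
    obtain ⟨b, rfl⟩ := h1
    exact mul_mem_right _ _ ((mem_projChart_iff c q _ _ (equation_mem_grading f)).mp
      (equation_mem_of_mem_closedLocus _ hq))

lemma exists_chartι (c : Bool) : ∃ j : Spec (.of (ChartRing f c)) ⟶ naiveModel f,
    ∃ _ : IsOpenImmersion j, j ≫ naiveModelι f =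
      Spec.map (ofHom (dehomAway f c)) ≫ projChart K g c ∧
      j.opensRange = naiveModelι f ⁻¹ᵁ (projChart K g c).opensRange :=
  exists_chart_vanishingIdeal (closedLocus f) (dehomAway f c) (dehomAway_surjective f c)
    (projChart K g c) (closedLocus_projChart hf c)

/-- The affine charts of the naive model. -/
def chartι (c : Bool) : Spec (.of (ChartRing f c)) ⟶ naiveModel f := (exists_chartι hf c).choose

instance (c : Bool) : IsOpenImmersion (chartι hf c) := (exists_chartι hf c).choose_spec.choose

lemma chartι_naiveModelι (c : Bool) : chartι hf c ≫ naiveModelι f =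
    Spec.map (ofHom (dehomAway f c)) ≫ projChart K g c :=
  (exists_chartι hf c).choose_spec.choose_spec.1

lemma chartι_opensRange (c : Bool) : (chartι hf c).opensRange =
    naiveModelι f ⁻¹ᵁ (projChart K g c).opensRange :=
  (exists_chartι hf c).choose_spec.choose_spec.2

lemma mem_chartι_opensRange_iff (c : Bool) (x : naiveModel f) :
    x ∈ (chartι hf c).opensRange ↔
      MvPolynomial.X (cIdx c) ∉ (naiveModelι f x).asHomogeneousIdeal := by
  rw [chartι_opensRange, projChart_opensRange]
  rfl

omit hf in
lemma naiveModelι_mem (x : naiveModel f) : naiveModelι f x ∈ closedLocus f := by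
  let I := vanishingIdeal (closedLocus f)
  let x' : I.subscheme := x
  have h : I.subschemeι x' ∈ (I.support : Set (WeightedProj (𝓞 K) g)) :=
    I.range_subschemeι ▸ ⟨x', rfl⟩
  rwa [coe_support_vanishingIdeal] at h

lemma exists_mem_chartι (x : naiveModel f) : ∃ c, x ∈ (chartι hf c).opensRange := by
  obtain ⟨c, hc⟩ := exists_X_notMem _ (equation_mem_of_mem_closedLocus _ (naiveModelι_mem x))
  exact ⟨c, (mem_chartι_opensRange_iff hf c x).mpr hc⟩

lemma mem_chartι_iff (c : Bool) (q : Spec (.of (ChartRing f c))) (n : ℕ)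
    (h : 𝓐 K) (hh : h ∈ grading (𝓞 K) g n) :
    h ∈ (naiveModelι f (chartι hf c q)).asHomogeneousIdeal ↔
      dehom f c h ∈ (q : PrimeSpectrum (ChartRing f c)).asIdeal := by
  rw [← Scheme.Hom.comp_apply, chartι_naiveModelι, Scheme.Hom.comp_apply,
    mem_projChart_iff c _ n h hh, ← dehomAway_awayFrac f c n h hh]
  rfl

lemma chartι_toSpec (c : Bool) : chartι hf c ≫ naiveModelToSpec f =
    Spec.map (ofHom (chartC f c)) := by
  rw [naiveModelToSpec, ← assoc, chartι_naiveModelι, weightedProjToSpec, assoc,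
    Proj.awayι_toSpecZero_assoc, ← Spec.map_comp, ← Spec.map_comp]
  rw [← dehomAway_comp_algebraMap]
  rfl

/-- A morphism from the spectrum of a local ring to the naive model factors through a chart. -/
lemma exists_chart_lift (c : Bool) {V : Type u} [CommRing V] [IsLocalRing V]
    (φ : Spec (.of V) ⟶ naiveModel f)
    (h : φ (closedPoint V) ∈ (chartι hf c).opensRange) :
    ∃ e : ChartRing f c →+* V, Spec.map (ofHom e) ≫ chartι hf c = φ := by
  have hle := top_le_preimage_of_closedPoint_mem φ _ h
  have hr : Set.range φ ⊆ Set.range (chartι hf c) := by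
    rintro _ ⟨x, rfl⟩
    exact hle (show x ∈ ⊤ from trivial)
  refine ⟨(Spec.preimage (IsOpenImmersion.lift (chartι hf c) φ hr)).hom, ?_⟩
  rw [ofHom_hom, Spec.map_preimage, IsOpenImmersion.lift_fac]

lemma chart_lift_injective (c : Bool) {V : Type u} [CommRing V] (e e' : ChartRing f c →+* V)
    (h : Spec.map (ofHom e) ≫ chartι hf c = Spec.map (ofHom e') ≫ chartι hf c) : e = e' := by
  rw [cancel_mono] at h
  have := Spec.map_injective h
  exact congrArg CommRingCat.Hom.hom this

omit hf in
lemma dehom_chartCoords {S : Type*} [CommRing S] (c : Bool) (e : ChartRing f c →+* S)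
    (h : 𝓐 K) : e (dehom f c h) =
      h.eval₂ (e.comp (chartC f c)) (chartCoords c (e (coordU f c)) (e (coordV f c))) := by
  have : e.comp (dehom f c) = eval₂Hom (e.comp (chartC f c))
      (chartCoords c (e (coordU f c)) (e (coordV f c))) := by
    refine MvPolynomial.ringHom_ext (fun r => ?_) fun i => ?_
    · simp [dehom]
    · simp only [RingHom.comp_apply, dehom, eval₂Hom_X']
      rw [← chartCoords_map]; rfl
  exact congrArg (fun φ => φ h) this

omit hf in
lemma dehom_transition {S : Type*} [CommRing S] (e₀ : ChartRing f false →+* S)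
    (e₁ : ChartRing f true →+* S) (hC : e₀.comp (chartC f false) = e₁.comp (chartC f true))
    (hu : e₀ (coordU f false) * e₁ (coordU f true) = 1)
    (hv : e₀ (coordV f false) = e₀ (coordU f false) ^ (g + 1) * e₁ (coordV f true)) (n : ℕ)
    (h : 𝓐 K) (hh : h ∈ grading (𝓞 K) g n) :
    e₀ (dehom f false h) = e₀ (coordU f false) ^ n * e₁ (dehom f true h) := by
  rw [dehom_chartCoords, dehom_chartCoords, hC, ← eval₂_weighted_scale (weights g) _ _ _ n h hh]
  congr 1
  funext i
  fin_cases i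
  · simp [chartCoords, weights]
  · simpa [chartCoords, weights] using hu.symm
  · simpa [chartCoords, weights] using hv

/-- The gluing of the two charts. -/
lemma chart_transition {V : Type u} [CommRing V] (e₀ : ChartRing f false →+* V)
    (e₁ : ChartRing f true →+* V) (hC : e₀.comp (chartC f false) = e₁.comp (chartC f true))
    (hu : e₀ (coordU f false) * e₁ (coordU f true) = 1)
    (hv : e₀ (coordV f false) = e₀ (coordU f false) ^ (g + 1) * e₁ (coordV f true)) :
    Spec.map (ofHom e₀) ≫ chartι hf false = Spec.map (ofHom e₁) ≫ chartι hf true := by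
  have hmono : Mono (naiveModelι f) := 
    (inferInstance : Mono (vanishingIdeal (closedLocus f)).subschemeι)
  -- The naive model embeds into `Proj`, so the equality may be checked there, on the overlap where
  -- `x * s` is invertible.
  rw [← cancel_mono (naiveModelι f), assoc, assoc, chartι_naiveModelι,
    chartι_naiveModelι, ← assoc, ← assoc, ← Spec.map_comp, ← Spec.map_comp]
  let X₀ : 𝓐 K := MvPolynomial.X (cIdx false)
  let X₁ : 𝓐 K := MvPolynomial.X (cIdx true)
  have hX₀ : X₀ ∈ grading (𝓞 K) g 1 := Xc_mem_grading false
  have hX₁ : X₁ ∈ grading (𝓞 K) g 1 := Xc_mem_grading true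
  let A := HomogeneousLocalization.Away (grading (𝓞 K) g) (X₀ * X₁)
  let m₀ : AwayRing K g false →+* A := awayMap (grading (𝓞 K) g) hX₁ (rfl : X₀ * X₁ = X₀ * X₁)
  let m₁ : AwayRing K g true →+* A := awayMap (grading (𝓞 K) g) hX₀ (mul_comm X₀ X₁)
  have hm₀ : Spec.map (ofHom m₀) ≫ projChart K g false =
      Proj.awayι (grading (𝓞 K) g) (X₀ * X₁) (SetLike.mul_mem_graded hX₀ hX₁) (by norm_num) :=
    Proj.SpecMap_awayMap_awayι (grading (𝓞 K) g) hX₀ one_pos hX₁ rfl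
  have hm₁ : Spec.map (ofHom m₁) ≫ projChart K g true =
      Proj.awayι (grading (𝓞 K) g) (X₀ * X₁) (SetLike.mul_mem_graded hX₀ hX₁) (by norm_num) :=
    Proj.SpecMap_awayMap_awayι (grading (𝓞 K) g) hX₁ one_pos hX₀ (mul_comm _ _)
  have hunit : IsUnit (e₀ (coordU f false)) := IsUnit.of_mul_eq_one _ hu
  let el : AwayRing K g false := isLocalizationElem hX₀ hX₁
  let alg : Algebra (AwayRing K g false) A := m₀.toAlgebra
  have hloc : IsLocalization.Away el A := isLocalization_mul hX₀ hX₁ rfl one_ne_zero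
  have hel : e₀ (dehomAway f false el) = e₀ (coordU f false) := by
    have : el = awayFrac false 1 (X₁ ^ 1) (by rwa [pow_one]) := rfl
    rw [this, dehomAway_awayFrac, pow_one]
    congr 1
    simp [X₁, dehom, cIdx, chartCoords]
  -- The coordinate ring of the overlap is the localisation of the chart `s ≠ 0` at `x / s`, whose
  -- image is the unit `e₀ (coordU f false)`.
  let E : A →+* V := IsLocalization.Away.lift el (g := e₀.comp (dehomAway f false))
    (by rw [RingHom.comp_apply, hel]; exact hunit)
  have hE₀ : E.comp m₀ = e₀.comp (dehomAway f false) := IsLocalization.Away.lift_comp el _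
  have hE₁ : E.comp m₁ = e₁.comp (dehomAway f true) := by
    ext z
    obtain ⟨n, h, hh, rfl⟩ := awayFrac_surjective z
    -- The identity `(h / x ^ n) * (x / s) ^ n = h / s ^ n` on the overlap.
    have h1 : m₁ (awayFrac true n h hh) * m₀ (el ^ n) = m₀ (awayFrac false n h hh) := by
      let ρ := algebraMap A (Localization.Away (X₀ * X₁))
      let pw (n : ℕ) : Submonoid.powers (X₀ * X₁) := ⟨(X₀ * X₁) ^ n, n, rfl⟩
      have hρ : Injective ρ := val_injective _
      have e1 : ρ (m₁ (awayFrac true n h hh)) = Localization.mk (h * X₀ ^ n) (pw n) := by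
        show (awayMap _ _ _ (HomogeneousLocalization.Away.mk _ _ _ _ _)).val = _
        rw [awayMap_mk, val_mk]
      have e2 : ρ (m₀ el) = Localization.mk (X₁ ^ 1 * X₁ ^ 1) (pw 1) := by
        show (awayMap _ _ _ (HomogeneousLocalization.Away.mk _ _ _ _ _)).val = _
        rw [awayMap_mk, val_mk]
      have e3 : ρ (m₀ (awayFrac false n h hh)) = Localization.mk (h * X₁ ^ n) (pw n) := by
        show (awayMap _ _ _ (HomogeneousLocalization.Away.mk _ _ _ _ _)).val = _
        rw [awayMap_mk, val_mk]
      apply hρ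
      rw [map_mul, map_pow, map_pow, e1, e2, e3, Localization.mk_pow, Localization.mk_mul]
      refine Localization.mk_eq_mk_iff.mpr ?_
      rw [Localization.r_iff_exists]
      refine ⟨1, ?_⟩
      simp only [pw, OneMemClass.coe_one, one_mul, pow_one, Submonoid.coe_mul,
        SubmonoidClass.coe_pow]
      ring
    have h2 := congrArg E h1
    have h3 : ∀ z, E (m₀ z) = e₀ (dehomAway f false z) := fun z => congrArg (fun φ => φ z) hE₀
    rw [map_mul, h3, h3, map_pow, map_pow, hel, dehomAway_awayFrac,
      dehom_transition e₀ e₁ hC hu hv n h hh, mul_comm] at h2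
    rw [RingHom.comp_apply, RingHom.comp_apply, dehomAway_awayFrac]
    exact (hunit.pow n).mul_left_cancel h2
  have g₀ : ofHom (dehomAway f false) ≫ ofHom e₀ = ofHom m₀ ≫ ofHom E := by
    rw [← ofHom_comp, ← ofHom_comp, hE₀]
  have g₁ : ofHom (dehomAway f true) ≫ ofHom e₁ = ofHom m₁ ≫ ofHom E := by
    rw [← ofHom_comp, ← ofHom_comp, hE₁]
  rw [g₀, g₁, Spec.map_comp, Spec.map_comp, assoc, assoc, hm₀, hm₁]

end Charts

/-! ### Evaluation of chart functions at points of the curve -/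

section Evaluation

variable {L : Type v} [Field L] [Algebra K L]

namespace CurvePoint

/-- The coordinate of weight one that has to be invertible on a chart. -/
def cval (p : CurvePoint f L) (c : Bool) : L := if c then p.x else p.s

/-- The other coordinate of weight one. -/
def oval (p : CurvePoint f L) (c : Bool) : L := if c then p.s else p.x

/-- The value of `coordU`. -/
def uval (p : CurvePoint f L) (c : Bool) : L := p.oval c / p.cval c

/-- The value of `coordV`. -/
def vval (p : CurvePoint f L) (c : Bool) : L := p.y / p.cval c ^ (g + 1)

lemma exists_cval_ne_zero (p : CurvePoint f L) : ∃ c, p.cval c ≠ 0 := by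
  rcases p.normalized with h | ⟨h, h'⟩
  · exact ⟨false, by simp [cval, h]⟩
  · exact ⟨true, by simp [cval, h']⟩

lemma vval_sq (p : CurvePoint f L) (c : Bool) (hc : p.cval c ≠ 0) :
    p.vval c ^ 2 = (affForm f c).eval₂ ((algebraMap K L).comp (algebraMap (𝓞 K) K)) (p.uval c) := by
  have h := p.eqn
  rw [vval, div_pow, h, affForm, eval₂_finsetSum, div_eq_iff (by positivity), sum_mul]
  refine sum_congr rfl fun i _ => ?_
  have hi : (i : ℕ) ≤ 2 * g + 2 := by omega
  rw [eval₂_mul, eval₂_C, eval₂_X_pow, uval, RingHom.comp_apply, mul_assoc, mul_assoc]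
  congr 1
  rw [← pow_mul, div_pow, div_mul_eq_mul_div, eq_div_iff (pow_ne_zero _ hc)]
  cases c
  · simp only [chartExp, cval, oval, Bool.false_eq_true, if_false]
    rw [show (g + 1) * 2 = (2 * g + 2 - i) + i by omega, pow_add]
    ring
  · simp only [chartExp, cval, oval, if_true]
    rw [show (g + 1) * 2 = (2 * g + 2 - i) + i by omega, pow_add]
    ring

/-- Evaluation of functions on a chart at a point. -/
def chartEval (p : CurvePoint f L) (c : Bool) (hc : p.cval c ≠ 0) : ChartRing f c →+* L :=
  chartHom c ((algebraMap K L).comp (algebraMap (𝓞 K) K)) (p.uval c) (p.vval c) (p.vval_sq c hc)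

@[simp] lemma chartEval_coordU (p : CurvePoint f L) (c : Bool) (hc : p.cval c ≠ 0) :
    p.chartEval c hc (coordU f c) = p.uval c := chartHom_coordU ..

@[simp] lemma chartEval_coordV (p : CurvePoint f L) (c : Bool) (hc : p.cval c ≠ 0) :
    p.chartEval c hc (coordV f c) = p.vval c := chartHom_coordV ..

@[simp] lemma chartEval_chartC (p : CurvePoint f L) (c : Bool) (hc : p.cval c ≠ 0) (r : 𝓞 K) :
    p.chartEval c hc (chartC f c r) = algebraMap K L (algebraMap (𝓞 K) K r) :=
  chartHom_chartC ..

lemma chartEval_comp_chartC (p : CurvePoint f L) (c : Bool) (hc : p.cval c ≠ 0) :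
    (p.chartEval c hc).comp (chartC f c) = (algebraMap K L).comp (algebraMap (𝓞 K) K) :=
  chartHom_comp_chartC ..

lemma eval₂_eq_chartEval (p : CurvePoint f L) (c : Bool) (hc : p.cval c ≠ 0) (n : ℕ)
    (h : 𝓐 K) (hh : h ∈ grading (𝓞 K) g n) :
    h.eval₂ ((algebraMap K L).comp (algebraMap (𝓞 K) K)) ![p.x, p.s, p.y] =
      p.cval c ^ n * p.chartEval c hc (dehom f c h) := by
  rw [dehom_chartCoords, ← eval₂_weighted_scale (weights g) _ _ _ n h hh, chartEval_comp_chartC]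
  congr 1
  have h2 : p.cval c ^ (g + 1) * p.vval c = p.y := by
    rw [vval, mul_div_cancel₀ _ (pow_ne_zero _ hc)]
  have h1 : p.cval c * p.uval c = p.oval c := by rw [uval, mul_div_cancel₀ _ hc]
  funext i
  rw [chartEval_coordU, chartEval_coordV]
  cases c
  · have h1 : p.cval false * p.uval false = p.x := h1
    fin_cases i
    · simpa [chartCoords, weights] using h1.symm
    · simp [chartCoords, weights, cval]
    · simpa [chartCoords, weights] using h2.symm
  · have h1 : p.cval true * p.uval true = p.s := h1
    fin_cases i
    · simp [chartCoords, weights, cval]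
    · simpa [chartCoords, weights] using h1.symm
    · simpa [chartCoords, weights] using h2.symm

/-- Each function on the chart is the dehomogenisation of a homogeneous polynomial, so the condition
on homogeneous polynomials determines the prime of the chart. From here on, `LiesAt` is used in this
affine form. -/
lemma liesAt_iff (hf : IsSeparableForm f) (p : CurvePoint f L) (c : Bool) (hc : p.cval c ≠ 0)
    (P : curve f) : p.LiesAt P ↔ ∃ q : Spec (.of (ChartRing f c)), chartι hf c q = curveι f P ∧
      (q : PrimeSpectrum (ChartRing f c)).asIdeal = ker (p.chartEval c hc) := by
  constructor
  · intro h
    have hX : MvPolynomial.X (cIdx c) ∉ (naiveModelι f (curveι f P)).asHomogeneousIdeal := by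
      have h1 := h 1 _ (Xc_mem_grading c)
      rw [Scheme.Hom.comp_apply] at h1
      rw [h1, eval₂_eq_chartEval p c hc 1 _ (Xc_mem_grading c), dehom_X_cIdx, map_one, mul_one,
        pow_one]
      exact hc
    obtain ⟨q, hq⟩ := (mem_chartι_opensRange_iff hf c _).mpr hX
    refine ⟨q, hq, ?_⟩
    ext a
    obtain ⟨z, rfl⟩ := dehomAway_surjective f c a
    obtain ⟨n, h', hh, rfl⟩ := awayFrac_surjective z
    have h1 := h n h' hh
    rw [Scheme.Hom.comp_apply, ← hq, mem_chartι_iff hf c q n h' hh,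
      eval₂_eq_chartEval p c hc n _ hh] at h1
    rw [dehomAway_awayFrac, mem_ker, h1, mul_eq_zero]
    exact ⟨fun h => h.resolve_left (pow_ne_zero _ hc), Or.inr⟩
  · rintro ⟨q, hq, hk⟩ n h hh
    rw [Scheme.Hom.comp_apply, ← hq, mem_chartι_iff hf c q n h hh, hk, mem_ker,
      eval₂_eq_chartEval p c hc n _ hh, mul_eq_zero]
    exact ⟨Or.inr, fun h => h.resolve_left (pow_ne_zero _ hc)⟩

lemma cval_ne_zero_of_liesAt (hf : IsSeparableForm f) (p : CurvePoint f L) {P : curve f}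
    (h : p.LiesAt P) (c : Bool) : p.cval c ≠ 0 ↔ curveι f P ∈ (chartι hf c).opensRange := by
  have h1 := h 1 _ (Xc_mem_grading c)
  rw [mem_chartι_opensRange_iff, ← Scheme.Hom.comp_apply, h1, MvPolynomial.eval₂_X]
  cases c <;> simp [cval, cIdx]

/-- The affine coordinates determine the point projectively, and the normalisation then fixes the
representative: `s = 1` in the first chart; in the second, `x` is `1` if `u = 0` and `u⁻¹`
otherwise. -/
lemma ext_chart {p q : CurvePoint f L} (c : Bool) (hp : p.cval c ≠ 0) (hq : q.cval c ≠ 0)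
    (hu : p.uval c = q.uval c) (hv : p.vval c = q.vval c) : p = q := by
  have key : ∀ r : CurvePoint f L, r.cval c ≠ 0 → r.oval c = r.uval c * r.cval c ∧
      r.y = r.vval c * r.cval c ^ (g + 1) := fun r hr =>
    ⟨(div_mul_cancel₀ _ hr).symm, (div_mul_cancel₀ _ (pow_ne_zero _ hr)).symm⟩
  have hc : p.cval c = q.cval c := by
    cases c
    · have h1 : ∀ r : CurvePoint f L, r.cval false ≠ 0 → r.cval false = 1 := fun r hr => by
        rcases r.normalized with h | h
        · exact h
        · exact absurd h.1 hr
      rw [h1 p hp, h1 q hq]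
    · have h1 : ∀ r : CurvePoint f L, r.cval true ≠ 0 → (r.uval true = 0 ∧ r.cval true = 1) ∨
          (r.uval true ≠ 0 ∧ r.cval true = (r.uval true)⁻¹) := fun r hr => by
        rcases r.normalized with h | h
        · right
          refine ⟨?_, ?_⟩
          · simp only [uval, oval, if_true, h]
            exact div_ne_zero one_ne_zero hr
          · simp [uval, oval, h]
        · left; simp [uval, oval, cval, h]
      rcases h1 p hp with h | h <;> rcases h1 q hq with h' | h'
      · rw [h.2, h'.2]
      · exact absurd (hu ▸ h.1) h'.1
      · exact absurd (hu ▸ h'.1) h.1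
      · rw [h.2, h'.2, hu]
  have h1 := key p hp
  have h2 := key q hq
  have ho : p.oval c = q.oval c := by rw [h1.1, h2.1, hu, hc]
  have hy : p.y = q.y := by rw [h1.2, h2.2, hv, hc]
  cases c
  · exact CurvePoint.ext ho hc hy
  · exact CurvePoint.ext hc ho hy

/-- The point with given affine coordinates in a chart. -/
lemma exists_of_chart {u v : L} (c : Bool)
    (h : v ^ 2 = (affForm f c).eval₂ ((algebraMap K L).comp (algebraMap (𝓞 K) K)) u) :
    ∃ p : CurvePoint f L, p.cval c ≠ 0 ∧ p.uval c = u ∧ p.vval c = v := by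
  rw [affForm, eval₂_finsetSum] at h
  simp only [eval₂_mul, eval₂_C, eval₂_X_pow] at h
  cases c
  · refine ⟨⟨u, 1, v, ?_, Or.inl rfl⟩, ?_, ?_, ?_⟩
    · rw [h]; simp [chartExp]
    · simp [cval]
    · simp [uval, oval, cval]
    · simp [vval, cval]
  · by_cases hu : u = 0
    · subst hu
      refine ⟨⟨1, 0, v, ?_, Or.inr ⟨rfl, rfl⟩⟩, ?_, ?_, ?_⟩
      · rw [h]; simp [chartExp]
      · simp [cval]
      · simp [uval, oval, cval]
      · simp [vval, cval]
    · refine ⟨⟨u⁻¹, 1, v * (u⁻¹) ^ (g + 1), ?_, Or.inl rfl⟩, ?_, ?_, ?_⟩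
      · rw [mul_pow, h, sum_mul]
        refine sum_congr rfl fun i _ => ?_
        have hi : (i : ℕ) ≤ 2 * g + 2 := by omega
        simp only [chartExp, if_true, one_pow, mul_one]
        rw [mul_assoc, RingHom.comp_apply]
        congr 1
        rw [← pow_mul, show (g + 1) * 2 = (2 * g + 2 - i) + i by omega, pow_add, inv_pow, inv_pow,
          ← mul_assoc, mul_inv_cancel₀ (pow_ne_zero _ hu), one_mul]
      · simp [cval, hu]
      · simp [uval, oval, cval]
      · simp [vval, cval, hu]

lemma uval_mul_uval (p : CurvePoint f L) (c : Bool) (h0 : p.cval c ≠ 0) (h1 : p.cval (!c) ≠ 0) :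
    p.uval c * p.uval (!c) = 1 := by
  cases c <;> simp [uval, cval, oval] at h0 h1 ⊢ <;> field_simp

lemma vval_transition (p : CurvePoint f L) (c : Bool) (h0 : p.cval c ≠ 0) (h1 : p.cval (!c) ≠ 0) :
    p.vval c = p.uval c ^ (g + 1) * p.vval (!c) := by
  cases c <;> simp [vval, uval, cval, oval, div_pow] at h0 h1 ⊢ <;> field_simp

end CurvePoint

end Evaluation

open CurvePoint (chartEval_coordU chartEval_comp_chartC chartEval_coordV chartEval_chartC liesAt_iff cval_ne_zero_of_liesAt)

/-! ### Local rings, specialisation and closures of points -/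

section Stalks

/-- The closed point of the spectrum of a local ring, as a point of a scheme. -/
abbrev closedPtSpec (V : Type u) [CommRing V] [IsLocalRing V] : Spec (.of V) :=
  (closedPoint V : PrimeSpectrum V)

/-- The closed point of the spectrum of a stalk. -/
abbrev closedPtStalk {X : Scheme.{u}} (x : X) : Spec (X.presheaf.stalk x) :=
  (closedPoint (X.presheaf.stalk x) : PrimeSpectrum (X.presheaf.stalk x))

lemma fromSpecStalk_closedPtStalk {X : Scheme.{u}} (x : X) :
    X.fromSpecStalk x (closedPtStalk x) = x := Scheme.fromSpecStalk_closedPoint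

/-- On an affine neighbourhood both stalks are localisations of the sections. A numerator that dies
at `ξ` is killed by an `m` that becomes a unit there; `m` is therefore nonzero at `Q`, and the
numerator vanishes because the stalk at `Q` is a domain. -/
lemma stalkSpecializes_injective {X : Scheme.{u}} {ξ Q : X} (h : ξ ⤳ Q)
    [IsDomain (X.presheaf.stalk Q)] : Injective (X.presheaf.stalkSpecializes h).hom := by
  rw [injective_iff_map_eq_zero]
  intro r hr
  obtain ⟨⟨U, hU⟩, hQ⟩ := exists_affineOpen_mem Q
  have hξ : ξ ∈ U := h.mem_open U.isOpen hQ
  let aQ := TopCat.Presheaf.algebra_section_stalk X.presheaf (⟨Q, hQ⟩ : U)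
  let aξ := TopCat.Presheaf.algebra_section_stalk X.presheaf (⟨ξ, hξ⟩ : U)
  have lQ := hU.isLocalization_stalk ⟨Q, hQ⟩
  have lξ := hU.isLocalization_stalk ⟨ξ, hξ⟩
  let γ := (X.presheaf.germ U Q hQ).hom
  let γ' := (X.presheaf.germ U ξ hξ).hom
  have hγ : ∀ a, (X.presheaf.stalkSpecializes h).hom (γ a) = γ' a := fun a => by
    have := X.presheaf.germ_stalkSpecializes hQ h
    exact congrArg (fun φ => φ.hom a) this
  obtain ⟨b, t, rfl⟩ := exists_mk'_eq (hU.primeIdealOf ⟨Q, hQ⟩).asIdeal.primeCompl r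
  have h1 : γ b = γ t * mk' (X.presheaf.stalk Q) b t := by
    rw [mul_comm]; exact (mk'_spec _ b t).symm
  have h2 : γ' b = 0 := by rw [← hγ, h1, map_mul, hr, mul_zero]
  obtain ⟨m, hm⟩ := (IsLocalization.map_eq_zero_iff
    (hU.primeIdealOf ⟨ξ, hξ⟩).asIdeal.primeCompl (X.presheaf.stalk ξ) b).mp h2
  have h3 : γ m * γ b = 0 := by rw [← map_mul, hm, map_zero]
  have h4 : γ m ≠ 0 := by
    intro h0
    have h5 : IsUnit (γ' m) := map_units (X.presheaf.stalk ξ) m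
    rw [← hγ, h0, map_zero] at h5
    exact not_isUnit_zero h5
  have h6 := (mul_eq_zero.mp h3).resolve_left h4
  exact (IsLocalization.mk'_eq_zero_iff b t).mpr
    ((IsLocalization.map_eq_zero_iff _ (X.presheaf.stalk Q) b).mp h6)

lemma comap_stalkSpecializes {X : Scheme.{u}} {Q : X} (q : Spec (X.presheaf.stalk Q)) {ξ : X}
    (hq : X.fromSpecStalk Q q = ξ) (h : ξ ⤳ Q) (r : X.presheaf.stalk Q) :
    r ∈ q.asIdeal ↔ (X.presheaf.stalkSpecializes h).hom r ∈
      maximalIdeal (X.presheaf.stalk ξ) := by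
  have h1 : X.fromSpecStalk Q (Spec.map (X.presheaf.stalkSpecializes h)
      (closedPtStalk ξ)) = ξ := by
    rw [← Scheme.Hom.comp_apply, Scheme.SpecMap_stalkSpecializes_fromSpecStalk,
      fromSpecStalk_closedPtStalk]
  have h2 : q = Spec.map (X.presheaf.stalkSpecializes h)
      (closedPtStalk ξ) :=
    (X.fromSpecStalk Q).isEmbedding.injective (hq.trans h1.symm)
  rw [h2]
  exact Iff.rfl

lemma exists_mul_toStalk_eq {A : Type u} [CommRing A] (𝔞 : PrimeSpectrum A)
    (z : (Spec.structureSheaf A).presheaf.stalk 𝔞) :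
    ∃ a s : A, IsUnit (algebraMap A ((Spec.structureSheaf A).presheaf.stalk 𝔞) s) ∧
      algebraMap A ((Spec.structureSheaf A).presheaf.stalk 𝔞) s * z =
        algebraMap A ((Spec.structureSheaf A).presheaf.stalk 𝔞) a := by
  have hloc := to_stalk A 𝔞
  obtain ⟨⟨a, s⟩, has⟩ := IsLocalization.surj 𝔞.asIdeal.primeCompl
    (S := (Spec.structureSheaf A).presheaf.stalk 𝔞) z
  exact ⟨a, s, map_units ((Spec.structureSheaf A).presheaf.stalk 𝔞) s, (mul_comm _ _).trans has⟩

lemma toStalk_injective {A : Type u} [CommRing A] [IsDomain A] (𝔞 : PrimeSpectrum A) :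
    Injective (algebraMap A ((Spec.structureSheaf A).presheaf.stalk 𝔞)) := by
  have hloc := to_stalk A 𝔞
  exact IsLocalization.injective ((Spec.structureSheaf A).presheaf.stalk 𝔞)
    𝔞.asIdeal.primeCompl_le_nonZeroDivisors

lemma mem_closureIdeal {X : Scheme.{u}} {η Q : X} (h : η ⤳ Q) (r : X.presheaf.stalk Q) :
    r ∈ closureIdeal η Q ↔ (X.presheaf.stalkSpecializes h).hom r ∈
      maximalIdeal (X.presheaf.stalk η) := by
  rw [closureIdeal, dif_pos h, mem_ker, CommRingCat.hom_comp, RingHom.comp_apply]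
  exact IsLocalRing.residue_eq_zero_iff _

lemma closureIdeal_fromSpecStalk {X : Scheme.{u}} {Q : X} (q : Spec (X.presheaf.stalk Q)) :
    closureIdeal (X.fromSpecStalk Q q) Q = q.asIdeal := by
  have h : X.fromSpecStalk Q q ⤳ Q := by
    have : X.fromSpecStalk Q q ∈ Set.range (X.fromSpecStalk Q) := ⟨q, rfl⟩
    rwa [Scheme.range_fromSpecStalk] at this
  ext r
  rw [mem_closureIdeal h, comap_stalkSpecializes q rfl h]

lemma exists_fromSpecStalk_eq {X : Scheme.{u}} {η Q : X} (h : closureIdeal η Q ≠ ⊤) :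
    ∃ q : Spec (X.presheaf.stalk Q), X.fromSpecStalk Q q = η := by
  have h1 : η ⤳ Q := by
    by_contra hcon
    exact h (by rw [closureIdeal, dif_neg hcon])
  have : η ∈ Set.range (X.fromSpecStalk Q) := by rw [Scheme.range_fromSpecStalk]; exact h1
  exact this

end Stalks

/-! ### Local rings of the model and points with values in them -/

section Resolution

variable (hf : IsSeparableForm f) {X : Scheme.{u}} (π : X ⟶ naiveModel f)

lemma exists_stalkChart (c : Bool) (Q : X) (hQ : π Q ∈ (chartι hf c).opensRange) :
    ∃ e : ChartRing f c →+* X.presheaf.stalk Q, Spec.map (ofHom e) ≫ chartι hf c =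
      X.fromSpecStalk Q ≫ π := by
  let φ : Spec (.of (X.presheaf.stalk Q)) ⟶ naiveModel f := X.fromSpecStalk Q ≫ π
  have h : (X.fromSpecStalk Q ≫ π) (closedPtStalk Q) ∈ (chartι hf c).opensRange := by
    rw [Scheme.Hom.comp_apply, fromSpecStalk_closedPtStalk]
    exact hQ
  exact exists_chart_lift hf c φ h

/-- The functions on a chart as germs on a model. -/
def stalkChart (c : Bool) (Q : X) (hQ : π Q ∈ (chartι hf c).opensRange) :
    ChartRing f c →+* X.presheaf.stalk Q := (exists_stalkChart hf π c Q hQ).choose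

variable {c : Bool} {Q : X} (hQ : π Q ∈ (chartι hf c).opensRange)

lemma stalkChart_spec : Spec.map (ofHom (stalkChart hf π c Q hQ)) ≫ chartι hf c =
    X.fromSpecStalk Q ≫ π := (exists_stalkChart hf π c Q hQ).choose_spec

lemma stalkChart_apply (q : Spec (X.presheaf.stalk Q)) :
    chartι hf c (Spec.map (ofHom (stalkChart hf π c Q hQ)) q) = π (X.fromSpecStalk Q q) := by
  rw [← Scheme.Hom.comp_apply, stalkChart_spec, Scheme.Hom.comp_apply]

lemma toSpec_fromSpecStalk (q : Spec (X.presheaf.stalk Q)) :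
    (π ≫ naiveModelToSpec f) (X.fromSpecStalk Q q) =
      Spec.map (ofHom ((stalkChart hf π c Q hQ).comp (chartC f c))) q := by
  rw [Scheme.Hom.comp_apply, ← stalkChart_apply hf π hQ, ← Scheme.Hom.comp_apply, chartι_toSpec,
    ofHom_comp, Spec.map_comp, Scheme.Hom.comp_apply]

/-- A local homomorphism out of a stalk gives a local point. -/
abbrev stalkPoint {V : Type u} [CommRing V] (ψ : X.presheaf.stalk Q →+* V) :
    Spec (.of V) ⟶ X := Spec.map (ofHom ψ) ≫ X.fromSpecStalk Q

lemma stalkPoint_comp {V : Type u} [CommRing V] (ψ : X.presheaf.stalk Q →+* V) :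
    stalkPoint ψ ≫ π = Spec.map (ofHom (ψ.comp (stalkChart hf π c Q hQ))) ≫ chartι hf c := by
  rw [ofHom_comp, Spec.map_comp, assoc, assoc]
  erw [stalkChart_spec]

omit hf in
lemma stalkPoint_injective {V : Type u} [CommRing V] {ψ ψ' : X.presheaf.stalk Q →+* V}
    (h : stalkPoint ψ = stalkPoint ψ') : ψ = ψ' := by
  rw [cancel_mono] at h
  exact congrArg CommRingCat.Hom.hom (Spec.map_injective h)

omit hf in
lemma stalkPoint_closedPoint {V : Type u} [CommRing V] [IsLocalRing V]
    (ψ : X.presheaf.stalk Q →+* V) [hψ : IsLocalHom ψ] :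
    stalkPoint ψ (closedPtSpec V) = Q := by
  have h : Spec.map (ofHom ψ) (closedPtSpec V) = closedPtStalk Q := IsLocalRing.comap_closedPoint ψ
  rw [Scheme.Hom.comp_apply]
  exact (congrArg (X.fromSpecStalk Q) h).trans (fromSpecStalk_closedPtStalk Q)

variable {π} {l : List (HeightOneSpectrum (𝓞 K))}
  (hπ : IsBlowupSequence (naiveModelToSpec f) π l)
include hπ

section Points

variable {V : Type u} [CommRing V] [IsDomain V] [IsLocalRing V] [IsPrincipalIdealRing V]
  [CharZero V]

/-- A germ on the model need not be a fraction of chart functions with an invertible denominator,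
but its value at a `V`-point is still determined by the chart functions: this is the uniqueness of
lifts. -/
lemma stalk_hom_ext {ψ ψ' : X.presheaf.stalk Q →+* V}
    (h : ψ.comp (stalkChart hf π c Q hQ) = ψ'.comp (stalkChart hf π c Q hQ)) : ψ = ψ' := by
  apply stalkPoint_injective
  refine (hπ.existsUnique_lift (stalkPoint ψ ≫ π)).unique rfl ?_
  rw [stalkPoint_comp hf π hQ, stalkPoint_comp hf π hQ, h]

omit hπ in
lemma exists_stalkPoint {W : Type u} [CommRing W] (Φ : Spec (.of W) ⟶ X) {x : X}
    (hx : ∀ y, Φ y ⤳ x) [IsLocalRing W] :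
    ∃ ψ : X.presheaf.stalk x →+* W, stalkPoint ψ = Φ := by
  let y := closedPtSpec W
  let ψ := X.presheaf.stalkSpecializes (hx y) ≫ Scheme.stalkClosedPointTo Φ
  refine ⟨ψ.hom, ?_⟩
  rw [stalkPoint, ofHom_hom, Spec.map_comp, assoc,
    Scheme.SpecMap_stalkSpecializes_fromSpecStalk, Scheme.Spec_stalkClosedPointTo_fromSpecStalk]

/-- Existence of the centre of a valuation: `Q` is the image of the closed point under the lift. -/
lemma exists_stalk_hom (c : Bool) (e : ChartRing f c →+* V) :
    ∃ (Q : X) (hQ : π Q ∈ (chartι hf c).opensRange) (ψ : X.presheaf.stalk Q →+* V),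
      IsLocalHom ψ ∧ ψ.comp (stalkChart hf π c Q hQ) = e := by
  obtain ⟨Ψ, hΨ, -⟩ := hπ.existsUnique_lift (Spec.map (ofHom e) ≫ chartι hf c)
  let y := closedPtSpec V
  have hQ : π (Ψ y) ∈ (chartι hf c).opensRange := by
    rw [← Scheme.Hom.comp_apply, hΨ, Scheme.Hom.comp_apply]
    exact ⟨_, rfl⟩
  have hl : IsLocalHom (Scheme.stalkClosedPointTo Ψ).hom := inferInstance
  refine ⟨Ψ y, hQ, (Scheme.stalkClosedPointTo Ψ).hom, hl, ?_⟩
  apply chart_lift_injective hf c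
  rw [← stalkPoint_comp hf π hQ, stalkPoint, ofHom_hom]
  erw [Scheme.Spec_stalkClosedPointTo_fromSpecStalk]
  exact hΨ

lemma stalk_point_unique {Q' : X} {c' : Bool} (hQ' : π Q' ∈ (chartι hf c').opensRange)
    (ψ : X.presheaf.stalk Q →+* V) (ψ' : X.presheaf.stalk Q' →+* V) [IsLocalHom ψ] [IsLocalHom ψ']
    (h : Spec.map (ofHom (ψ.comp (stalkChart hf π c Q hQ))) ≫ chartι hf c =
      Spec.map (ofHom (ψ'.comp (stalkChart hf π c' Q' hQ'))) ≫ chartι hf c') :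
    Q = Q' := by
  rw [← stalkPoint_comp, ← stalkPoint_comp] at h
  have := (hπ.existsUnique_lift (stalkPoint ψ ≫ π)).unique rfl h.symm
  rw [← stalkPoint_closedPoint ψ, ← stalkPoint_closedPoint ψ', this]

/-- Congruent local points of the naive model have lifts with the same centre. -/
lemma exists_congruent_hom {t : V} (ht : t ∈ maximalIdeal V)
    (θ : X.presheaf.stalk Q →+* V) (e' : ChartRing f c →+* V)
    (h : ∀ a, (normProd l : V) * t ∣ θ (stalkChart hf π c Q hQ a) - e' a) :
    ∃ θ' : X.presheaf.stalk Q →+* V, θ'.comp (stalkChart hf π c Q hQ) = e' ∧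
      ∀ r, θ' r ∈ maximalIdeal V ↔ θ r ∈ maximalIdeal V := by
  set κ := stalkChart hf π c Q hQ with hκ
  -- The given point and the point `e'` form one point with values in the ring of congruent pairs.
  let E : ChartRing f c →+* congruentPairs ((normProd l : V) * t) :=
    ((θ.comp κ).prod e').codRestrict _ h
  obtain ⟨Ψ, hΨ⟩ := hπ.exists_lift_congruentPairs ht dvd_rfl
    (Spec.map (ofHom E) ≫ chartι hf c)
  have hloc := isLocalRing_congruentPairs ht
  let p₁ : congruentPairs t →+* V := (RingHom.fst V V).comp (congruentPairs t).subtype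
  let p₂ : congruentPairs t →+* V := (RingHom.snd V V).comp (congruentPairs t).subtype
  have hp : ∀ z : congruentPairs t, p₁ z - p₂ z ∈ maximalIdeal V := by
    intro z
    obtain ⟨y, hy⟩ := z.2
    show z.1.1 - z.1.2 ∈ _
    rw [hy]
    exact mul_mem_right _ _ ht
  -- By uniqueness of lifts, the first component of the lifted pair is the point `θ` that was given.
  -- The second component will be `θ'`.
  have hp₁ : Spec.map (ofHom p₁) ≫ Ψ = stalkPoint θ := by
    refine (hπ.existsUnique_lift (stalkPoint θ ≫ π)).unique ?_ rfl
    rw [assoc, hΨ, stalkPoint_comp hf π hQ, ← assoc, ← assoc, ← Spec.map_comp, ← Spec.map_comp]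
    rfl
  have hp₁l : IsLocalHom p₁ := ⟨fun z hz => isUnit_congruentPairs ht z hz⟩
  have hclosed : Ψ (closedPtSpec (congruentPairs t)) = stalkPoint θ (closedPtSpec V) := by
    rw [← hp₁, Scheme.Hom.comp_apply]
    exact congrArg Ψ (IsLocalRing.comap_closedPoint p₁).symm
  -- The ring of pairs is local and its closed point has the image of the closed point of `θ`, which
  -- specialises to `Q`; so the lifted pair factors through the stalk at `Q`.
  have hs : ∀ y, Ψ y ⤳ Q := by
    intro y
    have h1 : Ψ y ⤳ Ψ (closedPtSpec (congruentPairs t)) :=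
      (IsLocalRing.specializes_closedPoint y).map Ψ.continuous
    rw [hclosed, Scheme.Hom.comp_apply] at h1
    refine h1.trans ?_
    have h2 : ∀ z, X.fromSpecStalk Q z ⤳ Q := fun z => by
      have : X.fromSpecStalk Q z ∈ Set.range (X.fromSpecStalk Q) := ⟨z, rfl⟩
      rwa [Scheme.range_fromSpecStalk] at this
    exact h2 _
  obtain ⟨Θ, hΘ⟩ := exists_stalkPoint Ψ hs
  have h1 : p₁.comp Θ = θ := by
    apply stalkPoint_injective
    rw [← hp₁, ← hΘ, stalkPoint, ofHom_comp, Spec.map_comp, assoc]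
  refine ⟨p₂.comp Θ, ?_, fun r => ?_⟩
  · apply chart_lift_injective hf c
    rw [hκ, ← stalkPoint_comp hf π hQ]
    have h2 : stalkPoint (p₂.comp Θ) = Spec.map (ofHom p₂) ≫ Ψ := by
      rw [← hΘ, stalkPoint, ofHom_comp, Spec.map_comp, assoc]
    rw [h2, assoc, hΨ, ← assoc, ← assoc, ← Spec.map_comp, ← Spec.map_comp]
    rfl
  · have h2 := hp (Θ r)
    rw [← h1, RingHom.comp_apply, RingHom.comp_apply]
    constructor
    · intro h3
      have := add_mem h2 h3
      change p₁ (Θ r) - p₂ (Θ r) + p₂ (Θ r) ∈ _ at this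
      rwa [sub_add_cancel] at this
    · intro h3
      have := sub_mem h3 h2
      change p₁ (Θ r) - (p₁ (Θ r) - p₂ (Θ r)) ∈ _ at this
      rwa [sub_sub_cancel] at this

end Points

/-- At points of the generic fibre, the local rings are the localisations of the coordinate ring of
a chart. -/
lemma exists_bijective_stalk [IsDomain (X.presheaf.stalk Q)] (q : Spec (X.presheaf.stalk Q))
    (hq : ∀ r : 𝓞 K, stalkChart hf π c Q hQ (chartC f c r) ∈ q.asIdeal → r = 0) :
    ∃ (hs : X.fromSpecStalk Q q ⤳ Q) (S : Type u) (_ : CommRing S) (τ : ChartRing f c →+* S)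
      (i : S →+* X.presheaf.stalk (X.fromSpecStalk Q q)), Injective τ ∧
      (∀ z, ∃ a s, IsUnit (τ s) ∧ τ s * z = τ a) ∧ Bijective i ∧
      ∀ a, (X.presheaf.stalkSpecializes hs).hom (stalkChart hf π c Q hQ a) = i (τ a) := by
  set ξ := X.fromSpecStalk Q q with hξ
  have hs : ξ ⤳ Q := by
    have : X.fromSpecStalk Q q ∈ Set.range (X.fromSpecStalk Q) := ⟨q, rfl⟩
    rwa [Scheme.range_fromSpecStalk] at this
  -- A prime without nonzero constants lies over the generic point of the base, so `ξ` is in no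
  -- fibre that contains a centre.
  have hiso : IsIso (π.stalkMap ξ) := by
    refine hπ.isIso_stalkMap ξ fun ν _ h => ?_
    rw [hξ, toSpec_fromSpecStalk hf π hQ] at h
    obtain ⟨x, hx, hx0⟩ := exists_mem_ne_zero_of_ne_bot ν.ne_bot
    refine hx0 (hq x ?_)
    have h2 : x ∈ (closedPt ν).asIdeal := hx
    rw [← h] at h2
    exact h2
  set κ := stalkChart hf π c Q hQ with hκ
  let 𝔞 : Spec (.of (ChartRing f c)) := Spec.map (ofHom κ) q
  have hy : chartι hf c 𝔞 = π ξ := stalkChart_apply hf π hQ q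
  let σ := X.presheaf.stalkSpecializes hs
  obtain ⟨j, hj⟩ : ∃ j : (naiveModel f).presheaf.stalk (π ξ) ⟶
      (Spec (.of (ChartRing f c))).presheaf.stalk 𝔞, IsIso j ∧
      Spec.map j ≫ (naiveModel f).fromSpecStalk (π ξ) =
        (Spec (.of (ChartRing f c))).fromSpecStalk 𝔞 ≫ chartι hf c := by
    rw [← hy]
    exact ⟨(chartι hf c).stalkMap 𝔞, inferInstance,
      Scheme.SpecMap_stalkMap_fromSpecStalk (chartι hf c)⟩
  obtain ⟨hj, hj'⟩ := hj
  let τ : CommRingCat.of (ChartRing f c) ⟶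
      (Spec (.of (ChartRing f c))).presheaf.stalk 𝔞 :=
    StructureSheaf.toStalk (ChartRing f c) 𝔞
  have hτ : (Spec (.of (ChartRing f c))).fromSpecStalk 𝔞 = Spec.map τ := Spec.fromSpecStalk_eq' _ _
  let i := inv j ≫ π.stalkMap ξ
  have hi : ofHom κ ≫ σ = τ ≫ i := by
    apply Spec.map_injective
    rw [← cancel_mono (chartι hf c), Spec.map_comp, assoc, hκ,
      stalkChart_spec, ← assoc, Scheme.SpecMap_stalkSpecializes_fromSpecStalk,
      Spec.map_comp, Spec.map_comp, assoc, assoc, ← hτ, ← hj',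
      ← Scheme.SpecMap_stalkMap_fromSpecStalk π, ← assoc (Spec.map (inv j)),
      ← Spec.map_comp, IsIso.hom_inv_id, Spec.map_id, id_comp]
  have hi' : ∀ a, σ.hom (κ a) = i.hom (τ.hom a) := fun a => congrArg (fun φ => φ.hom a) hi
  have := ChartRing.isDomain hf c
  exact ⟨hs, _, inferInstance, τ.hom, i.hom, toStalk_injective (𝔞 : PrimeSpectrum (ChartRing f c)),
    exists_mul_toStalk_eq (𝔞 : PrimeSpectrum (ChartRing f c)),
    ConcreteCategory.bijective_of_isIso i, hi'⟩

/-- At points of the generic fibre, germs are fractions of functions on a chart. -/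
lemma exists_stalkChart_mul_eq [IsDomain (X.presheaf.stalk Q)] (q : Spec (X.presheaf.stalk Q))
    (hq : ∀ r : 𝓞 K, stalkChart hf π c Q hQ (chartC f c r) ∈ q.asIdeal → r = 0)
    (r : X.presheaf.stalk Q) : ∃ a s : ChartRing f c, stalkChart hf π c Q hQ s ∉ q.asIdeal ∧
      stalkChart hf π c Q hQ s * r = stalkChart hf π c Q hQ a := by
  obtain ⟨hs, S, _, τ, i, -, hsurj, hib, hi'⟩ := exists_bijective_stalk hf hQ hπ q hq
  set κ := stalkChart hf π c Q hQ with hκ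
  let σ := X.presheaf.stalkSpecializes hs
  obtain ⟨z, hz⟩ := hib.2 (σ.hom r)
  obtain ⟨a, s, hsu', has'⟩ := hsurj z
  have hsu : IsUnit (σ.hom (κ s)) := by
    rw [hi']
    exact hsu'.map i
  have has : σ.hom (κ s) * σ.hom r = σ.hom (κ a) := by rw [hi', hi', ← hz, ← map_mul, has']
  refine ⟨a, s, ?_, stalkSpecializes_injective hs (by rw [map_mul]; exact has)⟩
  rw [comap_stalkSpecializes q rfl hs]
  exact fun h => (mem_maximalIdeal _).mp h hsu

lemma stalkChart_injective [IsDomain (X.presheaf.stalk Q)] (q : Spec (X.presheaf.stalk Q))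
    (hq : ∀ r : 𝓞 K, stalkChart hf π c Q hQ (chartC f c r) ∈ q.asIdeal → r = 0) :
    Injective (stalkChart hf π c Q hQ) := by
  obtain ⟨hs, S, _, τ, i, hτ, -, hib, hi'⟩ := exists_bijective_stalk hf hQ hπ q hq
  intro a b hab
  have h1 := hi' a
  rw [hab, hi' b] at h1
  exact (hτ (hib.1 h1)).symm

end Resolution

/-! ### Regular local rings -/

section Regular

open IsLocalRing

variable {R : Type u} [CommRing R]

/-- The class of `a` in the cotangent space is nonzero. Extend it to a basis and lift; by Nakayama's
lemma the lifts generate. -/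
lemma exists_span_insert_eq_maximalIdeal [IsLocalRing R] [IsNoetherianRing R] {a : R}
    (ha : a ∈ maximalIdeal R) (ha2 : a ∉ maximalIdeal R ^ 2) :
    ∃ s : Finset R, s.card + 1 = (maximalIdeal R).spanFinrank ∧
      span (insert a (s : Set R)) = maximalIdeal R := by
  classical
  let k := ResidueField R
  let a' : maximalIdeal R := ⟨a, ha⟩
  have h0 : (maximalIdeal R).toCotangent a' ≠ 0 := by rwa [Ne, Ideal.toCotangent_eq_zero]
  have hli : LinearIndepOn k id {(maximalIdeal R).toCotangent a'} :=
    LinearIndepOn.singleton (v := id) h0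
  let b := hli.extend (Set.subset_univ _)
  have hb : LinearIndepOn k id b := hli.linearIndepOn_extend _
  have hspan : Submodule.span k b = ⊤ := by
    have := hli.span_extend_eq_span (Set.subset_univ _)
    simpa [b] using this
  have hab : (maximalIdeal R).toCotangent a' ∈ b := hli.subset_extend _ rfl
  let B : Module.Basis b k (CotangentSpace R) := .mk hb (by simp [hspan])
  have : Fintype b := FiniteDimensional.fintypeBasisIndex B
  have hcard : card b = (maximalIdeal R).spanFinrank := by
    rw [spanFinrank_maximalIdeal_eq_finrank_cotangentSpace, Module.finrank_eq_card_basis B]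
  let l : CotangentSpace R → maximalIdeal R :=
    fun x => (Ideal.toCotangent_surjective (maximalIdeal R) x).choose
  have hl : ∀ x, (maximalIdeal R).toCotangent (l x) = x :=
    fun x => (Ideal.toCotangent_surjective (maximalIdeal R) x).choose_spec
  have hlinj : Injective (fun x => (l x : R)) := fun x y h => by
    rw [← hl x, ← hl y, Subtype.ext h]
  let t : Finset (CotangentSpace R) := b.toFinset.erase ((maximalIdeal R).toCotangent a')
  refine ⟨t.image fun x => (l x : R), ?_, ?_⟩
  · rw [Finset.card_image_of_injective _ hlinj, Finset.card_erase_add_one (by simpa using hab),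
      Set.toFinset_card, hcard]
  · let S : Set (maximalIdeal R) := insert a' (l '' t)
    have hS : Submodule.span R S = ⊤ := by
      rw [← CotangentSpace.span_image_eq_top_iff, ← hspan]
      congr 1
      ext x
      simp only [S, Set.image_insert_eq, Set.mem_insert_iff, Set.image_image, hl, Set.image_id',
        Finset.mem_coe, t, Finset.mem_erase, Set.mem_toFinset]
      constructor
      · rintro (rfl | h)
        exacts [hab, h.2]
      · intro h
        by_cases hx : x = (maximalIdeal R).toCotangent a'
        exacts [.inl hx, .inr ⟨hx, h⟩]
    have := congrArg (Submodule.map (maximalIdeal R).subtype) hS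
    rw [Submodule.map_span, Submodule.map_top, Submodule.range_subtype] at this
    refine Eq.trans ?_ this
    rw [span]
    congr 1
    ext x
    simp [S, a', eq_comm]

lemma spanFinrank_maximalIdeal_quotient_lt [IsLocalRing R] [IsNoetherianRing R] {a : R}
    (ha : a ∈ maximalIdeal R) (ha2 : a ∉ maximalIdeal R ^ 2)
    [IsLocalRing (R ⧸ span {a})] :
    (maximalIdeal (R ⧸ span {a})).spanFinrank < (maximalIdeal R).spanFinrank := by
  classical
  obtain ⟨s, hs, hspan⟩ := exists_span_insert_eq_maximalIdeal ha ha2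
  have h1 : maximalIdeal (R ⧸ span {a}) =
      span (s.image (Ideal.Quotient.mk (span {a})) : Set (R ⧸ span {a})) := by
    rw [← IsLocalRing.map_maximalIdeal_of_surjective (Ideal.Quotient.mk (span {a}))
      mk_surjective, ← hspan, map_span, Set.image_insert_eq,
      eq_zero_iff_mem.2 (mem_span_singleton_self a), Ideal.span_insert_zero,
      Finset.coe_image]
  rw [h1, ← hs, Nat.lt_succ_iff]
  refine (Submodule.spanFinrank_span_le_ncard_of_finite (Finset.finite_toSet _)).trans ?_
  rw [Set.ncard_coe_finset]
  exact Finset.card_image_le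

lemma isLocalRing_quotient_span [IsLocalRing R] {a : R} (ha : a ∈ maximalIdeal R) :
    IsLocalRing (R ⧸ span {a}) := by
  have : Nontrivial (R ⧸ span {a}) := by
    rw [Ideal.Quotient.nontrivial_iff, Ne, Ideal.span_singleton_eq_top]
    exact ha
  exact of_surjective' (Ideal.Quotient.mk _) mk_surjective

/-- The embedding dimension drops by at least one and the Krull dimension by at most one. -/
lemma isRegularLocalRing_quotient [IsRegularLocalRing R] {a : R}
    (ha : a ∈ maximalIdeal R) (ha2 : a ∉ maximalIdeal R ^ 2) :
    IsRegularLocalRing (R ⧸ span {a}) := by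
  have := isLocalRing_quotient_span ha
  refine IsRegularLocalRing.of_spanFinrank_maximalIdeal_le _ ?_
  have h1 := spanFinrank_maximalIdeal_quotient_lt ha ha2
  have h2 : ringKrullDim R ≤ ringKrullDim (R ⧸ span {a}) + 1 := by
    have := ringKrullDim_le_ringKrullDim_quotient_add_card (R := R) {a} (by
      simpa [IsLocalRing.ringJacobson_eq_maximalIdeal] using ha)
    rwa [Finset.coe_singleton, Finset.card_singleton, Nat.cast_one] at this
  rw [← spanFinrank_maximalIdeal] at h2
  have h3 : ((maximalIdeal (R ⧸ span {a})).spanFinrank : WithBot ℕ∞) + 1 ≤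
      (maximalIdeal R).spanFinrank := by exact_mod_cast h1
  have h4 := h3.trans h2
  generalize ringKrullDim (R ⧸ span {a}) = d at h4
  induction d with
  | bot => exact absurd h4 (by rw [WithBot.bot_add, not_le]; exact WithBot.bot_lt_coe _)
  | coe d =>
    induction d with
    | top => exact WithBot.coe_le_coe.2 le_top
    | coe d =>
      have h5 : (maximalIdeal (R ⧸ span {a})).spanFinrank + 1 ≤ d + 1 := by exact_mod_cast h4
      exact_mod_cast Nat.le_of_succ_le_succ h5

lemma eq_bot_of_eq_span_mul [IsLocalRing R] {I : Ideal R} (hI : I.FG) {a : R}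
    (ha : a ∈ maximalIdeal R) (h : ∀ x ∈ I, ∃ y ∈ I, x = a * y) : I = ⊥ := by
  refine Submodule.eq_bot_of_le_smul_of_le_jacobson_bot (span {a}) I hI (fun x hx => ?_) ?_
  · obtain ⟨y, hy, rfl⟩ := h x hx
    exact Submodule.smul_mem_smul (mem_span_singleton_self a) hy
  · rw [span_singleton_le_iff_mem]
    exact maximalIdeal_le_jacobson _ ha

/-- Induction on the embedding dimension. Prime avoidance gives `a ∈ 𝔪` outside `𝔪 ^ 2` and outside
all minimal primes. The quotient by `a` is regular, so `(a)` is prime; a minimal prime `𝔭 ⊆ (a)`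
satisfies `𝔭 = a 𝔭` and is zero by Nakayama's lemma. -/
lemma IsRegularLocalRing.isDomain [h : IsRegularLocalRing R] : IsDomain R := by
  obtain ⟨n, hn⟩ : ∃ n, (maximalIdeal R).spanFinrank = n := ⟨_, rfl⟩
  induction n using Nat.strong_induction_on generalizing R with
  | _ n ih =>
  by_cases hm : maximalIdeal R ≤ maximalIdeal R ^ 2
  · have : maximalIdeal R = ⊥ := by
      refine Submodule.eq_bot_of_le_smul_of_le_jacobson_bot (maximalIdeal R) _
        (IsNoetherian.noetherian _) (by rwa [smul_eq_mul, ← sq])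
        (maximalIdeal_le_jacobson _)
    exact (IsLocalRing.isField_iff_maximalIdeal_eq.2 this).isDomain
  -- If the maximal ideal were a minimal prime, the dimension, and by regularity the number of
  -- generators, would be zero, contrary to `hm`.
  have hdim0 : ∀ 𝔭 ∈ minimalPrimes R, ¬ maximalIdeal R ≤ 𝔭 := by
    intro 𝔭 h𝔭 hle
    have h𝔭' : 𝔭 = maximalIdeal R := le_antisymm (le_maximalIdeal h𝔭.1.1.ne_top) hle
    have h0 : (maximalIdeal R).height = 0 := Ideal.height_eq_zero_iff.2 (h𝔭' ▸ h𝔭)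
    have h1 := spanFinrank_maximalIdeal (R := R)
    rw [← maximalIdeal_height_eq_ringKrullDim, h0] at h1
    have h2 : (maximalIdeal R).spanFinrank = 0 := by exact_mod_cast h1
    rw [Submodule.spanFinrank_eq_zero_iff_eq_bot (IsNoetherian.noetherian _)] at h2
    exact hm (h2.le.trans bot_le)
  obtain ⟨a, ha, hna⟩ : ∃ a ∈ maximalIdeal R, a ∉ maximalIdeal R ^ 2 ∧
      ∀ 𝔭 ∈ minimalPrimes R, a ∉ 𝔭 := by
    by_contra! hcon
    classical
    let s : Finset (Ideal R) := insert (maximalIdeal R ^ 2) (minimalPrimes.finite_of_isNoetherianRing R).toFinset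
    have := (Ideal.subset_union_prime (s := s) (f := id) (I := maximalIdeal R)
      (maximalIdeal R ^ 2) (maximalIdeal R ^ 2) ?_).1 ?_
    · obtain ⟨i, hi, hle⟩ := this
      rcases Finset.mem_insert.1 hi with rfl | hi
      · exact hm hle
      · exact hdim0 i (by simpa using hi) hle
    · intro i hi hne _
      rcases Finset.mem_insert.1 hi with rfl | hi
      · exact absurd rfl hne
      · have : i ∈ minimalPrimes R := by simpa using hi
        exact this.1.1
    · intro x hx
      by_cases hx2 : x ∈ maximalIdeal R ^ 2
      · exact Set.mem_biUnion (x := maximalIdeal R ^ 2) (by simp [s]) hx2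
      · obtain ⟨𝔭, h𝔭, hx𝔭⟩ := hcon x hx hx2
        exact Set.mem_biUnion (x := 𝔭) (by simp [s, h𝔭]) hx𝔭
  have hreg := isRegularLocalRing_quotient ha hna.1
  have hdom : IsDomain (R ⧸ span {a}) :=
    ih _ (hn ▸ spanFinrank_maximalIdeal_quotient_lt ha hna.1) rfl
  have hpr : (span {a}).IsPrime := (isDomain_iff_prime _).1 hdom
  obtain ⟨𝔭, h𝔭, hle⟩ := Ideal.exists_minimalPrimes_le (I := ⊥) (J := span {a}) bot_le
  have hpp : 𝔭.IsPrime := h𝔭.1.1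
  have : 𝔭 = ⊥ := by
    refine eq_bot_of_eq_span_mul (IsNoetherian.noetherian _) ha fun x hx => ?_
    obtain ⟨y, rfl⟩ := mem_span_singleton.1 (hle hx)
    exact ⟨y, (hpp.mem_or_mem hx).resolve_left (hna.2 _ h𝔭), rfl⟩
  have : (⊥ : Ideal R).IsPrime := this ▸ hpp
  exact IsDomain.of_bot_isPrime R

lemma prime_of_notMem_sq [IsRegularLocalRing R] {a : R}
    (ha : a ∈ maximalIdeal R) (ha2 : a ∉ maximalIdeal R ^ 2) : Prime a := by
  have := isRegularLocalRing_quotient ha ha2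
  have hdom : IsDomain (R ⧸ span {a}) := IsRegularLocalRing.isDomain
  refine (span_singleton_prime ?_).1 ((isDomain_iff_prime _).1 hdom)
  rintro rfl
  exact ha2 (Ideal.zero_mem _)

/-- Choose `a ∈ 𝔪` outside `𝔪 ^ 2` and outside `𝔭`. Modulo `a` the ring is a domain of embedding
dimension at most one, hence principal. Lift a generator of the image of `𝔭` to `r ∈ 𝔭`; as `a ∉ 𝔭`,
one has `𝔭 = (r) + a 𝔭`, and Nakayama's lemma concludes. -/
lemma exists_eq_span_singleton_of_isPrime [IsRegularLocalRing R]
    (hdim : (maximalIdeal R).spanFinrank ≤ 2) {𝔭 : Ideal R} (h𝔭 : 𝔭.IsPrime)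
    (hne : 𝔭 ≠ maximalIdeal R) : ∃ r, 𝔭 = span {r} := by
  have := IsRegularLocalRing.isDomain (R := R)
  have hle : 𝔭 ≤ maximalIdeal R := le_maximalIdeal h𝔭.ne_top
  obtain ⟨a, ha, ha2, ha𝔭⟩ : ∃ a ∈ maximalIdeal R, a ∉ maximalIdeal R ^ 2 ∧ a ∉ 𝔭 := by
    by_contra! hcon
    have h1 : (maximalIdeal R : Set R) ⊆ (maximalIdeal R ^ 2 : Ideal R) ∪ 𝔭 := fun x hx => by
      by_cases hx2 : x ∈ maximalIdeal R ^ 2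
      exacts [.inl hx2, .inr (hcon x hx hx2)]
    rcases Ideal.subset_union.1 h1 with h | h
    · have : maximalIdeal R = ⊥ := by
        refine Submodule.eq_bot_of_le_smul_of_le_jacobson_bot (maximalIdeal R) _
          (IsNoetherian.noetherian _) (by rwa [smul_eq_mul, ← sq])
          (maximalIdeal_le_jacobson _)
      exact hne (le_antisymm hle (this.le.trans bot_le))
    · exact hne (le_antisymm hle h)
  have hreg := isRegularLocalRing_quotient ha ha2
  have hdom : IsDomain (R ⧸ span {a}) := IsRegularLocalRing.isDomain
  have h1 := spanFinrank_maximalIdeal_quotient_lt ha ha2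
  have hpid : IsPrincipalIdealRing (R ⧸ span {a}) := by
    refine ((tfae_of_isNoetherianRing_of_isLocalRing_of_isDomain (R ⧸ span {a})).out 5 0).1 ?_
    rw [← spanFinrank_maximalIdeal_eq_finrank_cotangentSpace]
    omega
  obtain ⟨r', hr'⟩ := hpid.principal (𝔭.map (Ideal.Quotient.mk (span {a})))
  have hr'' : r' ∈ 𝔭.map (Ideal.Quotient.mk (span {a})) :=
    hr' ▸ Submodule.mem_span_singleton_self r'
  obtain ⟨r, hr𝔭, rfl⟩ := (Ideal.mem_map_iff_of_surjective _ mk_surjective).1 hr''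
  refine ⟨r, le_antisymm ?_ ((span_singleton_le_iff_mem _).2 hr𝔭)⟩
  refine Submodule.le_of_le_smul_of_le_jacobson_bot (I := span {a})
    (IsNoetherian.noetherian _) ?_ fun x hx => ?_
  · rw [span_singleton_le_iff_mem]
    exact maximalIdeal_le_jacobson _ ha
  · have h2 := Ideal.mem_map_of_mem (Ideal.Quotient.mk (span {a})) hx
    rw [hr'] at h2
    obtain ⟨c', hc'⟩ := Submodule.mem_span_singleton.1 h2
    obtain ⟨c, rfl⟩ := mk_surjective c'
    rw [smul_eq_mul, ← map_mul, Ideal.Quotient.eq, mem_span_singleton] at hc'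
    obtain ⟨d, hd⟩ := hc'
    have hd𝔭 : d ∈ 𝔭 := by
      refine (h𝔭.mem_or_mem ?_).resolve_left ha𝔭
      rw [← hd]
      exact 𝔭.sub_mem (𝔭.mul_mem_left _ hr𝔭) hx
    have hx' : x = c * r + a * (-d) := by linear_combination -hd
    rw [hx']
    exact Submodule.add_mem_sup (mul_mem_left _ _ (mem_span_singleton_self r))
      (Submodule.smul_mem_smul (mem_span_singleton_self a) (𝔭.neg_mem hd𝔭))

/-- Kaplansky's criterion: every nonzero prime ideal contains a prime element. The maximal ideal
contains a regular parameter, and the other primes are principal. -/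
lemma uniqueFactorizationMonoid_of_spanFinrank_le_two [IsRegularLocalRing R] [IsDomain R]
    (hdim : (maximalIdeal R).spanFinrank ≤ 2) : UniqueFactorizationMonoid R := by
  rw [UniqueFactorizationMonoid.iff_exists_prime_mem_of_isPrime]
  intro I hI hIp
  by_cases hm : I = maximalIdeal R
  · subst hm
    obtain ⟨a, ha, ha2⟩ : ∃ a ∈ maximalIdeal R, a ∉ maximalIdeal R ^ 2 := by
      by_contra! hcon
      refine hI (Submodule.eq_bot_of_le_smul_of_le_jacobson_bot (maximalIdeal R) _
        (IsNoetherian.noetherian _) (fun x hx => ?_) (maximalIdeal_le_jacobson _))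
      rw [smul_eq_mul, ← sq]
      exact hcon x hx
    exact ⟨a, ha, prime_of_notMem_sq ha ha2⟩
  · obtain ⟨r, rfl⟩ := exists_eq_span_singleton_of_isPrime hdim hIp hm
    refine ⟨r, mem_span_singleton_self r, (span_singleton_prime ?_).1 hIp⟩
    rintro rfl
    exact hI (by simp)

end Regular

/-! ### The dimension of the local rings of a model -/

section Chains

variable {R : Type u} [CommRing R] [IsNoetherianRing R]

/-- Choose `y ∈ 𝔭₂` outside the finitely many minimal primes of `(x)`, and a minimal prime `𝔭 ⊆ 𝔭₂`
of `(y)`. By Krull's principal ideal theorem `𝔭` has height at most one, so it is not `𝔭₂`. If it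
contained `x`, it would properly contain a nonzero minimal prime of `(x)`. -/
lemma exists_isPrime_lt_notMem [IsDomain R] {𝔭₁ 𝔭₂ : Ideal R} [h₁ : 𝔭₁.IsPrime] [h₂ : 𝔭₂.IsPrime]
    (h01 : 𝔭₁ ≠ ⊥) (h12 : 𝔭₁ < 𝔭₂) {x : R} (hx : x ≠ 0) :
    ∃ 𝔭 : Ideal R, 𝔭.IsPrime ∧ 𝔭 ≠ ⊥ ∧ 𝔭 < 𝔭₂ ∧ x ∉ 𝔭 := by
  by_cases hx2 : x ∈ 𝔭₂
  swap
  · exact ⟨𝔭₁, h₁, h01, h12, fun h => hx2 (h12.le h)⟩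
  have key : ∀ (𝔮 : Ideal R) [𝔮.IsPrime], 𝔮 ≠ ⊥ → ∀ z, ∀ 𝔯 ∈ (span {z}).minimalPrimes, ¬ 𝔮 < 𝔯 := by
    intro 𝔮 _ hne z 𝔯 h𝔯 hlt
    have h𝔯p : 𝔯.IsPrime := h𝔯.1.1
    have ha := Ideal.height_le_one_of_isPrincipal_of_mem_minimalPrimes (span {z}) 𝔯 h𝔯
    have hb : (⊥ : Ideal R).height < 𝔮.height :=
      Ideal.height_strict_mono_of_isPrime_of_isPrime (bot_lt_iff_ne_bot.2 hne)
    have hc : 𝔮.height < 𝔯.height := Ideal.height_strict_mono_of_isPrime_of_isPrime hlt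
    have := hc.trans_le ha
    rw [Order.lt_one_iff] at this
    simp [this] at hb
  obtain ⟨y, hy, hy'⟩ : ∃ y ∈ 𝔭₂, ∀ 𝔯 ∈ (span {x}).minimalPrimes, y ∉ 𝔯 := by
    by_contra! hcon
    have := (Ideal.subset_union_prime (s := ((span {x}).finite_minimalPrimes_of_isNoetherianRing).toFinset)
      (f := id) (I := 𝔭₂) ⊥ ⊥ ?_).1 ?_
    · obtain ⟨𝔯, h𝔯, hle⟩ := this
      exact key 𝔭₁ h01 x 𝔯 (by simpa using h𝔯) (h12.trans_le hle)
    · intro i hi _ _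
      have : i ∈ (span {x}).minimalPrimes := by simpa using hi
      exact this.1.1
    · intro z hz
      obtain ⟨𝔯, h𝔯, hz𝔯⟩ := hcon z hz
      exact Set.mem_biUnion (x := 𝔯) (by simpa using h𝔯) hz𝔯
  obtain ⟨𝔭, h𝔭, hle⟩ := Ideal.exists_minimalPrimes_le (I := span {y}) (J := 𝔭₂)
    ((span_singleton_le_iff_mem _).2 hy)
  have h𝔭p : 𝔭.IsPrime := h𝔭.1.1
  have hy𝔭 : y ∈ 𝔭 := (span_singleton_le_iff_mem _).1 h𝔭.1.2
  have hy0 : y ≠ 0 := by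
    rintro rfl
    obtain ⟨𝔯, h𝔯, -⟩ := Ideal.exists_minimalPrimes_le (I := span {x}) (J := 𝔭₂)
      ((span_singleton_le_iff_mem _).2 hx2)
    exact hy' 𝔯 h𝔯 (zero_mem _)
  refine ⟨𝔭, h𝔭p, ?_, lt_of_le_of_ne hle ?_, fun hx𝔭 => ?_⟩
  · rintro rfl
    exact hy0 (by simpa using hy𝔭)
  · rintro rfl
    exact key 𝔭₁ h01 y 𝔭 h𝔭 h12
  · obtain ⟨𝔯, h𝔯, hle'⟩ := Ideal.exists_minimalPrimes_le (I := span {x}) (J := 𝔭)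
      ((span_singleton_le_iff_mem _).2 hx𝔭)
    have h𝔯p : 𝔯.IsPrime := h𝔯.1.1
    have hne : 𝔯 ≠ ⊥ := by
      rintro rfl
      exact hx (by simpa using (span_singleton_le_iff_mem _).1 h𝔯.1.2)
    have : 𝔯 < 𝔭 := lt_of_le_of_ne hle' (by rintro rfl; exact hy' _ h𝔯 hy𝔭)
    exact key 𝔯 hne y 𝔭 h𝔭 this

lemma exists_isPrime_between_notMem {𝔭₀ 𝔭₁ 𝔭₂ : Ideal R} [𝔭₀.IsPrime] [h₁ : 𝔭₁.IsPrime]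
    [h₂ : 𝔭₂.IsPrime] (h01 : 𝔭₀ < 𝔭₁) (h12 : 𝔭₁ < 𝔭₂) {x : R} (hx : x ∉ 𝔭₀) :
    ∃ 𝔭 : Ideal R, 𝔭.IsPrime ∧ 𝔭₀ < 𝔭 ∧ 𝔭 < 𝔭₂ ∧ x ∉ 𝔭 := by
  let m := Ideal.Quotient.mk 𝔭₀
  have hcomap : ∀ I : Ideal R, 𝔭₀ ≤ I → (I.map m).comap m = I := fun I hI => by
    rw [Ideal.comap_map_of_surjective _ mk_surjective, ← ker_eq_comap_bot, mk_ker, sup_eq_left.2 hI]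
  have h₁' : (𝔭₁.map m).IsPrime := Ideal.isPrime_map_quotientMk_of_isPrime h01.le
  have h₂' : (𝔭₂.map m).IsPrime := Ideal.isPrime_map_quotientMk_of_isPrime (h01.trans h12).le
  have hlt : 𝔭₁.map m < 𝔭₂.map m := by
    refine lt_of_le_of_ne (Ideal.map_mono h12.le) fun h => h12.ne ?_
    rw [← hcomap _ h01.le, h, hcomap _ (h01.trans h12).le]
  obtain ⟨𝔭, h𝔭, hne, hlt', hx𝔭⟩ := exists_isPrime_lt_notMem (𝔭₁ := 𝔭₁.map m) (𝔭₂ := 𝔭₂.map m)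
    (x := m x) (fun h => h01.ne (by rw [← hcomap _ h01.le, h, ← ker_eq_comap_bot, mk_ker]))
    hlt (by rwa [Ne, eq_zero_iff_mem])
  have hm : ∀ I J : Ideal (R ⧸ 𝔭₀), I < J → I.comap m < J.comap m := fun I J h =>
    lt_of_le_of_ne (Ideal.comap_mono h.le) fun h' =>
      h.ne (Ideal.comap_injective_of_surjective _ mk_surjective h')
  refine ⟨𝔭.comap m, comap_isPrime _ _, ?_, ?_, hx𝔭⟩
  · have := hm ⊥ 𝔭 (bot_lt_iff_ne_bot.2 hne)
    rwa [← ker_eq_comap_bot, mk_ker] at this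
  · rw [← hcomap _ (h01.trans h12).le]
    exact hm _ _ hlt'

/-- If the primes without `x` have height at most one, the dimension is at most two. -/
lemma ringKrullDim_le_two [IsLocalRing R] [IsDomain R] {x : R} (hx : x ≠ 0)
    (h : ∀ 𝔭 𝔮 : Ideal R, 𝔭.IsPrime → 𝔮.IsPrime → 𝔭 < 𝔮 → x ∉ 𝔮 → 𝔭 = ⊥) :
    ringKrullDim R ≤ 2 := by
  by_contra hcon
  have h3 : ((3 : ℕ) : WithBot ℕ∞) ≤ ringKrullDim R := by
    have h2 : ((2 : ℕ) : WithBot ℕ∞) < ringKrullDim R := not_le.1 hcon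
    have h2' : ¬ ringKrullDim R < ((3 : ℕ) : WithBot ℕ∞) := fun h3 => by
      revert h2 h3
      generalize ringKrullDim R = d
      induction d with
      | bot => intro h; exact absurd h not_lt_bot
      | coe d =>
        induction d with
        | top => intro _ h; exact absurd (WithBot.coe_lt_coe.1 h) not_top_lt
        | coe d =>
          intro h h'
          have h : 2 < d := by
            have := WithBot.coe_lt_coe.1 h
            exact_mod_cast this
          have h' : d < 3 := by
            have := WithBot.coe_lt_coe.1 h'
            exact_mod_cast this
          omega
    exact not_lt.1 h2'
  obtain ⟨s, hs⟩ := Order.le_krullDim_iff.1 h3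
  have hlt : ∀ i j : Fin (s.length + 1), i < j → (s i).asIdeal < (s j).asIdeal :=
    fun i j hij => s.strictMono hij
  let i0 : Fin (s.length + 1) := ⟨0, by omega⟩
  let i1 : Fin (s.length + 1) := ⟨1, by omega⟩
  let i2 : Fin (s.length + 1) := ⟨2, by omega⟩
  let i3 : Fin (s.length + 1) := ⟨3, by omega⟩
  have h01 : (s i0).asIdeal < (s i1).asIdeal := hlt _ _ (Fin.mk_lt_mk.2 (by omega))
  have h12 : (s i1).asIdeal < (s i2).asIdeal := hlt _ _ (Fin.mk_lt_mk.2 (by omega))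
  have h23 : (s i2).asIdeal < (s i3).asIdeal := hlt _ _ (Fin.mk_lt_mk.2 (by omega))
  -- In a chain of four primes, the second and then the third are replaced by primes without `x`;
  -- this yields `0 < 𝔭 < 𝔮` with `x ∉ 𝔮`, against the hypothesis.
  obtain ⟨𝔭, h𝔭, hne, h𝔭2, hx𝔭⟩ := exists_isPrime_lt_notMem (bot_le.trans_lt h01).ne' h12 hx
  obtain ⟨𝔮, h𝔮, h𝔭𝔮, -, hx𝔮⟩ := exists_isPrime_between_notMem h𝔭2 h23 hx𝔭
  exact hne (h 𝔭 𝔮 h𝔭 h𝔮 h𝔭𝔮 hx𝔮)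

end Chains

/-! ### Heights of horizontal primes of a chart -/

section ChartRing

/-- The primes of `𝓞 K[X]` over `(0)` have height at most one. -/
lemma eq_bot_of_lt_of_comap_C {𝔟₁ 𝔟₂ : Ideal (𝓞 K)[X]} (h₁ : 𝔟₁.IsPrime) (h₂ : 𝔟₂.IsPrime)
    (hlt : 𝔟₁ < 𝔟₂) (h0 : ∀ r : 𝓞 K, C r ∈ 𝔟₂ → r = 0) : 𝔟₁ = ⊥ := by
  let M : Submonoid (𝓞 K)[X] := (nonZeroDivisors (𝓞 K)).map C
  let _ : Algebra (𝓞 K)[X] K[X] := (Polynomial.mapRingHom (algebraMap (𝓞 K) K)).toAlgebra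
  have hloc : IsLocalization M K[X] := Polynomial.isLocalization _ _
  have hd2 : Disjoint (M : Set (𝓞 K)[X]) 𝔟₂ := by
    rw [Set.disjoint_left]
    rintro _ ⟨r, hr, rfl⟩ h
    exact nonZeroDivisors.ne_zero hr (h0 r h)
  have hd1 : Disjoint (M : Set (𝓞 K)[X]) 𝔟₁ := hd2.mono_right hlt.le
  by_contra hne
  have hp1 := IsLocalization.isPrime_of_isPrime_disjoint M K[X] 𝔟₁ h₁ hd1
  have hp2 := IsLocalization.isPrime_of_isPrime_disjoint M K[X] 𝔟₂ h₂ hd2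
  have e1 := IsLocalization.under_map_of_isPrime_disjoint M K[X] h₁ hd1
  have e2 := IsLocalization.under_map_of_isPrime_disjoint M K[X] h₂ hd2
  have hne1 : 𝔟₁.map (algebraMap (𝓞 K)[X] K[X]) ≠ ⊥ := by
    rw [Ne, Ideal.map_eq_bot_iff_of_injective]
    · exact hne
    · exact Polynomial.map_injective _ (algebraMap_injective (𝓞 K) K)
  have hmax : (𝔟₁.map (algebraMap (𝓞 K)[X] K[X])).IsMaximal := hp1.isMaximal hne1
  have := hmax.eq_of_le hp2.ne_top (Ideal.map_mono hlt.le)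
  rw [this, e2] at e1
  exact hlt.ne e1.symm

/-- The primes of the coordinate ring of a chart over `(0)` have height at most one. -/
lemma ChartRing.eq_bot_of_lt_of_comap (hf : IsSeparableForm f) {c : Bool}
    {𝔞₁ 𝔞₂ : Ideal (ChartRing f c)} (h₁ : 𝔞₁.IsPrime) (h₂ : 𝔞₂.IsPrime)
    (hlt : 𝔞₁ < 𝔞₂) (h0 : ∀ r : 𝓞 K, chartC f c r ∈ 𝔞₂ → r = 0) : 𝔞₁ = ⊥ := by
  by_contra hne
  have hfin := (chartPoly_monic f c).finite_adjoinRoot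
  obtain ⟨x, hx2, hx1⟩ := SetLike.exists_of_lt hlt
  -- The chart ring is finite over `𝓞 K[u]`, so a strict inclusion of primes stays strict after
  -- contraction.
  have hcl := Ideal.comap_lt_comap_of_integral_mem_sdiff (R := (𝓞 K)[X]) hlt.le ⟨hx2, hx1⟩
    (Algebra.IsIntegral.isIntegral x)
  have hb := eq_bot_of_lt_of_comap_C (𝔟₁ := 𝔞₁.comap (algebraMap (𝓞 K)[X] (ChartRing f c)))
    (𝔟₂ := 𝔞₂.comap (algebraMap (𝓞 K)[X] (ChartRing f c)))
    (comap_isPrime _ _) (comap_isPrime _ _) hcl h0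
  obtain ⟨z, hz, hz0⟩ := exists_mem_ne_zero_of_ne_bot hne
  obtain ⟨z', n, hn, hzn⟩ := ChartRing.exists_mul_eq_of hf c z hz0
  have : n ∈ 𝔞₁.comap (algebraMap (𝓞 K)[X] (ChartRing f c)) := by
    change of _ n ∈ 𝔞₁
    rw [← hzn]
    exact 𝔞₁.mul_mem_left _ hz
  rw [hb] at this
  exact hn this

end ChartRing

/-! ### The local rings of the model have dimension at most two -/

section Stalks

variable (hf : IsSeparableForm f) {X : Scheme.{u}} {π : X ⟶ naiveModel f} {c : Bool} {Q : X}
  (hQ : π Q ∈ (chartι hf c).opensRange) {l : List (HeightOneSpectrum (𝓞 K))}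
  (hπ : IsBlowupSequence (naiveModelToSpec f) π l)

include hπ in
/-- Primes of a stalk over `(0)` have height at most one. -/
lemma eq_bot_of_lt_of_comap_stalkChart [IsDomain (X.presheaf.stalk Q)]
    {𝔮₁ 𝔮₂ : Ideal (X.presheaf.stalk Q)} (h₁ : 𝔮₁.IsPrime) (h₂ : 𝔮₂.IsPrime) (hlt : 𝔮₁ < 𝔮₂)
    (h0 : ∀ r : 𝓞 K, stalkChart hf π c Q hQ (chartC f c r) ∈ 𝔮₂ → r = 0) : 𝔮₁ = ⊥ := by
  have key := exists_stalkChart_mul_eq hf hQ hπ (⟨𝔮₂, h₂⟩ : PrimeSpectrum _) h0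
  set κ := stalkChart hf π c Q hQ
  have hlt' : 𝔮₁.comap κ < 𝔮₂.comap κ := by
    refine lt_of_le_of_ne (Ideal.comap_mono hlt.le) fun h => ?_
    obtain ⟨r, hr2, hr1⟩ := SetLike.exists_of_lt hlt
    obtain ⟨a, s, hs, hsa⟩ := key r
    have : a ∈ 𝔮₂.comap κ := by rw [mem_comap, ← hsa]; exact 𝔮₂.mul_mem_left _ hr2
    rw [← h, mem_comap, ← hsa] at this
    rcases h₁.mem_or_mem this with h' | h'
    exacts [hs (hlt.le h'), hr1 h']
  have hb := ChartRing.eq_bot_of_lt_of_comap hf (comap_isPrime κ 𝔮₁)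
    (comap_isPrime κ 𝔮₂) hlt' h0
  by_contra hne
  obtain ⟨z, hz, hz0⟩ := exists_mem_ne_zero_of_ne_bot hne
  obtain ⟨a, s, hs, hsa⟩ := key z
  have : a ∈ 𝔮₁.comap κ := by rw [mem_comap, ← hsa]; exact 𝔮₁.mul_mem_left _ hz
  rw [hb, mem_bot] at this
  rw [this, map_zero, mul_eq_zero] at hsa
  rcases hsa with h | h
  · exact hs (by rw [h]; exact zero_mem _)
  · exact hz0 h

/-- The constants in the maximal ideal of the stalk at a point of the fibre over `ν`. -/
lemma mem_maximalIdeal_stalk_iff {ν : HeightOneSpectrum (𝓞 K)} (hν : Q ∈ specialFibre π ν)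
    (r : 𝓞 K) : stalkChart hf π c Q hQ (chartC f c r) ∈
      maximalIdeal (X.presheaf.stalk Q) ↔ r ∈ ν.asIdeal := by
  have h := toSpec_fromSpecStalk hf π hQ (closedPtStalk Q)
  rw [fromSpecStalk_closedPtStalk] at h
  have h2 : (π ≫ naiveModelToSpec f) Q = closedPt ν := hν
  rw [h2] at h
  have h3 : r ∈ (closedPt ν).asIdeal ↔ r ∈ ν.asIdeal := Iff.rfl
  rw [← h3, h]
  exact Iff.rfl

-- A nonzero constant `r ∈ ν` serves as the test element of `ringKrullDim_le_two`. A prime that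
-- contracts to a nonzero prime of `𝓞 K` contracts to `ν` and contains `r`; so a prime without `r`
-- lies over `(0)`, where heights are at most one.
include hπ in
lemma ringKrullDim_stalk_le_two [IsNoetherianRing (X.presheaf.stalk Q)]
    [IsDomain (X.presheaf.stalk Q)] (ν : HeightOneSpectrum (𝓞 K)) (hν : Q ∈ specialFibre π ν)
    (hinj : Injective ((stalkChart hf π c Q hQ).comp (chartC f c))) :
    ringKrullDim (X.presheaf.stalk Q) ≤ 2 := by
  obtain ⟨r, hr, hr0⟩ := exists_mem_ne_zero_of_ne_bot ν.ne_bot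
  set κ := stalkChart hf π c Q hQ with hκ
  refine ringKrullDim_le_two (x := κ (chartC f c r)) ?_ fun 𝔭 𝔮 h𝔭 h𝔮 hlt hx => ?_
  · intro h
    exact hr0 (hinj (by simpa using h))
  · refine eq_bot_of_lt_of_comap_stalkChart hf hQ hπ h𝔭 h𝔮 hlt fun t ht => ?_
    by_contra ht0
    have hp : (𝔮.comap (κ.comp (chartC f c))).IsPrime := comap_isPrime _ _
    have hne : 𝔮.comap (κ.comp (chartC f c)) ≠ ⊥ := fun h => by
      have : t ∈ 𝔮.comap (κ.comp (chartC f c)) := ht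
      rw [h] at this
      exact ht0 this
    have hle : 𝔮.comap (κ.comp (chartC f c)) ≤ ν.asIdeal := fun t ht =>
      (mem_maximalIdeal_stalk_iff hf hQ hν t).1 (le_maximalIdeal h𝔮.ne_top ht)
    have := (hp.isMaximal hne).eq_of_le ν.isPrime.ne_top hle
    rw [← this] at hr
    exact hx hr

end Stalks

/-! ### The affine curve over a field -/

section DoubleCover

lemma exists_eq_of_add_of_mul_root {R : Type v} [CommRing R] [Nontrivial R] (F : R)
    (z : AdjoinRoot (X ^ 2 - C F : R[X])) :
    ∃ p q : R, z = of _ p + of _ q * AdjoinRoot.root _ := by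
  have hm : (X ^ 2 - C F : R[X]).Monic := monic_X_pow_sub_C _ two_ne_zero
  obtain ⟨z, rfl⟩ := AdjoinRoot.mk_surjective z
  have hd : (z %ₘ (X ^ 2 - C F)).natDegree < 2 := by
    have hlt := natDegree_modByMonic_lt z hm (by
      intro h
      have := natDegree_X_pow_sub_C (n := 2) (r := F)
      rw [h] at this; simp at this)
    rwa [natDegree_X_pow_sub_C] at hlt
  have h1 : AdjoinRoot.mk (X ^ 2 - C F) z = AdjoinRoot.mk _ (z %ₘ (X ^ 2 - C F)) := by
    rw [mk_eq_mk]
    exact ⟨z /ₘ (X ^ 2 - C F), by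
      rw [sub_eq_iff_eq_add, add_comm]; exact (modByMonic_add_div z _).symm⟩
  refine ⟨(z %ₘ (X ^ 2 - C F)).coeff 0, (z %ₘ (X ^ 2 - C F)).coeff 1, ?_⟩
  rw [h1]
  generalize z %ₘ (X ^ 2 - C F) = y at hd
  conv_lhs => rw [eq_X_add_C_of_natDegree_le_one (Nat.lt_succ_iff.mp hd)]
  rw [map_add, map_mul, AdjoinRoot.mk_C, AdjoinRoot.mk_C, AdjoinRoot.mk_X, add_comm]

lemma eq_zero_of_of_add_of_mul_root {R : Type v} [CommRing R] [Nontrivial R] (F : R) {p q : R}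
    (h : of (X ^ 2 - C F : R[X]) p + of _ q * AdjoinRoot.root _ = 0) :
    p = 0 ∧ q = 0 := by
  have hm : (X ^ 2 - C F : R[X]).Monic := monic_X_pow_sub_C _ two_ne_zero
  have h1 : AdjoinRoot.mk (X ^ 2 - C F) (C q * X + C p) = 0 := by
    rw [map_add, map_mul, AdjoinRoot.mk_C, AdjoinRoot.mk_C, AdjoinRoot.mk_X, add_comm]; exact h
  rw [AdjoinRoot.mk_eq_zero] at h1
  have h2 : C q * X + C p = 0 := by
    by_contra h0
    refine hm.not_dvd_of_natDegree_lt h0 ?_ h1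
    rw [natDegree_X_pow_sub_C]
    exact natDegree_linear_le.trans_lt one_lt_two
  constructor
  · simpa using congrArg (fun P => P.coeff 0) h2
  · simpa using congrArg (fun P => P.coeff 1) h2

variable {L : Type v} [Field L] (F : L[X])

/-- The coordinate ring of the affine curve `y ^ 2 = F(x)`. -/
abbrev DoubleCover : Type v := AdjoinRoot (X ^ 2 - C F : L[X][X])

namespace DoubleCover

/-- The coordinate `x`. -/
def xc : DoubleCover F := of _ X

/-- The coordinate `y`. -/
def yc : DoubleCover F := AdjoinRoot.root _

/-- The inclusion of the constants. -/
def const : L →+* DoubleCover F := (of _).comp C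

lemma yc_sq : yc F ^ 2 = of _ F := by
  have h := eval₂_root (X ^ 2 - C F : L[X][X])
  rw [eval₂_sub, eval₂_X_pow, eval₂_C] at h
  exact sub_eq_zero.mp h

lemma of_eq_eval₂ (p : L[X]) : of (X ^ 2 - C F) p = p.eval₂ (const F) (xc F) := by
  rw [const, xc, ← hom_eval₂, eval₂_C_X]

lemma of_X_sub_C (a : L) : of (X ^ 2 - C F) (X - C a) = xc F - const F a := by
  rw [map_sub]; rfl

lemma exists_eq_add_mul (z : DoubleCover F) :
    ∃ p q : L[X], z = of _ p + of _ q * yc F :=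
  exists_eq_of_add_of_mul_root F z

lemma eq_zero_of_add_mul_eq_zero {p q : L[X]}
    (h : of (X ^ 2 - C F) p + of _ q * yc F = 0) : p = 0 ∧ q = 0 :=
  eq_zero_of_of_add_of_mul_root F h

lemma of_dvd_iff {n p q : L[X]} :
    of (X ^ 2 - C F) n ∣ of _ p + of _ q * yc F ↔
      n ∣ p ∧ n ∣ q := by
  constructor
  · rintro ⟨z, hz⟩
    obtain ⟨x, y, rfl⟩ := exists_eq_add_mul F z
    have := eq_zero_of_add_mul_eq_zero F (p := p - n * x) (q := q - n * y) (by
      simp only [map_sub, map_mul]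
      linear_combination hz)
    exact ⟨⟨x, sub_eq_zero.1 this.1⟩, ⟨y, sub_eq_zero.1 this.2⟩⟩
  · rintro ⟨⟨x, rfl⟩, y, rfl⟩
    exact ⟨of _ x + of _ y * yc F, by simp only [map_mul]; ring⟩

lemma eq_zero_of_of_mul {n : L[X]} (hn : n ≠ 0) {z : DoubleCover F}
    (h : of (X ^ 2 - C F) n * z = 0) : z = 0 := by
  obtain ⟨x, y, rfl⟩ := exists_eq_add_mul F z
  have := eq_zero_of_add_mul_eq_zero F (p := n * x) (q := n * y) (by
    simp only [map_mul]
    linear_combination h)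
  rw [mul_eq_zero, mul_eq_zero] at this
  rw [this.1.resolve_left hn, this.2.resolve_left hn]
  simp

variable {F}

/-- Evaluation at a point. -/
def ev (a b : L) (h : b ^ 2 = F.eval a) : DoubleCover F →+* L :=
  AdjoinRoot.lift (evalRingHom a) b (by simp [h])

@[simp] lemma ev_of (a b : L) (h : b ^ 2 = F.eval a) (p : L[X]) :
    ev a b h (of _ p) = p.eval a := by simp [ev]

@[simp] lemma ev_yc (a b : L) (h : b ^ 2 = F.eval a) : ev a b h (yc F) = b := by simp [ev, yc]

@[simp] lemma ev_xc (a b : L) (h : b ^ 2 = F.eval a) : ev a b h (xc F) = a := by simp [xc]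

@[simp] lemma ev_const (a b : L) (h : b ^ 2 = F.eval a) (r : L) : ev a b h (const F r) = r := by
  simp [const]

lemma ev_surjective (a b : L) (h : b ^ 2 = F.eval a) : Surjective (ev a b h) :=
  fun r => ⟨const F r, ev_const ..⟩

/-- The difference quotient `(F(x) - F(a)) / (x - a)`. -/
def slope (F : L[X]) (a : L) : L[X] := F /ₘ (X - C a)

lemma X_sub_C_mul_slope (F : L[X]) (a : L) : (X - C a) * slope F a = F - C (F.eval a) := by
  rw [slope, X_sub_C_mul_divByMonic_eq_sub_modByMonic]
  simp [modByMonic_X_sub_C_eq_C_eval]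

lemma xc_sub_mul_slope (a : L) :
    (xc F - const F a) * of _ (slope F a) = yc F ^ 2 - const F (F.eval a) := by
  rw [yc_sq, ← of_X_sub_C, ← map_mul, X_sub_C_mul_slope, map_sub]; rfl

/-- The product of two functions, vanishing at `(a, b)` and `(a, -b)`. -/
lemma line_mul_line (a b j k : L) (h : b ^ 2 = F.eval a) :
    (yc F - const F b - const F j * (xc F - const F a)) *
      (yc F + const F b - const F k * (xc F - const F a)) =
    (xc F - const F a) * (of _ (slope F a) - const F k * (yc F - const F b)
      - const F j * (yc F + const F b) + const F (j * k) * (xc F - const F a)) := by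
  have h1 := xc_sub_mul_slope (F := F) a
  rw [← h, map_pow] at h1
  rw [map_mul]
  linear_combination -h1

/-- A function vanishing at `(a, b)` lies in the ideal `(x - a, y - b)`, and `(y - b) * (y + b)` is
a multiple of `x - a`. The slope `k` of the conjugate line changes the product only by multiples of
`x - a`. -/
lemma xc_sub_dvd_of_ev_eq_zero (a b k : L) (h : b ^ 2 = F.eval a) {z : DoubleCover F}
    (hz : ev a b h z = 0) :
    xc F - const F a ∣ z * (yc F + const F b - const F k * (xc F - const F a)) := by
  obtain ⟨p, q, rfl⟩ := exists_eq_add_mul F z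
  have h0 : p.eval a + q.eval a * b = 0 := by simpa using hz
  have hp : ∀ p : L[X], of (X ^ 2 - C F) p =
      (xc F - const F a) * of _ (slope p a) + const F (p.eval a) := fun p => by
    rw [← of_X_sub_C, ← map_mul, X_sub_C_mul_slope, map_sub]
    exact (sub_add_cancel _ _).symm
  have h1 := xc_sub_mul_slope (F := F) a
  rw [← h, map_pow] at h1
  have h0' : const F (p.eval a) + const F (q.eval a) * const F b = 0 := by
    rw [← map_mul, ← map_add, h0, map_zero]
  refine ⟨(of _ (slope p a) + of _ (slope q a) * yc F) *
      (yc F + const F b - const F k * (xc F - const F a)) +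
      const F (q.eval a) * (of _ (slope F a) - const F k * (yc F - const F b)), ?_⟩
  rw [hp p, hp q]
  linear_combination (yc F + const F b - const F k * (xc F - const F a)) * h0' -
    const F (q.eval a) * h1

variable {ι : Type*} [Fintype ι]

/-- A function vanishing at distinct points, times functions vanishing at the conjugate points, is
divisible by the product of the vertical lines through the points. -/
lemma prod_dvd_of_ev_eq_zero (a b k : ι → L) (h : ∀ i, b i ^ 2 = F.eval (a i))
    (hinj : ∀ i j, a i = a j → b i = b j → i = j) {z : DoubleCover F}
    (hz : ∀ i, ev (a i) (b i) (h i) z = 0) :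
    ∏ i, (xc F - const F (a i)) ∣
      z * ∏ i, (yc F + const F (b i) - const F (k i) * (xc F - const F (a i))) := by
  let I : ι → Ideal (DoubleCover F) := fun i => ker (ev (a i) (b i) (h i))
  have hmax : ∀ i, (I i).IsMaximal := fun i => RingHom.ker_isMaximal_of_surjective _ (ev_surjective _ _ _)
  -- Distinct points have comaximal ideals, so a function vanishing at all of them lies in the
  -- product of the ideals and the previous divisibility can be multiplied over the points.
  have hcop : ∀ i j, i ≠ j → IsCoprime (I i) (I j) := fun i j hij => by
    refine Ideal.isCoprime_of_isMaximal fun he => hij (hinj i j ?_ ?_)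
    · have : xc F - const F (a j) ∈ I i := by rw [he]; simp [I, mem_ker]
      simpa [I, mem_ker, sub_eq_zero] using this
    · have : yc F - const F (b j) ∈ I i := by rw [he]; simp [I, mem_ker]
      simpa [I, mem_ker, sub_eq_zero] using this
  have hz' : z ∈ ∏ i, I i := by
    have h1 : ∏ i, I i = ⨅ i, I i := by
      rw [Ideal.prod_eq_iInf_of_pairwise_isCoprime fun i _ j _ hij => hcop i j hij]
      simp
    rw [h1, Ideal.mem_iInf]
    exact hz
  rw [← mem_span_singleton, ← Ideal.prod_span_singleton]
  have h2 := Ideal.mul_mem_mul hz' (Ideal.prod_mem_prod (s := Finset.univ)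
    (I := fun i => span {yc F + const F (b i) - const F (k i) * (xc F - const F (a i))})
    (x := fun i => yc F + const F (b i) - const F (k i) * (xc F - const F (a i)))
    fun i _ => mem_span_singleton_self _)
  rw [← prod_mul_distrib] at h2
  have hle : ∀ i ∈ (Finset.univ : Finset ι), I i * span {yc F + const F (b i) -
      const F (k i) * (xc F - const F (a i))} ≤ span {xc F - const F (a i)} := fun i _ => ?_
  · exact Finset.prod_le_prod' hle h2
  rw [Ideal.mul_le]
  intro x hx y hy
  obtain ⟨y, rfl⟩ := mem_span_singleton.1 hy
  rw [mem_span_singleton, ← mul_assoc]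
  exact (xc_sub_dvd_of_ev_eq_zero _ _ _ (h i) hx).mul_right _

end DoubleCover

end DoubleCover

/-! ### Descent of divisibility to the chart ring -/

section Descent

open DoubleCover hiding of_eq_eval₂

variable {c : Bool}
  {L : Type v} [Field L] (i : 𝓞 K →+* L)

/-- Extension of the coefficients from `𝓞 K` to a field. -/
def toDoubleCover (f : Fin (2 * g + 3) → 𝓞 K) (c : Bool) :
    ChartRing f c →+* DoubleCover ((affForm f c).map i) :=
  chartHom c ((const _).comp i) (xc _) (yc _) (by
    rw [yc_sq, DoubleCover.of_eq_eval₂, eval₂_map])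

@[simp] lemma toDoubleCover_coordU : toDoubleCover i f c (coordU f c) = xc _ := chartHom_coordU ..

@[simp] lemma toDoubleCover_coordV : toDoubleCover i f c (coordV f c) = yc _ := chartHom_coordV ..

@[simp] lemma toDoubleCover_chartC (r : 𝓞 K) :
    toDoubleCover i f c (chartC f c r) = const _ (i r) := chartHom_chartC ..

@[simp] lemma toDoubleCover_of (p : (𝓞 K)[X]) :
    toDoubleCover i f c (of _ p) = of _ (p.map i) := by
  rw [of_eq_eval₂, hom_eval₂, toDoubleCover_coordU, DoubleCover.of_eq_eval₂, eval₂_map]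
  congr 1
  ext r
  simp

lemma ev_toDoubleCover (a b : L) (h : b ^ 2 = ((affForm f c).map i).eval a) :
    (ev a b h).comp (toDoubleCover i f c) = chartHom c i a b (by rw [h, Polynomial.eval_map]) := by
  apply ChartRing.hom_ext
  · ext r; simp
  · simp
  · simp

/-- Divisibility by a polynomial in the first coordinate descends, up to constants. -/
lemma exists_mul_eq_of_dvd (hi : Injective i) {n : (𝓞 K)[X]} {z : ChartRing f c}
    (h : of _ (n.map i) ∣ toDoubleCover i f c z) :
    ∃ d : 𝓞 K, d ≠ 0 ∧ ∃ x, chartC f c d * z = of _ n * x := by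
  obtain ⟨p, q, rfl⟩ := ChartRing.exists_eq_add_mul f c z
  rw [map_add, map_mul, toDoubleCover_of, toDoubleCover_of, toDoubleCover_coordV, of_dvd_iff] at h
  have key : ∀ p : (𝓞 K)[X], n.map i ∣ p.map i → ∃ d : 𝓞 K, d ≠ 0 ∧ ∃ x, C d * p = n * x := by
    intro p hp
    -- Divisibility of polynomials descends along the field extension to `K`; the constant `d` then
    -- clears the denominators of the quotient.
    let j : K →+* L := IsFractionRing.lift (K := K) hi
    have hj : j.comp (algebraMap (𝓞 K) K) = i := RingHom.ext fun r => lift_algebraMap hi r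
    rw [← hj, ← map_map, ← map_map, Polynomial.map_dvd_map'] at hp
    obtain ⟨y, hy⟩ := hp
    obtain ⟨d, hd0, hd⟩ := IsLocalization.integerNormalization_spec (nonZeroDivisors (𝓞 K)) y
    refine ⟨d, nonZeroDivisors.ne_zero hd0, integerNormalization (nonZeroDivisors (𝓞 K)) y, ?_⟩
    apply Polynomial.map_injective (algebraMap (𝓞 K) K) (algebraMap_injective _ _)
    rw [Polynomial.map_mul, Polynomial.map_mul, hd, hy, map_C]
    rw [← algebraMap_smul K d y, smul_eq_C_mul]
    ring
  obtain ⟨d, hd, x, hx⟩ := key p h.1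
  obtain ⟨d', hd', x', hx'⟩ := key q h.2
  refine ⟨d * d', mul_ne_zero hd hd', of _ (C d' * x) +
    of _ (C d * x') * coordV f c, ?_⟩
  have hC : ∀ r, chartC f c r = of _ (C r) := fun _ => rfl
  have e1 := congrArg (of (chartPoly f c)) hx
  have e2 := congrArg (of (chartPoly f c)) hx'
  simp only [map_mul, hC] at e1 e2 ⊢
  linear_combination of _ (C d') * e1 + of _ (C d) * coordV f c * e2

end Descent

/-! ### Gauss's lemma over valuation rings -/

section Gauss

open IsLocalRing

variable (V : Type u) [CommRing V] [IsDomain V] [ValuationRing V] {E : Type v} [Field E]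
  [Algebra V E] [IsFractionRing V E]

open Classical in
/-- `a` if `a` is not integral, and `1` otherwise. -/
def nonintegralPart (a : E) : E := if a ∈ (algebraMap V E).range then 1 else a

/-- The primitive multiple of `X - a` is `X - a` itself or `a⁻¹ X - 1`, according to whether `a` is
integral. -/
lemma exists_primitive_linear (a : E) : ∃ P : V[X],
    P.map (algebraMap V E) = C (nonintegralPart V a)⁻¹ * (X - C a) ∧ P.map (residue V) ≠ 0 := by
  by_cases h : a ∈ (algebraMap V E).range
  · obtain ⟨a, rfl⟩ := h
    refine ⟨X - C a, by simp [nonintegralPart], ?_⟩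
    rw [Polynomial.map_sub, map_X, map_C]
    exact X_sub_C_ne_zero _
  · have ha : a ≠ 0 := by
      rintro rfl
      exact h (zero_mem _)
    obtain ⟨b, hb⟩ := (ValuationRing.isInteger_or_isInteger V a).resolve_left h
    refine ⟨C b * X - 1, ?_, ?_⟩
    · rw [nonintegralPart, if_neg h, Polynomial.map_sub, Polynomial.map_mul, map_C, map_X, hb,
        Polynomial.map_one, mul_sub, ← C_mul, inv_mul_cancel₀ ha, C_1]
    · intro h0
      have := congrArg (fun p => p.coeff 0) h0
      simp at this

/-- The product of the primitive linear factors is primitive, and so is `G`; their ratio is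
therefore a unit of the valuation ring. -/
lemma isUnit_mul_prod_nonintegralPart {ι : Type*} [Fintype ι] (a : ι → E) (c : E) (G : V[X])
    (hG : ∃ n, IsUnit (G.coeff n))
    (h : G.map (algebraMap V E) = C c * ∏ i, (X - C (a i))) :
    ∃ ε : V, IsUnit ε ∧ c * ∏ i, nonintegralPart V (a i) = algebraMap V E ε := by
  choose P hP hP0 using fun i => exists_primitive_linear V (a i)
  have hne : ∀ i, nonintegralPart V (a i) ≠ 0 := fun i => by
    unfold nonintegralPart
    split_ifs with h
    · exact one_ne_zero
    · intro h0
      exact h (h0 ▸ zero_mem _)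
  set c' := c * ∏ i, nonintegralPart V (a i) with hc'
  set Q : V[X] := ∏ i, P i with hQ
  have hQmap : G.map (algebraMap V E) = C c' * Q.map (algebraMap V E) := by
    rw [h, hQ, Polynomial.map_prod, prod_congr rfl fun i _ => hP i, prod_mul_distrib,
      hc', C_mul, mul_assoc, ← mul_assoc (C (∏ i, _)), ← map_prod C, ← C_mul,
      ← prod_mul_distrib, Finset.prod_eq_one fun i _ => mul_inv_cancel₀ (hne i), C_1, one_mul]
  have hQ0 : Q.map (residue V) ≠ 0 := by
    rw [hQ, Polynomial.map_prod]
    exact Finset.prod_ne_zero_iff.2 fun i _ => hP0 i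
  have hinj : Injective (Polynomial.map (algebraMap V E)) :=
    Polynomial.map_injective _ (injective V E)
  obtain ⟨n, hn⟩ := hG
  rcases ValuationRing.isInteger_or_isInteger V c' with ⟨ε, hε⟩ | ⟨ε, hε⟩
  · refine ⟨ε, ?_, hε.symm⟩
    have h1 : G = C ε * Q := hinj (by rw [hQmap, Polynomial.map_mul, map_C, hε])
    grind
  · have hc0 : c' ≠ 0 := by
      intro h0
      rw [h0, C_0, zero_mul] at hQmap
      have : G = 0 := hinj (by rw [hQmap, Polynomial.map_zero])
      rw [this] at hn
      simp at hn
    have h1 : Q = C ε * G := hinj (by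
      rw [Polynomial.map_mul, map_C, hε, hQmap, ← mul_assoc, ← C_mul, inv_mul_cancel₀ hc0, C_1,
        one_mul])
    have hu : IsUnit ε := by
      by_contra hcon
      refine hQ0 ?_
      have : residue V ε = 0 := (residue_eq_zero_iff ε).2 hcon
      rw [h1, Polynomial.map_mul, map_C, this, C_0, zero_mul]
    obtain ⟨ε', rfl⟩ := hu
    refine ⟨(ε'⁻¹ : Vˣ), Units.isUnit _, ?_⟩
    have : algebraMap V E (ε'⁻¹ : Vˣ) * algebraMap V E ε' = 1 := by
      rw [← map_mul, Units.inv_mul, map_one]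
    grind

end Gauss

/-! ### Scaling polynomials to be primitive at a prime -/

section Primitive

/-- A polynomial over `K` can be scaled to have coefficients in `𝓞 K`, not all of them in `ν`. -/
lemma exists_primitive_multiple (ν : HeightOneSpectrum (𝓞 K)) {P : K[X]} (hP : P ≠ 0) :
    ∃ (a : K) (G : (𝓞 K)[X]), a ≠ 0 ∧ G.map (algebraMap (𝓞 K) K) = C a * P ∧
      ∃ n, G.coeff n ∉ ν.asIdeal := by
  obtain ⟨d, hd0, hd⟩ := IsLocalization.integerNormalization_spec (nonZeroDivisors (𝓞 K)) P
  set G := integerNormalization (nonZeroDivisors (𝓞 K)) P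
  rw [← algebraMap_smul K d P, smul_eq_C_mul] at hd
  have hd0' : algebraMap (𝓞 K) K d ≠ 0 :=
    (map_ne_zero_iff _ (algebraMap_injective _ _)).2 (nonZeroDivisors.ne_zero hd0)
  have hG : G ≠ 0 := by
    intro h0
    rw [h0, Polynomial.map_zero] at hd
    exact mul_ne_zero (C_ne_zero.2 hd0') hP hd.symm
  -- A coefficient `G.coeff m` of smallest valuation at `ν` divides all the others up to
  -- denominators outside `ν`; division by it makes the polynomial primitive.
  let W := Localization.AtPrime ν.asIdeal
  have : IsDiscreteValuationRing W :=
    IsLocalization.AtPrime.isDiscreteValuationRing_of_dedekind_domain (𝓞 K) ν.ne_bot W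
  obtain ⟨m, hm, hmin⟩ := Finset.exists_min_image G.support
    (fun n => IsDiscreteValuationRing.addVal W (algebraMap (𝓞 K) W (G.coeff n)))
    (nonempty_support_iff.2 hG)
  have hm0 : G.coeff m ≠ 0 := mem_support_iff.1 hm
  have hinj : Injective (algebraMap (𝓞 K) W) :=
    IsLocalization.injective W ν.asIdeal.primeCompl_le_nonZeroDivisors
  have key : ∀ n, ∃ t b : 𝓞 K, t ∉ ν.asIdeal ∧ t * G.coeff n = b * G.coeff m := by
    intro n
    by_cases hn : n ∈ G.support
    swap
    · exact ⟨1, 0, fun h => ν.isPrime.ne_top ((Ideal.eq_top_iff_one _).2 h), by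
        rw [notMem_support_iff.1 hn]; ring⟩
    have h1 := hmin n hn
    rw [IsDiscreteValuationRing.addVal_le_iff_dvd] at h1
    obtain ⟨y, hy⟩ := h1
    obtain ⟨b, t, rfl⟩ := exists_mk'_eq ν.asIdeal.primeCompl y
    refine ⟨t, b, t.2, hinj ?_⟩
    rw [map_mul, map_mul, hy, mul_left_comm, IsLocalization.mk'_spec', mul_comm]
  choose t b ht htb using key
  -- A common denominator, still outside `ν`.
  let T := ∏ n ∈ G.support, t n
  have hT : T ∉ ν.asIdeal := fun h => by
    have := ν.isPrime
    obtain ⟨n, -, hn⟩ := (Ideal.IsPrime.prod_mem_iff (p := ν.asIdeal)).1 h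
    exact ht n hn
  have hdiv : ∀ n, ∃ e, T * G.coeff n = e * G.coeff m := fun n => by
    by_cases hn : n ∈ G.support
    · obtain ⟨e, he⟩ := Finset.dvd_prod_of_mem t hn
      exact ⟨e * b n, by rw [show T = t n * e from he]; grind⟩
    · grind
  choose e he using hdiv
  have hmK : algebraMap (𝓞 K) K (G.coeff m) ≠ 0 :=
    (map_ne_zero_iff _ (algebraMap_injective _ _)).2 hm0
  have hT0 : algebraMap (𝓞 K) K T ≠ 0 := by
    refine (map_ne_zero_iff _ (algebraMap_injective _ _)).2 ?_
    intro h
    exact hT (h ▸ zero_mem _)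
  refine ⟨algebraMap (𝓞 K) K T / algebraMap (𝓞 K) K (G.coeff m) * algebraMap (𝓞 K) K d,
    ∑ n ∈ G.support, C (e n) * X ^ n, mul_ne_zero (div_ne_zero hT0 hmK) hd0', ?_, m, ?_⟩
  · rw [C_mul, mul_assoc, ← hd]
    ext n
    rw [coeff_map, coeff_C_mul, coeff_map, finsetSum_coeff]
    simp only [coeff_C_mul_X_pow, sum_ite_eq]
    have := congrArg (algebraMap (𝓞 K) K) (he n)
    grind
  · rw [finsetSum_coeff]
    simp only [coeff_C_mul_X_pow, sum_ite_eq, if_pos hm]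
    rwa [← mul_right_cancel₀ hm0 (he m)]

end Primitive

/-! ### Horizontal approximation at vertical primes -/

section Extension

open IsLocalRing

/-- A discrete valuation ring of characteristic zero extends to a finite extension of its fraction
field over which a given polynomial splits. -/
lemma exists_isDiscreteValuationRing_splits (W : Type u) [CommRing W] [IsDomain W]
    [IsDiscreteValuationRing W] [CharZero W] (P : (FractionRing W)[X]) :
    ∃ (V : Type u) (_ : CommRing V) (_ : IsDomain V) (_ : IsDiscreteValuationRing V)
      (i : W →+* V) (j : FractionRing W →+* FractionRing V), IsLocalHom i ∧
      Injective i ∧ j.comp (algebraMap W _) = (algebraMap V _).comp i ∧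
      (P.map j).Splits := by
  let E' := P.SplittingField
  let B := integralClosure W E'
  have : CharZero (FractionRing W) :=
    charZero_of_injective_algebraMap (injective W (FractionRing W))
  have hB : IsDedekindDomain B := integralClosure.isDedekindDomain W (FractionRing W) E'
  have hfrac : IsFractionRing B E' :=
    integralClosure.isFractionRing_of_finite_extension (FractionRing W) E'
  have hinjE : Injective (algebraMap W E') := by
    rw [IsScalarTower.algebraMap_eq W (FractionRing W) E']
    exact (algebraMap (FractionRing W) E').injective.comp (injective W _)
  have hinjB : Injective (algebraMap W B) := by
    rw [IsScalarTower.algebraMap_eq W B E', RingHom.coe_comp] at hinjE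
    exact hinjE.of_comp
  have hint : Algebra.IsIntegral W B := inferInstance
  -- The new discrete valuation ring is the localisation, at a prime above the maximal ideal, of the
  -- integral closure in the splitting field.
  obtain ⟨𝔓, h𝔓, hcomap⟩ := Ideal.exists_ideal_over_maximal_of_isIntegral (S := B)
    (maximalIdeal W) (by rw [(RingHom.injective_iff_ker_eq_bot _).1 hinjB]; exact bot_le)
  have h𝔓0 : 𝔓 ≠ ⊥ := by
    rintro rfl
    refine IsDiscreteValuationRing.not_a_field W ?_
    rw [← hcomap, ← ker_eq_comap_bot, (RingHom.injective_iff_ker_eq_bot _).1 hinjB]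
  have : 𝔓.IsPrime := h𝔓.isPrime
  obtain ⟨V, _, _, hV, iB, hinjV, hmem⟩ : ∃ (V : Type u) (_ : CommRing V) (_ : IsDomain V)
      (_ : IsDiscreteValuationRing V) (iB : B →+* V), Injective iB ∧
      ∀ x, x ∈ 𝔓 → iB x ∈ maximalIdeal V :=
    ⟨Localization.AtPrime 𝔓, inferInstance, inferInstance,
      IsLocalization.AtPrime.isDiscreteValuationRing_of_dedekind_domain B h𝔓0 _,
      algebraMap B _, IsLocalization.injective _ 𝔓.primeCompl_le_nonZeroDivisors,
      fun x hx => (IsLocalization.AtPrime.to_map_mem_maximal_iff _ 𝔓 _).2 hx⟩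
  have hinjF : Injective ((algebraMap V (FractionRing V)).comp iB) :=
    (injective V _).comp hinjV
  let j' : E' →+* FractionRing V := IsFractionRing.lift (K := E') hinjF
  refine ⟨V, inferInstance, inferInstance, hV, iB.comp (algebraMap W B),
    j'.comp (algebraMap _ E'), ⟨fun x hx => ?_⟩, hinjV.comp hinjB, ?_, ?_⟩
  · by_contra hcon
    have h1 : x ∈ maximalIdeal W := hcon
    rw [← hcomap, mem_comap] at h1
    exact hmem _ h1 hx
  · ext x
    have h1 : algebraMap (FractionRing W) E' (algebraMap W _ x) = algebraMap B E' (algebraMap W B x) :=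
      (IsScalarTower.algebraMap_apply W (FractionRing W) E' x).symm
    have h2 : j' (algebraMap B E' (algebraMap W B x)) = _ := lift_algebraMap hinjF _
    simp only [RingHom.comp_apply]
    rw [h1, h2]
    rfl
  · rw [← Polynomial.map_map]
    exact (IsSplittingField.splits E' P).map _

lemma exists_eq_mul_prod_of_splits {E : Type v} [Field E] {P : E[X]} (hP : P.Splits) :
    ∃ a : Fin P.natDegree → E, P = C P.leadingCoeff * ∏ i, (X - C (a i)) := by
  obtain ⟨l, hl⟩ := Quot.exists_rep P.roots
  have hl' : P.roots = (l : Multiset E) := hl.symm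
  have h1 := hP.eq_prod_roots
  have hlen : l.length = P.natDegree := by rw [hP.natDegree_eq_card_roots, hl', Multiset.coe_card]
  refine ⟨fun i => l.get (i.cast hlen.symm), ?_⟩
  conv_lhs => rw [h1, hl', Multiset.map_coe, Multiset.prod_coe]
  congr 1
  rw [← Fin.prod_univ_getElem, ← Fin.prod_congr' _ (by rw [List.length_map, hlen])]
  simp

/-- In a valuation ring, an element not dividing another is a proper multiple of it. -/
lemma exists_eq_mul_of_not_dvd {V : Type u} [CommRing V] [IsDomain V] [ValuationRing V] {x y : V}
    (h : ¬ x ∣ y) : ∃ t ∈ maximalIdeal V, x = y * t := by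
  obtain ⟨t, rfl⟩ := (ValuationRing.dvd_total x y).resolve_left h
  refine ⟨t, fun ht => h ?_, rfl⟩
  exact (ht.mul_right_dvd).2 dvd_rfl

end Extension

/-! ### Vertical primes stay away from horizontal divisors -/

section Vertical

open IsLocalRing

variable (hf : IsSeparableForm f) {X : Scheme.{u}} {π : X ⟶ naiveModel f} {c : Bool} {Q : X}
  (hQ : π Q ∈ (chartι hf c).opensRange) {l : List (HeightOneSpectrum (𝓞 K))}
  (hπ : IsBlowupSequence (naiveModelToSpec f) π l)

include hπ in
/-- A local function whose vanishing locus is vertical does not come close to a root of a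
polynomial which defines a horizontal divisor. -/
lemma sub_dvd_normProd_sq [IsNoetherianRing (X.presheaf.stalk Q)] [IsDomain (X.presheaf.stalk Q)]
    {V : Type u} [CommRing V] [IsDomain V] [IsDiscreteValuationRing V] [CharZero V]
    (θ : X.presheaf.stalk Q →+* V) {r : X.presheaf.stalk Q} (hr : ¬ IsUnit r)
    (hθ : ∀ x, θ x ∈ maximalIdeal V → r ∣ x)
    (hinj : Injective ((θ.comp (stalkChart hf π c Q hQ)).comp (chartC f c)))
    {s₀ : 𝓞 K} (hs₀ : s₀ ≠ 0) (hrs : r ∣ stalkChart hf π c Q hQ (chartC f c s₀))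
    {G : (𝓞 K)[X]} (hG : stalkChart hf π c Q hQ (of _ G) ≠ 0) (α : V)
    (hα : G.eval₂ ((θ.comp (stalkChart hf π c Q hQ)).comp (chartC f c)) α = 0) :
    θ (stalkChart hf π c Q hQ (coordU f c)) - α ∣ (normProd l : V) ^ 2 := by
  set κ := stalkChart hf π c Q hQ with hκ
  by_contra hcon
  obtain ⟨t₀, ht₀, hut⟩ := exists_eq_mul_of_not_dvd hcon
  let i₀ : 𝓞 K →+* V := (θ.comp κ).comp (chartC f c)
  -- The ring is extended by a square root of `F(α)`, so that the curve has a point with first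
  -- coordinate `α`.
  let P : (FractionRing V)[X] := Polynomial.X ^ 2 - C (algebraMap V _ ((affForm f c).eval₂ i₀ α))
  obtain ⟨W, _, _, _, i, j, hi, hinji, hij, hs⟩ := exists_isDiscreteValuationRing_splits V P
  have : CharZero W := charZero_of_injective_ringHom hinji
  obtain ⟨b, hb⟩ : ∃ b : W, b ^ 2 = i ((affForm f c).eval₂ i₀ α) := by
    have hdeg : (P.map j).degree ≠ 0 := by
      rw [degree_map]
      exact (degree_X_pow_sub_C two_pos _).trans_ne (by decide)
    obtain ⟨b, hb⟩ := hs.exists_eval_eq_zero hdeg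
    have hb' : b ^ 2 = algebraMap W _ (i ((affForm f c).eval₂ i₀ α)) := by
      have := congrArg (fun φ => φ ((affForm f c).eval₂ i₀ α)) hij
      simp only [RingHom.comp_apply] at this
      rw [← this, ← sub_eq_zero]
      simpa [P, Polynomial.map_pow] using hb
    obtain ⟨b', rfl⟩ := IsIntegrallyClosed.exists_algebraMap_eq_of_isIntegral_pow (R := W)
      (K := FractionRing W) two_pos (hb' ▸ isIntegral_algebraMap)
    exact ⟨b', injective W (FractionRing W) (by rw [map_pow, hb'])⟩
  set i₁ : 𝓞 K →+* W := i.comp i₀ with hi₁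
  have hM0 : (normProd l : W) ≠ 0 := Nat.cast_ne_zero.2 (normProd_ne_zero l)
  set u' := i (θ (κ (coordU f c)))
  set v' := i (θ (κ (coordV f c)))
  have hv : v' ^ 2 = (affForm f c).eval₂ i₁ u' := by
    exact ChartRing.map_equation (i.comp (θ.comp κ))
  have hb' : b ^ 2 = (affForm f c).eval₂ i₁ (i α) := by rw [hb, hom_eval₂]
  have hut' : u' - i α = normProd l ^ 2 * i t₀ := by
    have := congrArg i hut
    simpa using this
  have him : ∀ x, i x ∈ maximalIdeal W ↔ x ∈ maximalIdeal V :=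
    fun x => not_congr (isUnit_map_iff i x)
  have ht₀' : i t₀ ∈ maximalIdeal W := (him _).2 ht₀
  -- One of the two roots is close to `v`: otherwise both `v - b` and `v + b` divide `M`, so that `u
  -- - α = M ^ 2 * t₀`, which divides their product, would divide `M ^ 2`. The square in the
  -- statement comes from here.
  obtain ⟨b₁, hb₁, t₁, ht₁, hvt⟩ : ∃ b₁ : W, b₁ ^ 2 = (affForm f c).eval₂ i₁ (i α) ∧
      ∃ t₁ ∈ maximalIdeal W, v' - b₁ = normProd l * t₁ := by
    by_contra! hcon2
    have h1 : v' - b ∣ (normProd l : W) := by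
      by_contra h
      obtain ⟨t, ht, h⟩ := exists_eq_mul_of_not_dvd h
      exact hcon2 b hb' t ht h
    have h2 : v' - -b ∣ (normProd l : W) := by
      by_contra h
      obtain ⟨t, ht, h⟩ := exists_eq_mul_of_not_dvd h
      exact hcon2 (-b) (by rw [neg_sq, hb']) t ht h
    have h3 : u' - i α ∣ (v' - b) * (v' - -b) := by
      have : (v' - b) * (v' - -b) = (affForm f c).eval₂ i₁ u' - (affForm f c).eval₂ i₁ (i α) := by
        rw [← hv, ← hb']; ring
      rw [this, ← Polynomial.eval_map, ← Polynomial.eval_map]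
      exact sub_dvd_eval_sub _ _ _
    have h4 := h3.trans (mul_dvd_mul h1 h2)
    rw [hut', ← sq] at h4
    obtain ⟨y, hy⟩ := h4
    have h5 : i t₀ * y = 1 := by
      refine mul_left_cancel₀ (pow_ne_zero 2 hM0) ?_
      rw [mul_one, ← mul_assoc, ← hy]
    exact ht₀' (IsUnit.of_mul_eq_one _ h5)
  obtain ⟨ϖ, hϖ⟩ := IsDiscreteValuationRing.exists_irreducible W
  have hϖm : ∀ t ∈ maximalIdeal W, ϖ ∣ t := fun t ht => by
    rwa [hϖ.maximalIdeal_eq, mem_span_singleton] at ht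
  let e' : ChartRing f c →+* W := chartHom c i₁ (i α) b₁ hb₁
  -- The point `(α, b₁)` is congruent to the given one modulo `M * ϖ`, so it lifts to the model with
  -- the same centre.
  obtain ⟨θ', hθ', hm⟩ := exists_congruent_hom hf hQ hπ (t := ϖ)
    (hϖ.maximalIdeal_eq ▸ mem_span_singleton_self ϖ) (i.comp θ) e' (by
      intro a
      have hE : (Ideal.Quotient.mk (span {(normProd l : W) * ϖ})).comp ((i.comp θ).comp κ) =
          (Ideal.Quotient.mk (span {(normProd l : W) * ϖ})).comp e' := by
        apply ChartRing.hom_ext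
        · rw [RingHom.comp_assoc _ e', chartHom_comp_chartC]
          rfl
        · simp only [RingHom.comp_apply]
          rw [chartHom_coordU, Ideal.Quotient.eq, mem_span_singleton]
          change _ ∣ u' - i α
          rw [hut', sq, mul_assoc]
          exact mul_dvd_mul_left _ ((hϖm _ ht₀').mul_left _)
        · simp only [RingHom.comp_apply]
          rw [chartHom_coordV, Ideal.Quotient.eq, mem_span_singleton]
          change _ ∣ v' - b₁
          rw [hvt]
          exact mul_dvd_mul_left _ (hϖm _ ht₁)
      have := congrArg (fun φ => φ a) hE
      simp only [RingHom.comp_apply] at this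
      rwa [Ideal.Quotient.eq, mem_span_singleton] at this)
  have hker : ∀ x, θ' x = 0 → r ∣ x := fun x hx => hθ x (by
    have h1 := (hm x).1 (hx ▸ zero_mem _)
    exact (him _).1 h1)
  have hn : θ' (κ (of _ G)) = 0 := by
    rw [← RingHom.comp_apply, hθ', of_eq_eval₂, hom_eval₂, chartHom_comp_chartC, chartHom_coordU,
      hi₁, ← hom_eval₂, hα, map_zero]
  -- Since `θ'` kills `G(u) = r ^ k * n'` and kills no element prime to `r`, it kills `r`, and with
  -- it the nonzero constant `s₀`. But `θ'` is injective on constants.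
  obtain ⟨k, n', hn', hk⟩ := WfDvdMonoid.max_power_factor' hG hr
  rw [hk, map_mul, map_pow, mul_eq_zero] at hn
  have hr0 : θ' r = 0 := by
    rcases hn with h | h
    · by_contra h0
      exact pow_ne_zero k h0 h
    · exact absurd (hker _ h) hn'
  obtain ⟨y, hy⟩ := hrs
  have h0 : θ' (κ (chartC f c s₀)) = 0 := by rw [hy, map_mul, hr0, zero_mul]
  rw [← RingHom.comp_apply θ', hθ', chartHom_chartC] at h0
  refine hs₀ (hinj (hinji ?_))
  rw [map_zero, map_zero]
  exact h0

end Vertical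

/-! ### A divisibility in the local rings of the model -/

section UFD

/-- Divisibility in a factorial domain may be checked locally at the prime elements. -/
lemma dvd_of_forall_prime_exists {R : Type u} [CommRing R] [IsDomain R] [UniqueFactorizationMonoid R]
    {n m : R} (hn : n ≠ 0) (h : ∀ r, Prime r → ∃ s, ¬ r ∣ s ∧ n ∣ s * m) : n ∣ m := by
  obtain ⟨n', m', c, hrel, rfl, rfl⟩ := UniqueFactorizationMonoid.exists_reduced_factors n hn m
  have hc : c ≠ 0 := left_ne_zero_of_mul hn
  have hn' : n' ≠ 0 := right_ne_zero_of_mul hn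
  by_cases hu : IsUnit n'
  · exact mul_dvd_mul_left c (hu.dvd)
  · obtain ⟨r, hr, hrn⟩ := WfDvdMonoid.exists_irreducible_factor hu hn'
    obtain ⟨s, hs, hns⟩ := h r (UniqueFactorizationMonoid.irreducible_iff_prime.1 hr)
    rw [mul_left_comm, mul_dvd_mul_iff_left hc] at hns
    exact absurd (hrn.trans (hrel.dvd_of_dvd_mul_right hns)) hs

end UFD

section Divisibility

open IsLocalRing DoubleCover

variable (hf : IsSeparableForm f) {X : Scheme.{u}} {π : X ⟶ naiveModel f} {c : Bool} {Q : X}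
  (hQ : π Q ∈ (chartι hf c).opensRange) {l : List (HeightOneSpectrum (𝓞 K))}
  (hπ : IsBlowupSequence (naiveModelToSpec f) π l)

-- In the localisation at a vertical prime `r`, extended until `G` splits, every integral root
-- satisfies `u - α ∣ M ^ 2`, and a nonintegral root `a` makes `u - a` a unit times `a`. By Gauss's
-- lemma these scaling factors and the leading coefficient multiply to a unit, so `G(u)` divides `M
-- ^ (2 * deg G)`; the denominator `s` is prime to `r`.
include hπ in
lemma exists_dvd_mul_normProd_pow [IsNoetherianRing (X.presheaf.stalk Q)]
    [IsDomain (X.presheaf.stalk Q)] (hinj : Injective (stalkChart hf π c Q hQ))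
    {r : X.presheaf.stalk Q} (hr : Prime r) {s₀ : 𝓞 K} (hs₀ : s₀ ≠ 0)
    (hrs : r ∣ stalkChart hf π c Q hQ (chartC f c s₀)) {G : (𝓞 K)[X]}
    (hG : ∃ n, ¬ r ∣ stalkChart hf π c Q hQ (chartC f c (G.coeff n))) :
    ∃ s, ¬ r ∣ s ∧ stalkChart hf π c Q hQ (of _ G) ∣
      s * ((normProd l : X.presheaf.stalk Q) ^ 2) ^ G.natDegree := by
  set κ := stalkChart hf π c Q hQ with hκ
  have hG0 : G ≠ 0 := by
    rintro rfl
    obtain ⟨n, hn⟩ := hG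
    simp at hn
  have hκC : Injective (κ.comp (chartC f c)) := hinj.comp (chartC_injective c)
  have hp : (span {r}).IsPrime := (span_singleton_prime hr.ne_zero).2 hr
  obtain ⟨R', _, _, hR', ρ, hρinj, hρ, hfrac⟩ : ∃ (R' : Type u) (_ : CommRing R') (_ : IsDomain R')
      (_ : IsDiscreteValuationRing R') (ρ : X.presheaf.stalk Q →+* R'), Injective ρ ∧
      (∀ x, ρ x ∈ maximalIdeal R' ↔ r ∣ x) ∧ ∀ z, ∃ a s, ¬ r ∣ s ∧ ρ s * z = ρ a := by
    let R' := Localization.AtPrime (span {r})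
    have hinj' : Injective (algebraMap (X.presheaf.stalk Q) R') :=
      IsLocalization.injective _ (span {r}).primeCompl_le_nonZeroDivisors
    have hmem : ∀ x, algebraMap _ R' x ∈ maximalIdeal R' ↔ r ∣ x := fun x => by
      rw [IsLocalization.AtPrime.to_map_mem_maximal_iff R' (span {r}), mem_span_singleton]
    have hnoeth : IsNoetherianRing R' :=
      IsLocalization.isNoetherianRing (span {r}).primeCompl _ inferInstance
    have hpr : (maximalIdeal R').IsPrincipal := ⟨algebraMap _ R' r, by
        rw [← Localization.AtPrime.map_eq_maximalIdeal, map_span, Set.image_singleton]⟩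
    have hpid := ((tfae_of_isNoetherianRing_of_isLocalRing_of_isDomain R').out 4 0).1 hpr
    refine ⟨R', inferInstance, inferInstance, { principal := hpid.principal, not_a_field' := fun h => ?_ },
      algebraMap _ R', hinj', hmem, fun z => ?_⟩
    · have := (hmem r).2 dvd_rfl
      rw [h, mem_bot, map_eq_zero_iff _ hinj'] at this
      exact hr.ne_zero this
    · obtain ⟨⟨a, s⟩, has⟩ := IsLocalization.surj (span {r}).primeCompl z
      refine ⟨a, s, fun h => s.2 (mem_span_singleton.2 h), (mul_comm _ _).trans has⟩
  let i' : 𝓞 K →+* R' := ρ.comp (κ.comp (chartC f c))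
  have hi' : Injective i' := hρinj.comp hκC
  have : CharZero R' := charZero_of_injective_ringHom hi'
  obtain ⟨V, _, _, _, i, j, hi, hinji, hij, hs⟩ := exists_isDiscreteValuationRing_splits R'
    ((G.map i').map (algebraMap R' _))
  have : CharZero V := charZero_of_injective_ringHom hinji
  let θ : X.presheaf.stalk Q →+* V := i.comp ρ
  let iV : 𝓞 K →+* V := (θ.comp κ).comp (chartC f c)
  have hiV : Injective iV := hinji.comp hi'
  have him : ∀ x, i x ∈ maximalIdeal V ↔ x ∈ maximalIdeal R' := fun x =>
    not_congr (isUnit_map_iff i x)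
  have hθ : ∀ x, θ x ∈ maximalIdeal V ↔ r ∣ x := fun x => (him _).trans (hρ x)
  have hmap : ((G.map i').map (algebraMap R' (FractionRing R'))).map j =
      (G.map iV).map (algebraMap V (FractionRing V)) := by
    rw [Polynomial.map_map, hij, Polynomial.map_map, Polynomial.map_map]
    rfl
  rw [hmap] at hs
  have hF : Injective (algebraMap V (FractionRing V)) := injective V _
  obtain ⟨a, ha⟩ := exists_eq_mul_prod_of_splits hs
  obtain ⟨ε, hε, hεa⟩ := isUnit_mul_prod_nonintegralPart V a _ (G.map iV) (by
    obtain ⟨n, hn⟩ := hG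
    refine ⟨n, ?_⟩
    rw [coeff_map]
    by_contra hcon
    exact hn ((hθ _).1 hcon)) ha
  set t := θ (κ (coordU f c)) with ht
  have hdeg : ((G.map iV).map (algebraMap V (FractionRing V))).natDegree = G.natDegree := by
    rw [natDegree_map_eq_of_injective hF, natDegree_map_eq_of_injective hiV]
  have hlead : ((G.map iV).map (algebraMap V (FractionRing V))).leadingCoeff ≠ 0 := by
    rw [leadingCoeff_ne_zero, Ne, Polynomial.map_eq_zero_iff hF, Polynomial.map_eq_zero_iff hiV]
    exact hG0
  have key : ∀ k, ∃ x : V, algebraMap V (FractionRing V) x * (algebraMap V _ t - a k) =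
      nonintegralPart V (a k) * algebraMap V _ ((normProd l : V) ^ 2) := by
    intro k
    by_cases hk : a k ∈ (algebraMap V (FractionRing V)).range
    · obtain ⟨α, hα⟩ := hk
      have hroot : G.eval₂ iV α = 0 := by
        apply hF
        rw [map_zero, hom_eval₂, hα, ← eval₂_map, ← Polynomial.eval_map, ha, Polynomial.eval_mul,
          Polynomial.eval_prod, Finset.prod_eq_zero (mem_univ k) (by simp), mul_zero]
      obtain ⟨x, hx⟩ := sub_dvd_normProd_sq hf hQ hπ θ hr.not_isUnit (fun x => (hθ x).1) hiV hs₀ hrs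
        (by rwa [Ne, map_eq_zero_iff _ hinj, map_eq_zero_iff _ (of_injective c)]) α hroot
      refine ⟨x, ?_⟩
      rw [nonintegralPart, if_pos ⟨α, hα⟩, one_mul, hx, ← hα, ← map_sub, ← map_mul, mul_comm]
    · have hk0 : a k ≠ 0 := fun h => hk (h ▸ zero_mem _)
      obtain ⟨b, hb⟩ := (ValuationRing.isInteger_or_isInteger V (a k)).resolve_left hk
      have hbm : b ∈ maximalIdeal V := fun hu => hk (by
        obtain ⟨b, rfl⟩ := hu
        refine ⟨(b⁻¹ : Vˣ), ?_⟩
        have h1 : algebraMap V (FractionRing V) (b⁻¹ : Vˣ) * algebraMap V (FractionRing V) b = 1 := by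
          rw [← map_mul, Units.inv_mul, map_one]
        rw [hb] at h1
        field_simp at h1
        exact h1)
      have hu : IsUnit (t * b - 1) := by
        by_contra hcon
        have h1 : (1 : V) ∈ maximalIdeal V := by
          have := (maximalIdeal V).sub_mem ((maximalIdeal V).mul_mem_left t hbm) hcon
          rwa [sub_sub_cancel] at this
        exact h1 isUnit_one
      obtain ⟨y, hy⟩ := hu.exists_right_inv
      refine ⟨y * normProd l ^ 2, ?_⟩
      have h2 := congrArg (algebraMap V (FractionRing V)) hy
      rw [map_mul, map_sub, map_mul, map_one, hb] at h2
      rw [nonintegralPart, if_neg hk, map_mul]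
      have h3 : (algebraMap V (FractionRing V) t - a k) * algebraMap V (FractionRing V) y = a k := by
        field_simp at h2
        linear_combination h2
      linear_combination algebraMap V (FractionRing V) (normProd l ^ 2) * h3
  choose x hx using key
  have hdvd : θ (κ (of _ G)) ∣ ((normProd l : V) ^ 2) ^ G.natDegree := by
    obtain ⟨ε, rfl⟩ := hε
    refine ⟨(ε⁻¹ : Vˣ) * ∏ k, x k, hF ?_⟩
    have h1 : algebraMap V (FractionRing V) (θ (κ (of _ G))) =
        ((G.map iV).map (algebraMap V (FractionRing V))).eval (algebraMap V _ t) := by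
      rw [of_eq_eval₂, hom_eval₂, hom_eval₂, hom_eval₂, Polynomial.eval_map, eval₂_map]
      rfl
    have h2 : algebraMap V (FractionRing V) (ε⁻¹ : Vˣ) * algebraMap V (FractionRing V) ε = 1 := by
      rw [← map_mul, Units.inv_mul, map_one]
    have h3 := prod_congr rfl fun k (_ : k ∈ Finset.univ) => hx k
    rw [prod_mul_distrib, prod_mul_distrib, prod_const, card_univ, card_fin] at h3
    have h4 := h1.trans (congrArg (Polynomial.eval (algebraMap V _ t)) ha)
    rw [Polynomial.eval_mul, Polynomial.eval_prod, eval_C] at h4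
    simp only [Polynomial.eval_sub, eval_X, eval_C] at h4
    rw [← hdeg, map_mul, map_mul, h4, map_prod, map_pow]
    rw [← hεa] at h2
    linear_combination (-(algebraMap V (FractionRing V)) (ε⁻¹ : Vˣ) *
      ((G.map iV).map (algebraMap V (FractionRing V))).leadingCoeff) * h3 -
      algebraMap V (FractionRing V) (normProd l ^ 2) ^
        ((G.map iV).map (algebraMap V (FractionRing V))).natDegree * h2
  -- Divisibility descends along the local extension: otherwise `G(u)` would be a nonunit multiple
  -- of the power of `M`, and would remain one in `V`.
  have hdvd' : ρ (κ (of _ G)) ∣ ((normProd l : R') ^ 2) ^ G.natDegree := by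
    by_contra hcon
    obtain ⟨t, ht, he⟩ := exists_eq_mul_of_not_dvd hcon
    have he' := congrArg i he
    rw [map_mul] at he'
    have h1 : θ (κ (of _ G)) = i (((normProd l : R') ^ 2) ^ G.natDegree) * i t := he'
    rw [h1] at hdvd
    simp only [map_pow, map_natCast] at hdvd
    obtain ⟨y, hy⟩ := hdvd
    have hM0 : ((normProd l : V) ^ 2) ^ G.natDegree ≠ 0 :=
      pow_ne_zero _ (pow_ne_zero _ (Nat.cast_ne_zero.2 (normProd_ne_zero l)))
    have h5 : i t * y = 1 := by
      refine mul_left_cancel₀ hM0 ?_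
      rw [mul_one, ← mul_assoc, ← hy]
    exact (him t).2 ht (IsUnit.of_mul_eq_one _ h5)
  obtain ⟨z, hz⟩ := hdvd'
  obtain ⟨a, s, hs, has⟩ := hfrac z
  refine ⟨s, hs, a, hρinj ?_⟩
  rw [map_mul, map_mul, ← has, map_pow, map_pow, map_natCast, hz]
  ring

include hπ in
/-- The norm of `x - x(P)` divides the product of a local equation of `P`, a function vanishing on
the conjugate of `P` and a power of the norm of the centres of the blowups. -/
lemma dvd_normProd_pow_mul [IsNoetherianRing (X.presheaf.stalk Q)] [IsDomain (X.presheaf.stalk Q)]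
    [UniqueFactorizationMonoid (X.presheaf.stalk Q)]
    (hinj : Injective (stalkChart hf π c Q hQ)) {ν : HeightOneSpectrum (𝓞 K)}
    (hν : Q ∈ specialFibre π ν) {L : Type v} [Field L] {i : 𝓞 K →+* L} (hi : Injective i)
    {ι : Type*} [Fintype ι] {a b k : ι → L}
    (hab : ∀ q, b q ^ 2 = (affForm f c).eval₂ i (a q))
    (habinj : ∀ q q', a q = a q' → b q = b q' → q = q') {h : X.presheaf.stalk Q}
    (hh : ∀ x, h ∣ stalkChart hf π c Q hQ x → ∀ q, chartHom c i (a q) (b q) (hab q) x = 0)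
    {G : (𝓞 K)[X]} (hG : ∃ n, G.coeff n ∉ ν.asIdeal) {c₁ : L} (hc₁ : c₁ ≠ 0)
    (hGa : G.map i = C c₁ * ∏ q, (Polynomial.X - C (a q))) {Z : ChartRing f c} {c₂ : L}
    (hZ : toDoubleCover i f c Z = const _ c₂ * ∏ q, (yc _ + const _ (b q) - const _ (k q) *
        (xc _ - const _ (a q)))) :
    stalkChart hf π c Q hQ (of _ G) ∣
      ((normProd l : X.presheaf.stalk Q) ^ 2) ^ card ι * h * stalkChart hf π c Q hQ Z := by
  set κ := stalkChart hf π c Q hQ with hκ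
  have hdeg : G.natDegree = card ι := by
    rw [← natDegree_map_eq_of_injective hi, hGa, natDegree_C_mul hc₁,
      natDegree_finsetProd_X_sub_C_eq_card, card_univ]
  have hG0 : G ≠ 0 := by
    rintro rfl
    obtain ⟨n, hn⟩ := hG
    simp at hn
  refine dvd_of_forall_prime_exists ?_ fun r hr => ?_
  · rwa [Ne, map_eq_zero_iff _ hinj, map_eq_zero_iff _ (of_injective c)]
  -- The prime `r` is called vertical if it divides a nonzero constant. In that case the power of
  -- `M` alone is divisible by `G(u)` up to a factor prime to `r`.
  by_cases hs : ∃ s₀ : 𝓞 K, s₀ ≠ 0 ∧ r ∣ κ (chartC f c s₀)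
  · obtain ⟨s₀, hs₀, hrs⟩ := hs
    obtain ⟨s, hs, hd⟩ := exists_dvd_mul_normProd_pow hf hQ hπ hinj hr hs₀ hrs (G := G) (by
      obtain ⟨n, hn⟩ := hG
      refine ⟨n, fun h => hn ((mem_maximalIdeal_stalk_iff hf hQ hν _).1 ?_)⟩
      obtain ⟨y, hy⟩ := h
      rw [← hκ, hy]
      exact mul_mem_right _ _ hr.not_isUnit)
    refine ⟨s, hs, ?_⟩
    rw [hdeg] at hd
    rw [mul_assoc, ← mul_assoc s]
    exact hd.mul_right _
  -- At a horizontal prime `h` is, up to a factor prime to `r`, a chart function `x`. Now `x`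
  -- vanishes at the points and `Z` is a product of lines through their conjugates, so the product
  -- of the `x - a` divides `x * Z` over `L`; constants arising from descent are prime to `r`.
  · push Not at hs
    have hp : (span {r}).IsPrime := (span_singleton_prime hr.ne_zero).2 hr
    obtain ⟨x, s, hs', hsx⟩ := exists_stalkChart_mul_eq hf hQ hπ
      (⟨span {r}, hp⟩ : PrimeSpectrum _) (fun r' hr' => by
        by_contra h0
        exact hs r' h0 (mem_span_singleton.1 hr')) h
    have hev := hh x ⟨_, (hsx.symm.trans (mul_comm _ _))⟩
    have hab' : ∀ q, b q ^ 2 = ((affForm f c).map i).eval (a q) := fun q => by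
      rw [hab, Polynomial.eval_map]
    have h1 := prod_dvd_of_ev_eq_zero a b k hab' habinj (z := toDoubleCover i f c x)
      (fun q => by rw [← RingHom.comp_apply, ev_toDoubleCover]; exact hev q)
    have h2 : of _ (G.map i) ∣ toDoubleCover i f c (x * Z) := by
      rw [hGa, map_mul, map_mul, map_prod, hZ]
      have hu : IsUnit (of (Polynomial.X ^ 2 - C ((affForm f c).map i)) (C c₁)) :=
        ((isUnit_iff_ne_zero.2 hc₁).map C).map _
      rw [hu.mul_left_dvd]
      simp only [of_X_sub_C]
      rw [mul_left_comm]
      exact h1.mul_left _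
    obtain ⟨d, hd, y, hy⟩ := exists_mul_eq_of_dvd i hi h2
    refine ⟨κ (chartC f c d) * κ s, fun h => ?_, ?_⟩
    · rcases hr.dvd_or_dvd h with h | h
      · exact hs d hd h
      · exact hs' (mem_span_singleton.2 h)
    · have h3 : κ (chartC f c d) * κ s * (((normProd l : X.presheaf.stalk Q) ^ 2) ^ card ι *
          h * κ Z) = ((normProd l : X.presheaf.stalk Q) ^ 2) ^ card ι *
          (κ (of _ G) * κ y) := by
        rw [← map_mul κ (of _ G), ← hy, map_mul, map_mul]
        change κ s * h = κ x at hsx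
        linear_combination κ (chartC f c d) * ((normProd l : X.presheaf.stalk Q) ^ 2) ^
          card ι * κ Z * hsx
      rw [h3, mul_left_comm]
      exact dvd_mul_right _ _

end Divisibility

/-! ### Estimates at a nonarchimedean absolute value -/

section Nonarchimedean

variable {L : Type v} [Field L] {w : AbsoluteValue L ℝ} (hw : IsNonarchimedean w)

include hw in
lemma abv_sub_le (x y : L) : w (x - y) ≤ max (w x) (w y) := by
  have := hw x (-y)
  rwa [← sub_eq_add_neg, w.map_neg] at this

/-- The valuation ring of a nonarchimedean absolute value. -/
def abvIntegers : Subring L where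
  carrier := {x | w x ≤ 1}
  mul_mem' {x y} hx hy := by
    simp only [Set.mem_ofPred_eq, map_mul] at *
    exact mul_le_one₀ hx (w.nonneg _) hy
  one_mem' := by simp
  add_mem' {x y} hx hy := (hw x y).trans (max_le hx hy)
  zero_mem' := by simp
  neg_mem' {x} hx := by simpa using hx

include hw in
lemma abv_natCast_le_one (n : ℕ) : w n ≤ 1 := natCast_mem (abvIntegers hw) n

include hw in
lemma abv_eq_of_lt {x y : L} (h : w y < w x) : w (x - y) = w x := by
  refine le_antisymm ((abv_sub_le hw x y).trans (max_le le_rfl h.le)) ?_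
  have h1 := hw (x - y) y
  rw [sub_add_cancel] at h1
  grind

include hw in
lemma gaussNorm_X_sub_C (r : L) : (X - C r : L[X]).gaussNorm w 1 = max 1 (w r) := by
  apply le_antisymm
  · obtain ⟨i, hi⟩ := exists_eq_gaussNorm w 1 (X - C r)
    rw [hi, one_pow, mul_one]
    match i with
    | 0 => simp
    | 1 => simp
    | k + 2 => simp [coeff_X]
  · have h0 := le_gaussNorm w (X - C r) zero_le_one 0
    have h1 := le_gaussNorm w (X - C r) zero_le_one 1
    rw [one_pow, mul_one, coeff_sub] at h0 h1
    simp only [coeff_X_zero, coeff_C_zero, zero_sub, w.map_neg, coeff_X_one, coeff_C_succ, sub_zero,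
      map_one] at h0 h1
    exact max_le h1 h0

-- Gauss's lemma: the Gauss norm is multiplicative, it is `1` for the primitive polynomial `G`, and
-- it is `max 1 |r|` for `X - r`.
include hw in
lemma abv_mul_prod_max_eq_one {O : Type*} [CommRing O] {i : O →+* L} (hi : ∀ x, w (i x) ≤ 1)
    {ι : Type*} [Fintype ι] {G : O[X]} (hG : ∃ n, w (i (G.coeff n)) = 1) {c : L} {r : ι → L}
    (h : G.map i = C c * ∏ q, (X - C (r q))) : w c * ∏ q, max 1 (w (r q)) = 1 := by
  have hprod : ∀ s : Finset ι, (∏ q ∈ s, (X - C (r q))).gaussNorm w 1 =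
      ∏ q ∈ s, max 1 (w (r q)) := by
    classical
    intro s
    induction s using Finset.induction_on with
    | empty =>
      have := gaussNorm_C (v := w) 1 (1 : L)
      simpa using this
    | insert q s hq ih =>
      rw [prod_insert hq, prod_insert hq, gaussNorm_mul hw one_pos, ih, gaussNorm_X_sub_C hw]
  have h1 : (G.map i).gaussNorm w 1 = 1 := by
    apply le_antisymm
    · obtain ⟨n, hn⟩ := exists_eq_gaussNorm w 1 (G.map i)
      rw [hn, one_pow, mul_one, coeff_map]
      exact hi _
    · obtain ⟨n, hn⟩ := hG
      simpa [hn] using le_gaussNorm w (G.map i) zero_le_one n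
  rw [h, gaussNorm_mul hw one_pos, hprod, gaussNorm_C] at h1
  exact h1

include hw in
lemma abv_eval₂_le_one {O : Type*} [CommRing O] {i : O →+* L} (hi : ∀ x, w (i x) ≤ 1)
    (G : O[X]) {a : L} (ha : w a ≤ 1) : w (G.eval₂ i a) ≤ 1 := by
  let i' : O →+* abvIntegers hw := i.codRestrict _ hi
  have : G.eval₂ i a = (abvIntegers hw).subtype (G.eval₂ i' ⟨a, ha⟩) := by rw [hom_eval₂]; rfl
  rw [this]
  exact (G.eval₂ i' ⟨a, ha⟩).2

-- The aim is one `j` for which no linear form `β - j α` is much smaller than its two terms. If two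
-- values `j < j'` failed for the same index, then `(j' - j) α` and `(j' - j) β` would both be too
-- small, although `j' - j` divides `n!`. So each index excludes at most one of `n + 1` values.
include hw in
lemma exists_shift {κ : Type*} [Fintype κ] (α β : κ → L) {n : ℕ} (hn : card κ ≤ n) :
    ∃ j : ℕ, ∀ t, w (n.factorial : L) * max (w (α t)) (w (β t)) ≤ w (β t - j * α t) := by
  by_contra! hcon
  choose t ht using hcon
  have hlt : card κ < card (Fin (n + 1)) := by rw [card_fin]; omega
  obtain ⟨j, j', hne, hjj⟩ := Fintype.exists_ne_map_eq_of_card_lt (fun j : Fin (n + 1) => t j) hlt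
  wlog hlt' : j < j' generalizing j j'
  · grind
  have h1 := ht j
  have h2 := ht j'
  rw [← hjj] at h2
  set A := α (t j)
  set B := β (t j)
  have hd : w (n.factorial : L) ≤ w ((j' : ℕ) - (j : ℕ) : L) := by
    obtain ⟨e, he⟩ := Nat.dvd_factorial (m := (j' : ℕ) - (j : ℕ)) (n := n)
      (Nat.sub_pos_of_lt hlt') (by omega)
    rw [he, Nat.cast_mul, map_mul, Nat.cast_sub (le_of_lt hlt')]
    exact mul_le_of_le_one_right (w.nonneg _) (abv_natCast_le_one hw e)
  have hpos : 0 < w (n.factorial : L) := by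
    by_contra hcon
    have h0 : w (n.factorial : L) = 0 := le_antisymm (not_lt.1 hcon) (w.nonneg _)
    rw [h0, zero_mul] at h1
    exact absurd (w.nonneg _) (not_le.2 h1)
  have hA : w A < max (w A) (w B) := by
    have h3 : w ((j' : ℕ) - (j : ℕ) : L) * w A < w (n.factorial : L) * max (w A) (w B) := by
      rw [← map_mul]
      have : ((j' : ℕ) - (j : ℕ) : L) * A = (B - (j : ℕ) * A) - (B - (j' : ℕ) * A) := by ring
      rw [this]
      exact (abv_sub_le hw _ _).trans_lt (max_lt h1 h2)
    have h4 := (mul_le_mul_of_nonneg_right hd (w.nonneg A)).trans_lt h3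
    grind
  have hB : w B < max (w A) (w B) := by
    have h3 : w ((j' : ℕ) - (j : ℕ) : L) * w B < w (n.factorial : L) * max (w A) (w B) := by
      rw [← map_mul]
      have : ((j' : ℕ) - (j : ℕ) : L) * B =
        (j' : ℕ) * (B - (j : ℕ) * A) - (j : ℕ) * (B - (j' : ℕ) * A) := by ring
      rw [this]
      refine (abv_sub_le hw _ _).trans_lt (max_lt ?_ ?_) <;> rw [map_mul]
      · exact (mul_le_of_le_one_left (w.nonneg _) (abv_natCast_le_one hw _)).trans_lt h1
      · exact (mul_le_of_le_one_left (w.nonneg _) (abv_natCast_le_one hw _)).trans_lt h2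
    have h4 := (mul_le_mul_of_nonneg_right hd (w.nonneg B)).trans_lt h3
    grind
  grind

/-- The distance of two points in an affine chart, the first of them being integral. -/
def chartDist (w : AbsoluteValue L ℝ) (u v a b : L) : ℝ :=
  if w a ≤ 1 then max (w (u - a)) (w (v - b)) else 1

-- Smoothness in quantitative form. The slope at `u` is `F'(a)` up to a multiple of `u - a`, and `(v
-- + b) - (v - b) = 2 b`. Since `s F + t F' = δ` and `F(a) = b ^ 2`, the number `4 δ` is an integral
-- combination of `4 b ^ 2` and `4 F'(a)`.
include hw in
lemma abv_eval_slope_ge {O : Type*} [CommRing O] {i : O →+* L} (hi : ∀ x, w (i x) ≤ 1)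
    {F s t : O[X]} {δ : O} (hδ : s * F + t * derivative F = C δ) {u v a b : L}
    (hu : w u ≤ 1) (ha : w a ≤ 1) (hb : w b ≤ 1)
    (hab : b ^ 2 = F.eval₂ i a) :
    w (4 * i δ) ≤ max (max (w (DoubleCover.slope (F.map i) a |>.eval u)) (w (v + b)))
      (max (w (v - b)) (w (u - a))) := by
  set μ := max (max (w (DoubleCover.slope (F.map i) a |>.eval u)) (w (v + b)))
      (max (w (v - b)) (w (u - a))) with hμ
  have hS : w (DoubleCover.slope (F.map i) a |>.eval u) ≤ μ := by simp [hμ]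
  have h1 : w (v + b) ≤ μ := by simp [hμ]
  have h2 : w (v - b) ≤ μ := by simp [hμ]
  have h3 : w (u - a) ≤ μ := by simp [hμ]
  -- For `u ≠ a` the coefficient `k` is the remainder in the Taylor expansion of `F` at `a`; for `u
  -- = a` the slope is the derivative.
  obtain ⟨k, hk, hkS⟩ : ∃ k, w k ≤ 1 ∧ (DoubleCover.slope (F.map i) a).eval u =
      (derivative F).eval₂ i a + k * (u - a) := by
    have hm := DoubleCover.X_sub_C_mul_slope (F.map i) a
    by_cases hua : u = a
    · refine ⟨0, by simp, ?_⟩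
      have := congrArg (fun P => (derivative P).eval a) hm
      simp only [derivative_mul, derivative_sub, derivative_X, derivative_C, Polynomial.eval_add,
        Polynomial.eval_mul, Polynomial.eval_sub, eval_X, eval_C, sub_self, zero_mul, sub_zero,
        one_mul, add_zero, derivative_map, Polynomial.eval_map] at this
      grind
    · let i' : O →+* abvIntegers hw := i.codRestrict _ hi
      obtain ⟨k, hk⟩ := (F.map i').binomExpansion ⟨a, ha⟩ ⟨u - a, (abv_sub_le hw _ _).trans
        (max_le hu ha)⟩
      refine ⟨k, k.2, mul_left_cancel₀ (sub_ne_zero.2 hua) ?_⟩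
      have h4 := congrArg (Polynomial.eval u) hm
      have h5 := congrArg (abvIntegers hw).subtype hk
      have h6 : ∀ (P : O[X]) (x : abvIntegers hw), (abvIntegers hw).subtype
          (Polynomial.eval x (P.map i')) = P.eval₂ i x := fun P x => by
        rw [Polynomial.eval_map, hom_eval₂]; rfl
      have h7 : (abvIntegers hw).subtype ⟨u - a, (abv_sub_le hw u a).trans (max_le hu ha)⟩ = u - a :=
        rfl
      rw [derivative_map, map_add, map_add, map_mul, map_mul, map_pow, h6, h6, h6, h7] at h5
      simp only [Polynomial.eval_map, Polynomial.eval_mul, Polynomial.eval_sub, eval_X,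
        eval_C] at h4
      simp only [Subring.coe_add, Subring.coe_subtype, add_sub_cancel] at h5
      grind
  have hμ0 : 0 ≤ μ := (w.nonneg _).trans h1
  have hF' : w ((derivative F).eval₂ i a) ≤ μ := by
    rw [← sub_eq_iff_eq_add] at hkS
    rw [← hkS]
    refine (abv_sub_le hw _ _).trans (max_le hS ?_)
    rw [map_mul]
    exact (mul_le_of_le_one_left (w.nonneg _) hk).trans h3
  have h2b : w (2 * b) ≤ μ := by
    rw [show 2 * b = (v + b) - (v - b) by ring]
    exact (abv_sub_le hw _ _).trans (max_le h1 h2)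
  have h4b : w (4 * b ^ 2) ≤ μ := by
    rw [show 4 * b ^ 2 = (2 * b) * ((2 : ℕ) * b) by push_cast; ring, map_mul]
    refine (mul_le_of_le_one_right (w.nonneg _) ?_).trans h2b
    rw [map_mul]
    exact mul_le_one₀ (abv_natCast_le_one hw _) (w.nonneg _) hb
  have hev := congrArg (Polynomial.eval₂ i a) hδ
  rw [eval₂_add, eval₂_mul, eval₂_mul, eval₂_C, ← hab] at hev
  rw [← hev, show 4 * (s.eval₂ i a * b ^ 2 + t.eval₂ i a * (derivative F).eval₂ i a) =
    s.eval₂ i a * (4 * b ^ 2) + ((4 : ℕ) * t.eval₂ i a) * (derivative F).eval₂ i a by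
      push_cast; ring]
  refine (hw _ _).trans (max_le ?_ ?_) <;> rw [map_mul]
  · exact (mul_le_of_le_one_left (w.nonneg _) (abv_eval₂_le_one hw hi _ ha)).trans h4b
  · refine (mul_le_of_le_one_left (w.nonneg _) ?_).trans hF'
    rw [map_mul]
    exact mul_le_one₀ (abv_natCast_le_one hw _) (w.nonneg _) (abv_eval₂_le_one hw hi _ ha)

lemma chartDist_nonneg (w : AbsoluteValue L ℝ) (u v a b : L) : 0 ≤ chartDist w u v a b := by
  unfold chartDist
  split_ifs
  exacts [le_max_of_le_left (w.nonneg _), zero_le_one]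

-- For an integral point this is the choice of `j`. A nonintegral point has distance `1`: then
-- either `b - j a` is nonintegral and dominates the integral terms, or `|u - a| = |a| > 1` and the
-- choice of `j` applies again.
include hw in
lemma chartDist_mul_max_le {u v a b : L} {n j : ℕ} (hu : w u ≤ 1) (hv : w v ≤ 1)
    (hb : w a ≤ 1 → w b ≤ 1)
    (hj : w (n.factorial : L) * max (w (u - a)) (w (v - b)) ≤ w (v - b - j * (u - a))) :
    w (n.factorial : L) * chartDist w u v a b * max 1 (w (b - j * a)) ≤
      w (v - b - j * (u - a)) := by
  have hjle := abv_natCast_le_one hw j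
  have hnle := abv_natCast_le_one hw n.factorial
  by_cases ha : w a ≤ 1
  · have : w (b - j * a) ≤ 1 := by
      refine (abv_sub_le hw _ _).trans (max_le (hb ha) ?_)
      rw [map_mul]
      exact mul_le_one₀ hjle (w.nonneg _) ha
    rw [chartDist, if_pos ha, max_eq_left this, mul_one]
    exact hj
  · rw [chartDist, if_neg ha, mul_one]
    rw [not_le] at ha
    by_cases hr : w (b - j * a) ≤ 1
    · rw [max_eq_left hr]
      refine le_trans (mul_le_mul_of_nonneg_left ?_ (w.nonneg _)) hj
      refine le_max_of_le_left ?_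
      rw [w.map_sub, abv_eq_of_lt hw (hu.trans_lt ha)]
      exact ha.le
    · rw [not_le] at hr
      rw [max_eq_right hr.le]
      have h1 : w (v - j * u) ≤ 1 := by
        refine (abv_sub_le hw _ _).trans (max_le hv ?_)
        rw [map_mul]
        exact mul_le_one₀ hjle (w.nonneg _) hu
      rw [show v - b - j * (u - a) = v - j * u - (b - j * a) by ring, w.map_sub (v - j * u),
        abv_eq_of_lt hw (h1.trans_lt hr)]
      exact mul_le_of_le_one_left (w.nonneg _) hnle

end Nonarchimedean

/-! ### Local equations of a closed point and distances -/

section NumericalFactor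

variable {L : Type v} [Field L] {w : AbsoluteValue L ℝ} (hw : IsNonarchimedean w)
  {F : L[X]} {a b u v₀ : L} {n j k : ℕ}

-- The contribution of one point to the converse bound. If `a` is integral, the line is at most the
-- distance, and `Y` is bounded below since the choices of `j` and `k` prevent cancellation between
-- the terms that smoothness keeps large. If not, then `|u - a| = |a|`, and the identity between
-- line, conjugate line and `Y` is used with a lower bound for the conjugate line.
include hw in
lemma abv_mul_max_le_chartDist {D : ℝ} (hu : w u ≤ 1) (hv : w v₀ ≤ 1)
    (hb : w a ≤ 1 → w b ≤ 1) (hF : v₀ ^ 2 = F.eval u) (hab : b ^ 2 = F.eval a)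
    (hD0 : 0 ≤ D) (hD1 : D ≤ 1)
    (hD : w a ≤ 1 → D ≤ max (max (w ((DoubleCover.slope F a).eval u)) (w (v₀ + b)))
      (max (w (v₀ - b)) (w (u - a))))
    (hj₁ : w (n.factorial : L) * max (w (u - a)) (w (v₀ - b)) ≤ w (v₀ - b - j * (u - a)))
    (hj₂ : w (n.factorial : L) * max (w (v₀ + b)) (w ((DoubleCover.slope F a).eval u)) ≤
        w ((DoubleCover.slope F a).eval u - j * (v₀ + b)))
    (hk₁ : w (n.factorial : L) * max (w (v₀ - b - j * (u - a)))
        (w ((DoubleCover.slope F a).eval u - j * (v₀ + b))) ≤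
      w ((DoubleCover.slope F a).eval u - j * (v₀ + b) - k * (v₀ - b - j * (u - a))))
    (hk₂ : w (n.factorial : L) * max (w (u - a)) (w (v₀ + b)) ≤ w (v₀ + b - k * (u - a))) :
    w (n.factorial : L) ^ 2 * D * w (v₀ - b - j * (u - a)) * max 1 (w (b + k * a)) ≤
      chartDist w u v₀ a b * max 1 (w a) *
        w ((DoubleCover.slope F a).eval u - j * (v₀ + b) - k * (v₀ - b - j * (u - a))) := by
  have hjle := abv_natCast_le_one hw j
  have hkle := abv_natCast_le_one hw k
  have hnle := abv_natCast_le_one hw n.factorial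
  have hn0 := w.nonneg (n.factorial : L)
  set S := (DoubleCover.slope F a).eval u with hS
  set Y := S - j * (v₀ + b) - k * (v₀ - b - j * (u - a)) with hY
  by_cases ha : w a ≤ 1
  · have hr : w (b + k * a) ≤ 1 := by
      refine (hw _ _).trans (max_le (hb ha) ?_)
      rw [map_mul]
      exact mul_le_one₀ hkle (w.nonneg _) ha
    rw [chartDist, if_pos ha, max_eq_left hr, max_eq_left ha, mul_one, mul_one]
    have hline : w (v₀ - b - j * (u - a)) ≤ max (w (u - a)) (w (v₀ - b)) := by
      refine (abv_sub_le hw _ _).trans (max_le (le_max_right _ _) (le_max_of_le_left ?_))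
      rw [map_mul]
      exact mul_le_of_le_one_left (w.nonneg _) hjle
    have h1 : w (n.factorial : L) * D ≤ max (w (v₀ - b - j * (u - a))) (w (S - j * (v₀ + b))) := by
      refine (mul_le_mul_of_nonneg_left (hD ha) hn0).trans ?_
      rw [mul_max_of_nonneg _ _ hn0]
      apply max_le
      · rw [max_comm (w S)]
        exact hj₂.trans (le_max_right _ _)
      · rw [max_comm (w (v₀ - b))]
        exact hj₁.trans (le_max_left _ _)
    have h2 : w (n.factorial : L) ^ 2 * D ≤ w Y := by
      rw [pow_two, mul_assoc]
      exact (mul_le_mul_of_nonneg_left h1 hn0).trans hk₁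
    rw [mul_comm (max _ _)]
    exact mul_le_mul h2 hline (w.nonneg _) (w.nonneg _)
  · rw [chartDist, if_neg ha, one_mul]
    rw [not_le] at ha
    rw [max_eq_right ha.le]
    have hua : w (u - a) = w a := by rw [w.map_sub, abv_eq_of_lt hw (hu.trans_lt ha)]
    have hmul : (v₀ - b - j * (u - a)) * (v₀ + b - k * (u - a)) = (u - a) * Y := by
      have h3 := congrArg (Polynomial.eval u) (DoubleCover.X_sub_C_mul_slope F a)
      simp only [Polynomial.eval_mul, Polynomial.eval_sub, eval_X, eval_C, ← hS] at h3
      rw [← hF, ← hab] at h3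
      rw [hY]
      linear_combination -h3
    have hmul' := congrArg w hmul
    rw [map_mul, map_mul, hua] at hmul'
    rw [← hmul']
    have hmax : max 1 (w (b + k * a)) ≤ max (w (u - a)) (w (v₀ + b)) := by
      rw [hua]
      by_cases hba : w b ≤ w a
      · refine le_max_of_le_left (max_le ha.le ((hw _ _).trans (max_le hba ?_)))
        rw [map_mul]
        exact mul_le_of_le_one_left (w.nonneg _) hkle
      · rw [not_le] at hba
        have h4 : w (v₀ + b) = w b := by
          rw [add_comm, ← sub_neg_eq_add, abv_eq_of_lt hw]
          rw [w.map_neg]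
          exact hv.trans_lt (ha.trans hba)
        refine le_max_of_le_right (max_le ?_ ((hw _ _).trans ?_))
        · rw [h4]; exact (ha.trans hba).le
        · rw [h4]
          refine max_le le_rfl ?_
          rw [map_mul]
          exact (mul_le_of_le_one_left (w.nonneg _) hkle).trans hba.le
    have h5 : w (n.factorial : L) * max 1 (w (b + k * a)) ≤ w (v₀ + b - k * (u - a)) :=
      (mul_le_mul_of_nonneg_left hmax hn0).trans hk₂
    calc w (n.factorial : L) ^ 2 * D * w (v₀ - b - j * (u - a)) * max 1 (w (b + k * a))
        = (w (n.factorial : L) * D) * (w (v₀ - b - j * (u - a)) *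
            (w (n.factorial : L) * max 1 (w (b + k * a)))) := by ring
      _ ≤ 1 * (w (v₀ - b - j * (u - a)) * w (v₀ + b - k * (u - a))) := by
          refine mul_le_mul (mul_le_one₀ hnle hD0 hD1)
            (mul_le_mul_of_nonneg_left h5 (w.nonneg _)) ?_ zero_le_one
          exact mul_nonneg (w.nonneg _) (mul_nonneg hn0 (le_max_of_le_left zero_le_one))
      _ = _ := one_mul _

end NumericalFactor

/-! ### A local equation compared with the product of the distances -/

section Key

open IsLocalRing DoubleCover

variable (hf : IsSeparableForm f) {X : Scheme.{u}} {π : X ⟶ naiveModel f} {c : Bool} {Q : X}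
  (hQ : π Q ∈ (chartι hf c).opensRange) {l : List (HeightOneSpectrum (𝓞 K))}
  (hπ : IsBlowupSequence (naiveModelToSpec f) π l) {ν : HeightOneSpectrum (𝓞 K)}
  (hν : Q ∈ specialFibre π ν)
  {L : Type v} [Field L] [Algebra K L] {w : AbsoluteValue L ℝ} (hw : IsNonarchimedean w)
  {ψ : X.presheaf.stalk Q →+* L} (hψ : ∀ r, w (ψ r) ≤ 1) {u v₀ : L}
  {huv : v₀ ^ 2 = (affForm f c).eval₂ ((algebraMap K L).comp (algebraMap (𝓞 K) K)) u}
  (hψκ : ψ.comp (stalkChart hf π c Q hQ) =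
    chartHom c ((algebraMap K L).comp (algebraMap (𝓞 K) K)) u v₀ huv)
  {ι : Type*} [Fintype ι] {a b : ι → L}
  (hab : ∀ q, b q ^ 2 = (affForm f c).eval₂ ((algebraMap K L).comp (algebraMap (𝓞 K) K)) (a q))
  (hdesc : ∀ m n : ℤ, ∃ P : K[X], P.map (algebraMap K L) = ∏ q, (Polynomial.X - C (m * a q + n * b q)))

include hψ hψκ in
lemma abv_algebraMap_le_one (x : 𝓞 K) :
    w (((algebraMap K L).comp (algebraMap (𝓞 K) K)) x) ≤ 1 := by
  have := RingHom.congr_fun hψκ (chartC f c x)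
  rw [chartHom_chartC] at this
  rw [← this]
  exact hψ _

include hψ hψκ in
lemma abv_coord_le_one : w u ≤ 1 ∧ w v₀ ≤ 1 := by
  have h1 := RingHom.congr_fun hψκ (coordU f c)
  have h2 := RingHom.congr_fun hψκ (coordV f c)
  rw [chartHom_coordU] at h1
  rw [chartHom_coordV] at h2
  constructor
  · rw [← h1]; exact hψ _
  · rw [← h2]; exact hψ _

include hψ in
lemma abv_eq_one_of_isUnit {R : Type*} [CommRing R] {ψ : R →+* L} (hψ : ∀ r, w (ψ r) ≤ 1) {x : R}
    (hx : IsUnit x) : w (ψ x) = 1 := by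
  obtain ⟨y, hy⟩ := hx.exists_right_inv
  have := congrArg (fun z => w (ψ z)) hy
  simp only [map_mul, map_one] at this
  refine le_antisymm (hψ _) ?_
  rw [← this]
  exact mul_le_of_le_one_right (w.nonneg _) (hψ _)

include hν hψ hψκ in
lemma abv_algebraMap_eq_one {x : 𝓞 K} (hx : x ∉ ν.asIdeal) :
    w (((algebraMap K L).comp (algebraMap (𝓞 K) K)) x) = 1 := by
  have h1 := RingHom.congr_fun hψκ (chartC f c x)
  rw [chartHom_chartC] at h1
  rw [← h1]
  refine abv_eq_one_of_isUnit hψ hψ ?_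
  by_contra h
  exact hx ((mem_maximalIdeal_stalk_iff hf hQ hν x).1 h)

-- The roots are the values of a linear form at the points of a closed point. Their monic polynomial
-- has coefficients in `K`, and primitivity at `ν` determines the size of the scaling factor `c₀`.
include hw hν hψ hψκ hdesc in
lemma exists_primitive_polynomial (m n : ℤ) : ∃ (c₀ : L) (G : (𝓞 K)[X]), c₀ ≠ 0 ∧
    G.map ((algebraMap K L).comp (algebraMap (𝓞 K) K)) =
      C c₀ * ∏ q, (Polynomial.X - C (m * a q + n * b q)) ∧
    (∃ n, G.coeff n ∉ ν.asIdeal) ∧ w c₀ * ∏ q, max 1 (w (m * a q + n * b q)) = 1 := by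
  obtain ⟨P, hP⟩ := hdesc m n
  have hP0 : P ≠ 0 := by
    rintro rfl
    rw [Polynomial.map_zero] at hP
    exact (monic_prod_of_monic _ _ fun q _ => monic_X_sub_C _).ne_zero hP.symm
  obtain ⟨a₀, G, ha₀, hG, hprim⟩ := exists_primitive_multiple ν hP0
  have hG' : G.map ((algebraMap K L).comp (algebraMap (𝓞 K) K)) =
      C (algebraMap K L a₀) * ∏ q, (Polynomial.X - C (m * a q + n * b q)) := by
    rw [← Polynomial.map_map, hG, Polynomial.map_mul, map_C, hP]
  refine ⟨algebraMap K L a₀, G, (_root_.map_ne_zero _).2 ha₀, hG', hprim, ?_⟩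
  refine abv_mul_prod_max_eq_one hw (abv_algebraMap_le_one hf hQ hψ hψκ) ?_ hG'
  obtain ⟨k, hk⟩ := hprim
  exact ⟨k, abv_algebraMap_eq_one hf hQ hν hψ hψκ hk⟩

include hw hψ hψκ hab in
lemma abv_root_le_one (q : ι) (ha : w (a q) ≤ 1) : w (b q) ≤ 1 := by
  by_contra h
  rw [not_le] at h
  have := abv_eval₂_le_one hw (abv_algebraMap_le_one hf hQ hψ hψκ) (affForm f c) ha
  rw [← hab, map_pow] at this
  exact absurd this (not_le.2 (one_lt_pow₀ h two_ne_zero))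

include hw hν hψ hψκ hab hdesc in
/-- A local equation of a closed point is not smaller than the product of the distances. -/
lemma prod_chartDist_le {h : X.presheaf.stalk Q} (hh : ∀ x, (∀ q, chartHom c _ (a q) (b q) (hab q) x = 0) →
      h ∣ stalkChart hf π c Q hQ x) {n : ℕ} (hn : card ι ≤ n) :
    w (n.factorial : L) ^ card ι * ∏ q, chartDist w u v₀ (a q) (b q) ≤ w (ψ h) := by
  obtain ⟨j, hj⟩ := exists_shift hw (fun q => u - a q) (fun q => v₀ - b q) hn
  obtain ⟨c₂, G, hc₂, hG, -, hgauss⟩ := exists_primitive_polynomial hf hQ hν hw hψ hψκ hdesc (-j) 1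
  obtain ⟨hu, hv⟩ := abv_coord_le_one hf hQ hψ hψκ
  set i := (algebraMap K L).comp (algebraMap (𝓞 K) K) with hi
  -- Over `L` this function is `c₂` times the product of the lines `y - b q - j (x - a q)`. It
  -- vanishes at all the points, so the local equation `h` divides it.
  let Z : ChartRing f c := G.eval₂ (chartC f c) (coordV f c - (j : ChartRing f c) * coordU f c)
  have hev : ∀ (a b : L) (h : b ^ 2 = (affForm f c).eval₂ i a), chartHom c i a b h Z =
      (G.map i).eval (b - j * a) := fun a b h => by
    simp only [Z]
    rw [hom_eval₂, Polynomial.eval_map, chartHom_comp_chartC, map_sub, map_mul, map_natCast,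
      chartHom_coordU, chartHom_coordV]
  obtain ⟨t, ht⟩ := hh Z fun q => by
    rw [hev, hG, Polynomial.eval_mul, Polynomial.eval_prod, Finset.prod_eq_zero (mem_univ q),
      mul_zero]
    simp only [Polynomial.eval_sub, eval_X, eval_C]
    push_cast
    ring
  have h1 : w c₂ * ∏ q, w (v₀ - b q - j * (u - a q)) ≤ w (ψ h) := by
    have h2 := RingHom.congr_fun hψκ Z
    rw [hev, RingHom.comp_apply, ht, map_mul, hG, Polynomial.eval_mul, Polynomial.eval_prod,
      eval_C] at h2
    have h3 := congrArg w h2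
    rw [map_mul, map_mul, map_prod] at h3
    have h4 : ∀ q, w (v₀ - b q - j * (u - a q)) = w (Polynomial.eval (v₀ - j * u)
        (Polynomial.X - C (((-j : ℤ) : L) * a q + ((1 : ℤ) : L) * b q))) := fun q => by
      congr 1
      simp only [Polynomial.eval_sub, eval_X, eval_C]
      push_cast
      ring
    rw [prod_congr rfl fun q _ => h4 q, ← h3]
    exact mul_le_of_le_one_right (w.nonneg _) (hψ _)
  have h5 : ∏ q, (w (n.factorial : L) * chartDist w u v₀ (a q) (b q) *
      max 1 (w (((-j : ℤ) : L) * a q + ((1 : ℤ) : L) * b q))) ≤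
        ∏ q, w (v₀ - b q - j * (u - a q)) := by
    refine prod_le_prod (fun q _ => ?_) fun q _ => ?_
    · exact mul_nonneg (mul_nonneg (w.nonneg _) (chartDist_nonneg ..)) (le_max_of_le_left zero_le_one)
    · have := chartDist_mul_max_le hw hu hv (abv_root_le_one hf hQ hw hψ hψκ hab q) (hj q)
      rwa [show ((-j : ℤ) : L) * a q + ((1 : ℤ) : L) * b q = b q - j * a q by push_cast; ring]
  rw [prod_mul_distrib, prod_mul_distrib, prod_const, card_univ] at h5
  refine le_trans ?_ ((mul_le_mul_of_nonneg_left h5 (w.nonneg c₂)).trans h1)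
  rw [mul_left_comm, hgauss, mul_one]

set_option maxHeartbeats 1000000 in
include hw hν hπ hψ hψκ hab hdesc in
/-- Up to a constant, the product of the distances is not smaller than a local equation of a closed
point. -/
lemma abv_le_prod_chartDist [IsNoetherianRing (X.presheaf.stalk Q)]
    [IsDomain (X.presheaf.stalk Q)] [UniqueFactorizationMonoid (X.presheaf.stalk Q)]
    (hinj : Injective (stalkChart hf π c Q hQ))
    (habinj : ∀ q q', a q = a q' → b q = b q' → q = q') {h : X.presheaf.stalk Q}
    (hh : ∀ x, h ∣ stalkChart hf π c Q hQ x → ∀ q, chartHom c _ (a q) (b q) (hab q) x = 0)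
    (hne : ∀ q, u = a q → v₀ ≠ b q) {s t : (𝓞 K)[X]} {δ : 𝓞 K}
    (hδ : s * affForm f c + t * derivative (affForm f c) = C δ)
    {n : ℕ} (hn : 2 * card ι ≤ n) :
    (w (n.factorial : L) ^ 2 * w (4 * algebraMap K L δ) * w (normProd l : L) ^ 2) ^ card ι *
      w (ψ h) ≤ ∏ q, chartDist w u v₀ (a q) (b q) := by
  set i := (algebraMap K L).comp (algebraMap (𝓞 K) K) with hi
  have hiinj : Injective i := (algebraMap K L).injective.comp (algebraMap_injective _ _)
  obtain ⟨hu, hv⟩ := abv_coord_le_one hf hQ hψ hψκ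
  have hint : ∀ x, w (i x) ≤ 1 := abv_algebraMap_le_one hf hQ hψ hψκ
  set F := (affForm f c).map i with hF
  set S : ι → L := fun q => (slope F (a q)).eval u with hS
  -- One `j` serves two families, the lines themselves and the part `S - j (v₀ + b)` of `Y`; hence
  -- the requirement `2 * card ι ≤ n`.
  obtain ⟨j, hj⟩ := exists_shift hw (Sum.elim (fun q => u - a q) fun q => v₀ + b q)
    (Sum.elim (fun q => v₀ - b q) S) (n := n) (by rw [Fintype.card_sum]; omega)
  -- Likewise `k` serves both `Y = (S - j (v₀ + b)) - k * line` and the conjugate lines.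
  obtain ⟨k, hk⟩ := exists_shift hw
    (Sum.elim (fun q => v₀ - b q - j * (u - a q)) fun q => u - a q)
    (Sum.elim (fun q => S q - j * (v₀ + b q)) fun q => v₀ + b q) (n := n)
    (by rw [Fintype.card_sum]; omega)
  -- The roots of `G₁`, `G₂`, `G₃` are `a`, `b - j a` and `-(b + k a)`. They give the vertical
  -- lines, the lines through the points and the lines through the conjugate points.
  obtain ⟨c₁, G₁, hc₁, hG₁, hprim₁, hgauss₁⟩ :=
    exists_primitive_polynomial hf hQ hν hw hψ hψκ hdesc 1 0
  obtain ⟨c₂, G₂, hc₂, hG₂, -, hgauss₂⟩ :=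
    exists_primitive_polynomial hf hQ hν hw hψ hψκ hdesc (-j) 1
  obtain ⟨c₃, G₃, hc₃, hG₃, -, hgauss₃⟩ :=
    exists_primitive_polynomial hf hQ hν hw hψ hψκ hdesc (-k) (-1)
  simp only [Int.cast_one, one_mul, Int.cast_zero, zero_mul, add_zero] at hG₁ hgauss₁
  set line : ι → DoubleCover F := fun q => yc F - const F (b q) -
    const F j * (xc F - const F (a q)) with hline
  set line' : ι → DoubleCover F := fun q => yc F + const F (b q) -
    const F k * (xc F - const F (a q)) with hline'
  set Y : ι → DoubleCover F := fun q => of _ (slope F (a q)) -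
    const F k * (yc F - const F (b q)) -
    const F j * (yc F + const F (b q)) +
    const F (j * k) * (xc F - const F (a q)) with hY
  have hab' : ∀ q, b q ^ 2 = F.eval (a q) := fun q => by rw [hab, hF, Polynomial.eval_map]
  have hll : ∀ q, line q * line' q = (xc F - const F (a q)) * Y q :=
    fun q => line_mul_line (a q) (b q) j k (hab' q)
  have htoD : ∀ (e : ℕ) (G : (𝓞 K)[X]), toDoubleCover i f c (G.eval₂ (chartC f c)
      (coordV f c - (e : ChartRing f c) * coordU f c)) = (G.map i).eval₂ (const F)
        (yc F - const F e * xc F) := fun e G => by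
    rw [hom_eval₂, eval₂_map, map_sub, map_mul, map_natCast, toDoubleCover_coordU,
      toDoubleCover_coordV, map_natCast,
      show (toDoubleCover i f c).comp (chartC f c) = (const F).comp i from
        RingHom.ext fun r => toDoubleCover_chartC ..]
  have hZ₂ : toDoubleCover i f c (G₂.eval₂ (chartC f c)
      (coordV f c - (j : ChartRing f c) * coordU f c)) = const F c₂ * ∏ q, line q := by
    rw [htoD, hG₂, eval₂_mul, eval₂_C, eval₂_finsetProd]
    congr 1
    refine prod_congr rfl fun q _ => ?_
    rw [eval₂_sub, eval₂_X, eval₂_C]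
    simp only [hline, map_add, map_mul, map_intCast, map_natCast]
    push_cast
    ring
  have hZ₃ : toDoubleCover i f c (G₃.eval₂ (chartC f c)
      (coordV f c - (k : ChartRing f c) * coordU f c)) = const F c₃ * ∏ q, line' q := by
    rw [htoD, hG₃, eval₂_mul, eval₂_C, eval₂_finsetProd]
    congr 1
    refine prod_congr rfl fun q _ => ?_
    rw [eval₂_sub, eval₂_X, eval₂_C]
    simp only [hline', map_add, map_mul, map_intCast, map_natCast]
    push_cast
    ring
  set Z₂ := G₂.eval₂ (chartC f c) (coordV f c - (j : ChartRing f c) * coordU f c)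
  set Z₃ := G₃.eval₂ (chartC f c) (coordV f c - (k : ChartRing f c) * coordU f c)
  have hofG₁ : of (Polynomial.X ^ 2 - C F) (G₁.map i) = const F c₁ *
      ∏ q, (xc F - const F (a q)) := by
    rw [hG₁, map_mul, map_prod]
    simp only [of_X_sub_C]
    rfl
  have hZZ : const F c₁ * toDoubleCover i f c (Z₂ * Z₃) =
      of (Polynomial.X ^ 2 - C F) (G₁.map i) * (const F (c₂ * c₃) * ∏ q, Y q) := by
    have h1 := prod_congr rfl fun q (_ : q ∈ Finset.univ) => hll q
    rw [prod_mul_distrib, prod_mul_distrib] at h1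
    rw [map_mul, hZ₂, hZ₃, hofG₁, map_mul]
    linear_combination (const F c₁ * const F c₂ * const F c₃) * h1
  -- The product of all lines and conjugate lines is divisible by the norm of `x - a`; the quotient
  -- `y` is the product of the `Y q`, up to constants.
  obtain ⟨d, hd0, y, hy⟩ := exists_mul_eq_of_dvd i hiinj (n := G₁) (z := Z₂ * Z₃) (f := f) (c := c) (by
    have hu : IsUnit (const F c₁) := (isUnit_iff_ne_zero.2 hc₁).map _
    exact hu.dvd_mul_left.1 (hZZ ▸ dvd_mul_right _ _))
  have hyD : const F c₁ * toDoubleCover i f c y = const F (i d * (c₂ * c₃)) * ∏ q, Y q := by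
    have hG₁0 : G₁.map i ≠ 0 := by
      rw [hG₁]
      exact mul_ne_zero (C_ne_zero.2 hc₁)
        (monic_prod_of_monic _ _ fun q _ => monic_X_sub_C _).ne_zero
    rw [← sub_eq_zero]
    refine eq_zero_of_of_mul (F := F) hG₁0 ?_
    have h1 := congrArg (toDoubleCover i f c) hy
    rw [map_mul, map_mul (toDoubleCover i f c) (of _ _), toDoubleCover_of,
      toDoubleCover_chartC] at h1
    rw [map_mul]
    linear_combination const F (i d) * hZZ - const F c₁ * h1
  have huv' : v₀ ^ 2 = F.eval u := by rw [huv, hF, Polynomial.eval_map]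
  have heval : ∀ x, ev u v₀ huv' (toDoubleCover i f c x) =
      ψ (stalkChart hf π c Q hQ x) := fun x => by
    rw [← RingHom.comp_apply, ev_toDoubleCover, ← RingHom.comp_apply, hψκ]
  set κ := stalkChart hf π c Q hQ with hκ
  obtain ⟨r, hr⟩ := dvd_normProd_pow_mul hf hQ hπ hinj hν hiinj hab habinj hh hprim₁ hc₁ hG₁
    (k := fun _ => (k : L)) hZ₃
  rw [← hκ] at hr
  have hG₁κ : κ (of _ G₁) ≠ 0 := by
    rw [Ne, map_eq_zero_iff _ hinj, map_eq_zero_iff _ (of_injective c)]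
    rintro rfl
    obtain ⟨n, hn⟩ := hprim₁
    simp at hn
  -- From `d Z₂ Z₃ = G₁ y` and `M ^ (2 * card ι) h Z₃ = G₁ r`, the common factor `G₁` is cancelled.
  -- Thus `h * ∏ Y` divides the product of the lines up to constants and the power of `M`.
  have hcancel : ((normProd l : X.presheaf.stalk Q) ^ 2) ^ card ι * h * κ y =
      κ (chartC f c d) * r * κ Z₂ := by
    refine mul_left_cancel₀ hG₁κ ?_
    have h1 := congrArg κ hy
    simp only [map_mul] at h1
    linear_combination (-((normProd l : X.presheaf.stalk Q) ^ 2) ^ card ι * h) * h1 +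
      κ (chartC f c d) * κ Z₂ * hr
  have hY' : ∀ q, ev u v₀ huv' (Y q) =
      S q - j * (v₀ + b q) - k * (v₀ - b q - j * (u - a q)) := fun q => by
    simp only [hY, hS, map_add, map_sub, map_mul, ev_of, ev_yc, ev_xc, ev_const]
    ring
  have hl' : ∀ q, ev u v₀ huv' (line q) = v₀ - b q - j * (u - a q) := fun q => by
    simp only [hline, map_sub, map_mul, ev_yc, ev_xc, ev_const]
  have hmain : w (normProd l : L) ^ (2 * card ι) * w (ψ h) * w c₃ *
      ∏ q, w (S q - j * (v₀ + b q) - k * (v₀ - b q - j * (u - a q))) ≤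
        w c₁ * ∏ q, w (v₀ - b q - j * (u - a q)) := by
    have h1 := congrArg (fun x => ψ x) hcancel
    simp only [map_mul, map_pow, map_natCast] at h1
    have h2 := congrArg (ev u v₀ huv') hyD
    rw [map_mul, map_mul, heval, map_prod, ev_const, ev_const] at h2
    have h3 := congrArg (ev u v₀ huv') hZ₂
    rw [map_mul, heval, map_prod, ev_const] at h3
    have h4 := heval (chartC f c d)
    rw [toDoubleCover_chartC, ev_const] at h4
    simp only [hY', hl'] at h2 h3
    rw [← h4, h3] at h1
    have hne : i d * c₂ ≠ 0 := mul_ne_zero ((map_ne_zero_iff _ hiinj).2 hd0) hc₂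
    have h5 : (normProd l : L) ^ (2 * card ι) * ψ h * c₃ *
        ∏ q, (S q - j * (v₀ + b q) - k * (v₀ - b q - j * (u - a q))) =
          ψ r * (c₁ * ∏ q, (v₀ - b q - j * (u - a q))) := by
      refine mul_left_cancel₀ hne ?_
      rw [pow_mul]
      linear_combination c₁ * h1 - ((normProd l : L) ^ 2) ^ card ι * ψ h * h2
    have h6 := congrArg w h5
    simp only [map_mul, map_pow, map_prod] at h6
    rw [h6]
    exact mul_le_of_le_one_left (mul_nonneg (w.nonneg _)
      (prod_nonneg fun q _ => w.nonneg _)) (hψ r)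
  have hD1 : w (4 * i δ) ≤ 1 := by
    rw [map_mul]
    exact mul_le_one₀ (by exact_mod_cast abv_natCast_le_one hw 4) (w.nonneg _) (hint δ)
  have hfac := fun q => abv_mul_max_le_chartDist hw hu hv (abv_root_le_one hf hQ hw hψ hψκ hab q)
    huv' (hab' q) (w.nonneg _) hD1 (fun ha => abv_eval_slope_ge hw hint hδ hu ha
      (abv_root_le_one hf hQ hw hψ hψκ hab q ha) (v := v₀) (hab q)) (hj (Sum.inl q)) (hj (Sum.inr q))
      (hk (Sum.inl q)) (hk (Sum.inr q))
  have : CharZero L := charZero_of_injective_algebraMap (algebraMap K L).injective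
  have hline0 : ∀ q, 0 < w (v₀ - b q - j * (u - a q)) := fun q => by
    refine lt_of_lt_of_le (mul_pos (w.pos (Nat.cast_ne_zero.2 n.factorial_ne_zero)) ?_)
      (hj (Sum.inl q))
    by_cases hq : u = a q
    · exact lt_max_of_lt_right (w.pos (sub_ne_zero.2 (hne q hq)))
    · exact lt_max_of_lt_left (w.pos (sub_ne_zero.2 hq))
  have hm₃ : ∀ q, w (((-k : ℤ) : L) * a q + ((-1 : ℤ) : L) * b q) = w (b q + k * a q) := fun q => by
    rw [← w.map_neg]
    congr 1
    push_cast
    ring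
  simp only [hm₃] at hgauss₃
  have hprod := prod_le_prod (s := Finset.univ) (fun q _ => mul_nonneg (mul_nonneg
    (mul_nonneg (pow_nonneg (w.nonneg (n.factorial : L)) 2) (w.nonneg (4 * i δ))) (w.nonneg
      (v₀ - b q - j * (u - a q)))) (le_max_of_le_left (zero_le_one' ℝ))) fun q _ => hfac q
  simp only [prod_mul_distrib, prod_const, card_univ] at hprod
  set N := card ι
  have hd0 : 0 ≤ ∏ q, chartDist w u v₀ (a q) (b q) := prod_nonneg fun q _ => chartDist_nonneg ..
  have hpos : 0 < w c₁ * ∏ q, w (v₀ - b q - j * (u - a q)) :=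
    mul_pos (w.pos hc₁) (prod_pos fun q _ => hline0 q)
  refine le_of_mul_le_mul_right ?_ hpos
  have hX := mul_le_mul_of_nonneg_right hprod (mul_nonneg (mul_nonneg (mul_nonneg (pow_nonneg
    (w.nonneg (normProd l : L)) (2 * N)) (w.nonneg (ψ h))) (w.nonneg c₃)) (w.nonneg c₁))
  have hX' := mul_le_mul_of_nonneg_left hmain hd0
  have hδi : algebraMap K L δ = i δ := rfl
  rw [hδi]
  calc _ = ((w (n.factorial : L) ^ 2) ^ N * w (4 * i δ) ^ N * (∏ q, w (v₀ - b q - j * (u - a q))) *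
          ∏ q, max 1 (w (b q + k * a q))) *
          (w (normProd l : L) ^ (2 * N) * w (ψ h) * w c₃ * w c₁) := by
        rw [mul_pow, mul_pow, ← pow_mul (w (normProd l : L))]
        linear_combination (-(w (n.factorial : L) ^ 2) ^ N * w (4 * i δ) ^ N *
          w (normProd l : L) ^ (2 * N) * w (ψ h) * w c₁ *
            ∏ q, w (v₀ - b q - j * (u - a q))) * hgauss₃
    _ ≤ _ := hX
    _ = (∏ q, chartDist w u v₀ (a q) (b q)) * (w (normProd l : L) ^ (2 * N) * w (ψ h) * w c₃ *
          ∏ q, w (S q - j * (v₀ + b q) - k * (v₀ - b q - j * (u - a q)))) := by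
        linear_combination ((∏ q, chartDist w u v₀ (a q) (b q)) * (w (normProd l : L) ^ (2 * N) *
          w (ψ h) * w c₃ * ∏ q, w (S q - j * (v₀ + b q) - k * (v₀ - b q - j * (u - a q))))) * hgauss₁
    _ ≤ _ := hX'

end Key

/-! ### The residue fields of the curve and the points over a closed point -/

section Preimmersion

/-- A preimmersion is surjective on stalks; at the only point this says that the field consists of
fractions of elements of the image. -/
lemma exists_mul_eq_of_isPreimmersion {A E : Type u} [CommRing A] [Field E] (e : A →+* E)
    [h : IsPreimmersion (Spec.map (ofHom e))] (z : E) :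
    ∃ a s, e s ≠ 0 ∧ e s * z = e a := by
  have h1 := (RingHom.surjectiveOnStalks_iff_forall_ideal.1
    ((IsPreimmersion.SpecMap_iff _).1 h).2) ⊥ bot_ne_top z
  obtain ⟨a, s, c, hc, hs, heq⟩ := h1
  exact ⟨a, s, hs, mul_left_cancel₀ hc (by simpa [mul_assoc] using heq)⟩

/-- It translates the residue field of a point of the scheme-theoretic fibre into ring
homomorphisms. The two residue fields consist of fractions of the coordinate ring and of the base,
and the residue degree becomes a degree of fields. -/
lemma exists_fiber_residue_field {N : Scheme.{u}} {A O : Type u} [CommRing A] [CommRing O]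
    (ι : Spec (.of A) ⟶ N) [IsOpenImmersion ι] (b : N ⟶ Spec (.of O))
    (β : O →+* A) (hβ : ι ≫ b = Spec.map (ofHom β)) (η : Spec (.of O))
    (P : b.fiber η) (hP : b.fiberι η P ∈ ι.opensRange) :
    ∃ (E κ₀ : Type u) (_ : Field E) (_ : Field κ₀) (e : A →+* E) (j : O →+* κ₀) (r : κ₀ →+* E),
      (∀ z, ∃ a s, e s ≠ 0 ∧ e s * z = e a) ∧ (∀ z, ∃ a s, j s ≠ 0 ∧ j s * z = j a) ∧
      e.comp β = r.comp j ∧ (∀ x, ι (Spec.map (ofHom e) x) = b.fiberι η P) ∧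
      (∀ x, Spec.map (ofHom j) x = η) ∧
      (b.fiberToSpecResidueField η).residueDegree P = @finrank κ₀ E _ _ r.toAlgebra.toModule := by
  let ρ := b.fiberToSpecResidueField η
  let φ : Spec ((b.fiber η).residueField P) ⟶ N := (b.fiber η).fromSpecResidueField P ≫ b.fiberι η
  have hφ : ∀ x, φ x = b.fiberι η P := fun x => by
    rw [Scheme.Hom.comp_apply, Scheme.fromSpecResidueField_apply]
  have hr : Set.range φ ⊆ Set.range ι := by
    rintro _ ⟨x, rfl⟩
    rw [hφ]
    exact hP
  let e' := Spec.preimage (IsOpenImmersion.lift ι φ hr)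
  have he' : Spec.map e' ≫ ι = φ := by rw [Spec.map_preimage, IsOpenImmersion.lift_fac]
  let φ₀ : Spec ((Spec ((Spec (.of O)).residueField η)).residueField (ρ P)) ⟶
      Spec (.of O) := Scheme.fromSpecResidueField _ (ρ P) ≫ Scheme.fromSpecResidueField _ η
  have hφ₀ : ∀ x, φ₀ x = η := fun x => by
    rw [Scheme.Hom.comp_apply, Scheme.fromSpecResidueField_apply]
  let j' := Spec.preimage φ₀
  have hj' : Spec.map j' = φ₀ := Spec.map_preimage φ₀
  have hpre : IsPreimmersion (Spec.map e') := by
    have : IsPreimmersion (Spec.map e' ≫ ι) := by rw [he']; infer_instance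
    exact IsPreimmersion.of_comp _ ι
  have hpre₀ : IsPreimmersion (Spec.map j') := by rw [hj']; infer_instance
  have hcomp : ofHom β ≫ e' = j' ≫ ρ.residueFieldMap P := by
    apply Spec.map_injective
    rw [Spec.map_comp, ← hβ, ← assoc, he', Spec.map_comp, hj', assoc,
      Scheme.Hom.fiber_fac, ← assoc, ← assoc,
      Scheme.Hom.SpecMap_residueFieldMap_fromSpecResidueField]
  refine ⟨(b.fiber η).residueField P,
    (Spec ((Spec (.of O)).residueField η)).residueField (ρ P), inferInstance,
    inferInstance, e'.hom, j'.hom, (ρ.residueFieldMap P).hom, ?_, ?_, ?_, ?_, ?_, rfl⟩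
  · exact @exists_mul_eq_of_isPreimmersion _ _ _ _ _ hpre
  · exact @exists_mul_eq_of_isPreimmersion _ _ _ _ _ hpre₀
  · exact congrArg CommRingCat.Hom.hom hcomp
  · intro x
    have : (Spec.map e' ≫ ι) x = b.fiberι η P := by rw [he', hφ]
    exact this
  · intro x
    have : Spec.map j' x = η := by rw [hj', hφ₀]
    exact this

end Preimmersion

section ResidueField

variable (hf : IsSeparableForm f)

instance : IsPreimmersion (curveι f) :=
  inferInstanceAs (IsPreimmersion ((naiveModelToSpec f).fiberι _))

lemma curveι_injective : Injective (curveι f) := (curveι f).isEmbedding.injective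

lemma genericPoint_spec_eq_bot :
    genericPoint (Spec (.of (𝓞 K))) = (⊥ : PrimeSpectrum (𝓞 K)) :=
  genericPoint_eq_bot_of_affine (CommRingCat.of (𝓞 K))

/-- The residue field of a point of the curve, with the tautological point over it. -/
lemma exists_residue_field (P : curve f) (c : Bool) (hc : curveι f P ∈ (chartι hf c).opensRange) :
    ∃ (E : Type u) (_ : Field E) (_ : Algebra K E) (p : CurvePoint f E) (hp : p.cval c ≠ 0),
      p.LiesAt P ∧ (∀ z, ∃ a s, p.chartEval c hp s ≠ 0 ∧
        p.chartEval c hp s * z = p.chartEval c hp a) ∧ residueDegree f P = finrank K E := by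
  obtain ⟨E, κ₀, _, _, e, j, r, hE, hκ₀, hcomp, he, hj, hdeg⟩ := exists_fiber_residue_field
    (chartι hf c) (naiveModelToSpec f) (chartC f c) (chartι_toSpec hf c)
      (genericPoint (Spec (.of (𝓞 K)))) P hc
  have hjinj : Injective j := by
    rw [RingHom.injective_iff_ker_eq_bot]
    have h1 := (hj (⊥ : PrimeSpectrum κ₀)).trans genericPoint_spec_eq_bot
    exact congrArg PrimeSpectrum.asIdeal h1
  let i : K →+* κ₀ := IsFractionRing.lift (A := 𝓞 K) hjinj
  have hij : ∀ x : 𝓞 K, i x = j x := fun x => lift_algebraMap hjinj x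
  let algE : Algebra K E := (r.comp i).toAlgebra
  have halg : (algebraMap K E).comp (algebraMap (𝓞 K) K) = e.comp (chartC f c) := by
    rw [hcomp]
    exact RingHom.ext fun x => congrArg r (hij x)
  have huv : (e (coordV f c)) ^ 2 =
      (affForm f c).eval₂ ((algebraMap K E).comp (algebraMap (𝓞 K) K)) (e (coordU f c)) := by
    rw [halg, ← map_pow, coordV_sq, ← hom_eval₂, ← of_eq_eval₂]
  obtain ⟨p, hp, hpu, hpv⟩ := CurvePoint.exists_of_chart c huv
  have hpe : p.chartEval c hp = e := by
    refine ChartRing.hom_ext ?_ ?_ ?_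
    · rw [chartEval_comp_chartC, halg]
    · rw [chartEval_coordU, hpu]
    · rw [chartEval_coordV, hpv]
  refine ⟨E, inferInstance, algE, p, hp, ?_, ?_, ?_⟩
  · rw [liesAt_iff hf p c hp P]
    refine ⟨Spec.map (ofHom e) (⊥ : PrimeSpectrum E), he _, ?_⟩
    rw [hpe]; rfl
  · rw [hpe]
    exact hE
  -- The residue field at the generic point of the base is generated by fractions of elements of `𝓞
  -- K`, so it is `K`.
  · have hi : Bijective i := by
      refine ⟨i.injective, fun z => ?_⟩
      obtain ⟨a, s, hs, hz⟩ := hκ₀ z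
      refine ⟨a / s, ?_⟩
      rw [map_div₀, hij, hij, div_eq_iff hs, mul_comm, hz]
    let alg₀ : Algebra κ₀ E := r.toAlgebra
    have := Algebra.rank_eq_of_equiv_equiv (RingEquiv.ofBijective i hi) (RingEquiv.refl E)
      (RingHom.ext fun x => rfl)
    exact hdeg.trans (congrArg Cardinal.toNat this).symm

end ResidueField

/-! ### Points over a closed point and embeddings of its residue field -/

section PointsOver

variable (hf : IsSeparableForm f)

namespace CurvePoint

variable {L M : Type v} [Field L] [Algebra K L] [Field M] [Algebra K M]

lemma liesAt_map (φ : L →ₐ[K] M) (p : CurvePoint f L) (P : curve f) :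
    (p.map φ).LiesAt P ↔ p.LiesAt P := by
  refine forall_congr' fun n => forall₂_congr fun h _ => iff_congr Iff.rfl ?_
  have h1 : MvPolynomial.eval₂ ((algebraMap K M).comp (algebraMap (𝓞 K) K))
      ![(p.map φ).x, (p.map φ).s, (p.map φ).y] h = φ (MvPolynomial.eval₂
        ((algebraMap K L).comp (algebraMap (𝓞 K) K)) ![p.x, p.s, p.y] h) := by
    have h2 := MvPolynomial.eval₂_comp_left (φ : L →+* M)
      ((algebraMap K L).comp (algebraMap (𝓞 K) K)) ![p.x, p.s, p.y] h
    refine Eq.trans ?_ h2.symm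
    congr 1
    · ext x
      simp
    · funext i
      fin_cases i <;> rfl
  rw [h1, map_eq_zero_iff φ φ.toRingHom.injective]

lemma map_injective (φ : L →ₐ[K] M) :
    Injective (CurvePoint.map φ : CurvePoint f L → CurvePoint f M) := by
  intro p q h
  ext
  · exact φ.injective (congrArg CurvePoint.x h)
  · exact φ.injective (congrArg CurvePoint.s h)
  · exact φ.injective (congrArg CurvePoint.y h)

lemma cval_map (φ : L →ₐ[K] M) (p : CurvePoint f L) (c : Bool) :
    (p.map φ).cval c = φ (p.cval c) := by cases c <;> rfl

lemma uval_map (φ : L →ₐ[K] M) (p : CurvePoint f L) (c : Bool) :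
    (p.map φ).uval c = φ (p.uval c) := by
  rw [uval, uval, map_div₀, cval_map]
  cases c <;> rfl

lemma vval_map (φ : L →ₐ[K] M) (p : CurvePoint f L) (c : Bool) :
    (p.map φ).vval c = φ (p.vval c) := by
  rw [vval, vval, map_div₀, map_pow, cval_map]
  rfl

include hf in
lemma ker_chartEval_eq {L : Type u} {M : Type v} [Field L] [Algebra K L] [Field M] [Algebra K M]
    {p : CurvePoint f L} {q : CurvePoint f M} {P : curve f} (hp : p.LiesAt P) (hq : q.LiesAt P)
    (c : Bool) (hpc : p.cval c ≠ 0) (hqc : q.cval c ≠ 0) :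
    ker (p.chartEval c hpc) = ker (q.chartEval c hqc) := by
  obtain ⟨x, hx, hkx⟩ := (liesAt_iff hf p c hpc P).1 hp
  obtain ⟨y, hy, hky⟩ := (liesAt_iff hf q c hqc P).1 hq
  have : x = y := (chartι hf c).isOpenEmbedding.injective (hx.trans hy.symm)
  rw [← hkx, ← hky, this]

include hf in
lemma liesAt_of_ker_eq {L : Type u} {M : Type v} [Field L] [Algebra K L] [Field M] [Algebra K M]
    {p : CurvePoint f L} {q : CurvePoint f M} {P : curve f} (hp : p.LiesAt P)
    (c : Bool) (hpc : p.cval c ≠ 0) (hqc : q.cval c ≠ 0)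
    (h : ker (p.chartEval c hpc) = ker (q.chartEval c hqc)) : q.LiesAt P := by
  obtain ⟨x, hx, hkx⟩ := (liesAt_iff hf p c hpc P).1 hp
  exact (liesAt_iff hf q c hqc P).2 ⟨x, hx, hkx.trans h⟩

end CurvePoint

section Universal

variable {P : curve f} {c : Bool} {E : Type u} [Field E] [Algebra K E] {p : CurvePoint f E}
  (hpc : p.cval c ≠ 0) (hp : p.LiesAt P)
  (hfrac : ∀ z, ∃ a s, p.chartEval c hpc s ≠ 0 ∧ p.chartEval c hpc s * z = p.chartEval c hpc a)
  {L : Type v} [Field L] [Algebra K L]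

include hfrac in
lemma algHom_ext_of_point {σ τ : E →ₐ[K] L} (hu : σ (p.uval c) = τ (p.uval c))
    (hv : σ (p.vval c) = τ (p.vval c)) : σ = τ := by
  have h1 : (σ : E →+* L).comp (p.chartEval c hpc) = (τ : E →+* L).comp (p.chartEval c hpc) := by
    apply ChartRing.hom_ext
    · ext x; simp
    · simpa using hu
    · simpa using hv
  ext z
  obtain ⟨a, s, hs, hz⟩ := hfrac z
  have h2 := congrArg σ hz
  have h3 := congrArg τ hz
  rw [map_mul] at h2 h3
  have h4 : ∀ a, σ (p.chartEval c hpc a) = τ (p.chartEval c hpc a) := fun a =>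
    RingHom.congr_fun h1 a
  rw [h4, h4] at h2
  exact mul_left_cancel₀ ((map_ne_zero_iff _ τ.injective).2 hs) (h2.trans h3.symm)

include hf hpc hp in
lemma liesAt_of_algHom {q : CurvePoint f L} (hqc : q.cval c ≠ 0) (σ : E →ₐ[K] L)
    (hu : σ (p.uval c) = q.uval c) (hv : σ (p.vval c) = q.vval c) : q.LiesAt P := by
  refine CurvePoint.liesAt_of_ker_eq hf hp c hpc hqc ?_
  have h1 : q.chartEval c hqc = (σ : E →+* L).comp (p.chartEval c hpc) := by
    apply ChartRing.hom_ext
    · ext x; simp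
    · simpa using hu.symm
    · simpa using hv.symm
  rw [h1]
  ext a
  rw [mem_ker, mem_ker, RingHom.comp_apply, map_eq_zero_iff _ (σ : E →+* L).injective]

-- Points at the same `P` have the same kernel of evaluation. Evaluation at `q` therefore factors
-- through the chart ring modulo the kernel of `p`, whose fraction field is `E`.
include hf hp hfrac in
lemma exists_algHom_of_liesAt {q : CurvePoint f L} (hq : q.LiesAt P) :
    ∃ σ : E →ₐ[K] L, σ (p.uval c) = q.uval c ∧ σ (p.vval c) = q.vval c := by
  have hqc : q.cval c ≠ 0 := (cval_ne_zero_of_liesAt hf q hq c).2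
    ((cval_ne_zero_of_liesAt hf p hp c).1 hpc)
  have hker := CurvePoint.ker_chartEval_eq hf hp hq c hpc hqc
  let B := ChartRing f c ⧸ ker (p.chartEval c hpc)
  let algB : Algebra B E := (RingHom.kerLift (p.chartEval c hpc)).toAlgebra
  have hBE : Injective (algebraMap B E) := RingHom.kerLift_injective _
  have hdom : IsDomain B := hBE.isDomain
  have htors : FaithfulSMul B E := (faithfulSMul_iff_algebraMap_injective B E).2 hBE
  have hfr : IsFractionRing B E := IsFractionRing.of_field B E fun z => by
    obtain ⟨a, s, hs, hz⟩ := hfrac z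
    refine ⟨Ideal.Quotient.mk _ a, Ideal.Quotient.mk _ s, ?_⟩
    change z = p.chartEval c hpc a / p.chartEval c hpc s
    rw [eq_div_iff hs, mul_comm, hz]
  let τ : B →+* L := Ideal.Quotient.lift _ (q.chartEval c hqc) fun a ha => by
    rw [hker] at ha
    exact ha
  have hτ : Injective τ := by
    rw [injective_iff_map_eq_zero]
    intro b hb
    obtain ⟨a, rfl⟩ := mk_surjective b
    rw [eq_zero_iff_mem, hker]
    exact hb
  let σ : E →+* L := IsFractionRing.lift hτ
  have hσ : ∀ a, σ (p.chartEval c hpc a) = q.chartEval c hqc a := fun a =>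
    lift_algebraMap hτ (Ideal.Quotient.mk _ a)
  refine ⟨{ σ with commutes' := fun x => ?_ }, ?_, ?_⟩
  · have : σ.comp (algebraMap K E) = algebraMap K L := by
      apply IsLocalization.ringHom_ext (nonZeroDivisors (𝓞 K))
      ext x
      have := hσ (chartC f c x)
      simpa using this
    exact RingHom.congr_fun this x
  · have := hσ (coordU f c)
    simpa using this
  · have := hσ (coordV f c)
    simpa using this

/-- The points over a closed point correspond to the embeddings of its residue field. -/
def pointsEquiv (L : Type v) [Field L] [Algebra K L] :
    (𝓢 f L P) ≃ (E →ₐ[K] L) :=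
  Equiv.ofBijective (fun q => (exists_algHom_of_liesAt hf hpc hp hfrac q.2).choose) (by
    constructor
    · intro q q' h
      have h1 := (exists_algHom_of_liesAt hf hpc hp hfrac q.2).choose_spec
      have h2 := (exists_algHom_of_liesAt hf hpc hp hfrac q'.2).choose_spec
      simp only at h
      rw [← h] at h2
      have hc : ∀ q : CurvePoint f L, q.LiesAt P → q.cval c ≠ 0 := fun q hq =>
        (cval_ne_zero_of_liesAt hf q hq c).2
          ((cval_ne_zero_of_liesAt hf p hp c).1 hpc)
      exact Subtype.ext (CurvePoint.ext_chart c (hc _ q.2) (hc _ q'.2) (h1.1.symm.trans h2.1)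
        (h1.2.symm.trans h2.2))
    · intro σ
      have h1 := congrArg σ (p.vval_sq c hpc)
      have h2 : σ (p.vval c) ^ 2 = (affForm f c).eval₂
          ((algebraMap K L).comp (algebraMap (𝓞 K) K)) (σ (p.uval c)) := by
        rw [← map_pow, h1]
        refine (hom_eval₂ _ _ (σ : E →+* L) _).trans ?_
        congr 1
        ext x
        simp
      obtain ⟨q, hqc, hu, hv⟩ := CurvePoint.exists_of_chart c h2
      have hq := liesAt_of_algHom hf hpc hp hqc σ hu.symm hv.symm
      refine ⟨⟨q, hq⟩, ?_⟩
      have h3 := (exists_algHom_of_liesAt hf hpc hp hfrac hq).choose_spec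
      exact algHom_ext_of_point hpc hfrac (h3.1.trans hu) (h3.2.trans hv))

include hf hp hfrac in
/-- The residue field at a closed point is a finite extension. -/
lemma finite_of_isClosed (hP : IsClosed {P}) : Module.Finite K E := by
  have hdomA := ChartRing.isDomain hf c
  have hinjKE : Injective ((algebraMap K E).comp (algebraMap (𝓞 K) K)) :=
    (algebraMap K E).injective.comp (algebraMap_injective _ _)
  obtain ⟨x, hx, hkx⟩ := (liesAt_iff hf p c hpc P).1 hp
  -- a nonzero polynomial vanishing at a geometric point
  have hzero : ∀ {M : Type u} [Field M] [Algebra K M] [Algebra.IsAlgebraic K M]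
      (q : CurvePoint f M) (hqc : q.cval c ≠ 0), ker (q.chartEval c hqc) ≠ ⊥ := by
    intro M _ _ _ q hqc hbot
    have h1 : IsAlgebraic (𝓞 K) (q.uval c) :=
      (isAlgebraic_iff (𝓞 K) K M).2 (Algebra.IsAlgebraic.isAlgebraic (q.uval c))
    obtain ⟨n, hn, hn0⟩ := h1
    have h2 : of (chartPoly f c) n ∈ ker (q.chartEval c hqc) := by
      rw [mem_ker, of_eq_eval₂, hom_eval₂, chartEval_comp_chartC, chartEval_coordU]
      exact hn0
    rw [hbot, mem_bot, map_eq_zero_iff _ (of_injective c)] at h2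
    exact hn h2
  -- If only zero vanished at `P`, then `P` would specialise to the point of the curve below an
  -- algebraic point. As `P` is closed the two agree, but at an algebraic point a nonzero polynomial
  -- in `u` vanishes.
  have hne : ker (p.chartEval c hpc) ≠ ⊥ := by
    intro hbot
    obtain ⟨v, hv⟩ := IsAlgClosed.exists_pow_nat_eq ((affForm f c).eval₂
      ((algebraMap K (AlgebraicClosure K)).comp (algebraMap (𝓞 K) K)) 0) two_pos
    obtain ⟨q, hqc, -, -⟩ := CurvePoint.exists_of_chart c hv
    let y : Spec (.of (ChartRing f c)) :=
      (⟨ker (q.chartEval c hqc), ker_isPrime _⟩ : PrimeSpectrum (ChartRing f c))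
    have hxy : x ⤳ y := by
      refine (PrimeSpectrum.le_iff_specializes (x : PrimeSpectrum (ChartRing f c)) y).1 ?_
      change (x : PrimeSpectrum (ChartRing f c)).asIdeal ≤ _
      rw [hkx, hbot]
      exact bot_le
    have hy : chartι hf c y ∈ Set.range (curveι f) := by
      unfold curveι
      erw [Scheme.Hom.range_fiberι]
      change (naiveModelToSpec f) (chartι hf c y) = _
      rw [← Scheme.Hom.comp_apply, chartι_toSpec, genericPoint_spec_eq_bot]
      apply PrimeSpectrum.ext
      change Ideal.comap (chartC f c) (ker (q.chartEval c hqc)) = ⊥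
      rw [comap_ker, chartEval_comp_chartC, ← RingHom.injective_iff_ker_eq_bot]
      exact (algebraMap K (AlgebraicClosure K)).injective.comp
        (algebraMap_injective _ _)
    obtain ⟨P', hP'⟩ := hy
    have h1 : curveι f P ⤳ curveι f P' := by
      rw [← hx, hP']
      exact hxy.map (chartι hf c).continuous
    rw [(curveι f).isEmbedding.isInducing.specializes_iff] at h1
    have h2 : P' = P := h1.mem_closed hP rfl
    rw [h2, ← hx] at hP'
    have h3 := (chartι hf c).isOpenEmbedding.injective hP'
    refine hzero q hqc ?_
    rw [← hbot, ← hkx, h3]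
  obtain ⟨z, hz, hz0⟩ := exists_mem_ne_zero_of_ne_bot hne
  obtain ⟨z', n, hn, hzn⟩ := ChartRing.exists_mul_eq_of hf c z hz0
  have hu : IsAlgebraic (𝓞 K) (p.uval c) := by
    refine ⟨n, hn, ?_⟩
    have h1 := congrArg (p.chartEval c hpc) hzn
    rw [map_mul, (mem_ker).1 hz, mul_zero, of_eq_eval₂, hom_eval₂,
      chartEval_comp_chartC, chartEval_coordU] at h1
    exact h1.symm
  have hu' : IsIntegral K (p.uval c) := ((isAlgebraic_iff (𝓞 K) K E).1 hu).isIntegral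
  have hv' : IsIntegral K (p.vval c) := by
    refine IsIntegral.of_pow two_pos ?_
    rw [p.vval_sq c hpc, eval₂_eq_sum_range]
    exact IsIntegral.sum _ fun i _ => isIntegral_algebraMap.mul (hu'.pow i)
  let F := IntermediateField.adjoin K {p.uval c, p.vval c}
  have hfin : FiniteDimensional K F := IntermediateField.finiteDimensional_adjoin (by
    rintro x (rfl | rfl)
    · exact hu'
    · exact hv')
  have huF : p.uval c ∈ F := IntermediateField.subset_adjoin K _ (by simp)
  have hvF : p.vval c ∈ F := IntermediateField.subset_adjoin K _ (by simp)
  have hmem : ∀ a, p.chartEval c hpc a ∈ F := by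
    have hpol : ∀ n : (𝓞 K)[X], p.chartEval c hpc (of _ n) ∈ F := fun n => by
      rw [of_eq_eval₂, hom_eval₂, chartEval_comp_chartC, chartEval_coordU, eval₂_eq_sum_range]
      exact sum_mem fun i _ => mul_mem (F.algebraMap_mem _) (pow_mem huF i)
    intro a
    obtain ⟨m, n, rfl⟩ := ChartRing.exists_eq_add_mul f c a
    rw [map_add, map_mul, chartEval_coordV]
    exact add_mem (hpol m) (mul_mem (hpol n) hvF)
  have htop : F = ⊤ := by
    rw [eq_top_iff]
    intro z _
    obtain ⟨a, s, hs, hz⟩ := hfrac z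
    have : z = p.chartEval c hpc a / p.chartEval c hpc s := by rw [eq_div_iff hs, mul_comm, hz]
    rw [this]
    exact div_mem (hmem a) (hmem s)
  rw [htop] at hfin
  exact Module.Finite.equiv (IntermediateField.topEquiv (F := K) (E := E)).toLinearEquiv

section Rational

variable [Module.Finite K E]

include hf hpc hp hfrac in
lemma finite_pointsOver : Finite (𝓢 f L P) :=
  Finite.of_equiv _ (pointsEquiv hf hpc hp hfrac L).symm

variable [NumberField L] (hrat : IsSplitAt L P)

-- In characteristic zero, the number of embeddings into an algebraically closed field is the
-- degree, and by assumption all geometric points come from `L`.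
include hf hpc hp hfrac hrat in
lemma card_pointsOver : Nat.card (𝓢 f L P) = finrank K E := by
  let Ω := AlgebraicClosure L
  have h1 : Nat.card (𝓢 f Ω P) = finrank K E := by
    rw [Nat.card_congr (pointsEquiv hf hpc hp hfrac Ω), Nat.card_eq_fintype_card, AlgHom.card]
  rw [← h1]
  let φ := toAlgHom K L Ω
  refine Nat.card_eq_of_bijective
    (fun q => (⟨q.1.map φ, (CurvePoint.liesAt_map φ _ _).2 q.2⟩ : 𝓢 f Ω P))
    ⟨fun q q' h => Subtype.ext (CurvePoint.map_injective φ (congrArg Subtype.val h)), fun q => ?_⟩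
  obtain ⟨r, hr⟩ := hrat q.1 q.2
  exact ⟨⟨r, (CurvePoint.liesAt_map φ _ _).1 (hr ▸ q.2)⟩, Subtype.ext hr⟩

include hrat in
/-- The symmetric functions of the coordinates of the points over a closed point are defined over
the ground field. -/
lemma exists_map_eq_prod_X_sub_C [Fintype (𝓢 f L P)] (m n : ℤ) :
    ∃ G : K[X], G.map (algebraMap K L) = ∏ q : 𝓢 f L P,
      (X - C (m * q.1.uval c + n * q.1.vval c)) := by
  let Ω := AlgebraicClosure L
  let φ := toAlgHom K L Ω
  have : Algebra.IsAlgebraic K Ω := Algebra.IsAlgebraic.trans K L Ω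
  have : IsAlgClosure K Ω := ⟨inferInstance, inferInstance⟩
  have : CharZero Ω := charZero_of_injective_algebraMap (algebraMap L Ω).injective
  have : Normal K Ω := IsAlgClosure.normal K Ω
  have : IsGalois K Ω := ⟨⟩
  set H : Polynomial Ω := ∏ q : 𝓢 f L P,
    (X - C (φ (m * q.1.uval c + n * q.1.vval c))) with hH
  -- An automorphism permutes the geometric points at `P`, and all of them are rational over `L`, so
  -- it permutes the factors.
  have hfix : ∀ σ : Ω ≃ₐ[K] Ω, H.map (σ : Ω →+* Ω) = H := by
    intro σ
    have hex : ∀ q : 𝓢 f L P, ∃ r : 𝓢 f L P,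
        r.1.map φ = (q.1.map φ).map (σ : Ω →ₐ[K] Ω) := fun q => by
      obtain ⟨r, hr⟩ := hrat ((q.1.map φ).map (σ : Ω →ₐ[K] Ω))
        ((CurvePoint.liesAt_map _ _ _).2 ((CurvePoint.liesAt_map _ _ _).2 q.2))
      exact ⟨⟨r, (CurvePoint.liesAt_map φ _ _).1
        (hr ▸ (CurvePoint.liesAt_map _ _ _).2 ((CurvePoint.liesAt_map _ _ _).2 q.2))⟩, hr⟩
    choose r hr using hex
    have hrinj : Injective r := fun q q' h => by
      have h1 := (hr q).symm.trans ((congrArg (fun r => r.1.map φ) h).trans (hr q'))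
      exact Subtype.ext (CurvePoint.map_injective φ (CurvePoint.map_injective _ h1))
    rw [hH, Polynomial.map_prod]
    refine Fintype.prod_bijective r (Finite.injective_iff_bijective.1 hrinj) _ _ fun q => ?_
    rw [Polynomial.map_sub, map_X, map_C]
    congr 2
    have hu := congrArg (fun x => CurvePoint.uval x c) (hr q)
    have hv := congrArg (fun x => CurvePoint.vval x c) (hr q)
    simp only [CurvePoint.uval_map, CurvePoint.vval_map] at hu hv
    simp only [map_add, map_mul, map_intCast]
    rw [hu, hv]
    rfl
  have hcoef : ∀ k, ∃ x, algebraMap K Ω x = H.coeff k := fun k => by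
    have h1 : H.coeff k ∈ (⊥ : IntermediateField K Ω) :=
      (InfiniteGalois.mem_bot_iff_fixed _).2 fun σ => by
        conv_rhs => rw [← hfix σ]
        rw [coeff_map]
        rfl
    exact IntermediateField.mem_bot.1 h1
  obtain ⟨G, hG⟩ : ∃ G : K[X], G.map (algebraMap K Ω) = H := by
    have : H ∈ Polynomial.lifts (algebraMap K Ω) := by
      rw [lifts_iff_coeff_lifts]
      exact fun k => hcoef k
    exact (mem_lifts _).1 this
  refine ⟨G, Polynomial.map_injective (algebraMap L Ω) (algebraMap L Ω).injective ?_⟩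
  rw [Polynomial.map_map, ← IsScalarTower.algebraMap_eq, hG, hH, Polynomial.map_prod]
  refine prod_congr rfl fun q _ => ?_
  rw [Polynomial.map_sub, map_X, map_C]
  rfl

end Rational

end Universal

end PointsOver

/-! ### Finite places and quotients of orders -/

section Places

variable {L : Type v} [Field L] [NumberField L]

lemma isNonarchimedean_finitePlace (w : FinitePlace L) : IsNonarchimedean w.1 := w.add_le

lemma finitePlace_int_le_one (w : FinitePlace L) (x : 𝓞 L) : w x ≤ 1 := by
  rw [← w.norm_embedding_eq]
  exact FinitePlace.norm_le_one L w.maximalIdeal x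

lemma finitePlace_int_lt_one_iff (w : FinitePlace L) (x : 𝓞 L) :
    w x < 1 ↔ x ∈ w.maximalIdeal.asIdeal := by
  rw [← w.norm_embedding_eq]
  exact FinitePlace.norm_lt_one_iff_mem L w.maximalIdeal x

lemma finitePlace_int_eq_one_iff (w : FinitePlace L) (x : 𝓞 L) :
    w x = 1 ↔ x ∉ w.maximalIdeal.asIdeal := by
  rw [← w.norm_embedding_eq]
  exact FinitePlace.norm_eq_one_iff_notMem L w.maximalIdeal x

lemma finitePlace_le_one_iff (w : FinitePlace L) (x : L) :
    w x ≤ 1 ↔ w.maximalIdeal.valuation L x ≤ 1 := by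
  rw [← w.norm_embedding_eq, FinitePlace.norm_embedding', ← NNReal.coe_one, NNReal.coe_le_coe,
    ← map_one (WithZeroMulInt.toNNReal _)]
  exact (WithZeroMulInt.toNNReal_strictMono (HeightOneSpectrum.one_lt_absNorm_nnreal _)).le_iff_le

lemma exists_mul_eq_of_finitePlace_le_one (w : FinitePlace L) {x : L} (hx : w x ≤ 1) :
    ∃ a s : 𝓞 L, s ∉ w.maximalIdeal.asIdeal ∧ (s : L) * x = a := by
  obtain ⟨a, s, h⟩ := w.maximalIdeal.exists_primeCompl_mul_eq_of_integer x
    ((finitePlace_le_one_iff w x).1 hx)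
  exact ⟨a, s, s.2, (mul_comm _ _).trans h⟩

lemma exists_eq_inv_pow_absNorm (w : FinitePlace L) {z : L} (hz0 : z ≠ 0) (hz : w z ≤ 1) :
    ∃ n : ℕ, w z = ((w.maximalIdeal.asIdeal.absNorm : ℝ) ^ n)⁻¹ ∧
      ∀ b : 𝓞 L, b ∈ w.maximalIdeal.asIdeal ^ n ↔ w b ≤ w z := by
  obtain ⟨a, s, hs, h⟩ := exists_mul_eq_of_finitePlace_le_one w hz
  have hs1 := (finitePlace_int_eq_one_iff w s).2 hs
  have hwz : w z = w a := by rw [← h, map_mul, hs1, one_mul]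
  have ha : a ≠ 0 := by
    rintro rfl
    rw [hwz] at hz
    have h1 : w z = 0 := by rw [hwz]; simp
    exact hz0 ((map_eq_zero w).1 h1)
  have key : ∀ b : 𝓞 L, b ≠ 0 → w b = ((w.maximalIdeal.asIdeal.absNorm : ℝ) ^
      multiplicity w.maximalIdeal.asIdeal (span {b}))⁻¹ := fun b hb =>
    eq_inv_of_mul_eq_one_left (FinitePlace.apply_mul_absNorm_pow_eq_one w hb)
  have hN : (1 : ℝ) < w.maximalIdeal.asIdeal.absNorm := by exact_mod_cast HeightOneSpectrum.one_lt_absNorm _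
  refine ⟨_, hwz.trans (key a ha), fun b => ?_⟩
  by_cases hb : b = 0
  · subst hb
    simp
  · have hfin : FiniteMultiplicity w.maximalIdeal.asIdeal (span {b}) :=
      FiniteMultiplicity.of_prime_left w.maximalIdeal.prime
        (by rwa [Ne, Ideal.zero_eq_bot, Ideal.span_singleton_eq_bot])
    rw [hwz, key a ha, key b hb, inv_le_inv₀ (by positivity) (by positivity),
      pow_le_pow_iff_right₀ hN, ← Ideal.dvd_span_singleton, hfin.pow_dvd_iff_le_multiplicity]

end Places

/-! ### Subrings of a number field and the places that are nonnegative on them -/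

section Orders

variable {L : Type v} [Field L] [NumberField L]

/-- The places which are nonnegative on a subring. -/
def placesOf (A : Subring L) : Set (FinitePlace L) := {w | ∀ a ∈ A, w a ≤ 1}

/-- The subalgebra generated by the algebraic integers. -/
def adjoinIntegers (A : Subring L) : Subalgebra A L :=
  Algebra.adjoin A (Set.range fun i => (RingOfIntegers.basis L i : L))

variable {A : Subring L}

lemma coe_mem_adjoinIntegers (x : 𝓞 L) : (x : L) ∈ adjoinIntegers A := by
  rw [← (RingOfIntegers.basis L).sum_repr x, RingOfIntegers.coe_eq_algebraMap, map_sum]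
  refine sum_mem fun i _ => ?_
  rw [zsmul_eq_mul, map_mul, map_intCast]
  exact mul_mem (intCast_mem _ _) (Algebra.subset_adjoin ⟨i, rfl⟩)

lemma fg_adjoinIntegers : (Subalgebra.toSubmodule (adjoinIntegers A)).FG :=
  fg_adjoin_of_finite (Set.finite_range _) (by
    rintro _ ⟨i, rfl⟩
    exact (RingOfIntegers.isIntegral_coe (RingOfIntegers.basis L i)).tower_top)

/-- The ring generated by `A` and the algebraic integers is the intersection of the valuation rings
that contain `A`. If the ideal `D` of denominators of `x` were proper, a maximal ideal above it
would lie over a prime of `𝓞 L`; the place of this prime is nonnegative on `A`, hence on `x`, which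
yields a denominator outside that prime. -/
lemma mem_adjoinIntegers_iff (x : L) :
    x ∈ adjoinIntegers A ↔ ∀ w ∈ placesOf A, w x ≤ 1 := by
  constructor
  · intro hx w hw
    induction hx using Algebra.adjoin_induction with
    | mem x hx =>
      obtain ⟨i, rfl⟩ := hx
      exact finitePlace_int_le_one w _
    | algebraMap a => exact hw a a.2
    | add x y _ _ hx hy => exact (w.add_le x y).trans (max_le hx hy)
    | mul x y _ _ hx hy =>
      rw [map_mul]
      exact mul_le_one₀ hx (apply_nonneg w y) hy
  · intro hx
    set S := adjoinIntegers A
    let D : Ideal S :=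
      { carrier := {d | (d : L) * x ∈ S}
        add_mem' := fun {a b} ha hb => by
          change ((a + b : S) : L) * x ∈ S
          rw [Subalgebra.coe_add, add_mul]
          exact add_mem ha hb
        zero_mem' := by
          change ((0 : S) : L) * x ∈ S
          rw [Subalgebra.coe_zero, zero_mul]
          exact zero_mem _
        smul_mem' := fun c a ha => by
          change ((c * a : S) : L) * x ∈ S
          rw [Subalgebra.coe_mul, mul_assoc]
          exact mul_mem c.2 ha }
    suffices h : D = ⊤ by
      have h1 : (1 : S) ∈ D := by rw [h]; trivial
      have h2 : ((1 : S) : L) * x ∈ S := h1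
      rwa [Subalgebra.coe_one, one_mul] at h2
    by_contra hD
    obtain ⟨𝔐, h𝔐, hle⟩ := Ideal.exists_le_maximal D hD
    let j : 𝓞 L →+* S := (algebraMap (𝓞 L) L).codRestrict S.toSubring coe_mem_adjoinIntegers
    have hj : ∀ a, ((j a : S) : L) = a := fun a => rfl
    by_cases h𝔓 : 𝔐.comap j = ⊥
    · obtain ⟨a, s, hs, hx'⟩ := IsFractionRing.div_surjective (𝓞 L) x
      have hs0 : (s : L) ≠ 0 := by
        rw [RingOfIntegers.coe_eq_algebraMap, Ne, algebraMap_eq_zero_iff]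
        exact nonZeroDivisors.ne_zero hs
      have h1 : j s ∈ D := by
        change (s : L) * x ∈ S
        rw [← hx', ← RingOfIntegers.coe_eq_algebraMap, ← RingOfIntegers.coe_eq_algebraMap,
          mul_div_cancel₀ _ hs0]
        exact coe_mem_adjoinIntegers a
      have h2 : s ∈ 𝔐.comap j := hle h1
      rw [h𝔓, mem_bot] at h2
      exact hs0 (by rw [h2]; rfl)
    · let ν : HeightOneSpectrum (𝓞 L) := ⟨𝔐.comap j, inferInstance, h𝔓⟩
      let w := FinitePlace.mk ν
      have hν : w.maximalIdeal = ν := FinitePlace.maximalIdeal_mk ν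
      -- If `|m|_w > 1` for some `m ∈ A`, write `m⁻¹ = a / s` with `a` in the prime and `s` outside.
      -- Then `s = m * a` lies in the maximal ideal, a contradiction.
      have hw : w ∈ placesOf A := by
        intro m hm
        by_contra hcon
        rw [not_le] at hcon
        have hm0 : m ≠ 0 := by
          rintro rfl
          rw [map_zero] at hcon
          exact absurd hcon (by norm_num)
        have h1 : w m⁻¹ < 1 := by
          rw [map_inv₀]
          exact inv_lt_one_of_one_lt₀ hcon
        obtain ⟨a, s, hs, has⟩ := exists_mul_eq_of_finitePlace_le_one w h1.le
        have ha : a ∈ w.maximalIdeal.asIdeal := by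
          rw [← finitePlace_int_lt_one_iff, ← has, map_mul, (finitePlace_int_eq_one_iff w s).2 hs,
            one_mul]
          exact h1
        rw [hν] at hs ha
        refine hs ?_
        change j s ∈ 𝔐
        have h2 : j s = algebraMap A S ⟨m, hm⟩ * j a := by
          apply Subtype.ext
          change (s : L) = m * a
          rw [← has, mul_left_comm, mul_inv_cancel₀ hm0, mul_one]
        rw [h2]
        exact 𝔐.mul_mem_left _ ha
      obtain ⟨a, s, hs, has⟩ := exists_mul_eq_of_finitePlace_le_one w (hx w hw)
      rw [hν] at hs
      refine hs (hle (show (s : L) * x ∈ S from ?_))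
      rw [has]
      exact coe_mem_adjoinIntegers a

lemma finite_placesOf_ne_one {z : L} (hz0 : z ≠ 0) : {w : FinitePlace L | w z ≠ 1}.Finite :=
  FinitePlace.hasFiniteMulSupport hz0

/-- The index of `zS` in the semilocal ring `S`, as a product over places. -/
lemma relIndex_adjoinIntegers {z : L} (hz0 : z ≠ 0) (hz : z ∈ adjoinIntegers A) :
    (((adjoinIntegers A).toSubring.toAddSubgroup.map (mulLeft z)).relIndex
      (adjoinIntegers A).toSubring.toAddSubgroup : ℝ) =
      ∏ᶠ w ∈ placesOf A, (w z)⁻¹ := by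
  set S := (adjoinIntegers A).toSubring.toAddSubgroup with hS
  have hmemS : ∀ x, x ∈ S ↔ ∀ w ∈ placesOf A, w x ≤ 1 := fun x => mem_adjoinIntegers_iff x
  have hmemz : ∀ x, x ∈ S.map (mulLeft z) ↔ ∀ w ∈ placesOf A, w x ≤ w z := by
    intro x
    constructor
    · rintro ⟨y, hy, rfl⟩ w hw
      rw [coe_mulLeft, map_mul]
      exact mul_le_of_le_one_right (apply_nonneg w z) ((hmemS y).1 hy w hw)
    · intro h
      refine ⟨x / z, (hmemS _).2 fun w hw => ?_, ?_⟩
      · rw [map_div₀]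
        exact div_le_one_of_le₀ (h w hw) (apply_nonneg w z)
      · rw [coe_mulLeft, mul_div_cancel₀ _ hz0]
  have hTfin : {w | w ∈ placesOf A ∧ w z ≠ 1}.Finite :=
    (finite_placesOf_ne_one hz0).subset fun w hw => hw.2
  have hzW : ∀ w ∈ placesOf A, w z ≤ 1 := (hmemS z).1 hz
  set T := hTfin.toFinset with hT
  have hTmem : ∀ w, w ∈ T ↔ w ∈ placesOf A ∧ w z ≠ 1 := fun w => by rw [hT]; simp
  choose! n hn hnmem using fun w (hw : w ∈ placesOf A) => exists_eq_inv_pow_absNorm w hz0 (hzW w hw)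
  let 𝔞 : Ideal (𝓞 L) := ∏ w ∈ T, w.maximalIdeal.asIdeal ^ n w
  have h𝔞mem : ∀ b, b ∈ 𝔞 ↔ ∀ w ∈ T, w b ≤ w z := by
    intro b
    have h1 : 𝔞 = ⨅ w ∈ T, w.maximalIdeal.asIdeal ^ n w := by
      rw [← Finset.inf_eq_iInf]
      exact (IsDedekindDomain.inf_pow_eq_prod_of_prime T (fun w => w.maximalIdeal.asIdeal) n
        (fun w _ => w.maximalIdeal.prime) (fun w _ w' _ h h' => h
          (FinitePlace.maximalIdeal_injective (HeightOneSpectrum.ext h')))).symm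
    rw [h1]
    simp only [Submodule.mem_iInf]
    exact forall₂_congr fun w hw => hnmem w ((hTmem w).1 hw).1 b
  -- Modulo `z S`, each `x ∈ S` is represented by an algebraic integer. Its denominators are prime
  -- to `𝔞`, so `1 = d + e` with `d x` integral and `e ∈ 𝔞`, that is, `e x ∈ z S`. Thus `S / z S` is
  -- `𝓞 L / 𝔞`.
  have hsup : S = (algebraMap (𝓞 L) L).toAddMonoidHom.range ⊔ S.map (mulLeft z) := by
    apply le_antisymm
    · intro x hx
      let 𝔡 : Ideal (𝓞 L) :=
        { carrier := {d | ∃ a : 𝓞 L, (d : L) * x = a}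
          add_mem' := by
            rintro a b ⟨a', ha⟩ ⟨b', hb⟩
            exact ⟨a' + b', by push_cast; rw [add_mul, ha, hb]⟩
          zero_mem' := ⟨0, by simp⟩
          smul_mem' := by
            rintro c a ⟨a', ha⟩
            exact ⟨c * a', by rw [smul_eq_mul]; push_cast; rw [mul_assoc, ha]⟩ }
      have hcop : 𝔡 ⊔ 𝔞 = ⊤ := by
        by_contra hcon
        obtain ⟨𝔓, h𝔓, hle⟩ := Ideal.exists_le_maximal _ hcon
        obtain ⟨w, hw, hwle⟩ := (Ideal.IsPrime.prod_le h𝔓.isPrime).1 (le_sup_right.trans hle)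
        have h1 : w.maximalIdeal.asIdeal = 𝔓 := w.maximalIdeal.isMaximal.eq_of_le h𝔓.ne_top
            (Ideal.IsPrime.le_of_pow_le (hP := h𝔓.isPrime) hwle)
        obtain ⟨a, s, hs, has⟩ := exists_mul_eq_of_finitePlace_le_one w
          ((hmemS x).1 hx w ((hTmem w).1 hw).1)
        refine hs (h1 ▸ hle (Ideal.mem_sup_left (show s ∈ 𝔡 from ⟨a, has⟩)))
      obtain ⟨d, ⟨y, hy⟩, e, he, hde⟩ := Submodule.mem_sup.1
        ((Ideal.eq_top_iff_one _).1 hcop)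
      refine AddSubgroup.mem_sup.2 ⟨y, ⟨y, rfl⟩, e * x, ?_, ?_⟩
      · rw [hmemz]
        intro w hw
        rw [map_mul]
        by_cases hwT : w ∈ T
        · exact (mul_le_of_le_one_right (apply_nonneg w _) ((hmemS x).1 hx w hw)).trans
            ((h𝔞mem e).1 he w hwT)
        · have : w z = 1 := by
            by_contra hne
            exact hwT ((hTmem w).2 ⟨hw, hne⟩)
          rw [this]
          exact mul_le_one₀ (finitePlace_int_le_one w e) (apply_nonneg w _) ((hmemS x).1 hx w hw)
      · rw [← hy, ← add_mul]
        have := congrArg (fun x : 𝓞 L => (x : L)) hde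
        push_cast at this
        rw [this, one_mul]
    · refine sup_le ?_ ?_
      · rintro _ ⟨a, rfl⟩
        exact coe_mem_adjoinIntegers a
      · intro x hx
        rw [hmemz] at hx
        exact (hmemS x).2 fun w hw => (hx w hw).trans (hzW w hw)
  have hidx : (S.map (mulLeft z)).relIndex S = absNorm 𝔞 := by
    have h0 := AddSubgroup.relIndex_sup_right (algebraMap (𝓞 L) L).toAddMonoidHom.range
      (S.map (mulLeft z))
    rw [← hsup] at h0
    rw [h0, ← AddSubgroup.index_comap]
    have : (S.map (mulLeft z)).comap (algebraMap (𝓞 L) L).toAddMonoidHom = 𝔞.toAddSubgroup := by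
      ext b
      change (b : L) ∈ S.map (mulLeft z) ↔ b ∈ 𝔞
      rw [hmemz, h𝔞mem]
      refine ⟨fun h w hw => h w ((hTmem w).1 hw).1, fun h w hw => ?_⟩
      by_cases hwT : w ∈ T
      · exact h w hwT
      · have : w z = 1 := by
          by_contra hne
          exact hwT ((hTmem w).2 ⟨hw, hne⟩)
        rw [this]
        exact finitePlace_int_le_one w b
    rw [this]
    rfl
  rw [hidx, map_prod, Nat.cast_prod, finprod_mem_def, finprod_eq_prod_of_mulSupport_subset (s := T)]
  · refine prod_congr rfl fun w hw => ?_
    have hw' := ((hTmem w).1 hw).1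
    rw [Set.mulIndicator_of_mem hw', map_pow, Nat.cast_pow, hn w hw', inv_inv]
  · intro w hw
    classical
    rw [Function.mem_mulSupport, Set.mulIndicator_apply] at hw
    split_ifs at hw with h
    · exact (hTmem w).2 ⟨h, fun h1 => hw (by rw [h1, inv_one])⟩
    · exact absurd rfl hw

end Orders

/-! ### The length of a quotient of an order -/

section Orders

/-- The index of `φ N` in `M` is computed through `φ M` and through `N`; the factor `[M : N] = [φ M
: φ N]` cancels. It allows `adjoinIntegers A` to be replaced by a free `A`-module of finite index.
-/
lemma relIndex_map_eq_of_injective {G : Type*} [AddCommGroup G] {φ : G →+ G}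
    (hφ : Injective φ) {N M : AddSubgroup G} (hNM : N ≤ M) (hN : N.map φ ≤ N)
    (hM : M.map φ ≤ M) (h0 : N.relIndex M ≠ 0) :
    (M.map φ).relIndex M = (N.map φ).relIndex N := by
  have h1 := AddSubgroup.relIndex_mul_relIndex (N.map φ) (M.map φ) M (AddSubgroup.map_mono hNM) hM
  have h2 := AddSubgroup.relIndex_mul_relIndex (N.map φ) N M hN hNM
  rw [AddSubgroup.relIndex_map_map_of_injective _ _ hφ, ← h2, mul_comm] at h1
  exact mul_right_cancel₀ h0 h1

lemma exists_smul_mem_of_fg {A V : Type*} [CommRing A] [IsDomain A] [AddCommGroup V] [Module A V]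
    {T N : Submodule A V} (hT : T.FG) (h : ∀ x ∈ T, ∃ s : A, s ≠ 0 ∧ s • x ∈ N) :
    ∃ c : A, c ≠ 0 ∧ ∀ x ∈ T, c • x ∈ N := by
  induction T, hT using Submodule.fg_induction with
  | singleton x =>
    obtain ⟨s, hs, hsx⟩ := h x (Submodule.mem_span_singleton_self x)
    refine ⟨s, hs, fun y hy => ?_⟩
    obtain ⟨r, rfl⟩ := Submodule.mem_span_singleton.1 hy
    rw [smul_comm]
    exact N.smul_mem r hsx
  | sup T₁ T₂ h₁ h₂ ih₁ ih₂ =>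
    obtain ⟨c₁, hc₁, H₁⟩ := ih₁ fun x hx => h x (Submodule.mem_sup_left hx)
    obtain ⟨c₂, hc₂, H₂⟩ := ih₂ fun x hx => h x (Submodule.mem_sup_right hx)
    refine ⟨c₁ * c₂, mul_ne_zero hc₁ hc₂, fun x hx => ?_⟩
    obtain ⟨y, hy, z, hz, rfl⟩ := Submodule.mem_sup.1 hx
    rw [smul_add]
    refine N.add_mem ?_ ?_
    · rw [mul_comm, mul_smul]
      exact N.smul_mem _ (H₁ y hy)
    · rw [mul_smul]
      exact N.smul_mem _ (H₂ z hz)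

lemma index_map_smul_pi {A ι : Type*} [CommRing A] [Fintype ι] (z : A) :
    ((⊤ : AddSubgroup (ι → A)).map (mulLeft (fun _ => z))).index =
      Nat.card (A ⧸ span {z}) ^ card ι := by
  have h : (⊤ : AddSubgroup (ι → A)).map (mulLeft (fun _ => z)) =
      (Ideal.pi fun _ : ι => span {z}).toAddSubgroup := by
    ext x
    simp only [AddSubgroup.mem_map, AddSubgroup.mem_top, true_and, Submodule.mem_toAddSubgroup,
      Ideal.mem_pi, Ideal.mem_span_singleton']
    constructor
    · rintro ⟨y, rfl⟩ i
      exact ⟨y i, mul_comm _ _⟩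
    · intro H
      choose y hy using H
      exact ⟨y, funext fun i => (mul_comm _ _).trans (hy i)⟩
  rw [h]
  have := Nat.card_congr ((span {z}).piQuotEquiv ι).toEquiv
  rw [Nat.card_pi, prod_const, card_univ] at this
  exact this

variable {L : Type v} [Field L] [NumberField L] {E : Type*} [Field E] [Algebra E L]

/-- Counting a quotient of an order of a number field `E` by the places of an extension `L`. -/
theorem card_quotient_pow_finrank (A : Subring L) (hA : ∀ a : A, ∃ e : E, algebraMap E L e = a)
    (hfrac : ∀ e : E, ∃ a s : A, s ≠ 0 ∧ (s : L) * algebraMap E L e = a) {z : A} (hz : z ≠ 0) :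
    (Nat.card (A ⧸ span {z}) : ℝ) ^ finrank E L = ∏ᶠ w ∈ placesOf A, (w z)⁻¹ := by
  have hchar : CharZero E := ⟨fun m n h => Nat.cast_injective (R := L) (by
    rw [← map_natCast (algebraMap E L), h, map_natCast])⟩
  have hfin : Module.Finite E L := of_restrictScalars_finite ℚ E L
  have hz0 : (z : L) ≠ 0 := fun h => hz (Subtype.ext h)
  have hzS : (z : L) ∈ adjoinIntegers A := Subalgebra.algebraMap_mem _ z
  rw [← relIndex_adjoinIntegers hz0 hzS]
  set S := (adjoinIntegers A).toSubring.toAddSubgroup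
  have hmz : ∀ {y : A}, y ≠ 0 → Injective (mulLeft (y : L)) := fun hy =>
    mul_right_injective₀ fun h => hy (Subtype.ext h)
  have hSpos : ∀ {y : A}, y ≠ 0 → (S.map (mulLeft (y : L))).relIndex S ≠ 0 := by
    intro y hy h
    have hy0 : (y : L) ≠ 0 := fun h => hy (Subtype.ext h)
    have h1 := relIndex_adjoinIntegers hy0 (Subalgebra.algebraMap_mem (adjoinIntegers A) y)
    rw [show (AddSubgroup.relIndex _ _) = 0 from h, Nat.cast_zero] at h1
    refine absurd h1.symm (finprod_mem_induction (fun x : ℝ => x ≠ 0) one_ne_zero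
      (fun x y => mul_ne_zero) fun w _ => inv_ne_zero ((map_ne_zero w).2 hy0))
  -- A basis of `L` over `E`, scaled to consist of algebraic integers, spans a free `A`-module `N`
  -- inside `S`.
  let b₀ := finBasis E L
  have halg : Algebra.IsAlgebraic ℤ L := (IsFractionRing.comap_isAlgebraic_iff (K := ℚ)).2 inferInstance
  choose m hm0 hm using fun i => (halg.isAlgebraic (b₀ i)).exists_integral_multiple
  have hmE : ∀ i, ((m i : ℤ) : E) ≠ 0 := fun i => Int.cast_ne_zero.2 (hm0 i)
  let b := b₀.unitsSMul fun i => Units.mk0 ((m i : ℤ) : E) (hmE i)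
  have hb : ∀ i, b i ∈ S := by
    intro i
    have h1 : b i = m i • b₀ i := by
      rw [Module.Basis.unitsSMul_apply, Units.smul_def, Units.val_mk0, Algebra.smul_def,
        map_intCast, zsmul_eq_mul]
    rw [h1]
    exact coe_mem_adjoinIntegers (⟨_, hm i⟩ : 𝓞 L)
  let ψ : (Fin (finrank E L) → A) →ₗ[A] L := Fintype.linearCombination A b
  have hψ : ∀ x, ψ x = ∑ i, (x i : L) * b i := fun x => rfl
  choose ιA hιA using hA
  have hψinj : Injective ψ.toAddMonoidHom := by
    rw [injective_iff_map_eq_zero]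
    intro x hx
    have h1 : ∑ i, ιA (x i) • b i = 0 := by
      rw [← hx]
      change _ = ψ x
      rw [hψ]
      exact sum_congr rfl fun i _ => by rw [Algebra.smul_def, hιA]
    funext i
    have h2 := (Fintype.linearIndependent_iff.1 b.linearIndependent) _ h1 i
    apply Subtype.ext
    rw [← hιA, h2, map_zero]
    rfl
  set N := (⊤ : AddSubgroup (Fin (finrank E L) → A)).map ψ.toAddMonoidHom with hN
  have hNmem : ∀ y, y ∈ N ↔ y ∈ LinearMap.range ψ := by
    intro y
    rw [hN, AddSubgroup.mem_map]
    simp [LinearMap.mem_range]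
  have hNS : N ≤ S := by
    rintro _ ⟨x, -, rfl⟩
    change ψ x ∈ adjoinIntegers A
    rw [hψ]
    exact sum_mem fun i _ => mul_mem (Subalgebra.algebraMap_mem _ _) (hb i)
  -- Since `S` is finitely generated, a single nonzero `c` satisfies `c S ⊆ N`; as `c S` has finite
  -- index in `S`, so does `N`.
  obtain ⟨c, hc0, hc⟩ := exists_smul_mem_of_fg (N := LinearMap.range ψ)
    (fg_adjoinIntegers (A := A)) (by
      intro x _
      choose a s hs0 hs using hfrac
      refine ⟨∏ i, s (b.repr x i), Finset.prod_ne_zero_iff.2 fun i _ => hs0 _,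
        fun i => (∏ j ∈ Finset.univ.erase i, s (b.repr x j)) * a (b.repr x i), ?_⟩
      rw [hψ]
      conv_rhs => rw [← congrArg (_ • ·) (b.sum_repr x), Finset.smul_sum]
      refine sum_congr rfl fun i _ => ?_
      rw [← Finset.prod_erase_mul _ _ (mem_univ i), mul_smul, Algebra.smul_def (b.repr x i),
        Subring.coe_mul, ← hs, Subring.smul_def, Subring.smul_def, smul_eq_mul, smul_eq_mul]
      ring)
  have hNz : N.map (mulLeft (z : L)) = (((⊤ : AddSubgroup (Fin (finrank E L) → A)).map
        (mulLeft (fun _ => z))).map ψ.toAddMonoidHom) := by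
    rw [hN, AddSubgroup.map_map, AddSubgroup.map_map]
    refine congrArg (fun φ => AddSubgroup.map φ _) (AddMonoidHom.ext fun x => ?_)
    change (z : L) * ψ x = ψ (z • x)
    rw [map_smul]
    rfl
  rw [relIndex_map_eq_of_injective (hmz hz) hNS, hNz, hN,
    AddSubgroup.relIndex_map_map_of_injective _ _ hψinj, AddSubgroup.relIndex_top_right,
    index_map_smul_pi, card_fin, Nat.cast_pow]
  · rw [hNz]
    exact AddSubgroup.map_mono le_top
  · rintro _ ⟨x, hx, rfl⟩
    exact (adjoinIntegers A).mul_mem hzS hx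
  · refine fun h => hSpos hc0 (Nat.eq_zero_of_zero_dvd (h ▸ AddSubgroup.relIndex_dvd_of_le_left S ?_))
    rintro _ ⟨x, hx, rfl⟩
    exact (hNmem _).2 (hc x hx)

end Orders

/-! ### Lengths over local rings -/

section Length

lemma length_and_card_of_finite {R : Type*} [CommRing R] [IsLocalRing R] {M : Type*}
    [AddCommGroup M] [Module R M] [Finite M] :
    Module.length R M ≠ ⊤ ∧
      Nat.card M = Nat.card (IsLocalRing.ResidueField R) ^ (Module.length R M).toNat := by
  have hfl : IsFiniteLength R M := isFiniteLength_iff_isNoetherian_isArtinian.2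
    ⟨inferInstance, inferInstance⟩
  refine ⟨Module.length_ne_top_iff.2 hfl, ?_⟩
  induction hfl with
  | of_subsingleton =>
    rw [Module.length_eq_zero, ENat.toNat_zero, pow_zero, Nat.card_unique]
  | @of_simple_quotient M _ _ N hs hN ih =>
    have h1 := Module.length_eq_add_of_exact N.subtype N.mkQ N.injective_subtype
      N.mkQ_surjective (LinearMap.exact_subtype_mkQ N)
    obtain ⟨𝔪, h𝔪, ⟨e⟩⟩ := isSimpleModule_iff_quot_maximal.1 hs
    obtain rfl := IsLocalRing.eq_maximalIdeal h𝔪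
    rw [h1, Module.length_eq_one R (_ ⧸ N), ENat.toNat_add (Module.length_ne_top_iff.2 hN) (by simp),
      pow_add, ENat.toNat_one, pow_one, ← ih, Submodule.card_eq_card_quotient_mul_card N, Nat.card_congr e.toEquiv]
    rfl

variable {R : Type*} [CommRing R]

/-- The length of `R / (a, b)`. -/
def interLength (a b : R) : ℕ∞ := Module.length R (R ⧸ (span {a} ⊔ span {b}))

lemma interLength_comm (a b : R) : interLength a b = interLength b a := by
  rw [interLength, interLength, sup_comm]

lemma interLength_one_left (b : R) : interLength 1 b = 0 := by
  rw [interLength, Ideal.span_singleton_one, top_sup_eq, Module.length_eq_zero_iff]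
  exact Ideal.Quotient.subsingleton_iff.2 rfl

/-- Multiplication by `a` gives an exact sequence `0 → R / (b, c) → R / (a b, c) → R / (a, c) → 0`;
it is injective because `a` is a non-zero-divisor modulo `c`. -/
lemma interLength_mul {a c : R} (b : R) (hac : ∀ x, c ∣ a * x → c ∣ x) :
    interLength (a * b) c = interLength a c + interLength b c := by
  have hmem : ∀ y x : R, x ∈ (span {y} ⊔ span {c} : Ideal R) ↔ ∃ r t, x = y * r + c * t := by
    intro y x
    rw [Submodule.mem_sup]
    constructor
    · rintro ⟨_, h1, _, h2, rfl⟩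
      obtain ⟨r, rfl⟩ := mem_span_singleton.1 h1
      obtain ⟨t, rfl⟩ := mem_span_singleton.1 h2
      grind
    · rintro ⟨r, t, rfl⟩
      exact ⟨_, mem_span_singleton.2 ⟨r, rfl⟩, _, mem_span_singleton.2 ⟨t, rfl⟩, rfl⟩
  let F : (R ⧸ (span {b} ⊔ span {c})) →ₗ[R]
      (R ⧸ (span {a * b} ⊔ span {c})) :=
    mapQ _ _ (LinearMap.mulLeft R a) (by
      intro x hx
      obtain ⟨r, t, rfl⟩ := (hmem _ _).1 hx
      refine (hmem _ _).2 ⟨r, a * t, ?_⟩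
      rw [LinearMap.mulLeft_apply]
      ring)
  let G : (R ⧸ (span {a * b} ⊔ span {c})) →ₗ[R]
      (R ⧸ (span {a} ⊔ span {c})) :=
    mapQ _ _ LinearMap.id (by
      intro x hx
      obtain ⟨r, t, rfl⟩ := (hmem _ _).1 hx
      exact (hmem _ _).2 ⟨b * r, t, by ring⟩)
  have hF : Injective F := by
    rw [injective_iff_map_eq_zero]
    intro x hx
    obtain ⟨x, rfl⟩ := Submodule.Quotient.mk_surjective _ x
    rw [mapQ_apply, Submodule.Quotient.mk_eq_zero, LinearMap.mulLeft_apply] at hx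
    obtain ⟨r, t, h⟩ := (hmem _ _).1 hx
    obtain ⟨s, hs⟩ := hac (x - b * r) ⟨t, by grind⟩
    rw [Submodule.Quotient.mk_eq_zero]
    exact (hmem _ _).2 ⟨r, s, by grind⟩
  have hG : Surjective G := by
    intro x
    obtain ⟨x, rfl⟩ := Submodule.Quotient.mk_surjective _ x
    exact ⟨Submodule.Quotient.mk x, rfl⟩
  have hFG : Function.Exact F G := by
    intro x
    obtain ⟨x, rfl⟩ := Submodule.Quotient.mk_surjective _ x
    rw [mapQ_apply, Submodule.Quotient.mk_eq_zero, LinearMap.id_apply, hmem]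
    constructor
    · rintro ⟨r, t, rfl⟩
      refine ⟨Submodule.Quotient.mk r, ?_⟩
      rw [mapQ_apply, Submodule.Quotient.eq, hmem, LinearMap.mulLeft_apply]
      exact ⟨0, -t, by ring⟩
    · rintro ⟨y, hy⟩
      obtain ⟨y, rfl⟩ := Submodule.Quotient.mk_surjective _ y
      rw [mapQ_apply, Submodule.Quotient.eq, hmem, LinearMap.mulLeft_apply] at hy
      obtain ⟨r, t, h⟩ := hy
      exact ⟨y - b * r, -t, by grind⟩
  rw [interLength, Module.length_eq_add_of_exact F G hF hG hFG, add_comm]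
  rfl

lemma interLength_prod_pow [IsDomain R] [UniqueFactorizationMonoid R] {ι : Type*} (s : Finset ι)
    (n : ι → ℕ) {a : ι → R} {c : R} (h : ∀ i ∈ s, IsRelPrime (a i) c) :
    interLength (∏ i ∈ s, a i ^ n i) c = ∑ i ∈ s, n i * interLength (a i) c := by
  classical
  have hpow : ∀ x, IsRelPrime x c → ∀ n : ℕ, interLength (x ^ n) c = n * interLength x c := by
    intro x hx n
    induction n with
    | zero => rw [pow_zero, interLength_one_left, Nat.cast_zero, zero_mul]
    | succ n ih =>
      rw [pow_succ', interLength_mul _ fun y hy => hx.symm.dvd_of_dvd_mul_left hy, ih]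
      grind
  induction s using Finset.induction_on with
  | empty => rw [Finset.prod_empty, Finset.sum_empty, interLength_one_left]
  | insert i s hi ih =>
    rw [prod_insert hi, Finset.sum_insert hi, interLength_mul, hpow _ (h i (by simp)),
      ih fun j hj => h j (Finset.mem_insert_of_mem hj)]
    exact fun y hy => (IsRelPrime.pow_left (h i (by simp))).symm.dvd_of_dvd_mul_left hy

lemma interLength_prod_pow_prod_pow [IsDomain R] [UniqueFactorizationMonoid R] {ι κ : Type*}
    (s : Finset ι) (t : Finset κ) (n : ι → ℕ) (m : κ → ℕ) {a : ι → R} {c : κ → R}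
    (h : ∀ i ∈ s, ∀ j ∈ t, IsRelPrime (a i) (c j)) :
    interLength (∏ i ∈ s, a i ^ n i) (∏ j ∈ t, c j ^ m j) =
      ∑ i ∈ s, ∑ j ∈ t, n i * (m j * interLength (a i) (c j)) := by
  rw [interLength_prod_pow s n fun i hi => IsRelPrime.prod_right fun j hj =>
    IsRelPrime.pow_right (h i hi j hj)]
  refine sum_congr rfl fun i hi => ?_
  rw [← mul_sum, interLength_comm, interLength_prod_pow t m fun j hj => (h i hi j hj).symm]
  simp only [interLength_comm (a i)]

/-- The quotient `R / (a, c)` is the quotient of the image of `ψ` by the value of `a`, so it is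
finite and its length can be read off from its cardinality. -/
lemma interLength_of_range {L : Type*} [CommRing L] [IsLocalRing R] (ψ : R →+* L) {a c : R}
    (hker : ker ψ = span {c})
    (hfin : Nat.card (ψ.range ⧸ span {ψ.rangeRestrict a}) ≠ 0) :
    interLength a c ≠ ⊤ ∧ Nat.card (ψ.range ⧸ span {ψ.rangeRestrict a}) =
        Nat.card (IsLocalRing.ResidueField R) ^ (interLength a c).toNat := by
  have e : (R ⧸ (span {a} ⊔ span {c})) ≃ ψ.range ⧸ span {ψ.rangeRestrict a} := by
    let φ : R →+* ψ.range ⧸ span {ψ.rangeRestrict a} := (Ideal.Quotient.mk _).comp ψ.rangeRestrict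
    have hφ : Surjective φ := mk_surjective.comp ψ.rangeRestrict_surjective
    have hφk : ker φ = span {a} ⊔ span {c} := by
      rw [← comap_ker, mk_ker, ← Set.image_singleton, ← map_span,
        Ideal.comap_map_of_surjective _ ψ.rangeRestrict_surjective, ← hker]
      congr 1
      ext x
      rw [mem_comap, mem_bot, mem_ker, ← Subtype.coe_inj]
      rfl
    rw [← hφk]
    exact (RingHom.quotientKerEquivOfSurjective hφ).toEquiv
  have hf := Nat.finite_of_card_ne_zero hfin
  have hf' : Finite (R ⧸ (span {a} ⊔ span {c})) := Finite.of_equiv _ e.symm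
  rw [← Nat.card_congr e]
  exact length_and_card_of_finite

end Length

/-! ### Germs of the model at points of the curve -/

section Germs

lemma exists_ringHom_extension {A R L : Type*} [CommRing A] [CommRing R] [Field L]
    {κ : A →+* R} (hκ : Injective κ) (e : A →+* L)
    (h : ∀ r, ∃ a s, e s ≠ 0 ∧ κ s * r = κ a) : ∃ ψ : R →+* L, ψ.comp κ = e := by
  choose a s hs has using h
  have key : ∀ r b t, e t ≠ 0 → κ t * r = κ b → e (a r) / e (s r) = e b / e t := by
    intro r b t ht hb
    rw [div_eq_div_iff (hs r) ht, ← map_mul, ← map_mul]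
    congr 1
    apply hκ
    rw [map_mul, map_mul, ← has, ← hb]
    ring
  have he0 : (1 : L) ≠ 0 := one_ne_zero
  refine ⟨{ toFun := fun r => e (a r) / e (s r)
            map_one' := ?_
            map_mul' := fun r r' => ?_
            map_zero' := ?_
            map_add' := fun r r' => ?_ }, RingHom.ext fun b => ?_⟩
  · rw [key 1 1 1 (by rwa [map_one]) (by simp), map_one, div_one]
  · rw [key (r * r') (a r * a r') (s r * s r') (by rw [map_mul]; exact mul_ne_zero (hs r) (hs r'))
      (by rw [map_mul, map_mul, ← has, ← has]; ring), map_mul, map_mul, div_mul_div_comm]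
  · rw [key 0 0 1 (by rwa [map_one]) (by simp), map_zero, zero_div]
  · rw [key (r + r') (a r * s r' + s r * a r') (s r * s r')
      (by rw [map_mul]; exact mul_ne_zero (hs r) (hs r'))
      (by rw [map_mul, map_add, map_mul, map_mul, ← has, ← has]; ring), map_add, map_mul, map_mul,
      map_mul, div_add_div _ _ (hs r) (hs r')]
  · change e (a (κ b)) / e (s (κ b)) = e b
    rw [key (κ b) b 1 (by rwa [map_one]) (by simp), map_one, div_one]

variable (hf : IsSeparableForm f) {X : Scheme.{u}} (π : X ⟶ naiveModel f)

include hf in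
lemma chart_transition_bool (c : Bool) {V : Type u} [CommRing V] (e : ChartRing f c →+* V)
    (e' : ChartRing f (!c) →+* V) (hC : e.comp (chartC f c) = e'.comp (chartC f (!c)))
    (hu : e (coordU f c) * e' (coordU f (!c)) = 1)
    (hv : e (coordV f c) = e (coordU f c) ^ (g + 1) * e' (coordV f (!c))) :
    Spec.map (ofHom e) ≫ chartι hf c = Spec.map (ofHom e') ≫ chartι hf (!c) := by
  cases c
  · exact chart_transition hf e e' hC hu hv
  · have hu' : e' (coordU f false) * e (coordU f true) = 1 := (mul_comm _ _).trans hu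
    have hv' : e (coordV f true) = e (coordU f true) ^ (g + 1) * e' (coordV f false) := hv
    refine (chart_transition hf e' e hC.symm hu' ?_).symm
    rw [hv', ← mul_assoc, ← mul_pow, hu', one_pow, one_mul]

variable {c : Bool} {Q : X}

lemma stalkChart_comp_chartC (hQ : π Q ∈ (chartι hf c).opensRange) {c' : Bool}
    (hQ' : π Q ∈ (chartι hf c').opensRange) :
    (stalkChart hf π c Q hQ).comp (chartC f c) = (stalkChart hf π c' Q hQ').comp (chartC f c') := by
  have h : ∀ (c : Bool) (hQ : π Q ∈ (chartι hf c).opensRange),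
      Spec.map (ofHom ((stalkChart hf π c Q hQ).comp (chartC f c))) =
        X.fromSpecStalk Q ≫ π ≫ naiveModelToSpec f := by
    intro c hQ
    rw [ofHom_comp, Spec.map_comp, ← chartι_toSpec hf c, ← assoc, stalkChart_spec, assoc]
  exact congrArg CommRingCat.Hom.hom (Spec.map_injective ((h c hQ).trans (h c' hQ').symm))

lemma isUnit_stalkChart_coordU (hQ : π Q ∈ (chartι hf c).opensRange)
    (hQ' : π Q ∈ (chartι hf (!c)).opensRange) :
    IsUnit (stalkChart hf π c Q hQ (coordU f c)) := by
  have h1 := stalkChart_apply hf π hQ (closedPtStalk Q)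
  rw [fromSpecStalk_closedPtStalk] at h1
  rw [mem_chartι_opensRange_iff, ← h1, mem_chartι_iff hf c _ 1 _ (Xc_mem_grading (!c))] at hQ'
  have h2 : dehom f c (MvPolynomial.X (cIdx (!c))) = coordU f c := by
    cases c <;> simp [dehom, chartCoords, cIdx]
  rw [h2] at hQ'
  by_contra hcon
  exact hQ' ((mem_maximalIdeal _).2 hcon)

/-- The coordinate changes between the charts, in the local rings of a model. -/
lemma stalkChart_transition (hQ : π Q ∈ (chartι hf c).opensRange)
    (hQ' : π Q ∈ (chartι hf (!c)).opensRange) :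
    stalkChart hf π c Q hQ (coordU f c) * stalkChart hf π (!c) Q hQ' (coordU f (!c)) = 1 ∧
      stalkChart hf π c Q hQ (coordV f c) = stalkChart hf π c Q hQ (coordU f c) ^ (g + 1) *
        stalkChart hf π (!c) Q hQ' (coordV f (!c)) := by
  obtain ⟨b, hb⟩ := (isUnit_stalkChart_coordU hf π hQ hQ').exists_right_inv
  set κ := stalkChart hf π c Q hQ with hκ
  set a := κ (coordU f c) with ha
  let φ := κ.comp (chartC f c)
  have hv : (κ (coordV f c) * b ^ (g + 1)) ^ 2 = (affForm f (!c)).eval₂ φ b := by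
    have h1 : κ (coordV f c) ^ 2 = (affForm f c).eval₂ φ a := by
      rw [← map_pow, coordV_sq, hom_eval₂]
    rw [mul_pow, h1, affForm, affForm, eval₂_finsetSum, eval₂_finsetSum, sum_mul]
    refine sum_congr rfl fun i _ => ?_
    rw [eval₂_mul, eval₂_mul, eval₂_C, eval₂_C, eval₂_X_pow, eval₂_X_pow, mul_assoc]
    congr 1
    have hi : (i : ℕ) ≤ 2 * g + 2 := by omega
    have h2 : chartExp g c i + chartExp g (!c) i = 2 * g + 2 := by
      cases c <;> simp [chartExp] <;> omega
    rw [← pow_mul, show (g + 1) * 2 = chartExp g c i + chartExp g (!c) i by omega, pow_add, ← mul_assoc,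
      ← mul_pow, hb, one_pow, one_mul]
  have h1 := chart_transition_bool hf c κ (chartHom (!c) φ b (κ (coordV f c) * b ^ (g + 1)) hv)
    (by rw [chartHom_comp_chartC]) (by rw [chartHom_coordU]; exact hb) (by
      rw [chartHom_coordV, ← ha, mul_left_comm, ← mul_pow, hb, one_pow, mul_one])
  -- The homomorphism built from the expected coordinates defines the same morphism to the naive
  -- model, and lifts to a chart are unique.
  have h2 : stalkChart hf π (!c) Q hQ' = chartHom (!c) φ b (κ (coordV f c) * b ^ (g + 1)) hv :=
    chart_lift_injective hf (!c) _ _ (by rw [← h1, stalkChart_spec, hκ, stalkChart_spec])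
  rw [h2, chartHom_coordU, chartHom_coordV]
  refine ⟨hb, ?_⟩
  rw [mul_left_comm, ← mul_pow, hb, one_pow, mul_one]

/-- `ψ` is evaluation of germs at the curve point `p`. -/
def IsGerm {L : Type v} [Field L] [Algebra K L] (p : CurvePoint f L) (Q : X)
    (ψ : X.presheaf.stalk Q →+* L) : Prop :=
  ∃ (c : Bool) (hQ : π Q ∈ (chartι hf c).opensRange) (hp : p.cval c ≠ 0),
    ψ.comp (stalkChart hf π c Q hQ) = p.chartEval c hp

variable {L : Type v} [Field L] [Algebra K L] {p : CurvePoint f L}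
  {ψ : X.presheaf.stalk Q →+* L}

variable {hf π}

/-- The chart in the definition of `IsGerm` is immaterial: any chart that contains the image of `Q`
will do, and the point `p` then automatically lies in it. -/
lemma IsGerm.comp_stalkChart (h : IsGerm hf π p Q ψ) (c : Bool)
    (hQ : π Q ∈ (chartι hf c).opensRange) :
    ∃ hp : p.cval c ≠ 0, ψ.comp (stalkChart hf π c Q hQ) = p.chartEval c hp := by
  obtain ⟨c', hQ', hp', h'⟩ := h
  by_cases hcc : c = c'
  · subst hcc
    exact ⟨hp', h'⟩
  obtain rfl : c' = !c := by cases c <;> cases c' <;> simp_all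
  obtain ⟨hu, hv⟩ := stalkChart_transition hf π hQ hQ'
  have hU : ψ (stalkChart hf π (!c) Q hQ' (coordU f (!c))) = p.uval (!c) := by
    rw [← chartEval_coordU p (!c) hp', ← h']; rfl
  have hV : ψ (stalkChart hf π (!c) Q hQ' (coordV f (!c))) = p.vval (!c) := by
    rw [← chartEval_coordV p (!c) hp', ← h']; rfl
  have h1 := congrArg ψ hu
  rw [map_mul, hU, map_one] at h1
  have hp : p.cval c ≠ 0 := by
    intro h0
    have : p.uval (!c) = 0 := by
      have h2 : p.oval (!c) = p.cval c := by cases c <;> rfl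
      rw [CurvePoint.uval, h2, h0, zero_div]
    rw [this, mul_zero] at h1
    exact zero_ne_one h1
  have h2 := p.uval_mul_uval c hp hp'
  have h3 : ψ (stalkChart hf π c Q hQ (coordU f c)) = p.uval c :=
    mul_right_cancel₀ (right_ne_zero_of_mul_eq_one h2) (h1.trans h2.symm)
  refine ⟨hp, ChartRing.hom_ext ?_ ?_ ?_⟩
  · rw [RingHom.comp_assoc, stalkChart_comp_chartC hf π hQ hQ', ← RingHom.comp_assoc, h',
      chartEval_comp_chartC, chartEval_comp_chartC]
  · rw [chartEval_coordU]
    exact h3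
  · rw [chartEval_coordV, p.vval_transition c hp hp', RingHom.comp_apply, hv, map_mul,
      map_pow, h3, hV]

lemma IsGerm.of_algHom {M : Type*} [Field M] [Algebra K M] {q : CurvePoint f M} {c : Bool}
    (hQ : π Q ∈ (chartι hf c).opensRange) (h : IsGerm hf π p Q ψ) (hq : q.cval c ≠ 0)
    (φ : L →ₐ[K] M) (hu : φ (p.uval c) = q.uval c) (hv : φ (p.vval c) = q.vval c) :
    IsGerm hf π q Q ((φ : L →+* M).comp ψ) := by
  obtain ⟨hp, h⟩ := h.comp_stalkChart c hQ
  refine ⟨c, hQ, hq, ?_⟩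
  rw [RingHom.comp_assoc, h]
  refine ChartRing.hom_ext ?_ ?_ ?_
  · rw [RingHom.comp_assoc, chartEval_comp_chartC, chartEval_comp_chartC]
    ext x
    simp
  · simpa using hu
  · simpa using hv

variable {l : List (HeightOneSpectrum (𝓞 K))} (hπ : IsBlowupSequence (naiveModelToSpec f) π l)

include hπ in
lemma IsGerm.unique [CharZero L] [Small.{u} L] {ψ' : X.presheaf.stalk Q →+* L}
    (h : IsGerm hf π p Q ψ) (h' : IsGerm hf π p Q ψ') : ψ = ψ' := by
  obtain ⟨c, hQ, hp, h1⟩ := h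
  obtain ⟨hp', h2⟩ := h'.comp_stalkChart c hQ
  -- The lifting property concerns rings in the universe of the schemes, so `L` is replaced by a
  -- small copy.
  let σ := (Shrink.ringEquiv.{u} L).symm
  have hchar : CharZero (Shrink.{u} L) := charZero_of_injective_ringHom (f := (σ : L →+* _)) σ.injective
  have h3 : (σ : L →+* Shrink.{u} L).comp ψ = (σ : L →+* Shrink.{u} L).comp ψ' := by
    apply stalk_hom_ext hf hQ hπ
    rw [RingHom.comp_assoc, RingHom.comp_assoc, h1, h2]
  ext r
  exact σ.injective (congrArg (fun φ => φ r) h3)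

lemma mem_range_curveι (x : naiveModel f) : x ∈ Set.range (curveι f) ↔
    naiveModelToSpec f x = genericPoint (Spec (.of (𝓞 K))) := by
  have h : Set.range (curveι f) = naiveModelToSpec f ⁻¹'
      {genericPoint (Spec (.of (𝓞 K)))} :=
    (naiveModelToSpec f).range_fiberι (genericPoint (Spec (.of (𝓞 K))))
  rw [h]
  rfl

lemma exists_liesAt (hf : IsSeparableForm f) (p : CurvePoint f L) : ∃ P : curve f, p.LiesAt P := by
  obtain ⟨c, hc⟩ := p.exists_cval_ne_zero
  let q : Spec (.of (ChartRing f c)) :=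
    (⟨ker (p.chartEval c hc), ker_isPrime _⟩ : PrimeSpectrum (ChartRing f c))
  have h : naiveModelToSpec f (chartι hf c q) = genericPoint (Spec (.of (𝓞 K))) := by
    rw [← Scheme.Hom.comp_apply, chartι_toSpec, genericPoint_spec_eq_bot]
    refine PrimeSpectrum.ext (Ideal.ext fun r => ?_)
    change chartC f c r ∈ ker (p.chartEval c hc) ↔ r ∈ (⊥ : Ideal (𝓞 K))
    rw [mem_ker, chartEval_chartC, mem_bot, _root_.map_eq_zero, algebraMap_eq_zero_iff]
  obtain ⟨P, hP⟩ := (mem_range_curveι _).2 h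
  exact ⟨P, (liesAt_iff hf p c hc P).2 ⟨q, hP.symm, rfl⟩⟩

lemma liesAt_unique (hf : IsSeparableForm f) {P P' : curve f} (h : p.LiesAt P) (h' : p.LiesAt P') :
    P = P' := by
  obtain ⟨c, hc⟩ := p.exists_cval_ne_zero
  obtain ⟨q, hq, hk⟩ := (liesAt_iff hf p c hc P).1 h
  obtain ⟨q', hq', hk'⟩ := (liesAt_iff hf p c hc P').1 h'
  have : q = q' := PrimeSpectrum.ext (hk.trans hk'.symm)
  exact curveι_injective (by rw [← hq, ← hq', this])

variable (π) in
/-- The ideal of the closure of a point of the curve, in a local ring of the model. -/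
def pointIdeal (P : curve f) (Q : X) : Ideal (X.presheaf.stalk Q) :=
  ⨅ (η : X) (_ : π η = curveι f P), closureIdeal η Q

include hπ in
lemma existsUnique_generic (P : curve f) : ∃! η : X, π η = curveι f P := by
  refine hπ.existsUnique_point _ fun ν _ h => ?_
  have h1 := (mem_range_curveι (curveι f P)).1 ⟨P, rfl⟩
  rw [h1, genericPoint_spec_eq_bot] at h
  exact ν.ne_bot (congrArg PrimeSpectrum.asIdeal h).symm

include hπ in
lemma pointIdeal_eq {P : curve f} {η : X} (hη : π η = curveι f P) (Q : X) :
    pointIdeal π P Q = closureIdeal η Q := by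
  obtain ⟨η', -, hu⟩ := existsUnique_generic hπ P
  rw [pointIdeal]
  refine le_antisymm (iInf₂_le η hη) (le_iInf₂ fun η'' h => ?_)
  rw [hu η hη, hu η'' h]

include hπ in
lemma IsGerm.ker_eq {P : curve f} (hp : p.LiesAt P) (h : IsGerm hf π p Q ψ) :
    ker ψ = pointIdeal π P Q := by
  obtain ⟨c, hQ, hpc, h⟩ := h
  let q : Spec (X.presheaf.stalk Q) := (⟨ker ψ, ker_isPrime _⟩ : PrimeSpectrum (X.presheaf.stalk Q))
  obtain ⟨q', hq', hk⟩ := (liesAt_iff hf p c hpc P).1 hp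
  have h1 : Spec.map (ofHom (stalkChart hf π c Q hQ)) q = q' := by
    refine PrimeSpectrum.ext (Eq.trans ?_ hk.symm)
    rw [← h, ← comap_ker]
    rfl
  have h2 := stalkChart_apply hf π hQ q
  rw [h1, hq'] at h2
  rw [pointIdeal_eq hπ h2.symm, closureIdeal_fromSpecStalk]

-- If the closure of `P` passes through `Q`, then `P` is a prime of the local ring without nonzero
-- constants. Germs are fractions of chart functions whose denominators do not vanish at `P`, so
-- evaluation at `p` extends to them.
include hπ in
lemma exists_isGerm {P : curve f} (hp : p.LiesAt P) [IsDomain (X.presheaf.stalk Q)]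
    (hQ : pointIdeal π P Q ≠ ⊤) : ∃ ψ : X.presheaf.stalk Q →+* L, IsGerm hf π p Q ψ := by
  obtain ⟨η, hη, -⟩ := existsUnique_generic hπ P
  rw [pointIdeal_eq hπ hη] at hQ
  obtain ⟨q, hq⟩ := exists_fromSpecStalk_eq hQ
  obtain ⟨c, hc⟩ := exists_mem_chartι hf (π Q)
  have h1 := stalkChart_apply hf π hc q
  rw [hq, hη] at h1
  have hpc : p.cval c ≠ 0 := (cval_ne_zero_of_liesAt hf p hp c).2 ⟨_, h1⟩
  obtain ⟨q', hq', hk⟩ := (liesAt_iff hf p c hpc P).1 hp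
  obtain rfl := (chartι hf c).isOpenEmbedding.injective (h1.trans hq'.symm)
  have hk' : ∀ a, stalkChart hf π c Q hc a ∈ q.asIdeal ↔ p.chartEval c hpc a = 0 := fun a => by
    rw [← mem_ker, ← hk]
    rfl
  have hq0 : ∀ r : 𝓞 K, stalkChart hf π c Q hc (chartC f c r) ∈ q.asIdeal → r = 0 := by
    intro r hr
    rwa [hk', chartEval_chartC, _root_.map_eq_zero, algebraMap_eq_zero_iff] at hr
  obtain ⟨ψ, hψ⟩ := exists_ringHom_extension (stalkChart_injective hf hc hπ q hq0)
    (p.chartEval c hpc) (fun r => by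
      obtain ⟨a, s, hs, has⟩ := exists_stalkChart_mul_eq hf hc hπ q hq0 r
      exact ⟨a, s, fun h0 => hs ((hk' s).2 h0), has⟩)
  exact ⟨ψ, c, hc, hpc, hψ⟩

end Germs

/-! ### Centres of places -/

section PlaceRing

variable {L : Type v} [Field L] [NumberField L]

/-- The valuation ring of `w`, as a local principal ideal domain in the universe of the schemes, to
which the lifting criterion applies. The copy exists because `L` is countable. -/
lemma exists_placeRing (w : FinitePlace L) : ∃ (V : Type u) (_ : CommRing V) (_ : IsDomain V)
    (_ : IsLocalRing V) (_ : IsPrincipalIdealRing V) (i : V →+* L), Injective i ∧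
    (∀ x, w x ≤ 1 ↔ x ∈ i.range) ∧ ∀ y, y ∈ maximalIdeal V ↔ w (i y) < 1 := by
  let 𝔓 := w.maximalIdeal.asIdeal
  have h𝔓 : 𝔓.IsPrime := w.maximalIdeal.isPrime
  let V' := Localization.AtPrime 𝔓
  have hdvr : IsDiscreteValuationRing V' :=
    IsLocalization.AtPrime.isDiscreteValuationRing_of_dedekind_domain (𝓞 L) w.maximalIdeal.ne_bot V'
  have hunit : ∀ y : 𝔓.primeCompl, IsUnit (algebraMap (𝓞 L) L y) := fun y => by
    rw [isUnit_iff_ne_zero, Ne, algebraMap_eq_zero_iff]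
    intro h
    exact y.2 (h ▸ 𝔓.zero_mem)
  let i' : V' →+* L := IsLocalization.lift hunit
  have hi' : Injective i' := IsLocalization.lift_injective_iff hunit |>.2 fun a b => by
    rw [(IsLocalization.injective V' 𝔓.primeCompl_le_nonZeroDivisors).eq_iff,
      (algebraMap_injective (𝓞 L) L).eq_iff]
  have hrange : ∀ x, w x ≤ 1 ↔ x ∈ i'.range := by
    intro x
    constructor
    · intro hx
      obtain ⟨a, s, hs, has⟩ := exists_mul_eq_of_finitePlace_le_one w hx
      refine ⟨mk' V' a (⟨s, show s ∈ 𝔓.primeCompl from hs⟩ : 𝔓.primeCompl), ?_⟩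
      rw [lift_mk'_spec]
      exact has.symm
    · rintro ⟨y, rfl⟩
      obtain ⟨a, s, rfl⟩ := exists_mk'_eq 𝔓.primeCompl y
      have h1 : algebraMap (𝓞 L) L s * i' (mk' V' a s) = algebraMap (𝓞 L) L a :=
        ((lift_mk'_spec _ _ _ _).1 rfl).symm
      have h2 := congrArg w h1
      rw [map_mul] at h2
      have h3 : w (algebraMap (𝓞 L) L s) = 1 := (finitePlace_int_eq_one_iff w s).2 s.2
      rw [h3, one_mul] at h2
      rw [h2]
      exact finitePlace_int_le_one w a
  have hsmall : Small.{u} V' := by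
    have : Countable L := (finBasis ℚ L).equivFun.injective.countable
    have : Countable V' := hi'.countable
    infer_instance
  let σ := Shrink.ringEquiv.{u} V'
  have hdom : IsDomain (Shrink.{u} V') := σ.toMulEquiv.isDomain
  have hloc : IsLocalRing (Shrink.{u} V') := of_surjective' (σ.symm : V' →+* _)
    σ.symm.surjective
  let i : Shrink.{u} V' →+* L := i'.comp (σ : Shrink.{u} V' →+* V')
  have hi : Injective i := hi'.comp σ.injective
  have hr : ∀ x, w x ≤ 1 ↔ x ∈ i.range := by
    intro x
    rw [hrange]
    constructor
    · rintro ⟨y, rfl⟩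
      exact ⟨σ.symm y, congrArg i' (σ.apply_symm_apply y)⟩
    · rintro ⟨y, rfl⟩
      exact ⟨σ y, rfl⟩
  refine ⟨Shrink.{u} V', inferInstance, hdom, hloc,
    IsPrincipalIdealRing.of_surjective (σ.symm : V' →+* _) σ.symm.surjective, i, hi, hr, fun y => ?_⟩
  rw [mem_maximalIdeal, mem_nonunits_iff]
  have hle : w (i y) ≤ 1 := (hr _).2 ⟨y, rfl⟩
  constructor
  · intro h
    refine lt_of_le_of_ne hle fun h1 => h ?_
    have hy : i y ≠ 0 := fun h0 => by
      rw [h0, map_zero] at h1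
      exact zero_ne_one h1
    obtain ⟨z, hz⟩ := (hr (i y)⁻¹).1 (by rw [map_inv₀, h1, inv_one])
    refine IsUnit.of_mul_eq_one z (hi ?_)
    rw [map_mul, hz, mul_inv_cancel₀ hy, map_one]
  · intro h hu
    obtain ⟨z, hyz⟩ := hu.exists_right_inv
    have h1 : w (i y) * w (i z) = 1 := by rw [← map_mul, ← map_mul, hyz, map_one, map_one]
    have h2 : w (i z) ≤ 1 := (hr _).2 ⟨z, rfl⟩
    have h3 := mul_lt_one_of_nonneg_of_lt_one_left (apply_nonneg w _) h h2
    exact h3.ne h1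

/-- The elements of absolute value less than `1` form a prime ideal that contains the kernel of a
map to a finite ring. Its quotient is a finite domain, hence a field, so the prime is the maximal
ideal: the place is centred at the closed point. -/
lemma lt_one_of_mem_placesOf {R : Type*} [CommRing R] [IsLocalRing R] {ψ : R →+* L}
    {w : FinitePlace L} (hw : w ∈ placesOf ψ.range) {n : R}
    (hn : Nat.card (ψ.range ⧸ span {ψ.rangeRestrict n}) ≠ 0) (hwn : w (ψ n) < 1) {r : R}
    (hr : r ∈ maximalIdeal R) : w (ψ r) < 1 := by
  have hw1 : ∀ r, w (ψ r) ≤ 1 := fun r => hw _ ⟨r, rfl⟩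
  let 𝔮 : Ideal R :=
    { carrier := {r | w (ψ r) < 1}
      add_mem' := fun {a b} ha hb => by
        change w (ψ (a + b)) < 1
        rw [map_add]
        exact (w.add_le _ _).trans_lt (max_lt ha hb)
      zero_mem' := by
        change w (ψ 0) < 1
        rw [map_zero, map_zero]
        exact one_pos
      smul_mem' := fun c a ha => by
        change w (ψ (c * a)) < 1
        rw [map_mul, map_mul]
        exact (mul_le_of_le_one_left (apply_nonneg w _) (hw1 c)).trans_lt ha }
  have hq : 𝔮.IsPrime := by
    refine ⟨fun h => ?_, fun {a b} hab => ?_⟩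
    · have h1 : w (ψ 1) < 1 := (Ideal.eq_top_iff_one _).1 h
      rw [map_one, map_one] at h1
      exact lt_irrefl _ h1
    · by_contra! hcon
      have ha : w (ψ a) = 1 := (hw1 a).antisymm (not_lt.1 hcon.1)
      have hb : w (ψ b) = 1 := (hw1 b).antisymm (not_lt.1 hcon.2)
      have hab' : w (ψ (a * b)) < 1 := hab
      rw [map_mul, map_mul, ha, hb, one_mul] at hab'
      exact lt_irrefl _ hab'
  have hfin := Nat.finite_of_card_ne_zero hn
  let φ : R →+* ψ.range ⧸ span {ψ.rangeRestrict n} := (Ideal.Quotient.mk _).comp ψ.rangeRestrict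
  have hφ : ker φ ≤ 𝔮 := by
    intro r hr
    rw [mem_ker, RingHom.comp_apply, eq_zero_iff_mem, Ideal.mem_span_singleton'] at hr
    obtain ⟨⟨_, s, rfl⟩, hs⟩ := hr
    have h1 : ψ s * ψ n = ψ r := congrArg Subtype.val hs
    change w (ψ r) < 1
    rw [← h1, map_mul]
    exact (mul_le_of_le_one_left (apply_nonneg w _) (hw1 s)).trans_lt hwn
  have hfin1 : Finite (R ⧸ ker φ) := Finite.of_injective _ (RingHom.kerLift_injective φ)
  have hfin2 : Finite (R ⧸ 𝔮) := Finite.of_surjective _ (Ideal.Quotient.factor_surjective hφ)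
  have hmax : 𝔮.IsMaximal := Ideal.Quotient.maximal_of_isField _ (Finite.isField_of_domain _)
  rw [← IsLocalRing.eq_maximalIdeal hmax] at hr
  exact hr

end PlaceRing

/-! ### Reduction of points of the curve at the places of `L` -/

section Centres

variable (hf : IsSeparableForm f) {X : Scheme.{u}} (π : X ⟶ naiveModel f)
  {L : Type v} [Field L] [NumberField L] [Algebra K L]

lemma exists_place_below (w : FinitePlace L) : ∃ ν : HeightOneSpectrum (𝓞 K),
    ∀ r : 𝓞 K, r ∈ ν.asIdeal ↔ w (algebraMap K L r) < 1 := by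
  let 𝔭 := w.maximalIdeal.asIdeal.comap (algebraMap (𝓞 K) (𝓞 L))
  have h𝔭 : 𝔭 ≠ ⊥ := Ideal.IsIntegral.comap_ne_bot (𝓞 K) w.maximalIdeal.ne_bot
  refine ⟨⟨𝔭, inferInstance, h𝔭⟩, fun r => ?_⟩
  exact (finitePlace_int_lt_one_iff w (algebraMap (𝓞 K) (𝓞 L) r)).symm

/-- `ψ` is evaluation at `p` of germs at the reduction `Q` of `p` at the place `w`. -/
structure IsCentredGerm (w : FinitePlace L) (p : CurvePoint f L) (Q : X)
    (ψ : X.presheaf.stalk Q →+* L) : Prop where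
  isGerm : IsGerm hf π p Q ψ
  le_one : ∀ r, w (ψ r) ≤ 1
  lt_one : ∀ r ∈ maximalIdeal (X.presheaf.stalk Q), w (ψ r) < 1

variable {hf π} {l : List (HeightOneSpectrum (𝓞 K))}
  (hπ : IsBlowupSequence (naiveModelToSpec f) π l)

lemma abv_chartEval_le_one {w : FinitePlace L} {p : CurvePoint f L} {c : Bool} (hp : p.cval c ≠ 0)
    (h : w (p.oval c) ≤ w (p.cval c)) (a : ChartRing f c) : w (p.chartEval c hp a) ≤ 1 := by
  have hw := isNonarchimedean_finitePlace w
  have hu : w (p.uval c) ≤ 1 := by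
    rw [CurvePoint.uval, map_div₀]
    exact div_le_one_of_le₀ h (apply_nonneg w _)
  have hK : ∀ r : 𝓞 K, w (algebraMap K L r) ≤ 1 := fun r =>
    finitePlace_int_le_one w (algebraMap (𝓞 K) (𝓞 L) r)
  have hpol : ∀ P : Polynomial (𝓞 K), w (P.eval₂ ((algebraMap K L).comp (algebraMap (𝓞 K) K))
      (p.uval c)) ≤ 1 := fun P => abv_eval₂_le_one (w := w.1) hw hK P hu
  have hv : w (p.vval c) ≤ 1 := by
    have := hpol (affForm f c)
    rw [← p.vval_sq c hp, map_pow] at this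
    exact (pow_le_one_iff_of_nonneg (apply_nonneg w _) two_ne_zero).1 this
  obtain ⟨P, Q, rfl⟩ := ChartRing.exists_eq_add_mul f c a
  rw [map_add, map_mul, of_eq_eval₂, of_eq_eval₂, hom_eval₂, hom_eval₂,
    chartEval_comp_chartC, chartEval_coordU, chartEval_coordV]
  refine (w.add_le _ _).trans (max_le (hpol P) ?_)
  rw [map_mul]
  exact mul_le_one₀ (hpol Q) (apply_nonneg w _) hv

-- In a chart where `p` has integral coordinates, evaluation takes values in the valuation ring of
-- `w`. The centre of the resulting local point is the reduction of `p` on the model.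
include hπ in
lemma exists_centredGerm (w : FinitePlace L) (p : CurvePoint f L) {c : Bool} (hp : p.cval c ≠ 0)
    (h : w (p.oval c) ≤ w (p.cval c)) : ∃ (Q : X) (hQ : π Q ∈ (chartι hf c).opensRange)
      (ψ : X.presheaf.stalk Q →+* L), ψ.comp (stalkChart hf π c Q hQ) = p.chartEval c hp ∧
      IsCentredGerm hf π w p Q ψ := by
  obtain ⟨V, _, _, _, _, i, hi, hr, hm⟩ := exists_placeRing.{u} w
  let e' : ChartRing f c →+* i.range := (p.chartEval c hp).codRestrict i.range fun a =>
    (hr _).1 (abv_chartEval_le_one hp h a)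
  let σ := RingEquiv.ofBijective i.rangeRestrict
    ⟨fun a b hab => hi (congrArg Subtype.val hab), i.rangeRestrict_surjective⟩
  let e : ChartRing f c →+* V := (σ.symm : i.range →+* V).comp e'
  have he : i.comp e = p.chartEval c hp := by
    exact RingHom.ext fun a => congrArg Subtype.val (σ.apply_symm_apply (e' a))
  have hchar : CharZero V := ⟨fun m n hmn => Nat.cast_injective (R := L) (by
    rw [← map_natCast i, hmn, map_natCast])⟩
  obtain ⟨Q, hQ, ψ, hψ, hψe⟩ := exists_stalk_hom hf hπ c e
  have h1 : (i.comp ψ).comp (stalkChart hf π c Q hQ) = p.chartEval c hp := by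
    rw [RingHom.comp_assoc, hψe, he]
  refine ⟨Q, hQ, i.comp ψ, h1, ⟨c, hQ, hp, h1⟩, fun r => (hr _).2 ⟨ψ r, rfl⟩, fun r hr' => ?_⟩
  rw [RingHom.comp_apply, ← hm]
  rw [mem_maximalIdeal] at hr' ⊢
  exact fun hu => hr' (hψ.map_nonunit r hu)

lemma IsCentredGerm.mem_specialFibre {w : FinitePlace L} {p : CurvePoint f L} {Q : X}
    {ψ : X.presheaf.stalk Q →+* L} (h : IsCentredGerm hf π w p Q ψ) {ν : HeightOneSpectrum (𝓞 K)}
    (hν : ∀ r : 𝓞 K, r ∈ ν.asIdeal ↔ w (algebraMap K L r) < 1) : Q ∈ specialFibre π ν := by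
  obtain ⟨c, hQ, hp, hψ⟩ := h.isGerm
  have h1 := toSpec_fromSpecStalk hf π hQ (closedPtStalk Q)
  rw [fromSpecStalk_closedPtStalk] at h1
  change (π ≫ naiveModelToSpec f) Q = closedPt ν
  rw [h1]
  refine PrimeSpectrum.ext (Ideal.ext fun r => ?_)
  change stalkChart hf π c Q hQ (chartC f c r) ∈ maximalIdeal (X.presheaf.stalk Q) ↔
    r ∈ ν.asIdeal
  have h2 : ψ (stalkChart hf π c Q hQ (chartC f c r)) = algebraMap K L r := by
    rw [← chartEval_chartC p c hp, ← hψ]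
    rfl
  rw [hν, ← h2]
  refine ⟨h.lt_one _, fun hlt => ?_⟩
  by_contra hcon
  rw [IsLocalRing.notMem_maximalIdeal] at hcon
  obtain ⟨b, hab⟩ := hcon.exists_right_inv
  have h3 := congrArg (fun x => w (ψ x)) hab
  simp only [map_mul, map_one] at h3
  exact (mul_lt_one_of_nonneg_of_lt_one_left (apply_nonneg w _) hlt (h.le_one b)).ne h3

include hπ in
lemma IsCentredGerm.unique {w : FinitePlace L} {p : CurvePoint f L} {Q Q' : X}
    {ψ : X.presheaf.stalk Q →+* L} {ψ' : X.presheaf.stalk Q' →+* L}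
    (h : IsCentredGerm hf π w p Q ψ) (h' : IsCentredGerm hf π w p Q' ψ') : Q = Q' := by
  obtain ⟨V, _, _, _, _, i, hi, hr, hm⟩ := exists_placeRing.{u} w
  have hchar : CharZero V := ⟨fun m n hmn => Nat.cast_injective (R := L) (by
    rw [← map_natCast i, hmn, map_natCast])⟩
  let σ := RingEquiv.ofBijective i.rangeRestrict
    ⟨fun a b hab => hi (congrArg Subtype.val hab), i.rangeRestrict_surjective⟩
  have key : ∀ {Q : X} {ψ : X.presheaf.stalk Q →+* L} (_ : IsCentredGerm hf π w p Q ψ),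
      ∃ φ : X.presheaf.stalk Q →+* V, i.comp φ = ψ ∧ IsLocalHom φ := by
    intro Q ψ h
    let φ : X.presheaf.stalk Q →+* V := (σ.symm : i.range →+* V).comp
      (ψ.codRestrict i.range fun a => (hr _).1 (h.le_one a))
    have hφ : i.comp φ = ψ := by
      ext a
      exact congrArg Subtype.val (σ.apply_symm_apply _)
    refine ⟨φ, hφ, ⟨fun a ha => ?_⟩⟩
    by_contra hcon
    have h1 := h.lt_one a ((mem_maximalIdeal _).2 hcon)
    rw [← hφ, RingHom.comp_apply, ← hm] at h1
    exact (mem_maximalIdeal _).1 h1 ha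
  obtain ⟨φ, hφ, hφl⟩ := key h
  obtain ⟨φ', hφ', hφl'⟩ := key h'
  obtain ⟨c, hQ, hp, hψ⟩ := h.isGerm
  obtain ⟨c', hQ', hp', hψ'⟩ := h'.isGerm
  refine stalk_point_unique hf hQ hπ hQ' φ φ' ?_
  have e1 : i.comp (φ.comp (stalkChart hf π c Q hQ)) = p.chartEval c hp := by
    rw [← RingHom.comp_assoc, hφ, hψ]
  have e2 : i.comp (φ'.comp (stalkChart hf π c' Q' hQ')) = p.chartEval c' hp' := by
    rw [← RingHom.comp_assoc, hφ', hψ']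
  generalize φ.comp (stalkChart hf π c Q hQ) = e at e1
  generalize φ'.comp (stalkChart hf π c' Q' hQ') = e' at e2
  by_cases hcc : c = c'
  · subst hcc
    have : e = e' := by
      refine RingHom.ext fun a => ?_
      exact hi (congrArg (fun φ => φ a) (e1.trans e2.symm))
    rw [this]
  obtain rfl : c' = !c := by cases c <;> cases c' <;> simp_all
  have a1 : ∀ a, i (e a) = p.chartEval c hp a := fun a => congrArg (fun φ => φ a) e1
  have a2 : ∀ a, i (e' a) = p.chartEval (!c) hp' a := fun a => congrArg (fun φ => φ a) e2
  refine chart_transition_bool hf c e e' (RingHom.ext fun r => hi ?_) (hi ?_) (hi ?_)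
  · rw [RingHom.comp_apply, RingHom.comp_apply, a1, a2, chartEval_chartC, chartEval_chartC]
  · rw [map_mul, a1, a2, chartEval_coordU, chartEval_coordU, map_one, p.uval_mul_uval c hp hp']
  · rw [map_mul, map_pow, a1, a1, a2, chartEval_coordU, chartEval_coordV,
      chartEval_coordV, p.vval_transition c hp hp']

end Centres

/-! ### The local equations of closed points -/

section Residue

/-- The subfield generated by the image of one chart contains the coordinates of the other: the
first is the inverse of `u`, the second is `v` times a power of it. -/
lemma chartEval_frac_of_chart {E : Type u} [Field E] [Algebra K E] {p : CurvePoint f E} {c : Bool}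
    (hp : p.cval c ≠ 0)
    (hfrac : ∀ z, ∃ a s, p.chartEval c hp s ≠ 0 ∧ p.chartEval c hp s * z = p.chartEval c hp a)
    (c' : Bool) (hp' : p.cval c' ≠ 0) (z : E) :
    ∃ a s, p.chartEval c' hp' s ≠ 0 ∧ p.chartEval c' hp' s * z = p.chartEval c' hp' a := by
  by_cases hcc : c' = c
  · subst hcc
    exact hfrac z
  obtain rfl : c = !c' := by cases c <;> cases c' <;> simp_all
  let F := Subfield.closure (Set.range (p.chartEval c' hp'))
  have hr : ∀ a, p.chartEval c' hp' a ∈ F := fun a => Subfield.subset_closure ⟨a, rfl⟩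
  have hu' := hr (coordU f c')
  have hv' := hr (coordV f c')
  rw [chartEval_coordU] at hu'
  rw [chartEval_coordV] at hv'
  have h1 := p.uval_mul_uval c' hp' hp
  have hu : p.uval (!c') ∈ F := by
    rw [eq_inv_of_mul_eq_one_right h1]
    exact inv_mem hu'
  have hv : p.vval (!c') ∈ F := by
    have h2 := p.vval_transition c' hp' hp
    have h3 : p.vval (!c') = p.vval c' * p.uval (!c') ^ (g + 1) := by
      rw [h2, mul_right_comm, ← mul_pow, h1, one_pow, one_mul]
    rw [h3]
    exact mul_mem hv' (pow_mem hu _)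
  have hpol : ∀ G : Polynomial (𝓞 K), G.eval₂ ((algebraMap K E).comp (algebraMap (𝓞 K) K))
      (p.uval (!c')) ∈ F := fun G => by
    rw [eval₂_eq_sum_range]
    refine sum_mem fun i _ => mul_mem ?_ (pow_mem hu i)
    rw [RingHom.comp_apply, ← chartEval_chartC p c' hp']
    exact hr _
  have hF : ∀ a, p.chartEval (!c') hp a ∈ F := by
    intro a
    obtain ⟨G, H, rfl⟩ := ChartRing.exists_eq_add_mul f (!c') a
    rw [map_add, map_mul, of_eq_eval₂, of_eq_eval₂, hom_eval₂, hom_eval₂,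
      chartEval_comp_chartC, chartEval_coordU, chartEval_coordV]
    exact add_mem (hpol G) (mul_mem (hpol H) hv)
  have hz : z ∈ F := by
    obtain ⟨a, s, hs, has⟩ := hfrac z
    rw [(eq_div_iff_mul_eq hs).2 ((mul_comm _ _).trans has)]
    exact div_mem (hF a) (hF s)
  obtain ⟨y, hy, s, hs, rfl⟩ := Subfield.mem_closure_iff.1 hz
  rw [← RingHom.coe_range, Subring.closure_eq] at hy hs
  obtain ⟨a, rfl⟩ := hy
  obtain ⟨s, rfl⟩ := hs
  by_cases h0 : p.chartEval c' hp' s = 0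
  · exact ⟨0, 1, by simp, by simp [h0]⟩
  · exact ⟨a, s, h0, mul_div_cancel₀ _ h0⟩

/-- The residue field of a closed point of the curve, with the tautological point over it. -/
lemma exists_number_field_point (hf : IsSeparableForm f) {P : curve f}
    (hP : IsClosed {P}) : ∃ (E : Type u) (_ : Field E) (_ : NumberField E)
    (_ : Algebra K E) (p : CurvePoint f E), p.LiesAt P ∧ residueDegree f P = finrank K E ∧
      ∀ c (hp : p.cval c ≠ 0) (z : E), ∃ a s, p.chartEval c hp s ≠ 0 ∧
        p.chartEval c hp s * z = p.chartEval c hp a := by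
  obtain ⟨c, hc⟩ := exists_mem_chartι hf (curveι f P)
  obtain ⟨E, _, _, p, hpc, hp, hfrac, hdeg⟩ := exists_residue_field hf P c hc
  have hfin := finite_of_isClosed hf hpc hp hfrac hP
  have : NumberField E := NumberField.of_module_finite K E
  exact ⟨E, inferInstance, this, inferInstance, p, hp, hdeg,
    fun c' hp' z => chartEval_frac_of_chart hpc hfrac c' hp' z⟩

end Residue

/-! ### Principality and coprimality of the ideals of closed points -/

section Equations

variable (hf : IsSeparableForm f) {X : Scheme.{u}} {π : X ⟶ naiveModel f}
  {l : List (HeightOneSpectrum (𝓞 K))} (hπ : IsBlowupSequence (naiveModelToSpec f) π l)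
  {Q : X}

include hf in
lemma ker_chartEval_ne_bot {L : Type v} [Field L] [NumberField L] [Algebra K L]
    (p : CurvePoint f L) (c : Bool) (hp : p.cval c ≠ 0) : ker (p.chartEval c hp) ≠ ⊥ := by
  have : Algebra.IsAlgebraic (𝓞 K) L := (IsFractionRing.comap_isAlgebraic_iff (K := K)).2 inferInstance
  obtain ⟨G, hG0, hG⟩ := Algebra.IsAlgebraic.isAlgebraic (R := 𝓞 K) (p.uval c)
  intro h
  have h1 : of _ G ∈ ker (p.chartEval c hp) := by
    rw [mem_ker, of_eq_eval₂, hom_eval₂, chartEval_comp_chartC, chartEval_coordU]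
    exact hG
  rw [h, mem_bot] at h1
  exact hG0 (of_injective c (h1.trans (map_zero _).symm))

include hπ in
lemma pointIdeal_injective {P P' : curve f} (h : pointIdeal π P Q = pointIdeal π P' Q)
    (hP : pointIdeal π P Q ≠ ⊤) : P = P' := by
  obtain ⟨η, hη, -⟩ := existsUnique_generic hπ P
  obtain ⟨η', hη', -⟩ := existsUnique_generic hπ P'
  have hP' := h ▸ hP
  rw [pointIdeal_eq hπ hη, pointIdeal_eq hπ hη'] at h
  rw [pointIdeal_eq hπ hη] at hP
  rw [pointIdeal_eq hπ hη'] at hP'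
  obtain ⟨q, rfl⟩ := exists_fromSpecStalk_eq hP
  obtain ⟨q', rfl⟩ := exists_fromSpecStalk_eq hP'
  rw [closureIdeal_fromSpecStalk, closureIdeal_fromSpecStalk] at h
  have hq : q = q' := PrimeSpectrum.ext h
  subst hq
  exact curveι_injective (hη.symm.trans hη')

variable (hX : IsRegularScheme X) {ν : HeightOneSpectrum (𝓞 K)} (hν : Q ∈ specialFibre π ν)

include hX in
lemma isDomain_stalk (Q : X) : IsDomain (X.presheaf.stalk Q) := by
  have := hX Q
  exact IsRegularLocalRing.isDomain

include hX in
lemma isNoetherianRing_stalk (Q : X) : IsNoetherianRing (X.presheaf.stalk Q) := by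
  have := hX Q
  infer_instance

include hf hπ hX in
lemma stalkChart_injective_of_pointIdeal {P : curve f} (hP : IsClosed {P})
    (hPQ : pointIdeal π P Q ≠ ⊤) {c : Bool} (hQ : π Q ∈ (chartι hf c).opensRange) :
    Injective (stalkChart hf π c Q hQ) := by
  have := isDomain_stalk hX Q
  obtain ⟨E, _, _, _, p, hp, -, -⟩ := exists_number_field_point hf hP
  obtain ⟨ψ, hψ⟩ := exists_isGerm (hf := hf) hπ hp hPQ
  obtain ⟨hpc, h⟩ := hψ.comp_stalkChart c hQ
  refine stalkChart_injective hf hQ hπ ⟨ker ψ, ker_isPrime _⟩ fun r hr => ?_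
  have h1 : p.chartEval c hpc (chartC f c r) = 0 := by rw [← h]; exact hr
  rwa [chartEval_chartC, _root_.map_eq_zero, algebraMap_eq_zero_iff] at h1

include hf hπ hX hν in
lemma spanFinrank_stalk_le_two {P : curve f} (hP : IsClosed {P})
    (hPQ : pointIdeal π P Q ≠ ⊤) :
    (maximalIdeal (X.presheaf.stalk Q)).spanFinrank ≤ 2 := by
  have := hX Q
  have := isDomain_stalk hX Q
  obtain ⟨c, hc⟩ := exists_mem_chartι hf (π Q)
  have h := ringKrullDim_stalk_le_two hf hc hπ ν hν
    ((stalkChart_injective_of_pointIdeal hf hπ hX hP hPQ hc).comp (chartC_injective c))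
  rw [← spanFinrank_maximalIdeal] at h
  exact_mod_cast h

include hf hπ hX hν in
lemma uniqueFactorizationMonoid_stalk {P : curve f} (hP : IsClosed {P})
    (hPQ : pointIdeal π P Q ≠ ⊤) : UniqueFactorizationMonoid (X.presheaf.stalk Q) := by
  have := hX Q
  have := isDomain_stalk hX Q
  exact uniqueFactorizationMonoid_of_spanFinrank_le_two
    (spanFinrank_stalk_le_two hf hπ hX hν hP hPQ)

include hf hπ hX hν in
/-- The closure of a closed point of the curve has a local equation. -/
lemma exists_pointIdeal_eq_span {P : curve f} (hP : IsClosed {P}) :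
    ∃ h, pointIdeal π P Q = span {h} ∧ (pointIdeal π P Q ≠ ⊤ → Prime h) := by
  by_cases hPQ : pointIdeal π P Q = ⊤
  · exact ⟨1, by rw [hPQ, Ideal.span_singleton_one], fun h => absurd hPQ h⟩
  have := hX Q
  have := isDomain_stalk hX Q
  obtain ⟨E, _, _, _, p, hp, -, -⟩ := exists_number_field_point hf hP
  obtain ⟨ψ, hψ⟩ := exists_isGerm (hf := hf) hπ hp hPQ
  have hker := hψ.ker_eq hπ hp
  have hprime : (pointIdeal π P Q).IsPrime := hker ▸ ker_isPrime ψ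
  obtain ⟨c, hQ, hpc, h⟩ := hψ
  -- The maximal ideal contains the nonzero constants of `ν`, which do not vanish at `P`; so the
  -- prime of `P` is not maximal and is principal in dimension two.
  have hne : pointIdeal π P Q ≠ maximalIdeal _ := by
    intro hm
    obtain ⟨r, hr, hr0⟩ := exists_mem_ne_zero_of_ne_bot ν.ne_bot
    have h1 := (mem_maximalIdeal_stalk_iff hf hQ hν r).2 hr
    rw [← hm, ← hker, mem_ker, ← RingHom.comp_apply, h, chartEval_chartC,
      _root_.map_eq_zero, algebraMap_eq_zero_iff] at h1
    exact hr0 h1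
  obtain ⟨r, hr⟩ := exists_eq_span_singleton_of_isPrime
    (spanFinrank_stalk_le_two hf hπ hX hν hP hPQ) hprime hne
  refine ⟨r, hr, fun _ => (span_singleton_prime ?_).1 (hr ▸ hprime)⟩
  rintro rfl
  obtain ⟨a, ha, ha0⟩ := exists_mem_ne_zero_of_ne_bot (ker_chartEval_ne_bot hf p c hpc)
  rw [← h] at ha
  have h1 : stalkChart hf π c Q hQ a ∈ ker ψ := ha
  rw [hker, hr, Ideal.span_singleton_eq_bot.2 rfl, mem_bot] at h1
  exact ha0 (stalkChart_injective_of_pointIdeal hf hπ hX hP hPQ hQ (h1.trans (map_zero _).symm))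

-- Local equations are units or primes. Associated primes would define the same ideal, and the ideal
-- determines the point of the curve.
include hf hπ hX hν in
lemma isRelPrime_of_ne {P P' : curve f} (hP : IsClosed {P}) (hP' : IsClosed {P'})
    (hne : P ≠ P') {h h' : X.presheaf.stalk Q}
    (hh : pointIdeal π P Q = span {h}) (hh' : pointIdeal π P' Q = span {h'}) :
    IsRelPrime h h' := by
  have := isDomain_stalk hX Q
  by_cases hPQ : pointIdeal π P Q = ⊤
  · rw [hh, Ideal.span_singleton_eq_top] at hPQ
    exact hPQ.isRelPrime_left
  by_cases hPQ' : pointIdeal π P' Q = ⊤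
  · rw [hh', Ideal.span_singleton_eq_top] at hPQ'
    exact hPQ'.isRelPrime_right
  obtain ⟨r, hr, hrp⟩ := exists_pointIdeal_eq_span hf hπ hX hν hP
  obtain ⟨r', hr', hrp'⟩ := exists_pointIdeal_eq_span hf hπ hX hν hP'
  have hp : Prime h := (Ideal.span_singleton_eq_span_singleton.1 (hr.symm.trans hh)).prime (hrp hPQ)
  have hp' : Prime h' :=
    (Ideal.span_singleton_eq_span_singleton.1 (hr'.symm.trans hh')).prime (hrp' hPQ')
  rw [hp.irreducible.isRelPrime_iff_not_dvd, hp.dvd_prime_iff_associated hp',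
    ← Ideal.span_singleton_eq_span_singleton, ← hh, ← hh']
  exact fun h => hne (pointIdeal_injective hπ h hPQ)

end Equations

/-! ### The distance on a chart -/

section Distance

variable {L : Type v} [Field L] [NumberField L] [Algebra K L]

/-- The change of charts on `|u| = 1` does not increase distances. Applied in both directions, it
shows that the two formulas for `dist` agree where both apply. -/
lemma max_inv_sub_le {w : AbsoluteValue L ℝ} (hw : IsNonarchimedean w) {a a' b b' : L}
    (ha : w a = 1) (ha' : w a' = 1) (hb' : w b' ≤ 1) (k : ℕ) :
    max (w (a⁻¹ - a'⁻¹)) (w (b * a⁻¹ ^ k - b' * a'⁻¹ ^ k)) ≤ max (w (a - a')) (w (b - b')) := by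
  have ha0 : a ≠ 0 := fun h => by rw [h, map_zero] at ha; grind
  have ha0' : a' ≠ 0 := fun h => by rw [h, map_zero] at ha'; grind
  have hi : w a⁻¹ = 1 := by rw [map_inv₀, ha, inv_one]
  have hi' : w a'⁻¹ = 1 := by rw [map_inv₀, ha', inv_one]
  have h1 : w (a⁻¹ - a'⁻¹) = w (a - a') := by
    rw [inv_sub_inv ha0 ha0', map_div₀, map_mul, ha, ha', mul_one, div_one, w.map_sub]
  have h2 : w (a⁻¹ ^ k - a'⁻¹ ^ k) ≤ w (a - a') := by
    let A := abvIntegers hw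
    obtain ⟨t, ht⟩ := sub_dvd_pow_sub_pow (⟨a⁻¹, hi.le⟩ : A) ⟨a'⁻¹, hi'.le⟩ k
    have h3 : a⁻¹ ^ k - a'⁻¹ ^ k = (a⁻¹ - a'⁻¹) * t := congrArg Subtype.val ht
    rw [h3, map_mul, h1]
    exact mul_le_of_le_one_right (w.nonneg _) t.2
  refine max_le (h1.le.trans (le_max_left _ _)) ?_
  have h3 : b * a⁻¹ ^ k - b' * a'⁻¹ ^ k = (b - b') * a⁻¹ ^ k + b' * (a⁻¹ ^ k - a'⁻¹ ^ k) := by ring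
  rw [h3]
  refine (hw _ _).trans (max_le (le_max_of_le_right ?_) (le_max_of_le_left ?_))
  · rw [map_mul, map_pow, hi, one_pow, mul_one]
  · rw [map_mul]
    exact (mul_le_of_le_one_left (w.nonneg _) hb').trans h2

namespace CurvePoint

variable {w : FinitePlace L} {p q : CurvePoint f L} {c : Bool}

lemma exists_abv_oval_le (w : FinitePlace L) (p : CurvePoint f L) :
    ∃ c, p.cval c ≠ 0 ∧ w (p.oval c) ≤ w (p.cval c) := by
  by_cases h : w p.x ≤ w p.s
  · refine ⟨false, fun h0 => ?_, h⟩
    have h0 : p.s = 0 := h0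
    rcases p.normalized with h1 | ⟨-, h1⟩
    · grind
    · grind
  · refine ⟨true, fun h0 => ?_, (not_le.1 h).le⟩
    have h0 : p.x = 0 := h0
    exact h (by rw [h0, map_zero]; exact apply_nonneg w _)

lemma cval_ne_zero_of_abv_le (h : w (p.oval c) ≤ w (p.cval c)) : p.cval c ≠ 0 := by
  intro h0
  rw [h0, map_zero] at h
  have h1 : p.oval c = 0 := (map_eq_zero w).1 (h.antisymm (apply_nonneg w _))
  rcases p.normalized with h2 | ⟨-, h2⟩ <;> cases c <;> simp_all [cval, oval]

lemma abv_uval_le_one (h : w (p.oval c) ≤ w (p.cval c)) : w (p.uval c) ≤ 1 := by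
  rw [← chartEval_coordU p c (cval_ne_zero_of_abv_le h)]
  exact abv_chartEval_le_one _ h _

lemma abv_vval_le_one (h : w (p.oval c) ≤ w (p.cval c)) : w (p.vval c) ≤ 1 := by
  rw [← chartEval_coordV p c (cval_ne_zero_of_abv_le h)]
  exact abv_chartEval_le_one _ h _

lemma abv_uval_eq_one (h : w (p.oval c) = w (p.cval c)) : w (p.uval c) = 1 := by
  have h0 := cval_ne_zero_of_abv_le h.le
  rw [uval, map_div₀, h, div_self ((_root_.map_ne_zero w).2 h0)]

lemma abv_uval_lt_one (h : w (p.oval c) < w (p.cval c)) : w (p.uval c) < 1 := by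
  have h0 := cval_ne_zero_of_abv_le h.le
  rw [uval, map_div₀, div_lt_one (lt_of_le_of_lt (apply_nonneg w _) h)]
  exact h

lemma max_le_one (hp : w (p.oval c) ≤ w (p.cval c)) (hq : w (q.oval c) ≤ w (q.cval c)) :
    max (w (p.uval c - q.uval c)) (w (p.vval c - q.vval c)) ≤ 1 :=
  have hw := isNonarchimedean_finitePlace w
  max_le ((abv_sub_le hw _ _).trans (max_le (abv_uval_le_one hp) (abv_uval_le_one hq)))
    ((abv_sub_le hw _ _).trans (max_le (abv_vval_le_one hp) (abv_vval_le_one hq)))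

lemma max_eq_one (hp : w (p.oval c) = w (p.cval c)) (hq : w (q.oval c) < w (q.cval c)) :
    max (w (p.uval c - q.uval c)) (w (p.vval c - q.vval c)) = 1 := by
  refine (max_le_one hp.le hq.le).antisymm (le_max_of_le_left ?_)
  have h1 : w (q.uval c) < w (p.uval c) := by
    rw [abv_uval_eq_one hp]
    exact abv_uval_lt_one hq
  have h2 := abv_eq_of_lt (w := w.1) (isNonarchimedean_finitePlace w) h1
  exact ((abv_uval_eq_one hp).symm.trans h2.symm).le

lemma max_transition_le (hp : w (p.oval c) = w (p.cval c)) (hq : w (q.oval c) = w (q.cval c))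
    (hp' : w (p.oval (!c)) = w (p.cval (!c))) (hq' : w (q.oval (!c)) = w (q.cval (!c))) :
    max (w (p.uval c - q.uval c)) (w (p.vval c - q.vval c)) ≤
      max (w (p.uval (!c) - q.uval (!c))) (w (p.vval (!c) - q.vval (!c))) := by
  have key : ∀ {p : CurvePoint f L}, w (p.oval c) = w (p.cval c) →
      w (p.oval (!c)) = w (p.cval (!c)) → p.uval c = (p.uval (!c))⁻¹ ∧
        p.vval c = p.vval (!c) * (p.uval (!c))⁻¹ ^ (g + 1) := by
    intro p hp hp'
    have h0 := cval_ne_zero_of_abv_le hp.le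
    have h0' := cval_ne_zero_of_abv_le hp'.le
    have h1 := eq_inv_of_mul_eq_one_left (p.uval_mul_uval c h0 h0')
    exact ⟨h1, by rw [p.vval_transition c h0 h0', h1, mul_comm]⟩
  rw [(key hp hp').1, (key hp hp').2, (key hq hq').1, (key hq hq').2]
  exact max_inv_sub_le (w := w.1) (isNonarchimedean_finitePlace w) (abv_uval_eq_one hp')
    (abv_uval_eq_one hq') (abv_vval_le_one hq'.le) (g + 1)

-- The distance may be computed in any chart in which `p` is integral. Where both branches apply
-- they agree; if `q` is not integral there, either only the default value applies or the other
-- chart separates the reductions, and the value is `1` in both cases.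
open Classical in
lemma dist_eq (hp : w (p.oval c) ≤ w (p.cval c)) : dist w p q = if w (q.oval c) ≤ w (q.cval c) then
      max (w (p.uval c - q.uval c)) (w (p.vval c - q.vval c)) else 1 := by
  cases c
  · have hp : w p.x ≤ w p.s := hp
    by_cases hq : w (q.oval false) ≤ w (q.cval false)
    · rw [dist, if_pos ⟨hp, hq⟩, if_pos hq]
      rfl
    · rw [if_neg hq, dist, if_neg fun h => hq h.2]
      split_ifs with h
      · exact max_eq_one (c := true) (h.1.antisymm hp) (not_le.1 hq)
      · rfl
  · have hp : w p.s ≤ w p.x := hp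
    by_cases hq : w (q.oval true) ≤ w (q.cval true)
    · rw [if_pos hq]
      by_cases h : w p.x ≤ w p.s ∧ w q.x ≤ w q.s
      · rw [dist, if_pos h]
        exact (max_transition_le (c := false) (h.1.antisymm hp) (h.2.antisymm hq)
          (hp.antisymm h.1) (le_antisymm hq h.2)).antisymm
          (max_transition_le (c := true) (hp.antisymm h.1) (le_antisymm hq h.2)
            (h.1.antisymm hp) (h.2.antisymm hq))
      · rw [dist, if_neg h, if_pos ⟨hp, hq⟩]
        rfl
    · rw [if_neg hq, dist]
      split_ifs with h1 h2
      · exact max_eq_one (c := false) (h1.1.antisymm hp) (not_le.1 hq)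
      · exact absurd h2.2 hq
      · rfl

lemma dist_le_one (w : FinitePlace L) (p q : CurvePoint f L) : dist w p q ≤ 1 := by
  obtain ⟨c, -, hc⟩ := exists_abv_oval_le w p
  rw [dist_eq hc]
  split_ifs with h
  · exact max_le_one hc h
  · exact le_rfl

lemma dist_pos (w : FinitePlace L) {p q : CurvePoint f L} (hpq : p ≠ q) : 0 < dist w p q := by
  obtain ⟨c, -, hc⟩ := exists_abv_oval_le w p
  rw [dist_eq hc]
  split_ifs with h
  · by_contra hcon
    have h1 := not_lt.1 hcon
    have hz : ∀ x : L, w x ≤ 0 → x = 0 := fun x hx =>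
      (map_eq_zero w).1 (hx.antisymm (apply_nonneg w _))
    exact hpq (ext_chart c (cval_ne_zero_of_abv_le hc) (cval_ne_zero_of_abv_le h)
      (sub_eq_zero.1 (hz _ ((le_max_left _ _).trans h1)))
      (sub_eq_zero.1 (hz _ ((le_max_right _ _).trans h1))))
  · exact one_pos

/-- A distance less than `1` makes a nonzero difference of coordinates, in one of the two charts,
have absolute value different from `1`. -/
lemma finite_dist_ne_one {p q : CurvePoint f L} (hpq : p ≠ q) :
    {w : FinitePlace L | dist w p q ≠ 1}.Finite := by
  have hfin : ∀ x : L, {w : FinitePlace L | x ≠ 0 ∧ w x ≠ 1}.Finite := by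
    intro x
    by_cases hx : x = 0
    · simp [hx]
    · exact (finite_placesOf_ne_one hx).subset fun w hw => hw.2
  refine (((hfin (p.uval false - q.uval false)).union (hfin (p.vval false - q.vval false))).union
    ((hfin (p.uval true - q.uval true)).union (hfin (p.vval true - q.vval true)))).subset ?_
  intro w hw
  obtain ⟨c, hc0, hc⟩ := exists_abv_oval_le w p
  have hw' : dist w p q ≠ 1 := hw
  rw [dist_eq hc] at hw'
  split_ifs at hw' with h
  · have h1 : (p.uval c - q.uval c ≠ 0 ∧ w (p.uval c - q.uval c) ≠ 1) ∨
        (p.vval c - q.vval c ≠ 0 ∧ w (p.vval c - q.vval c) ≠ 1) := by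
      by_contra! hcon
      have hm := max_le_one hc h
      by_cases hu : p.uval c - q.uval c = 0
      · by_cases hv : p.vval c - q.vval c = 0
        · exact hpq (ext_chart c hc0 (cval_ne_zero_of_abv_le h) (sub_eq_zero.1 hu)
            (sub_eq_zero.1 hv))
        · grind
      · grind
    cases c
    · exact Or.inl h1
    · exact Or.inr h1
  · grind

end CurvePoint

end Distance

/-! ### Local equations and distances at a place -/

section Estimate

open CurvePoint (dist dist_pos dist_le_one dist_eq finite_dist_ne_one)

variable (hf : IsSeparableForm f) {X : Scheme.{u}} {π : X ⟶ naiveModel f}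
  {l : List (HeightOneSpectrum (𝓞 K))} (hπ : IsBlowupSequence (naiveModelToSpec f) π l)
  {L : Type v} [Field L] [NumberField L] [Algebra K L]

/-- Away from this element, local intersection numbers are logarithms of distances. -/
def badElement (l : List (HeightOneSpectrum (𝓞 K))) (δ : 𝓞 K) (n : ℕ) : 𝓞 K :=
  (n.factorial : 𝓞 K) ^ 2 * (4 * δ) * (normProd l : 𝓞 K) ^ 2

lemma badElement_ne_zero (l : List (HeightOneSpectrum (𝓞 K))) {δ : 𝓞 K} (hδ : δ ≠ 0) (n : ℕ) :
    badElement l δ n ≠ 0 :=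
  mul_ne_zero (mul_ne_zero (pow_ne_zero _ (Nat.cast_ne_zero.2 n.factorial_ne_zero))
    (mul_ne_zero (by norm_num) hδ)) (pow_ne_zero _ (Nat.cast_ne_zero.2 (normProd_ne_zero l)))

lemma algebraMap_badElement (l : List (HeightOneSpectrum (𝓞 K))) (δ : 𝓞 K) (n : ℕ) :
    algebraMap K L (badElement l δ n) =
      (n.factorial : L) ^ 2 * (4 * algebraMap K L δ) * (normProd l : L) ^ 2 := by
  have h4 : algebraMap K L (algebraMap (𝓞 K) K 4) = 4 := by rw [map_ofNat, map_ofNat]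
  simp only [badElement, map_mul, map_pow, map_natCast, h4]

lemma abv_badElement_le (w : FinitePlace L) (l : List (HeightOneSpectrum (𝓞 K))) (δ : 𝓞 K) (n : ℕ) :
    w (algebraMap K L (badElement l δ n)) ≤ 1 ∧
    w (algebraMap K L (badElement l δ n)) ≤ w (n.factorial : L) ∧
    w (algebraMap K L (badElement l δ n)) ≤ w (normProd l : L) := by
  have hw : IsNonarchimedean w.1 := isNonarchimedean_finitePlace w
  have h1 : w (n.factorial : L) ≤ 1 := abv_natCast_le_one hw _
  have h2 : w (normProd l : L) ≤ 1 := abv_natCast_le_one hw _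
  have h3 : w (4 * algebraMap K L δ) ≤ 1 := finitePlace_int_le_one w (4 * algebraMap (𝓞 K) (𝓞 L) δ)
  have n1 := apply_nonneg w (n.factorial : L)
  have n2 := apply_nonneg w (normProd l : L)
  have n3 := apply_nonneg w (4 * algebraMap K L δ)
  rw [algebraMap_badElement, map_mul, map_mul, map_pow, map_pow]
  have h4 : w (n.factorial : L) ^ 2 ≤ w (n.factorial : L) := pow_le_of_le_one n1 h1 two_ne_zero
  have h5 : w (normProd l : L) ^ 2 ≤ w (normProd l : L) := pow_le_of_le_one n2 h2 two_ne_zero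
  have h6 : w (n.factorial : L) ^ 2 * w (4 * algebraMap K L δ) ≤ w (n.factorial : L) :=
    (mul_le_of_le_one_right (by positivity) h3).trans h4
  have h7 : w (n.factorial : L) ^ 2 * w (4 * algebraMap K L δ) * w (normProd l : L) ^ 2 ≤
      w (n.factorial : L) :=
    (mul_le_of_le_one_right (by positivity) (h5.trans h2)).trans h6
  exact ⟨h7.trans h1, h7, (mul_le_of_le_one_left (by positivity) (h6.trans h1)).trans h5⟩

include hπ in
/-- Points that are very close to each other have the same reduction on the model. -/
lemma abv_normProd_le_dist {w : FinitePlace L} {p q : CurvePoint f L} {c : Bool} {Q : X}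
    {ψ : X.presheaf.stalk Q →+* L} (hp : w (p.oval c) ≤ w (p.cval c))
    (hψ : IsCentredGerm hf π w p Q ψ) (hQ : π Q ∈ (chartι hf c).opensRange)
    (hq : ∀ ψ' : X.presheaf.stalk Q →+* L, ¬ IsGerm hf π q Q ψ') :
    w (normProd l : L) ≤ dist w p q := by
  classical
  have hw : IsNonarchimedean w.1 := isNonarchimedean_finitePlace w
  have hM1 : w (normProd l : L) ≤ 1 := abv_natCast_le_one hw _
  rw [dist_eq hp]
  split_ifs with hqc
  swap
  · exact hM1
  by_contra! hcon
  have hpc := CurvePoint.cval_ne_zero_of_abv_le hp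
  have hqc' := CurvePoint.cval_ne_zero_of_abv_le hqc
  obtain ⟨hpc, hψκ⟩ := hψ.isGerm.comp_stalkChart c hQ
  obtain ⟨V, _, _, _, _, i, hi, hr, hm⟩ := exists_placeRing.{u} w
  have hchar : CharZero V := ⟨fun m n hmn => Nat.cast_injective (R := L) (by
    rw [← map_natCast i, hmn, map_natCast])⟩
  let σ := RingEquiv.ofBijective i.rangeRestrict
    ⟨fun a b hab => hi (congrArg Subtype.val hab), i.rangeRestrict_surjective⟩
  have hlift : ∀ {R : Type u} [CommRing R] (φ : R →+* L), (∀ a, w (φ a) ≤ 1) →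
      ∃ φ' : R →+* V, i.comp φ' = φ := by
    intro R _ φ hφ
    refine ⟨(σ.symm : i.range →+* V).comp (φ.codRestrict i.range fun a => (hr _).1 (hφ a)), ?_⟩
    exact RingHom.ext fun a => congrArg Subtype.val (σ.apply_symm_apply _)
  obtain ⟨θ, hθ⟩ := hlift ψ hψ.le_one
  obtain ⟨e', he'⟩ := hlift (q.chartEval c hqc') (abv_chartEval_le_one hqc' hqc)
  have hM0 : (normProd l : L) ≠ 0 := Nat.cast_ne_zero.2 (normProd_ne_zero l)
  have hMpos : 0 < w (normProd l : L) := lt_of_le_of_ne (apply_nonneg w _)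
    fun h => hM0 ((map_eq_zero w).1 h.symm)
  -- `D` is the larger of the two coordinate differences. The points are congruent modulo `D = M *
  -- t` with `|t| < 1`, which is the form needed for lifting.
  obtain ⟨D, hD, hDu, hDv⟩ : ∃ D : L, w D < w (normProd l : L) ∧
      w (p.uval c - q.uval c) ≤ w D ∧ w (p.vval c - q.vval c) ≤ w D := by
    rcases le_total (w (p.uval c - q.uval c)) (w (p.vval c - q.vval c)) with h | h
    · exact ⟨_, (le_max_right _ _).trans_lt hcon, h, le_rfl⟩
    · exact ⟨_, (le_max_left _ _).trans_lt hcon, le_rfl, h⟩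
  have htlt : w (D / normProd l) < 1 := by
    rw [map_div₀, div_lt_one hMpos]
    exact hD
  obtain ⟨t, ht⟩ := (hr _).1 htlt.le
  have htm : t ∈ maximalIdeal V := by rwa [hm, ht]
  have hMt : i ((normProd l : V) * t) = D := by rw [map_mul, map_natCast, ht, mul_div_cancel₀ _ hM0]
  have hdvd : ∀ x y : V, w (i x - i y) ≤ w D → (normProd l : V) * t ∣ x - y := by
    intro x y hxy
    by_cases hD0 : D = 0
    · rw [hD0, map_zero] at hxy
      have h1 := (map_eq_zero w).1 (hxy.antisymm (apply_nonneg w _))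
      rw [sub_eq_zero] at h1
      rw [hi h1, sub_self]
      exact dvd_zero _
    · have hwD : 0 < w D := lt_of_le_of_ne (apply_nonneg w _)
        fun h => hD0 ((map_eq_zero w).1 h.symm)
      obtain ⟨z, hz⟩ := (hr ((i x - i y) / D)).1 (by
        rw [map_div₀]
        exact div_le_one_of_le₀ hxy hwD.le)
      refine ⟨z, hi ?_⟩
      rw [map_mul, hMt, hz, map_sub, mul_div_cancel₀ _ hD0]
  let κ := stalkChart hf π c Q hQ
  have hpκ : ∀ a, i (θ (κ a)) = p.chartEval c hpc a := fun a => by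
    rw [← hψκ, ← hθ]
    rfl
  have hqe : ∀ a, i (e' a) = q.chartEval c hqc' a := fun a => by
    rw [← he']
    rfl
  let I : Ideal V := span {(normProd l : V) * t}
  have hcongr : (Ideal.Quotient.mk I).comp (θ.comp κ) = (Ideal.Quotient.mk I).comp e' := by
    refine ChartRing.hom_ext ?_ ?_ ?_
    · have : (θ.comp κ).comp (chartC f c) = e'.comp (chartC f c) := by
        refine RingHom.ext fun r => hi ?_
        rw [RingHom.comp_apply, RingHom.comp_apply, RingHom.comp_apply, hpκ, hqe,
          chartEval_chartC, chartEval_chartC]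
      exact congrArg (Ideal.Quotient.mk I).comp this
    · refine Ideal.Quotient.eq.2 (mem_span_singleton.2 (hdvd _ _ ?_))
      rw [RingHom.comp_apply, hpκ, hqe, chartEval_coordU, chartEval_coordU]
      exact hDu
    · refine Ideal.Quotient.eq.2 (mem_span_singleton.2 (hdvd _ _ ?_))
      rw [RingHom.comp_apply, hpκ, hqe, chartEval_coordV, chartEval_coordV]
      exact hDv
  -- The lift of `q` has the same centre as that of `p`, so germs at `Q` can be evaluated at `q`,
  -- against the assumption.
  obtain ⟨θ', hθ', -⟩ := exists_congruent_hom hf hQ hπ htm θ e' fun a =>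
    mem_span_singleton.1 (Ideal.Quotient.eq.1 (congrArg (fun φ => φ a) hcongr))
  refine hq (i.comp θ') ⟨c, hQ, hqc', ?_⟩
  rw [RingHom.comp_assoc, hθ', he']

variable (hX : IsRegularScheme X)

include hπ hX in
/-- The absolute value of a local equation is the product of the distances, up to a bounded
factor. -/
theorem abv_localEquation {w : FinitePlace L} {P P' : curve f} (hPP' : P ≠ P')
    (hP' : IsClosed {P'}) {p : CurvePoint f L} (hpP : p.LiesAt P) {c : Bool}
    {Q : X} {ψ : X.presheaf.stalk Q →+* L} (hp : w (p.oval c) ≤ w (p.cval c))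
    (hψ : IsCentredGerm hf π w p Q ψ) (hQ : π Q ∈ (chartι hf c).opensRange)
    {h : X.presheaf.stalk Q} (hh : pointIdeal π P' Q = span {h})
    (hrat : IsSplitAt L P')
    [Fintype (𝓢 f L P')] {δ : 𝓞 K}
    (hδ : ∃ s t : Polynomial (𝓞 K), s * affForm f c + t * derivative (affForm f c) = C δ) {n : ℕ}
    (hn : 2 * residueDegree f P' ≤ n) :
    w (algebraMap K L (badElement l δ n)) ^ residueDegree f P' *
        ∏ q : 𝓢 f L P', dist w p q.1 ≤ w (ψ h) ∧
      w (algebraMap K L (badElement l δ n)) ^ residueDegree f P' * w (ψ h) ≤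
        ∏ q : 𝓢 f L P', dist w p q.1 := by
  classical
  have hw : IsNonarchimedean w.1 := isNonarchimedean_finitePlace w
  obtain ⟨hΘ1, hΘn, hΘM⟩ := abv_badElement_le w l δ n
  set Θ := w (algebraMap K L (badElement l δ n)) with hΘ
  have hΘ0 : 0 ≤ Θ := apply_nonneg w _
  have hd1 : ∏ q : 𝓢 f L P', dist w p q.1 ≤ 1 :=
    prod_le_one (fun q _ => by
      refine (dist_pos w ?_).le
      rintro rfl
      exact hPP' (liesAt_unique hf hpP q.2)) fun q _ => dist_le_one w p q.1
  obtain ⟨E, _, _, _, p', hp', hdeg, hfrac'⟩ := exists_number_field_point hf hP'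
  obtain ⟨c', hc'⟩ := p'.exists_cval_ne_zero
  have hcard : card (𝓢 f L P') = residueDegree f P' := by
    rw [hdeg, ← card_pointsOver hf hc' hp' (hfrac' c' hc') hrat, Nat.card_eq_fintype_card]
  obtain ⟨ν, hν⟩ := exists_place_below (K := K) w
  have hQν := hψ.mem_specialFibre hν
  have hdom := isDomain_stalk hX Q
  -- If `P'` does not pass through `Q`, the local equation is a unit and no point of `P'` is closer
  -- to `p` than `|M|_w`. The lower bound is then clear, and the upper one follows because `|Θ|_w ≤
  -- |M|_w`.
  by_cases htop : pointIdeal π P' Q = ⊤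
  · have hunit : IsUnit h := by rwa [hh, Ideal.span_singleton_eq_top] at htop
    have hψh : w (ψ h) = 1 := by
      obtain ⟨b, hb⟩ := hunit.exists_right_inv
      have h1 := congrArg (fun x => w (ψ x)) hb
      simp only [map_mul, map_one] at h1
      refine (hψ.le_one h).antisymm ?_
      rw [← h1]
      exact mul_le_of_le_one_right (apply_nonneg w _) (hψ.le_one b)
    rw [hψh, mul_one]
    refine ⟨mul_le_one₀ (pow_le_one₀ hΘ0 hΘ1) (prod_nonneg fun q _ => ?_) hd1, ?_⟩
    · refine (dist_pos w ?_).le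
      rintro rfl
      exact hPP' (liesAt_unique hf hpP q.2)
    · rw [← hcard, ← card_univ, ← prod_const]
      refine prod_le_prod (fun _ _ => hΘ0) fun q _ => hΘM.trans ?_
      refine abv_normProd_le_dist hf hπ hp hψ hQ fun ψ' hψ' => ?_
      have h1 := hψ'.ker_eq hπ q.2
      rw [htop] at h1
      exact (ker_isPrime ψ').ne_top h1
  · have hnoeth := isNoetherianRing_stalk hX Q
    have hufd := uniqueFactorizationMonoid_stalk hf hπ hX hQν hP' htop
    have hgerm : ∀ q : 𝓢 f L P', ∃ (hqc : q.1.cval c ≠ 0)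
        (ψ' : X.presheaf.stalk Q →+* L), ψ'.comp (stalkChart hf π c Q hQ) = q.1.chartEval c hqc ∧
        ker ψ' = pointIdeal π P' Q := by
      intro q
      obtain ⟨ψ', hψ'⟩ := exists_isGerm (hf := hf) hπ q.2 htop
      obtain ⟨hqc, h1⟩ := hψ'.comp_stalkChart c hQ
      exact ⟨hqc, ψ', h1, hψ'.ker_eq hπ q.2⟩
    choose hqc ψq hψq hkerq using hgerm
    have hdvd : ∀ (q : 𝓢 f L P') (x : ChartRing f c),
        q.1.chartEval c (hqc q) x = 0 ↔ h ∣ stalkChart hf π c Q hQ x := by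
      intro q x
      rw [← hψq q, RingHom.comp_apply, ← mem_ker, hkerq, hh, mem_span_singleton]
    have hdist : ∀ q : 𝓢 f L P', dist w p q.1 =
        chartDist w.1 (p.uval c) (p.vval c) (q.1.uval c) (q.1.vval c) := by
      intro q
      rw [dist_eq hp, chartDist]
      have h1 : w (q.1.oval c) ≤ w (q.1.cval c) ↔ w.1 (q.1.uval c) ≤ 1 := by
        have h2 : 0 < w (q.1.cval c) := lt_of_le_of_ne (apply_nonneg w _)
          fun h => hqc q ((map_eq_zero w).1 h.symm)
        change _ ↔ w (q.1.uval c) ≤ 1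
        rw [CurvePoint.uval, map_div₀, div_le_one h2]
      simp only [h1]
      rfl
    obtain ⟨hpc, hψκ⟩ := hψ.isGerm.comp_stalkChart c hQ
    have hp'c : p'.cval c ≠ 0 := by
      obtain ⟨ψ', hψ'⟩ := exists_isGerm (hf := hf) hπ hp' htop
      exact (hψ'.comp_stalkChart c hQ).1
    have hdesc := exists_map_eq_prod_X_sub_C (c := c) hrat
    have hne0 : Nonempty (𝓢 f L P') := by
      rw [← Fintype.card_pos_iff, hcard, hdeg]
      exact finrank_pos
    simp only [hdist]
    rw [← hcard]
    constructor
    · refine le_trans (mul_le_mul_of_nonneg_right (pow_le_pow_left₀ hΘ0 hΘn _)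
        (prod_nonneg fun q _ => ?_)) (prod_chartDist_le (w := w.1) hf hQ hQν hw hψ.le_one hψκ
          (fun q => q.1.vval_sq c (hqc q)) hdesc (fun x hx => ?_) (n := n) (by omega))
      · rw [← hdist]
        refine (dist_pos w ?_).le
        rintro rfl
        exact hPP' (liesAt_unique hf hpP q.2)
      · exact (hdvd hne0.some x).1 (hx hne0.some)
    · obtain ⟨s, t, hst⟩ := hδ
      rw [hΘ, algebraMap_badElement, map_mul, map_mul, map_pow, map_pow]
      refine abv_le_prod_chartDist (w := w.1) hf hQ hπ hQν hw hψ.le_one hψκ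
          (fun q => q.1.vval_sq c (hqc q)) hdesc
          (stalkChart_injective_of_pointIdeal hf hπ hX hP' htop hQ) (fun q q' h1 h2 => ?_)
          (fun x hx q => (hdvd q x).2 hx) (fun q h1 h2 => ?_) hst (by omega)
      · exact Subtype.ext (CurvePoint.ext_chart c (hqc q) (hqc q') h1 h2)
      · have := CurvePoint.ext_chart c hpc (hqc q) h1 h2
        rw [this] at hpP
        exact hPP' (liesAt_unique hf hpP q.2)


/-! ### Intersection numbers of two closed points -/


lemma log_finprod {α : Type*} {F : α → ℝ} (h0 : ∀ a, 0 < F a) (hfin : (Function.mulSupport F).Finite) :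
    Real.log (∏ᶠ a, F a) = ∑ᶠ a, Real.log (F a) := by
  rw [finprod_eq_prod_of_mulSupport_subset (s := hfin.toFinset) F (by simp),
    finsum_eq_sum_of_support_subset (s := hfin.toFinset) _ (fun a ha => ?_),
    log_prod fun a _ => (h0 a).ne']
  simp only [Set.Finite.coe_toFinset]
  intro h1
  exact ha (by simp [h1])


include hf in
/-- A function on a chart that vanishes at `P'` and not at `P`. -/
lemma exists_chartEval_ne_zero {P P' : curve f} (hP' : IsClosed {P'})
    (hne : P ≠ P') {M : Type*} [Field M] [Algebra K M] {p : CurvePoint f L} {q : CurvePoint f M}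
    (hp : p.LiesAt P) (hq : q.LiesAt P') (c : Bool) (hpc : p.cval c ≠ 0) (hqc : q.cval c ≠ 0) :
    ∃ x, q.chartEval c hqc x = 0 ∧ p.chartEval c hpc x ≠ 0 := by
  by_contra! hcon
  obtain ⟨y, hy, hky⟩ := (liesAt_iff hf p c hpc P).1 hp
  obtain ⟨y', hy', hky'⟩ := (liesAt_iff hf q c hqc P').1 hq
  have hle : y'.asIdeal ≤ y.asIdeal := by
    rw [hky, hky']
    exact hcon
  have hs : y' ⤳ y := (PrimeSpectrum.le_iff_specializes (R := ChartRing f c) y' y).1 hle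
  have hs1 : chartι hf c y' ⤳ chartι hf c y := Specializes.map hs (chartι hf c).continuous
  rw [hy, hy', (curveι f).isEmbedding.isInducing.specializes_iff] at hs1
  have := hs1.mem_closure
  rw [hP'.closure_eq] at this
  exact hne this

/-- The local intersection number of the closures of two points of the curve. -/
def pairLength (π : X ⟶ naiveModel f) (P P' : curve f) (Q : X) : ℕ∞ :=
  Module.length (X.presheaf.stalk Q)
    (X.presheaf.stalk Q ⧸ (pointIdeal π P Q ⊔ pointIdeal π P' Q))

lemma pairLength_eq_interLength {P P' : curve f} {Q : X} {h h' : X.presheaf.stalk Q}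
    (hh : pointIdeal π P Q = span {h}) (hh' : pointIdeal π P' Q = span {h'}) :
    pairLength π P P' Q = interLength h h' := by
  rw [pairLength, hh, hh']
  rfl

lemma pairLength_eq_zero_of_left {P P' : curve f} {Q : X} (h : pointIdeal π P Q = ⊤) :
    pairLength π P P' Q = 0 := by
  rw [pairLength, h, top_sup_eq, Module.length_eq_zero_iff]
  exact Ideal.Quotient.subsingleton_iff.2 rfl

-- Evaluation at `p` factors through the residue field `E` of `P`, and its image is a subring with
-- fraction field `E`. The exponent is `m = [L : E]`, and `residueDegree f P = [E : K]`.
include hπ hX in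
lemma card_range_germ {P : curve f} (hP : IsClosed {P}) {p : CurvePoint f L}
    (hp : p.LiesAt P) {Q : X} {ψ : X.presheaf.stalk Q →+* L} (hψ : IsGerm hf π p Q ψ)
    {r : X.presheaf.stalk Q} (hr : ψ r ≠ 0) :
    ∃ m : ℕ, m * residueDegree f P = finrank K L ∧
      (Nat.card (ψ.range ⧸ span {ψ.rangeRestrict r}) : ℝ) ^ m =
        ∏ᶠ w ∈ placesOf ψ.range, (w (ψ r))⁻¹ := by
  have hdom := isDomain_stalk hX Q
  obtain ⟨E, _, _, _, p₀, hp₀, hdeg, hfrac⟩ := exists_number_field_point hf hP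
  obtain ⟨c, hQ⟩ := exists_mem_chartι hf (π Q)
  obtain ⟨hpc, hψκ⟩ := hψ.comp_stalkChart c hQ
  have htop : pointIdeal π P Q ≠ ⊤ := by
    rw [← hψ.ker_eq hπ hp]
    exact (ker_isPrime ψ).ne_top
  obtain ⟨ψ₀, hψ₀⟩ := exists_isGerm (hf := hf) hπ hp₀ htop
  obtain ⟨hp₀c, hψ₀κ⟩ := hψ₀.comp_stalkChart c hQ
  obtain ⟨σ, hσu, hσv⟩ := exists_algHom_of_liesAt hf hp₀c hp₀ (hfrac c hp₀c) hp
  have hsmall : Small.{u} L := by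
    have : Countable L := (finBasis ℚ L).equivFun.injective.countable
    infer_instance
  have hψσ : (σ : E →+* L).comp ψ₀ = ψ := (hψ₀.of_algHom hQ hpc σ hσu hσv).unique hπ hψ
  let alg : Algebra E L := (σ : E →+* L).toAlgebra
  have htow : IsScalarTower K E L := IsScalarTower.of_algebraMap_eq fun x => (σ.commutes x).symm
  have hσ : ∀ r, algebraMap E L (ψ₀ r) = ψ r := fun r => congrArg (fun φ => φ r) hψσ
  refine ⟨finrank E L, ?_, ?_⟩
  · rw [hdeg, mul_comm, Module.finrank_mul_finrank]
  · have hz : ψ.rangeRestrict r ≠ 0 := fun h => hr (congrArg Subtype.val h)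
    refine card_quotient_pow_finrank (E := E) ψ.range ?_ ?_ hz
    · rintro ⟨_, r, rfl⟩
      exact ⟨ψ₀ r, hσ r⟩
    · intro e
      obtain ⟨a, s, hs, has⟩ := hfrac c hp₀c e
      have hκ : ∀ a, ψ (stalkChart hf π c Q hQ a) = algebraMap E L (p₀.chartEval c hp₀c a) :=
        fun a => by rw [← hσ, ← hψ₀κ]; rfl
      refine ⟨ψ.rangeRestrict (stalkChart hf π c Q hQ a), ψ.rangeRestrict (stalkChart hf π c Q hQ s),
        fun h => hs ?_, ?_⟩
      · have h1 : ψ (stalkChart hf π c Q hQ s) = 0 := congrArg Subtype.val h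
        rwa [hκ, _root_.map_eq_zero] at h1
      · change ψ _ * _ = ψ _
        rw [hκ, hκ, ← map_mul, has]

lemma residueDegree_pos (hf : IsSeparableForm f) {P : curve f} (hP : IsClosed {P}) :
    0 < residueDegree f P := by
  obtain ⟨E, _, _, _, p₀, hp₀, hdeg, hfrac⟩ := exists_number_field_point hf hP
  rw [hdeg]
  exact finrank_pos

lemma card_ne_zero_of_pow_eq {n m : ℕ} {A : Subring L} {x : L} (hm : m ≠ 0) (hx : x ≠ 0)
    (h : (n : ℝ) ^ m = ∏ᶠ w ∈ placesOf A, (w x)⁻¹) : n ≠ 0 := by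
  rintro rfl
  rw [Nat.cast_zero, zero_pow hm] at h
  exact (finprod_mem_induction (fun x : ℝ => x ≠ 0) one_ne_zero
      (fun x y => mul_ne_zero) fun w _ => inv_ne_zero ((map_ne_zero w).2 hx)) h.symm

include hπ hX in
/-- The places with a given centre. -/
lemma isCentredGerm_iff {P : curve f} (hP : IsClosed {P}) {p : CurvePoint f L}
    (hp : p.LiesAt P) {Q : X} {ν : HeightOneSpectrum (𝓞 K)} (hν : Q ∈ specialFibre π ν)
    {ψ : X.presheaf.stalk Q →+* L} (hψ : IsGerm hf π p Q ψ) (w : FinitePlace L) :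
    IsCentredGerm hf π w p Q ψ ↔ w ∈ placesOf ψ.range := by
  constructor
  · rintro h _ ⟨r, rfl⟩
    exact h.le_one r
  · intro hw
    have hw1 : ∀ r, w (ψ r) ≤ 1 := fun r => hw _ ⟨r, rfl⟩
    refine ⟨hψ, hw1, ?_⟩
    obtain ⟨c, hQ, hpc, hψκ⟩ := hψ
    have hK : ∀ r : 𝓞 K, ψ (stalkChart hf π c Q hQ (chartC f c r)) = algebraMap K L r := fun r => by
      rw [← chartEval_chartC p c hpc, ← hψκ]
      rfl
    obtain ⟨ν', hν'⟩ := exists_place_below (K := K) w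
    -- A constant of absolute value less than `1` cannot be a unit at `Q`. So `w` lies over `ν`, and
    -- a nonzero constant of `ν` is the element of finite colength needed below.
    have hle : ν'.asIdeal ≤ ν.asIdeal := by
      intro r hr
      rw [← mem_maximalIdeal_stalk_iff hf hQ hν r]
      by_contra hcon
      rw [IsLocalRing.notMem_maximalIdeal] at hcon
      obtain ⟨b, hb⟩ := hcon.exists_right_inv
      have h1 := congrArg (fun x => w (ψ x)) hb
      simp only [map_mul, map_one, hK] at h1
      exact (mul_lt_one_of_nonneg_of_lt_one_left (apply_nonneg w _) ((hν' r).1 hr) (hw1 b)).ne h1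
    have hνν : ν'.asIdeal = ν.asIdeal := ν'.isMaximal.eq_of_le ν.isPrime.ne_top hle
    obtain ⟨r, hr, hr0⟩ := exists_mem_ne_zero_of_ne_bot ν.ne_bot
    have hψr : ψ (stalkChart hf π c Q hQ (chartC f c r)) ≠ 0 := by
      rw [hK, _root_.map_ne_zero, Ne, algebraMap_eq_zero_iff]
      exact hr0
    obtain ⟨m, hm, hcard⟩ := card_range_germ hf hπ hX hP hp ⟨c, hQ, hpc, hψκ⟩ hψr
    have hm0 : m ≠ 0 := by
      rintro rfl
      have := finrank_pos (R := K) (M := L)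
      omega
    intro s hs
    refine lt_one_of_mem_placesOf hw (card_ne_zero_of_pow_eq hm0 hψr hcard) ?_ hs
    rw [hK]
    exact (hν' r).1 (hνν ▸ hr)

-- Otherwise `h` would be a multiple of the prime equation of `P`, to which it is relatively prime.
include hf hπ hX in
lemma germ_localEquation_ne_zero {P P' : curve f} (hP : IsClosed {P}) (hP' : IsClosed {P'})
    (hne : P ≠ P') {p : CurvePoint f L} (hp : p.LiesAt P)
    {Q : X} {ν : HeightOneSpectrum (𝓞 K)} (hν : Q ∈ specialFibre π ν)
    {ψ : X.presheaf.stalk Q →+* L} (hψ : IsGerm hf π p Q ψ) {h : X.presheaf.stalk Q}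
    (hh : pointIdeal π P' Q = span {h}) : ψ h ≠ 0 := by
  intro h0
  have hker := hψ.ker_eq hπ hp
  obtain ⟨r, hr, hrp⟩ := exists_pointIdeal_eq_span hf hπ hX hν hP
  have hrel := isRelPrime_of_ne hf hπ hX hν hP hP' hne hr hh
  have h1 : h ∈ ker ψ := h0
  rw [hker, hr, mem_span_singleton] at h1
  have h2 := hrel dvd_rfl h1
  have htop : pointIdeal π P Q ≠ ⊤ := by
    rw [← hker]
    exact (ker_isPrime ψ).ne_top
  exact (hrp htop).not_isUnit h2

include hf hπ hX in
/-- The local intersection number of two points, computed on the normalisation of one of them. -/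
lemma pairLength_mul_log {P P' : curve f} (hP : IsClosed {P}) (hP' : IsClosed {P'})
    (hne : P ≠ P') {p : CurvePoint f L} (hp : p.LiesAt P)
    {Q : X} {ν : HeightOneSpectrum (𝓞 K)} (hν : Q ∈ specialFibre π ν)
    {ψ : X.presheaf.stalk Q →+* L} (hψ : IsGerm hf π p Q ψ) {h : X.presheaf.stalk Q}
    (hh : pointIdeal π P' Q = span {h}) :
    pairLength π P P' Q ≠ ⊤ ∧
      (pairLength π P P' Q ≠ 0 → Real.log (Nat.card (X.residueField Q)) ≠ 0) ∧
      finrank K L * ((pairLength π P P' Q).toNat * Real.log (Nat.card (X.residueField Q))) =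
        residueDegree f P * ∑ᶠ w ∈ placesOf ψ.range, - Real.log (w (ψ h)) := by
  have hψh := germ_localEquation_ne_zero hf hπ hX hP hP' hne hp hν hψ hh
  obtain ⟨m, hm, hcard⟩ := card_range_germ hf hπ hX hP hp hψ hψh
  have hm0 : m ≠ 0 := by
    rintro rfl
    have := finrank_pos (R := K) (M := L)
    omega
  have hc0 := card_ne_zero_of_pow_eq hm0 hψh hcard
  obtain ⟨r, hr, -⟩ := exists_pointIdeal_eq_span hf hπ hX hν hP
  have hker := hψ.ker_eq hπ hp
  obtain ⟨h1, h2⟩ := interLength_of_range ψ (hker.trans hr) hc0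
  rw [interLength_comm, ← pairLength_eq_interLength hr hh] at h1 h2
  refine ⟨h1, fun hlen => ?_, ?_⟩
  · have hlen' : (pairLength π P P' Q).toNat ≠ 0 := by
      rw [Ne, ENat.toNat_eq_zero]
      tauto
    have hκ0 : Nat.card (X.residueField Q) ≠ 0 := by
      intro h0
      have h3 : Nat.card (IsLocalRing.ResidueField (X.presheaf.stalk Q)) = 0 := h0
      rw [h3, zero_pow hlen'] at h2
      exact hc0 h2
    have hfin := Nat.finite_of_card_ne_zero hκ0
    have hκ1 : 1 < Nat.card (X.residueField Q) := Finite.one_lt_card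
    exact (Real.log_pos (by exact_mod_cast hκ1)).ne'
  · have h3 := congrArg Real.log hcard
    have hpos : ∀ w ∈ placesOf ψ.range, 0 < (w (ψ h))⁻¹ := fun w _ =>
      inv_pos.2 (lt_of_le_of_ne (apply_nonneg w _) ((map_ne_zero w).2 hψh).symm)
    rw [finprod_mem_def, log_finprod, log_pow, h2] at h3
    · have h4 : ∀ w, Real.log (Set.mulIndicator (placesOf ψ.range) (fun w => (w (ψ h))⁻¹) w) =
          Set.indicator (placesOf ψ.range) (fun w => - Real.log (w (ψ h))) w := by
        classical
        intro w
        rw [Set.mulIndicator_apply, Set.indicator_apply]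
        split_ifs
        · rw [Real.log_inv]
        · rw [Real.log_one]
      rw [finsum_congr h4, ← finsum_mem_def, Nat.cast_pow, log_pow] at h3
      rw [← h3, ← hm, Nat.cast_mul]
      change _ = (residueDegree f P : ℝ) * (m * (_ * Real.log (Nat.card (X.residueField Q))))
      ring
    · intro w
      classical
      rw [Set.mulIndicator_apply]
      split_ifs with hw
      · exact hpos w hw
      · exact one_pos
    · refine (finite_placesOf_ne_one hψh).subset fun w hw => ?_
      classical
      rw [Function.mem_mulSupport, Set.mulIndicator_apply] at hw
      split_ifs at hw
      · exact fun h5 => hw (by rw [h5, inv_one])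
      · exact absurd rfl hw


/-! ### Summation over the places -/



/-- The union of the closed fibres of a model. -/
def closedFibres (π : X ⟶ naiveModel f) : Set X := {Q | ∃ ν, Q ∈ specialFibre π ν}

/-- The weighted local intersection number of two points. -/
def pairTerm (π : X ⟶ naiveModel f) (P P' : curve f) (Q : X) : ℝ :=
  (pairLength π P P' Q).toNat * Real.log (Nat.card (X.residueField Q))

variable {P P' : curve f} (hP : IsClosed {P})
  (hP' : IsClosed {P'}) (hne : P ≠ P')

-- A term can vanish only with its length, because a nonzero finite length here forces a finite
-- residue field with at least two elements. This turns finiteness of the nonzero terms into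
-- finiteness of the nonzero lengths.
include hf hπ hX hP hP' hne in
lemma pairLength_ne_top {Q : X} (hQ : Q ∈ closedFibres π) : pairLength π P P' Q ≠ ⊤ ∧
    (pairTerm π P P' Q = 0 → pairLength π P P' Q = 0) := by
  by_cases htop : pointIdeal π P Q = ⊤
  · rw [pairLength_eq_zero_of_left htop]
    exact ⟨ENat.zero_ne_top, fun _ => rfl⟩
  obtain ⟨ν, hν⟩ := hQ
  have hdom := isDomain_stalk hX Q
  obtain ⟨E, _, _, _, p, hp, -, -⟩ := exists_number_field_point hf hP
  obtain ⟨ψ, hψ⟩ := exists_isGerm (hf := hf) hπ hp htop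
  obtain ⟨h, hh, -⟩ := exists_pointIdeal_eq_span hf hπ hX hν hP'
  obtain ⟨h1, h2, -⟩ := pairLength_mul_log hf hπ hX hP hP' hne hp hν hψ hh
  refine ⟨h1, fun h0 => ?_⟩
  by_contra hcon
  rcases mul_eq_zero.1 h0 with h3 | h3
  · rw [Nat.cast_eq_zero, ENat.toNat_eq_zero] at h3
    exact h3.elim hcon h1
  · exact h2 hcon h3

include hπ hX hP hP' hne in
/-- The intersection numbers of two points of the curve as a sum over the places of a field of
definition of one of them. -/
lemma exists_sum_pairTerm {p : CurvePoint f L} (hp : p.LiesAt P) :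
    ∃ z : FinitePlace L → ℝ, (∀ w, 0 < z w) ∧ {w | z w ≠ 1}.Finite ∧
      (∀ w, ∃ (c : Bool) (Q : X) (ψ : X.presheaf.stalk Q →+* L) (h : X.presheaf.stalk Q),
        w (p.oval c) ≤ w (p.cval c) ∧ IsCentredGerm hf π w p Q ψ ∧
        π Q ∈ (chartι hf c).opensRange ∧ pointIdeal π P' Q = span {h} ∧ z w = w (ψ h)) ∧
      {Q | Q ∈ closedFibres π ∧ pairLength π P P' Q ≠ 0}.Finite ∧
      finrank K L * ∑ᶠ Q ∈ closedFibres π, pairTerm π P P' Q =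
        residueDegree f P * ∑ᶠ w, - Real.log (z w) := by
  classical
  have hsmall : Small.{u} L := by
    have : Countable L := (finBasis ℚ L).equivFun.injective.countable
    infer_instance
  choose c hc0 hc using fun w : FinitePlace L => CurvePoint.exists_abv_oval_le w p
  choose Qf hQf ψf hψκ hψf using fun w => exists_centredGerm (hf := hf) hπ w p (hc0 w) (hc w)
  choose νf hνf using fun w : FinitePlace L => exists_place_below (K := K) w
  have hQν : ∀ w, Qf w ∈ specialFibre π (νf w) := fun w => (hψf w).mem_specialFibre (hνf w)
  choose h hh _ using fun w => exists_pointIdeal_eq_span hf hπ hX (hQν w) hP'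
  let z : FinitePlace L → ℝ := fun w => w (ψf w (h w))
  have hz0 : ∀ w, 0 < z w := fun w => lt_of_le_of_ne (apply_nonneg w _)
    ((map_ne_zero w).2 (germ_localEquation_ne_zero hf hπ hX hP hP' hne hp (hQν w)
      (hψf w).isGerm (hh w))).symm
  have hz1 : ∀ w, z w ≤ 1 := fun w => (hψf w).le_one _
  have hztop : ∀ w, z w ≠ 1 → pointIdeal π P' (Qf w) ≠ ⊤ := by
    intro w hw htop
    rw [hh w, Ideal.span_singleton_eq_top] at htop
    exact hw (abv_eq_one_of_isUnit (w := w.1) (hψf w).le_one (hψf w).le_one htop)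
  -- A chart function that vanishes at `P'` but not at `P` is a multiple of the local equation
  -- wherever the latter is not a unit. So `z w ≠ 1` forces its value at `p` to have absolute value
  -- less than `1`.
  have hzfin : {w | z w ≠ 1}.Finite := by
    obtain ⟨E, _, _, _, q, hq, -, -⟩ := exists_number_field_point hf hP'
    have key : ∀ b, ∃ A : Set (FinitePlace L), A.Finite ∧ ∀ w, c w = b → z w ≠ 1 → w ∈ A := by
      intro b
      by_cases hb : p.cval b ≠ 0 ∧ q.cval b ≠ 0
      · obtain ⟨x, hx, hx0⟩ := exists_chartEval_ne_zero hf hP' hne hp hq b hb.1 hb.2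
        refine ⟨_, finite_placesOf_ne_one hx0, ?_⟩
        rintro w rfl hw
        have hdom := isDomain_stalk hX (Qf w)
        obtain ⟨ψ', hψ'⟩ := exists_isGerm (hf := hf) hπ hq (hztop w hw)
        obtain ⟨hqc, hκ'⟩ := hψ'.comp_stalkChart _ (hQf w)
        have h1 : stalkChart hf π (c w) (Qf w) (hQf w) x ∈ ker ψ' := by
          rw [mem_ker, ← RingHom.comp_apply, hκ', hx]
        rw [hψ'.ker_eq hπ hq, hh w, mem_span_singleton] at h1
        obtain ⟨t, ht⟩ := h1
        have h2 : p.chartEval (c w) (hc0 w) x = ψf w (h w) * ψf w t := by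
          rw [← hψκ w, RingHom.comp_apply, ht, map_mul]
        refine ne_of_lt ?_
        rw [h2, map_mul]
        exact mul_lt_one_of_nonneg_of_lt_one_left (apply_nonneg w _) (lt_of_le_of_ne (hz1 w) hw)
          ((hψf w).le_one _)
      · refine ⟨∅, Set.finite_empty, ?_⟩
        rintro w rfl hw
        refine absurd ⟨hc0 w, ?_⟩ hb
        have hdom := isDomain_stalk hX (Qf w)
        obtain ⟨ψ', hψ'⟩ := exists_isGerm (hf := hf) hπ hq (hztop w hw)
        exact (hψ'.comp_stalkChart _ (hQf w)).1
    choose A hA hA' using key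
    refine ((hA false).union (hA true)).subset fun w hw => ?_
    cases hcw : c w
    · exact Or.inl (hA' _ w hcw hw)
    · exact Or.inr (hA' _ w hcw hw)
  have hzeq : ∀ (w : FinitePlace L) (Q : X) (ψ : X.presheaf.stalk Q →+* L)
      (h' : X.presheaf.stalk Q), IsCentredGerm hf π w p Q ψ → pointIdeal π P' Q = span {h'} →
      Qf w = Q ∧ z w = w (ψ h') := by
    intro w Q ψ h' hψ hh'
    obtain rfl := (hψf w).unique hπ hψ
    obtain rfl := (hψf w).isGerm.unique hπ hψ.isGerm
    have hdom := isDomain_stalk hX (Qf w)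
    obtain ⟨e, he⟩ := Ideal.span_singleton_eq_span_singleton.1 ((hh w).symm.trans hh')
    refine ⟨rfl, ?_⟩
    rw [← he, map_mul, map_mul]
    have h1 : w (ψf w e) = 1 := abv_eq_one_of_isUnit (w := w.1) (hψf w).le_one (hψf w).le_one e.isUnit
    rw [h1, mul_one]
  set B := hzfin.toFinset with hB
  have hBmem : ∀ w, w ∈ B ↔ z w ≠ 1 := fun w => by rw [hB]; simp
  have hlog : ∀ w, - Real.log (z w) ≠ 0 → z w ≠ 1 := fun w hw h1 => hw (by rw [h1, Real.log_one,
    neg_zero])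
  -- The places of `L` are grouped by the reduction of `p`: those with reduction `Q` are the places
  -- nonnegative on the image of the germs at `Q`.
  have hfib : ∀ Q ∈ closedFibres π, finrank K L * pairTerm π P P' Q =
      residueDegree f P * ∑ w ∈ B with Qf w = Q, - Real.log (z w) := by
    rintro Q ⟨ν, hν⟩
    have hdom := isDomain_stalk hX Q
    by_cases htop : pointIdeal π P Q = ⊤
    · rw [pairTerm, pairLength_eq_zero_of_left htop, sum_eq_zero]
      · simp
      · intro w hw
        obtain ⟨-, rfl⟩ := Finset.mem_filter.1 hw
        rw [← (hψf w).isGerm.ker_eq hπ hp] at htop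
        exact absurd htop (ker_isPrime _).ne_top
    · obtain ⟨ψ, hψ⟩ := exists_isGerm (hf := hf) hπ hp htop
      obtain ⟨h', hh', -⟩ := exists_pointIdeal_eq_span hf hπ hX hν hP'
      obtain ⟨-, -, h3⟩ := pairLength_mul_log hf hπ hX hP hP' hne hp hν hψ hh'
      rw [pairTerm, h3]
      congr 1
      have hw1 : ∀ w ∈ placesOf ψ.range, Qf w = Q ∧ z w = w (ψ h') := fun w hw =>
        hzeq w Q ψ h' ((isCentredGerm_iff hf hπ hX hP hp hν hψ w).2 hw) hh'
      have hw2 : ∀ w, Qf w = Q → w ∈ placesOf ψ.range := by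
        rintro w rfl
        rw [← isCentredGerm_iff hf hπ hX hP hp hν hψ w, hψ.unique hπ (hψf w).isGerm]
        exact hψf w
      rw [finsum_mem_eq_sum_of_inter_support_eq (t := B.filter fun w => Qf w = Q)]
      · refine sum_congr rfl fun w hw => ?_
        rw [(hw1 w (hw2 w (Finset.mem_filter.1 hw).2)).2]
      · ext w
        simp only [Set.mem_inter_iff, Function.mem_support, Finset.coe_filter, Set.mem_ofPred_eq]
        constructor
        · rintro ⟨h4, h5⟩
          rw [← (hw1 w h4).2] at h5
          exact ⟨⟨(hBmem w).2 (hlog w h5), (hw1 w h4).1⟩, by rwa [← (hw1 w h4).2]⟩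
        · rintro ⟨⟨-, h4⟩, h5⟩
          exact ⟨hw2 w h4, h5⟩
  have hn0 : (finrank K L : ℝ) ≠ 0 := Nat.cast_ne_zero.2 finrank_pos.ne'
  have himage : ∀ Q ∈ closedFibres π, pairTerm π P P' Q ≠ 0 → Q ∈ B.image Qf := by
    intro Q hQ h0
    have h1 := mul_ne_zero hn0 h0
    rw [hfib Q hQ] at h1
    obtain ⟨w, hw, -⟩ := Finset.exists_ne_zero_of_sum_ne_zero (right_ne_zero_of_mul h1)
    rw [Finset.mem_filter] at hw
    exact Finset.mem_image.2 ⟨w, hw⟩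
  refine ⟨z, hz0, hzfin, fun w => ⟨c w, Qf w, ψf w, h w, hc w, hψf w, hQf w, hh w, rfl⟩,
    (B.image Qf).finite_toSet.subset ?_, ?_⟩
  · rintro Q ⟨hQ, h0⟩
    exact himage Q hQ fun h1 => h0 ((pairLength_ne_top hf hπ hX hP hP' hne hQ).2 h1)
  · rw [finsum_mem_eq_sum_of_inter_support_eq (t := B.image Qf),
      finsum_eq_sum_of_support_subset (s := B), mul_sum,
      ← Finset.sum_fiberwise_of_maps_to (g := Qf) (t := B.image Qf)
        (fun w hw => Finset.mem_image_of_mem _ hw), mul_sum]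
    · refine sum_congr rfl fun Q hQ => ?_
      obtain ⟨w, -, rfl⟩ := Finset.mem_image.1 hQ
      exact hfib _ ⟨_, hQν w⟩
    · intro w hw
      exact (hBmem w).2 (hlog w hw)
    · ext Q
      constructor
      · rintro ⟨h1, h2⟩
        exact ⟨himage Q h1 h2, h2⟩
      · rintro ⟨h1, h2⟩
        obtain ⟨w, -, rfl⟩ := Finset.mem_image.1 h1
        exact ⟨⟨_, hQν w⟩, h2⟩


/-! ### The main estimate for two closed points -/


lemma abs_finsum_sub_le {α : Type*} {a b t : α → ℝ} (ha : a.support.Finite) (hb : b.support.Finite)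
    (ht : t.support.Finite) (h : ∀ i, |a i - b i| ≤ t i) : |∑ᶠ i, a i - ∑ᶠ i, b i| ≤ ∑ᶠ i, t i := by
  have hs : ∀ {x : α → ℝ}, x.support.Finite → x.support ⊆ a.support ∪ b.support ∪ t.support →
      ∑ᶠ i, x i = ∑ i ∈ ((ha.union hb).union ht).toFinset, x i := fun _ hx =>
    finsum_eq_sum_of_support_subset _ (by simpa using hx)
  rw [hs ha fun i hi => Or.inl (Or.inl hi), hs hb fun i hi => Or.inl (Or.inr hi),
    hs ht fun i hi => Or.inr hi, ← sum_sub_distrib]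
  exact (abs_sum_le_sum_abs _ _).trans (sum_le_sum fun i _ => h i)

lemma finite_support_log {α : Type*} {F : α → ℝ} (h : {a | F a ≠ 1}.Finite) :
    (Function.support fun a => - Real.log (F a)).Finite :=
  h.subset fun a ha h1 => ha (by simp [h1])


/-- The product formula, with the archimedean part expressed by the norm from `L` through `K`. -/
lemma finsum_neg_log_abv {x : K} (hx : x ≠ 0) :
    ∑ᶠ w : FinitePlace L, - Real.log (w (algebraMap K L x)) =
      finrank K L * Real.log |(Algebra.norm ℚ x : ℝ)| := by
  have hx' : algebraMap K L x ≠ 0 := (_root_.map_ne_zero _).2 hx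
  have h1 := FinitePlace.prod_eq_inv_abs_norm hx'
  rw [← Algebra.norm_norm (S := K), Algebra.norm_algebraMap, map_pow] at h1
  rw [finsum_neg_distrib, ← log_finprod (fun w => lt_of_le_of_ne (apply_nonneg w _)
    ((map_ne_zero w).2 hx').symm) (finite_placesOf_ne_one hx'), h1]
  push_cast
  rw [abs_pow, Real.log_inv, log_pow, neg_neg]

variable {δ : 𝓞 K} (hδ0 : δ ≠ 0) (hδ : ∀ c, ∃ s t : Polynomial (𝓞 K),
    s * affForm f c + t * derivative (affForm f c) = C δ) {n : ℕ}

include hf in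
lemma card_pointsOver_eq (hP : IsClosed {P})
    (hrat : IsSplitAt L P) :
    Finite (𝓢 f L P) ∧
      Nat.card (𝓢 f L P) = residueDegree f P := by
  obtain ⟨E, _, _, _, p, hp, hdeg, hfrac⟩ := exists_number_field_point hf hP
  obtain ⟨c, hc⟩ := p.exists_cval_ne_zero
  exact ⟨finite_pointsOver hf hc hp (hfrac c hc), hdeg ▸ card_pointsOver hf hc hp (hfrac c hc) hrat⟩

include hf hπ hX hP hP' hne hδ0 hδ in
/-- The intersection number of the closures of two closed points is the sum of the logarithms of
the distances of their geometric points, up to a bounded error. -/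
lemma abs_sum_pairTerm_sub_le
    (hrat : IsSplitAt L P)
    (hrat' : IsSplitAt L P')
    (hn : 2 * residueDegree f P' ≤ n) [Fintype (𝓢 f L P)]
    [Fintype (𝓢 f L P')] :
    |finrank K L * ∑ᶠ Q ∈ closedFibres π, pairTerm π P P' Q -
      ∑ p : 𝓢 f L P, ∑ q : 𝓢 f L P',
        ∑ᶠ w, - Real.log (dist w p.1 q.1)| ≤
      finrank K L * (residueDegree f P * (residueDegree f P' *
        Real.log |(Algebra.norm ℚ (badElement l δ n : K) : ℝ)|)) := by
  have hcard : (card (𝓢 f L P) : ℝ) = residueDegree f P := by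
    rw [← Nat.card_eq_fintype_card, (card_pointsOver_eq hf hP hrat).2]
  set Θ : K := algebraMap (𝓞 K) K (badElement l δ n)
  have hΘ : Θ ≠ 0 := RingOfIntegers.coe_ne_zero_iff.2 (badElement_ne_zero l hδ0 n)
  have hΘ' : algebraMap K L Θ ≠ 0 := (_root_.map_ne_zero _).2 hΘ
  choose z hz0 hzfin hz _ hzsum using fun p : 𝓢 f L P =>
    exists_sum_pairTerm hf hπ hX hP hP' hne p.2
  have hpq : ∀ (p : 𝓢 f L P)
      (q : 𝓢 f L P'), p.1 ≠ q.1 := fun p q h =>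
    hne (liesAt_unique hf p.2 (h ▸ q.2))
  have hdfin := fun p q => finite_support_log (finite_dist_ne_one (hpq p q))
  have hdeg0 : (residueDegree f P : ℝ) ≠ 0 := Nat.cast_ne_zero.2 (residueDegree_pos hf hP).ne'
  -- Each of the `deg P` points over `P` gives the same formula with weight `deg P`; adding these
  -- formulas removes the weight.
  have h1 : finrank K L * ∑ᶠ Q ∈ closedFibres π, pairTerm π P P' Q =
      ∑ p, ∑ᶠ w, - Real.log (z p w) := by
    refine mul_left_cancel₀ hdeg0 ?_
    rw [mul_sum, ← sum_congr rfl fun p _ => hzsum p, Finset.sum_const, nsmul_eq_mul,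
      card_univ, hcard]
  rw [h1, ← sum_sub_distrib]
  refine (abs_sum_le_sum_abs _ _).trans ((Finset.sum_le_card_nsmul _ _ _ fun p _ => ?_).trans
    (b := card (𝓢 f L P) • (residueDegree f P' *
      (finrank K L * Real.log |(Algebra.norm ℚ Θ : ℝ)|))) (le_of_eq ?_))
  · rw [← finsum_sum_comm _ _ fun q _ => hdfin p q, ← finsum_neg_log_abv hΘ,
      ← smul_eq_mul (residueDegree f P' : ℝ), smul_finsum' _ (finite_support_log
        (finite_placesOf_ne_one hΘ'))]
    refine abs_finsum_sub_le (finite_support_log (hzfin p))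
      ((Set.finite_iUnion fun q => hdfin p q).subset fun w hw => ?_)
      ((finite_support_log (finite_placesOf_ne_one hΘ')).subset fun w hw h0 =>
        hw (smul_eq_zero_of_right _ h0)) fun w => ?_
    · obtain ⟨q, -, hq⟩ := Finset.exists_ne_zero_of_sum_ne_zero hw
      exact Set.mem_iUnion.2 ⟨q, hq⟩
    · obtain ⟨c, Q, ψ, h, hc, hψ, hQ, hh, hzw⟩ := hz p w
      obtain ⟨h2, h3⟩ := abv_localEquation hf hπ hX hne hP' p.2 hc hψ hQ hh hrat' (hδ c) hn
      rw [← hzw] at h2 h3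
      have hd : 0 < ∏ q : 𝓢 f L P', dist w p.1 q.1 :=
        prod_pos fun q _ => dist_pos w (hpq p q)
      have hwΘ : 0 < w (algebraMap K L Θ) ^ residueDegree f P' :=
        pow_pos (lt_of_le_of_ne (apply_nonneg w _) ((map_ne_zero w).2 hΘ').symm) _
      have h4 := Real.log_le_log (mul_pos hwΘ hd) h2
      have h5 := Real.log_le_log (mul_pos hwΘ (hz0 p w)) h3
      rw [Real.log_mul hwΘ.ne' hd.ne', log_pow] at h4
      rw [Real.log_mul hwΘ.ne' (hz0 p w).ne', log_pow] at h5
      rw [Finset.sum_neg_distrib, ← log_prod fun q _ => (dist_pos w (hpq p q)).ne',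
        abs_le, smul_eq_mul]
      constructor <;> linarith
  · rw [nsmul_eq_mul, hcard]
    ring


/-! ### Intersection numbers of divisors -/


variable {D E : EffectiveDivisor f} (hDE : D.DisjointSupport E)

lemma EffectiveDivisor.isClosed_of_mem {P : curve f} (hP : P ∈ D.mult.support) :
    IsClosed {P} :=
  D.isClosed P (Finsupp.mem_support_iff.1 hP)

include hDE in
lemma EffectiveDivisor.DisjointSupport.ne {P P' : curve f} (hP : P ∈ D.mult.support)
    (hP' : P' ∈ E.mult.support) : P ≠ P' := by
  rintro rfl
  exact (hDE P).elim (Finsupp.mem_support_iff.1 hP) (Finsupp.mem_support_iff.1 hP')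

-- At `Q` the divisor ideals are generated by products of powers of the local equations of their
-- points, pairwise coprime between `D` and `E`, and lengths are additive in each argument.
include hf hπ hX hDE in
lemma localMultiplicity_eq {Q : X} (hQ : Q ∈ closedFibres π) :
    localMultiplicity π D E Q = ((∑ P ∈ D.mult.support, ∑ P' ∈ E.mult.support,
      D.mult P * (E.mult P' * (pairLength π P P' Q).toNat) : ℕ) : ℕ∞) := by
  obtain ⟨ν, hν⟩ := hQ
  have h1 : ∀ P ∈ D.mult.support, ∀ P' ∈ E.mult.support,
      ((pairLength π P P' Q).toNat : ℕ∞) = pairLength π P P' Q := fun P hP P' hP' =>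
    ENat.natCast_toNat (pairLength_ne_top hf hπ hX (D.isClosed_of_mem hP) (E.isClosed_of_mem hP')
      (hDE.ne hP hP') ⟨ν, hν⟩).1
  push_cast
  rw [sum_congr rfl fun P hP => sum_congr rfl fun P' hP' => by rw [h1 P hP P' hP']]
  -- If no component of `D` passes through `Q`, both sides vanish. Otherwise such a component makes
  -- the local ring factorial.
  by_cases htop : ∀ P ∈ D.mult.support, pointIdeal π P Q = ⊤
  · have h2 : divisorIdeal π D Q = ⊤ := by
      rw [divisorIdeal, ← Ideal.one_eq_top]
      refine Finset.prod_eq_one fun P hP => ?_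
      change pointIdeal π P Q ^ _ = 1
      rw [htop P hP, ← Ideal.one_eq_top, one_pow]
    rw [localMultiplicity, h2, top_sup_eq, Module.length_eq_zero_iff.2
      (Ideal.Quotient.subsingleton_iff.2 rfl)]
    refine (sum_eq_zero fun P hP => sum_eq_zero fun P' _ => ?_).symm
    rw [pairLength_eq_zero_of_left (htop P hP), mul_zero, mul_zero]
  · push Not at htop
    obtain ⟨P₀, hP₀, htop⟩ := htop
    have hdom := isDomain_stalk hX Q
    have hufd := uniqueFactorizationMonoid_stalk hf hπ hX hν (D.isClosed_of_mem hP₀) htop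
    have hgen : ∀ P : curve f, IsClosed {P} →
        ∃ h, pointIdeal π P Q = span {h} := fun P hP =>
      (exists_pointIdeal_eq_span hf hπ hX hν hP).imp fun _ h => h.1
    choose! h hh using hgen
    have hspan : ∀ G : EffectiveDivisor f, divisorIdeal π G Q =
        span {∏ P ∈ G.mult.support, h P ^ G.mult P} := by
      intro G
      rw [← Ideal.prod_span_singleton]
      refine prod_congr rfl fun P hP => ?_
      rw [← Ideal.span_singleton_pow, ← hh P (G.isClosed_of_mem hP)]
      rfl
    have h3 := interLength_prod_pow_prod_pow D.mult.support E.mult.support D.mult E.mult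
      (a := h) (c := h) fun P hP P' hP' => isRelPrime_of_ne hf hπ hX hν (D.isClosed_of_mem hP)
        (E.isClosed_of_mem hP') (hDE.ne hP hP') (hh P (D.isClosed_of_mem hP))
        (hh P' (E.isClosed_of_mem hP'))
    rw [localMultiplicity, hspan, hspan]
    refine h3.trans (sum_congr rfl fun P hP => sum_congr rfl fun P' hP' => ?_)
    rw [pairLength_eq_interLength (hh P (D.isClosed_of_mem hP)) (hh P' (E.isClosed_of_mem hP'))]

include hf hπ hX in
lemma finite_pairLength_ne_zero {P P' : curve f} (hP : IsClosed {P}) (hP' : IsClosed {P'})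
    (hne : P ≠ P') :
    {Q | Q ∈ closedFibres π ∧ pairLength π P P' Q ≠ 0}.Finite := by
  obtain ⟨E, _, _, _, p, hp, -⟩ := exists_number_field_point hf hP
  obtain ⟨z, -, -, -, h, -⟩ := exists_sum_pairTerm hf hπ hX hP hP' hne hp
  exact h

include hf hπ hX hDE in
lemma finite_localMultiplicity_ne_zero :
    {Q | Q ∈ closedFibres π ∧ localMultiplicity π D E Q ≠ 0}.Finite := by
  refine (D.mult.support.finite_toSet.biUnion' fun P hP => E.mult.support.finite_toSet.biUnion'
    fun P' hP' => finite_pairLength_ne_zero hf hπ hX (D.isClosed_of_mem hP)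
      (E.isClosed_of_mem hP') (hDE.ne hP hP')).subset ?_
  rintro Q ⟨hQ, h0⟩
  rw [localMultiplicity_eq hf hπ hX hDE hQ, Nat.cast_ne_zero] at h0
  obtain ⟨P, hP, h1⟩ := Finset.exists_ne_zero_of_sum_ne_zero h0
  obtain ⟨P', hP', h2⟩ := Finset.exists_ne_zero_of_sum_ne_zero h1
  simp only [Set.mem_iUnion]
  refine ⟨P, hP, P', hP', hQ, fun h3 => h2 ?_⟩
  rw [h3, ENat.toNat_zero, mul_zero, mul_zero]

include hf hπ hX hDE in
lemma finsum_intersectionPairing : ∑ᶠ ν, intersectionPairing π D E ν =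
    ∑ P ∈ D.mult.support, ∑ P' ∈ E.mult.support,
      (D.mult P * E.mult P' : ℝ) * ∑ᶠ Q ∈ closedFibres π, pairTerm π P P' Q := by
  classical
  have hfin := D.mult.support.finite_toSet.biUnion' fun P hP =>
    E.mult.support.finite_toSet.biUnion' fun P' hP' => finite_pairLength_ne_zero hf hπ hX
      (D.isClosed_of_mem hP) (E.isClosed_of_mem hP') (hDE.ne hP hP')
  set t := hfin.toFinset with ht
  have htc : ∀ Q ∈ t, Q ∈ closedFibres π := by
    intro Q hQ
    rw [ht, Set.Finite.mem_toFinset] at hQ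
    simp only [Set.mem_iUnion] at hQ
    grind
  have hmem : ∀ Q ∈ closedFibres π, Q ∉ t → ∀ P ∈ D.mult.support, ∀ P' ∈ E.mult.support,
      pairLength π P P' Q = 0 := by
    intro Q hQ hQt P hP P' hP'
    by_contra hcon
    rw [ht, Set.Finite.mem_toFinset] at hQt
    simp only [Set.mem_iUnion] at hQt
    exact hQt ⟨P, hP, P', hP', hQ, hcon⟩
  set T : X → ℝ := fun Q =>
    (localMultiplicity π D E Q).toNat * Real.log (Nat.card (X.residueField Q)) with hT
  have hTeq : ∀ Q ∈ closedFibres π, T Q = ∑ P ∈ D.mult.support, ∑ P' ∈ E.mult.support,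
      (D.mult P * E.mult P' : ℝ) * pairTerm π P P' Q := by
    intro Q hQ
    rw [hT]
    simp only [localMultiplicity_eq hf hπ hX hDE hQ, ENat.toNat_natCast, pairTerm]
    push_cast
    simp only [sum_mul]
    grind
  have hT0 : ∀ Q ∈ closedFibres π, T Q ≠ 0 → Q ∈ t := by
    intro Q hQ h0
    by_contra hQt
    refine h0 ?_
    rw [hTeq Q hQ]
    refine sum_eq_zero fun P hP => sum_eq_zero fun P' hP' => ?_
    rw [pairTerm, hmem Q hQ hQt P hP P' hP', ENat.toNat_zero, Nat.cast_zero, zero_mul, mul_zero]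
  have h1 : ∀ ν, intersectionPairing π D E ν = ∑ Q ∈ t, if Q ∈ specialFibre π ν then T Q else 0 := by
    intro ν
    rw [← Finset.sum_filter]
    refine finsum_mem_eq_sum_of_inter_support_eq _ ?_
    ext Q
    simp only [Set.mem_inter_iff, Function.mem_support, Finset.coe_filter, Set.mem_ofPred_eq]
    exact ⟨fun h => ⟨⟨hT0 Q ⟨ν, h.1⟩ h.2, h.1⟩, h.2⟩, fun h => ⟨h.1.2, h.2⟩⟩
  have h2 : ∀ Q ∈ t, ∃ ν, ∀ ν', Q ∈ specialFibre π ν' ↔ ν' = ν := by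
    intro Q hQ
    obtain ⟨ν, hν⟩ := htc Q hQ
    refine ⟨ν, fun ν' => ⟨fun h => ?_, fun h => h ▸ hν⟩⟩
    exact HeightOneSpectrum.ext (congrArg PrimeSpectrum.asIdeal (Eq.trans (Eq.symm h) hν))
  choose ν₀ hν₀ using h2
  rw [finsum_congr h1, finsum_sum_comm]
  · have h3 : ∀ Q ∈ t, (∑ᶠ ν, if Q ∈ specialFibre π ν then T Q else 0) = T Q := by
      intro Q hQ
      simp only [hν₀ Q hQ]
      rw [finsum_eq_single _ (ν₀ Q hQ) fun ν hν => if_neg hν, if_pos rfl]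
    rw [sum_congr rfl fun Q hQ => (h3 Q hQ).trans (hTeq Q (htc Q hQ)), sum_comm]
    refine sum_congr rfl fun P hP => ?_
    rw [sum_comm]
    refine sum_congr rfl fun P' hP' => ?_
    rw [← mul_sum]
    congr 1
    refine (finsum_mem_eq_sum_of_inter_support_eq _ ?_).symm
    ext Q
    refine ⟨fun h => ⟨by_contra fun hQt => h.2 ?_, h.2⟩, fun h => ⟨htc Q h.1, h.2⟩⟩
    rw [pairTerm, hmem Q h.1 hQt P hP P' hP', ENat.toNat_zero, Nat.cast_zero, zero_mul]
  · intro Q hQ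
    refine (Set.finite_singleton (ν₀ Q hQ)).subset fun ν hν => ?_
    by_contra hcon
    exact hν (if_neg fun h => hcon ((hν₀ Q hQ ν).1 h))


/-! ### The comparison for divisors -/


variable {d e : ℕ}
  {p : Fin d → CurvePoint f L} {q : Fin e → CurvePoint f L}
  (hp : D.IsSumOf p) (hq : E.IsSumOf q)

include hp in
lemma EffectiveDivisor.IsSumOf.mem_support {i : Fin d} {P : curve f} (hP : (p i).LiesAt P) :
    P ∈ D.mult.support := by
  rw [Finsupp.mem_support_iff, ← hp _ _ hP]
  exact Nat.card_ne_zero.2 ⟨⟨⟨i, rfl⟩⟩, inferInstance⟩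

-- A sum over the points of `D` is regrouped by the closed points below them; `IsSumOf` gives each
-- geometric point at `P` the multiplicity of `P`.
include hf hp in
lemma EffectiveDivisor.IsSumOf.sum_eq {S : curve f → Finset (CurvePoint f L)}
    (hS : ∀ P ∈ D.mult.support, ∀ c, c ∈ S P ↔ c.LiesAt P) (F : CurvePoint f L → ℝ) :
    ∑ i, F (p i) = ∑ P ∈ D.mult.support, D.mult P * ∑ c ∈ S P, F c := by
  classical
  have h1 : Finset.univ.image p = D.mult.support.biUnion S := by
    ext c
    rw [Finset.mem_image, Finset.mem_biUnion]
    constructor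
    · rintro ⟨i, -, rfl⟩
      obtain ⟨P, hP⟩ := exists_liesAt hf (p i)
      exact ⟨P, hp.mem_support hP, (hS P (hp.mem_support hP) _).2 hP⟩
    · rintro ⟨P, hP, hc⟩
      rw [hS P hP] at hc
      rw [Finsupp.mem_support_iff, ← hp c P hc, Nat.card_ne_zero] at hP
      obtain ⟨i, hi⟩ := hP.1.some
      grind
  rw [Finset.sum_comp F p, h1, Finset.sum_biUnion]
  · refine sum_congr rfl fun P hP => ?_
    rw [mul_sum]
    refine sum_congr rfl fun c hc => ?_
    rw [← hp c P ((hS P hP c).1 hc), Nat.card_eq_fintype_card, Fintype.card_subtype, nsmul_eq_mul]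
  · intro P hP P' hP' hne
    refine Finset.disjoint_left.2 fun c hc hc' => hne ?_
    exact liesAt_unique hf ((hS P hP c).1 hc) ((hS P' hP' c).1 hc')

lemma EffectiveDivisor.degree_eq_sum : (D.degree : ℝ) =
    ∑ P ∈ D.mult.support, (D.mult P : ℝ) * residueDegree f P := by
  rw [degree, Finsupp.sum]
  push_cast
  rfl

include hf hDE hp hq in
lemma ne_of_isSumOf (i : Fin d) (j : Fin e) : p i ≠ q j := by
  intro h
  obtain ⟨P, hP⟩ := exists_liesAt hf (p i)
  exact hDE.ne (hp.mem_support hP) (hq.mem_support (h ▸ hP)) rfl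

include hf hπ hX hDE hp hq hδ0 hδ in
/-- The sum of the local intersection numbers of two divisors and the sum of the logarithms of the
distances of their points differ by a bounded amount. -/
lemma abs_finsum_intersectionPairing_sub_le (hD : D.degree ≤ g) (hE : E.degree ≤ g)
    (hDL : D.PointwiseRational L) (hEL : E.PointwiseRational L) :
    |(∑ᶠ ν : HeightOneSpectrum (𝓞 K), intersectionPairing π D E ν) -
      1 / (finrank K L : ℝ) * ∑ᶠ w : FinitePlace L, posLog (1 / ∏ i, ∏ j, dist w (p i) (q j))| ≤
      g * g * Real.log |(Algebra.norm ℚ (badElement l δ (2 * g) : K) : ℝ)| := by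
  classical
  set N : ℝ := Real.log |(Algebra.norm ℚ (badElement l δ (2 * g) : K) : ℝ)|
  have hN : 0 ≤ N := by
    have h := Real.log_intCast_nonneg (Algebra.norm ℤ (badElement l δ (2 * g)))
    rw [← Real.log_abs, ← Rat.cast_intCast, Algebra.coe_norm_int] at h
    exact h
  have hn0 : (finrank K L : ℝ) ≠ 0 := Nat.cast_ne_zero.2 finrank_pos.ne'
  have hn : (0 : ℝ) < finrank K L := Nat.cast_pos.2 finrank_pos
  have hrat : ∀ {G : EffectiveDivisor f}, G.PointwiseRational L → ∀ P ∈ G.mult.support,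
      IsSplitAt L P := fun hG P hP q hqP =>
    hG q P hqP (Finsupp.mem_support_iff.1 hP)
  let S : curve f → Finset (CurvePoint f L) := fun P =>
    if h : {c : CurvePoint f L | c.LiesAt P}.Finite then h.toFinset else ∅
  have hSfin : ∀ {G : EffectiveDivisor f}, G.PointwiseRational L → ∀ P ∈ G.mult.support,
      Finite {c : CurvePoint f L // c.LiesAt P} := fun {G} hG P hP =>
    (card_pointsOver_eq hf (G.isClosed_of_mem hP) (hrat hG P hP)).1
  have hS : ∀ {G : EffectiveDivisor f}, G.PointwiseRational L → ∀ P ∈ G.mult.support,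
      ∀ c, c ∈ S P ↔ c.LiesAt P := by
    intro G hG P hP c
    have h : {c : CurvePoint f L | c.LiesAt P}.Finite := hSfin hG P hP
    simp only [S, dif_pos h, Set.Finite.mem_toFinset, Set.mem_ofPred_eq]
  set A : curve f → curve f → ℝ := fun P P' => ∑ c ∈ S P, ∑ c' ∈ S P',
    ∑ᶠ w, - Real.log (dist w c c') with hA
  have hpair : ∀ P ∈ D.mult.support, ∀ P' ∈ E.mult.support,
      |finrank K L * ∑ᶠ Q ∈ closedFibres π, pairTerm π P P' Q - A P P'| ≤
        finrank K L * (residueDegree f P * (residueDegree f P' * N)) := by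
    intro P hP P' hP'
    have := hSfin hDL P hP
    have := hSfin hEL P' hP'
    have i1 : Fintype {c : CurvePoint f L // c.LiesAt P} := Fintype.ofFinite _
    have i2 : Fintype {c : CurvePoint f L // c.LiesAt P'} := Fintype.ofFinite _
    have hg : residueDegree f P' ≤ g := by
      refine le_trans ?_ hE
      refine le_trans ?_ (Finset.single_le_sum (f := fun P => E.mult P * residueDegree f P)
        (fun _ _ => Nat.zero_le _) hP')
      exact Nat.le_mul_of_pos_left _ (Nat.pos_of_ne_zero (Finsupp.mem_support_iff.1 hP'))
    -- Since `deg P' ≤ deg E ≤ g`, the value `n = 2 * g` serves all pairs of components.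
    have h := abs_sum_pairTerm_sub_le hf hπ hX (D.isClosed_of_mem hP) (E.isClosed_of_mem hP')
      (hDE.ne hP hP') hδ0 hδ (hrat hDL P hP) (hrat hEL P' hP') (n := 2 * g) (by omega)
    rw [hA]
    simp only
    rw [Finset.sum_subtype (S P) (hS hDL P hP), sum_congr rfl fun c _ =>
      Finset.sum_subtype (S P') (hS hEL P' hP') _]
    exact h
  have hne := ne_of_isSumOf hf hDE hp hq
  -- All distances are at most `1`, so the truncated logarithm is the logarithm and is additive over
  -- the pairs of points.
  have hlog : ∀ w : FinitePlace L, posLog (1 / ∏ i, ∏ j, dist w (p i) (q j)) =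
      ∑ i, ∑ j, - Real.log (dist w (p i) (q j)) := by
    intro w
    have h0 : 0 < ∏ i, ∏ j, dist w (p i) (q j) :=
      prod_pos fun i _ => prod_pos fun j _ => dist_pos w (hne i j)
    have h1 : ∏ i, ∏ j, dist w (p i) (q j) ≤ 1 :=
      prod_le_one (fun i _ => prod_nonneg fun j _ => (dist_pos w (hne i j)).le)
        fun i _ => prod_le_one (fun j _ => (dist_pos w (hne i j)).le)
          fun j _ => dist_le_one w _ _
    rw [one_div, Real.posLog_apply, Real.log_inv, max_eq_right (neg_nonneg.2 (Real.log_nonpos h0.le h1)),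
      log_prod fun i _ => (prod_pos fun j _ => dist_pos w (hne i j)).ne']
    simp only [Finset.sum_neg_distrib]
    congr 1
    exact sum_congr rfl fun i _ => log_prod fun j _ => (dist_pos w (hne i j)).ne'
  have hsum : ∑ᶠ w : FinitePlace L, posLog (1 / ∏ i, ∏ j, dist w (p i) (q j)) =
      ∑ P ∈ D.mult.support, ∑ P' ∈ E.mult.support, (D.mult P * E.mult P' : ℝ) * A P P' := by
    have hfin := fun i j => finite_support_log (finite_dist_ne_one (hne i j))
    rw [finsum_congr hlog, finsum_sum_comm _ _ fun i _ =>
      (Set.finite_iUnion fun j => hfin i j).subset fun w hw => ?_]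
    · rw [sum_congr rfl fun i _ => (finsum_sum_comm _ _ fun j _ => hfin i j).trans
        (hq.sum_eq hf (hS hEL) fun c' => ∑ᶠ w, - Real.log (dist w (p i) c')),
        hp.sum_eq hf (hS hDL) fun c => ∑ P' ∈ E.mult.support, (E.mult P' : ℝ) *
          ∑ c' ∈ S P', ∑ᶠ w, - Real.log (dist w c c')]
      refine sum_congr rfl fun P _ => ?_
      rw [sum_comm, mul_sum]
      refine sum_congr rfl fun P' _ => ?_
      rw [← mul_sum, mul_assoc]
    · obtain ⟨j, -, hj⟩ := Finset.exists_ne_zero_of_sum_ne_zero hw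
      exact Set.mem_iUnion.2 ⟨j, hj⟩
  rw [finsum_intersectionPairing hf hπ hX hDE, hsum, mul_sum, ← sum_sub_distrib]
  calc _ ≤ ∑ P ∈ D.mult.support, ∑ P' ∈ E.mult.support,
        (D.mult P * residueDegree f P : ℝ) * ((E.mult P' * residueDegree f P' : ℝ) * N) := by
        refine (abs_sum_le_sum_abs _ _).trans (sum_le_sum fun P hP => ?_)
        rw [mul_sum, ← sum_sub_distrib]
        refine (abs_sum_le_sum_abs _ _).trans (sum_le_sum fun P' hP' => ?_)
        set I := ∑ᶠ Q ∈ closedFibres π, pairTerm π P P' Q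
        have h1 : (D.mult P * E.mult P' : ℝ) * I - 1 / finrank K L *
            (D.mult P * E.mult P' * A P P') = D.mult P * E.mult P' / finrank K L *
              (finrank K L * I - A P P') := by
          field_simp
        rw [h1, abs_mul, abs_of_nonneg (by positivity)]
        refine (mul_le_mul_of_nonneg_left (hpair P hP P' hP') (by positivity)).trans (le_of_eq ?_)
        field_simp
    _ = D.degree * E.degree * N := by
        rw [EffectiveDivisor.degree_eq_sum, EffectiveDivisor.degree_eq_sum, mul_assoc, sum_mul]
        simp only [← mul_sum, ← sum_mul]
    _ ≤ g * g * N := by gcongr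

end Estimate

/-! ### Bounds in terms of the data -/

section Bounds

lemma natAbs_le_encode (a : ℤ) : a.natAbs ≤ encode a := by
  cases a with
  | ofNat n =>
    change n ≤ 2 * n
    omega
  | negSucc n =>
    change n + 1 ≤ 2 * n + 1
    omega

lemma encode_le_of_mem {α : Type*} [Encodable α] {a : α} {l : List α} (h : a ∈ l) :
    encode a ≤ encode l := by
  induction l with
  | nil => simp at h
  | cons b l ih =>
    rw [Encodable.encode_list_cons]
    rcases List.mem_cons.1 h with rfl | h
    · exact (Nat.left_le_pair _ _).trans (Nat.le_succ _)
    · exact (ih h).trans ((Nat.right_le_pair _ _).trans (Nat.le_succ _))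

lemma norm_getD_le {l : List ℤ} {e : ℕ} (h : encode l ≤ e) (i : ℕ) :
    ‖((l.getD i 0 : ℤ) : ℂ)‖ ≤ e := by
  have h1 : (l.getD i 0).natAbs ≤ e := by
    rcases lt_or_ge i l.length with hi | hi
    · rw [List.getD_eq_getElem _ _ hi]
      exact (natAbs_le_encode _).trans ((encode_le_of_mem (List.getElem_mem hi)).trans h)
    · grind
  rw [Complex.norm_intCast, ← Int.cast_abs, Int.abs_eq_natAbs]
  exact_mod_cast h1

lemma norm_aeval_polyOfList_le {l : List ℤ} {e : ℕ} (h : encode l ≤ e) {z : ℂ}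
    (hz : ‖z‖ ≤ e + 1) : ‖aeval z (polyOfList l)‖ ≤ e * (e * (e + 2) ^ e) := by
  rw [polyOfList, map_sum]
  have hle := (length_le_encode l).trans h
  refine (norm_sum_le_of_le _ (f := fun i => aeval z (C (l.getD i 0) * X ^ i))
    (n := fun _ => (e * (e + 2) ^ e : ℝ)) fun i hi => ?_).trans ?_
  · rw [map_mul, map_pow, aeval_X, aeval_C, norm_mul, norm_pow]
    refine mul_le_mul (norm_getD_le h i) ?_ (by positivity) (by positivity)
    refine (pow_le_pow_left₀ (norm_nonneg _) (hz.trans (by linarith : (e + 1 : ℝ) ≤ e + 2)) _).trans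
      (pow_le_pow_right₀ (by grind) ?_)
    grind
  · rw [Finset.sum_const, Finset.card_range, nsmul_eq_mul]
    gcongr

lemma coeff_polyOfList (l : List ℤ) (j : ℕ) : (polyOfList l).coeff j = l.getD j 0 := by
  rw [polyOfList, finsetSum_coeff]
  simp only [coeff_C_mul_X_pow, sum_ite_eq, Finset.mem_range]
  grind

/-- Cauchy's bound for the roots of a monic polynomial. -/
lemma norm_root_polyOfList_le {l : List ℤ} {e : ℕ} (h : encode l ≤ e)
    (hm : (polyOfList l).Monic) {z : ℂ} (hz : aeval z (polyOfList l) = 0) : ‖z‖ ≤ e + 1 := by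
  set p := (polyOfList l).map (Int.castRingHom ℂ) with hp
  have hpm : p.Monic := hm.map _
  have hroot : p.IsRoot z := by
    rw [IsRoot, hp, Polynomial.eval_map]
    exact hz
  have h1 := hroot.norm_lt_cauchyBound hpm.ne_zero
  rw [cauchyBound, hpm.leadingCoeff, nnnorm_one, div_one] at h1
  have h2 : ((Finset.range p.natDegree).sup fun x => ‖p.coeff x‖₊) ≤ e := by
    refine Finset.sup_le fun j _ => ?_
    rw [hp, coeff_map, coeff_polyOfList]
    exact NNReal.coe_le_coe.1 ((norm_getD_le h j).trans_eq (NNReal.coe_natCast e).symm)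
  have h3 : ‖z‖₊ ≤ (e : NNReal) + 1 := h1.le.trans (by gcongr)
  exact_mod_cast h3

/-- The code of the input bounds the lengths and entries of its lists. The conjugates of `θ` are
roots of the listed minimal polynomial, and the conjugates of `f i` are values of listed polynomials
at them; a positive denominator only makes them smaller. -/
lemma Describes.norm_le {data : CurveData} (hdata : Describes data f) {e : ℕ}
    (he : encode data ≤ e) :
    2 * g + 3 ≤ e ∧ finrank ℚ K ≤ e ∧ ∀ (σ : K →ₐ[ℚ] ℂ) (i), ‖σ (f i)‖ ≤ e * (e * (e + 2) ^ e) := by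
  obtain ⟨m, N, c⟩ := data
  obtain ⟨θ, hθ, hint, hmin, hN, hlen, hf⟩ := hdata
  simp only at hmin hN hlen hf
  simp only [Encodable.encode_prod_val] at he
  have hm : encode m ≤ e := (Nat.left_le_pair _ _).trans he
  have hc : encode c ≤ e := (Nat.right_le_pair _ _).trans ((Nat.right_le_pair _ _).trans he)
  have hmonic : (polyOfList m).Monic := hmin ▸ minpoly.monic hint
  refine ⟨hlen ▸ (length_le_encode c).trans hc, ?_, fun σ i => ?_⟩
  · rw [← IntermediateField.finrank_top', ← hθ,
      IntermediateField.adjoin.finrank (hint.tower_top (A := ℚ)),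
      minpoly.isIntegrallyClosed_eq_field_fractions' ℚ hint, hmin, hmonic.natDegree_map]
    refine le_trans ?_ ((length_le_encode m).trans hm)
    refine natDegree_le_iff_coeff_eq_zero.2 fun j hj => ?_
    rw [coeff_polyOfList, List.getD_eq_default _ _ hj.le]
  · have hz : aeval (σ θ) (polyOfList m) = 0 := by
      rw [← hmin, ← map_zero σ, ← minpoly.aeval ℤ θ]
      exact aeval_algHom_apply (σ.restrictScalars ℤ) θ _
    have h1 : (N : ℂ) * σ (f i) = aeval (σ θ) (polyOfList (c.getD i [])) := by
      rw [← map_natCast σ, ← map_mul, hf i]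
      exact (aeval_algHom_apply (σ.restrictScalars ℤ) θ _).symm
    have h2 : encode (c.getD i []) ≤ e := by
      have hi : (i : ℕ) < c.length := by omega
      rw [List.getD_eq_getElem _ _ hi]
      exact (encode_le_of_mem (List.getElem_mem hi)).trans hc
    have h3 := norm_aeval_polyOfList_le h2 (norm_root_polyOfList_le hm hmonic hz)
    rw [← h1, norm_mul, Complex.norm_natCast] at h3
    exact (le_mul_of_one_le_left (norm_nonneg _)
      (Nat.one_le_cast.2 (Nat.one_le_iff_ne_zero.2 hN))).trans h3

/-- A discriminant of the binary form, with a bound for its size. -/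
lemma exists_discriminant (hf : IsSeparableForm f) {e : ℕ} (he : 2 * g + 3 ≤ e) (c : Bool) :
    ∃ δ : 𝓞 K, δ ≠ 0 ∧ (∃ s t : Polynomial (𝓞 K),
      s * affForm f c + t * derivative (affForm f c) = C δ) ∧
      ∀ (σ : K →ₐ[ℚ] ℂ) (F : ℝ), 1 ≤ F → (∀ i, ‖σ (f i)‖ ≤ F) →
        ‖σ δ‖ ≤ (2 * e) ^ (2 * e) * (e * (e * F)) ^ (2 * e) := by
  have hdeg := natDegree_affForm_le (f := f) c
  have hder := natDegree_derivative_le (affForm f c)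
  have hinj := algebraMap_injective (𝓞 K) K
  have hmapdeg : ∀ p : Polynomial (𝓞 K), (p.map (algebraMap (𝓞 K) K)).natDegree = p.natDegree :=
    fun p => natDegree_map_eq_of_injective hinj p
  have hpos := natDegree_affFormK_pos hf c
  -- The discriminant used is the resultant of the polynomial and its derivative at their actual
  -- degrees; it is nonzero because squarefree polynomials over `K` are separable.
  obtain ⟨s, t, -, -, hst⟩ := exists_mul_add_mul_eq_C_resultant (affForm f c)
    (derivative (affForm f c)) le_rfl le_rfl (Or.inl ((hmapdeg _).symm ▸ hpos).ne')
  refine ⟨_, fun h0 => ?_, ⟨s, t, by rw [← hst]; ring⟩, fun σ F hF hσ => ?_⟩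
  · have h1 := resultant_map_map (affForm f c) (derivative (affForm f c))
      (affForm f c).natDegree (derivative (affForm f c)).natDegree (algebraMap (𝓞 K) K)
    rw [h0, map_zero, ← hmapdeg, ← hmapdeg, ← derivative_map, resultant_eq_zero_iff] at h1
    exact h1.2 (PerfectField.separable_iff_squarefree.2 (squarefree_affFormK hf c))
  · let abv : AbsoluteValue (𝓞 K) ℝ := (NormedField.toAbsoluteValue ℂ).comp
      (f := (σ : K →+* ℂ).comp (algebraMap (𝓞 K) K)) (σ.toRingHom.injective.comp hinj)
    have habv : ∀ x : 𝓞 K, abv x = ‖σ x‖ := fun x => rfl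
    have he1 : (1 : ℝ) ≤ e := Nat.one_le_cast.2 (by omega)
    have hcoef : ∀ k, abv ((affForm f c).coeff k) ≤ e * F := by
      intro k
      rw [affForm, finsetSum_coeff]
      refine (abv.sum_le _ _).trans ((Finset.sum_le_card_nsmul _ _ F fun i _ => ?_).trans ?_)
      · grind
      · rw [card_univ, card_fin, nsmul_eq_mul]
        gcongr
    have hcoef' : ∀ k, abv ((derivative (affForm f c)).coeff k) ≤ e * (e * F) := by
      intro k
      rcases le_or_gt (k + 1) (2 * g + 2) with hk | hk
      · rw [coeff_derivative, map_mul, mul_comm]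
        refine mul_le_mul ?_ (hcoef _) (abv.nonneg _) (by positivity)
        have h1 : abv ((k : 𝓞 K) + 1) = ((k + 1 : ℕ) : ℝ) := by
          rw [habv, ← Nat.cast_succ, ← Complex.norm_natCast]
          simp
        rw [h1, Nat.cast_le]
        omega
      · rw [coeff_derivative, coeff_eq_zero_of_natDegree_lt (hdeg.trans_lt hk), zero_mul, map_zero]
        positivity
    have hH : 1 ≤ e * (e * F) := one_le_mul_of_one_le_of_one_le he1
      (one_le_mul_of_one_le_of_one_le he1 hF)
    -- The Sylvester matrix has size at most `4 * g + 3 ≤ 2 * e`, and its entries are zero or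
    -- coefficients of the two polynomials.
    have hdet := Matrix.det_le (abv := abv) (x := e * (e * F)) (A := sylvester (affForm f c)
      (derivative (affForm f c)) (affForm f c).natDegree (derivative (affForm f c)).natDegree)
      fun i j => by
        have h0 : abv 0 ≤ e * (e * F) := by grind
        rw [sylvester, Matrix.of_apply]
        induction j using Fin.addCases with
        | left j =>
          grind
        | right j =>
          rw [Fin.addCases_right]
          split_ifs
          exacts [(hcoef _).trans (le_mul_of_one_le_left (by positivity) he1), h0]
    refine hdet.trans ?_
    rw [card_fin, nsmul_eq_mul]
    have hk : (affForm f c).natDegree + (derivative (affForm f c)).natDegree ≤ 2 * e := by omega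
    refine mul_le_mul ?_ (pow_le_pow_right₀ hH hk) (by positivity) (by positivity)
    exact_mod_cast (Nat.factorial_le hk).trans (Nat.factorial_le_pow _)

end Bounds

/-! ### The constant -/

section Constant

/-- A bound for the conjugates of the bad element in terms of the code of the data. -/
def conjugateBound (e : ℕ) : ℕ :=
  (e ^ e) ^ 2 * (4 * ((2 * e) ^ (2 * e) * (e * (e * (e * (e * (e + 2) ^ e)))) ^ (2 * e)) ^ 2) *
    (e ^ e) ^ 2

lemma primrec_pow {α : Type*} [Primcodable α] {F G : α → ℕ} (hF : Primrec F) (hG : Primrec G) :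
    Primrec fun a => F a ^ G a :=
  (Primrec₂.unpaired'.1 Nat.Primrec.pow).comp hF hG

lemma primrec_conjugateBound : Primrec conjugateBound := by
  have m : ∀ {F G : ℕ → ℕ}, Primrec F → Primrec G → Primrec fun a => F a * G a :=
    fun hF hG => Primrec.nat_mul.comp hF hG
  have i : Primrec fun a : ℕ => a := Primrec.id
  have c : ∀ n : ℕ, Primrec fun _ : ℕ => n := fun n => Primrec.const n
  have h2 := m (c 2) i
  have hF := m i (m i (m i (m i (primrec_pow (Primrec.nat_add.comp i (c 2)) i))))
  have hee := primrec_pow (primrec_pow i i) (c 2)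
  exact m (m hee (m (c 4) (primrec_pow (m (primrec_pow h2 h2) (primrec_pow hF h2)) (c 2)))) hee

/-- The product of the discriminants of the two charts serves both charts. The norm is the product
of at most `e` conjugates, each at most `conjugateBound e`, and `g ≤ e`; this gives the factor `e ^
3`. -/
lemma exists_log_norm_badElement_le (hf : IsSeparableForm f) {data : CurveData}
    (hdata : Describes data f) (l : List (HeightOneSpectrum (𝓞 K))) {e : ℕ}
    (he : encode (data, l.map fun ν => absNorm ν.asIdeal) = e) :
    ∃ δ : 𝓞 K, δ ≠ 0 ∧ (∀ c, ∃ s t : Polynomial (𝓞 K),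
      s * affForm f c + t * derivative (affForm f c) = C δ) ∧
      g * g * Real.log |(Algebra.norm ℚ (badElement l δ (2 * g) : K) : ℝ)| ≤
        (e ^ 3 * conjugateBound e : ℕ) := by
  rw [Encodable.encode_prod_val] at he
  obtain ⟨hge, hdeg, hσ⟩ := hdata.norm_le ((Nat.left_le_pair _ _).trans_eq he)
  have hl := (Nat.right_le_pair _ _).trans_eq he
  have hM : normProd l ≤ e ^ e :=
    (List.prod_le_pow_card _ e fun n hn => (encode_le_of_mem hn).trans hl).trans
      (Nat.pow_le_pow_right (by omega) ((length_le_encode _).trans hl))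
  choose δ hδ0 hδ hδσ using exists_discriminant hf hge
  refine ⟨δ false * δ true, mul_ne_zero (hδ0 _) (hδ0 _), fun c => ?_, ?_⟩
  · obtain ⟨s, t, hst⟩ := hδ c
    refine ⟨C (δ !c) * s, C (δ !c) * t, ?_⟩
    rw [mul_assoc, mul_assoc, ← mul_add, hst, ← C_mul]
    cases c
    · rw [Bool.not_false, mul_comm]
    · rw [Bool.not_true]
  set Θ : K := algebraMap (𝓞 K) K (badElement l (δ false * δ true) (2 * g)) with hΘ
  have hΘ0 : Θ ≠ 0 := RingOfIntegers.coe_ne_zero_iff.2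
    (badElement_ne_zero l (mul_ne_zero (hδ0 _) (hδ0 _)) _)
  have he1 : (1 : ℝ) ≤ e := Nat.one_le_cast.2 (by omega)
  have hF : (1 : ℝ) ≤ e * (e * (e + 2) ^ e) := one_le_mul_of_one_le_of_one_le he1
    (one_le_mul_of_one_le_of_one_le he1 (one_le_pow₀ (by linarith)))
  have hconj : ∀ σ : K →ₐ[ℚ] ℂ, ‖σ Θ‖ ≤ conjugateBound e := by
    intro σ
    have h1 := hδσ false σ _ hF (hσ σ)
    have h2 := hδσ true σ _ hF (hσ σ)
    have h3 : ‖((2 * g).factorial : ℂ)‖ ≤ e ^ e := by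
      rw [Complex.norm_natCast]
      exact_mod_cast (Nat.factorial_le (by omega : 2 * g ≤ e)).trans (Nat.factorial_le_pow e)
    have h4 : ‖(normProd l : ℂ)‖ ≤ e ^ e := by
      rw [Complex.norm_natCast]
      exact_mod_cast hM
    have h5 : Θ = ((2 * g).factorial : K) ^ 2 * (4 * (δ false * δ true : 𝓞 K)) *
        (normProd l : K) ^ 2 := algebraMap_badElement (L := K) l _ _
    -- The factors of `conjugateBound` bound, in this order, the square of the factorial, four times
    -- the two discriminants, and the square of `normProd l`.
    rw [h5]
    simp only [map_mul, map_pow, map_natCast, map_ofNat, norm_mul, norm_pow, Complex.norm_ofNat,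
      conjugateBound]
    push_cast
    rw [pow_two (_ * _ : ℝ)]
    gcongr
  have hN : |(Algebra.norm ℚ Θ : ℝ)| ≤ (conjugateBound e : ℝ) ^ finrank ℚ K := by
    have h1 := congrArg norm (Algebra.norm_eq_prod_embeddings ℚ ℂ Θ)
    rw [norm_prod, eq_ratCast, Complex.norm_ratCast] at h1
    rw [h1, ← AlgHom.card ℚ K ℂ, ← card_univ, ← prod_const]
    exact prod_le_prod (fun _ _ => norm_nonneg _) fun σ _ => hconj σ
  have hN0 : 0 < |(Algebra.norm ℚ Θ : ℝ)| :=
    abs_pos.2 (Rat.cast_ne_zero.2 (Algebra.norm_ne_zero_iff.2 hΘ0))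
  have hlog : Real.log |(Algebra.norm ℚ Θ : ℝ)| ≤ e * conjugateBound e := by
    refine (Real.log_le_log hN0 hN).trans ?_
    rw [log_pow]
    refine (mul_le_mul_of_nonneg_left (Real.log_le_self (Nat.cast_nonneg _)) (Nat.cast_nonneg _)).trans ?_
    gcongr
  have hg : (g : ℝ) ≤ e := Nat.cast_le.2 (by omega)
  push_cast
  calc (g * g : ℝ) * Real.log |(Algebra.norm ℚ Θ : ℝ)| ≤ g * g * (e * conjugateBound e) := by gcongr
    _ ≤ e * e * (e * conjugateBound e) := by gcongr
    _ = _ := by ring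

end Constant
end Hyperelliptic
end
open Hyperelliptic in
theorem mainTheorem5 :
    ∃ 𝓑₂ : CurveData × List ℕ → ℕ, Computable 𝓑₂ ∧
      ∀ (K : Type u) [Field K] [NumberField K] (g : ℕ) (_ : 1 ≤ g)
        (f : Fin (2 * g + 3) → 𝓞 K) (_ : IsSeparableForm f)
        (data : CurveData) (_ : Describes data f)
        (X : Scheme.{u}) (π : X ⟶ naiveModel f) (l : List (HeightOneSpectrum (𝓞 K)))
        (_ : IsBlowupSequence (naiveModelToSpec f) π l) (_ : IsRegularScheme X)
        (D E : EffectiveDivisor f) (_ : D.IsReduced) (_ : E.IsReduced)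
        (_ : D.DisjointSupport E),
        (∀ ν, ∀ Q ∈ specialFibre π ν, localMultiplicity π D E Q ≠ ⊤) ∧
        {Q | ∃ ν, Q ∈ specialFibre π ν ∧ localMultiplicity π D E Q ≠ 0}.Finite ∧
        ∀ (L : Type v) [Field L] [NumberField L] [Algebra K L]
          (_ : D.PointwiseRational L) (_ : E.PointwiseRational L)
          (d e : ℕ) (p : Fin d → CurvePoint f L) (q : Fin e → CurvePoint f L)
          (_ : D.IsSumOf p) (_ : E.IsSumOf q),
          {w : FinitePlace L | ∏ i, ∏ j, CurvePoint.dist w (p i) (q j) ≠ 1}.Finite ∧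
          (∀ w : FinitePlace L, 0 < ∏ i, ∏ j, CurvePoint.dist w (p i) (q j)) ∧
          |(∑ᶠ ν : HeightOneSpectrum (𝓞 K), intersectionPairing π D E ν) -
            1 / (Module.finrank K L : ℝ) * ∑ᶠ w : FinitePlace L,
              Real.posLog (1 / ∏ i, ∏ j, CurvePoint.dist w (p i) (q j))|
            ≤ 𝓑₂ (data, l.map fun ν => Ideal.absNorm ν.asIdeal) := by
  -- The constant depends only on the code of the whole input, and as a function of it is primitive
  -- recursive.
  refine ⟨fun a => Encodable.encode a ^ 3 * conjugateBound (Encodable.encode a),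
    (Primrec.nat_mul.comp (primrec_pow Primrec.encode (Primrec.const 3))
      (primrec_conjugateBound.comp Primrec.encode)).to_comp, ?_⟩
  intro K _ _ g _ f hf data hdata X π l hπ hX D E hD hE hDE
  obtain ⟨δ, hδ0, hδ, hN⟩ := exists_log_norm_badElement_le hf hdata l rfl
  refine ⟨fun ν Q hQ => ?_, ?_, fun L _ _ _ hDL hEL d e p q hp hq => ?_⟩
  · rw [localMultiplicity_eq hf hπ hX hDE ⟨ν, hQ⟩]
    exact ENat.natCast_ne_top _
  · refine (finite_localMultiplicity_ne_zero hf hπ hX hDE).subset ?_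
    rintro Q ⟨ν, hQ, h0⟩
    exact ⟨⟨ν, hQ⟩, h0⟩
  · have hne := ne_of_isSumOf hf hDE hp hq
    refine ⟨?_, fun w => Finset.prod_pos fun i _ => Finset.prod_pos fun j _ =>
      CurvePoint.dist_pos w (hne i j), ?_⟩
    · refine (Set.finite_iUnion fun i => Set.finite_iUnion fun j =>
        CurvePoint.finite_dist_ne_one (hne i j)).subset fun w hw => ?_
      obtain ⟨i, -, hi⟩ := Finset.exists_ne_one_of_prod_ne_one hw
      obtain ⟨j, -, hj⟩ := Finset.exists_ne_one_of_prod_ne_one hi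
      exact Set.mem_iUnion.2 ⟨i, Set.mem_iUnion.2 ⟨j, hj⟩⟩
    · exact (abs_finsum_intersectionPairing_sub_le hf hπ hX hδ0 hδ hDE hp hq hD.2.2 hE.2.2 hDL
        hEL).trans hN
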